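/- Let $n\ge 1$, $\tau\in\mathbb C$ with $\mathrm{Im}\,\tau>0$, $E_\tau=\mathbb C/(\mathbb Z+\tau\mathbb Z)$, and let $(E_\tau^\#)^n=\mathbb C^{2n}/\{(a+b\tau,-2\pi\mathrm i\,b)\mid a,b\in\mathbb Z^n\}$, where $\mathbb C^{2n}$ has coordinates $(p,c)=(p_1,\dots,p_n,c_1,\dots,c_n)$ ($E_\tau^\#$ is the universal vector extension of $E_\tau$). Set $p_{ij}=p_i-p_j$, $c_{ij}=c_i-c_j$; let $D_{ij}\subset(E_\tau^\#)^n$ be the divisor given by $p_{ij}\in\mathbb Z+\tau\mathbb Z$, $C=\{p\in\mathbb C^n\mid p_{ij}\notin\mathbb Z+\tau\mathbb Z \text{ for } i\neq j\}$ and $\tilde C=\{(p,c)\in\mathbb C^{2n}\mid p\in C\}$. Let $\theta(z)=\frac{e^{\pi\mathrm iz}-e^{-\pi\mathrm iz}}{2\pi\mathrm i}\prod_{j\ge1}\frac{(1-e^{2\pi\mathrm i(z+j\tau)})(1-e^{2\pi\mathrm i(-z+j\tau)})}{(1-e^{2\pi\mathrm ij\tau})^2}$, so that $\theta'(0)=1$.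 For a Lie algebra $\mathfrak g$ over $\mathbb C$ with augmentation ideal $I\subset U(\mathfrak g)$, $\exp(\mathfrak g)$ denotes the pro-unipotent group of $\varprojlim_k\mathfrak g/\gamma_k(\mathfrak g)$ ($\gamma_k$ = lower central series), realized in $\varprojlim_k U(\mathfrak g)/I^k$. Let $\Omega^1$ be the sum, over $i<j$, of the spaces of algebraic 1-forms on $(E_\tau^\#)^n$ with logarithmic poles along $D_{ij}$ only, and of the space of regular algebraic 1-forms. Let $\omega_{ij}^\alpha$ ($i<j$, $\alpha\ge0$) be the coefficient of $z^\alpha$ in $$\Big(\frac{\theta(p_{ij}+z)}{\theta(z)\theta(p_{ij})}e^{-c_{ij}z}-\frac1z\Big)dp_{ij}.$$ Let $(X_i,Y_i,T_{ij}^\alpha)$ be the family dual to $(dc_i,dp_i,\omega_{ij}^\alpha)$, where $dc_i$, $dp_i$, $\omega_{ij}^\alpha$ have degrees $1$, $0$, $\alpha+1$; let $\mathfrak L$ be the free Lie algebra on this dual family, and let $\mathfrak G$ be the quotient of $\mathfrak L$ by the ideal generated by all $d^*(\varphi)+\frac12\wedge^*(\varphi)$, where $\varphi$ runs over the graded dual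 of the image of $\wedge:\Lambda^2(\Omega^1)\to\Omega^2$. Let $$\omega=\sum_iX_i\,dc_i+\sum_iY_i\,dp_i+\sum_{i<j,\ \alpha\ge0}T_{ij}^\alpha\,\omega_{ij}^\alpha .$$ Let $\mathfrak t_{1,n}$ be the complex Lie algebra with generators $x_i,y_i$ ($1\le i\le n$), $t_{ij}$ ($i\ne j$) and relations $[x_i,x_j]=[y_i,y_j]=0$ for all $i,j$; $[x_i,y_j]=t_{ij}=t_{ji}$ for $i\ne j$; $[x_i,y_i]=-\sum_{j\ne i}t_{ij}$; $[x_k,t_{ij}]=[y_k,t_{ij}]=0$ for $i,j,k$ distinct; $[x_i+x_j,t_{ij}]=[y_i+y_j,t_{ij}]=0$ for $i\neq j$. The universal KZB bundle with connection $(\mathcal P_{\mathrm{KZB}},\nabla_{\mathrm{KZB}})$ over $C/(\mathbb Z+\tau\mathbb Z)^n\subset E_\tau^n$ is the principal $\exp(\mathfrak t_{1,n})$-bundle with sections the functions $\sigma$ satisfying $\sigma(p+e_i)=\sigma(p)$, $\sigma(p+\tau e_i)=e^{-2\pi\mathrm i\,x_i}\sigma(p)$ ($e_i$ the $i$-th basis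 vector of $\mathbb C^n$), with connection $d+A_{\mathrm{KZB}}$, $$A_{\mathrm{KZB}}=-\sum_i\Big(-y_i+\sum_{j\ne i}\Big(\frac{\theta(p_{ij}+\mathrm{ad}\,x_i)\,\mathrm{ad}\,x_i}{\theta(p_{ij})\,\theta(\mathrm{ad}\,x_i)}-1\Big)(y_j)\Big)dp_i,$$ where the function of $\mathrm{ad}\,x_i$ is to be expanded as a power series in $\mathrm{ad}\,x_i$. **Theorem.** 1. $(dc_i)_i,(dp_i)_i,(\omega_{ij}^\alpha)_{i<j,\alpha\ge0}$ is a basis of $\Omega^1$. 2. The sums which define $\omega$ and $A_{\mathrm{KZB}}$ converge in the completions of $U(\mathfrak G)$ and $U(\mathfrak t_{1,n})$. $(\mathcal P_{\mathrm{KZB}},\nabla_{\mathrm{KZB}})$ is a well-defined holomorphic principal $\exp(\mathfrak t_{1,n})$-bundle with flat connection over the image of $C$ in $E_\tau^n$. The trivial $\exp(\mathfrak G)$-bundle with connection $d+\omega$ is a well-defined holomorphic principal bundle with flat connection over the image of $\tilde C$ in $(E_\tau^\#)^n$. 3. There is an isomorphism of Lie algebras $\mathfrak G\simeq\mathfrak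 t_{1,n}$ with $X_i\mapsto x_i$, $Y_i\mapsto y_i$, $T_{ij}^\alpha\mapsto-(\mathrm{ad}\,x_i)^\alpha(t_{ij})$. It induces an isomorphism of the groups $\exp(\mathfrak G)\simeq\exp(\mathfrak t_{1,n})$. With respect to it, the map $\mathbb C^{2n}\to\exp(\mathfrak t_{1,n})\simeq\exp(\mathfrak G)$, $(p,c)\mapsto g(p,c)=\exp(\sum_ic_ix_i)$, sets up (by left multiplication in the canonical trivializations over $\tilde C$) an isomorphism of principal bundles with flat connection over $\tilde C\subset\mathbb C^{2n}$ between * the pull-back under $\mathbb C^{2n}\to(E_\tau^\#)^n$ of the trivial $\exp(\mathfrak G)$-bundle with connection $d+\omega$, and * the pull-back under $\mathbb C^{2n}\to\mathbb C^n\to E_\tau^n$ of $(\mathcal P_{\mathrm{KZB}},\nabla_{\mathrm{KZB}})$; that is, $g\,(d+\omega)\,g^{-1}=d+A_{\mathrm{KZB}}$. -/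

import Mathlib

attribute [local instance 100] LieRing.ofAssociativeRing
attribute [local instance 100] LieAlgebra.ofAssociativeAlgebra

noncomputable section

namespace KZB

/-! ## Pro-unipotent completion of a Lie algebra and its group -/

section Completion

variable (𝔤 : Type) [LieRing 𝔤] [LieAlgebra ℂ 𝔤]

/-- The augmentation ideal of the universal enveloping algebra of `𝔤`. -/
def augIdeal : Ideal (UniversalEnvelopingAlgebra ℂ 𝔤) :=
  RingHom.ker (UniversalEnvelopingAlgebra.lift ℂ (0 : 𝔤 →ₗ⁅ℂ⁆ ℂ))

instance : (augIdeal 𝔤).IsTwoSided := by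
  unfold augIdeal; infer_instance

/-- The quotient of the enveloping algebra by the `k`-th power of the augmentation ideal. -/
def NilQuot (k : ℕ) : Type := UniversalEnvelopingAlgebra ℂ 𝔤 ⧸ (augIdeal 𝔤) ^ k

instance (k : ℕ) : Ring (NilQuot 𝔤 k) :=
  inferInstanceAs (Ring (UniversalEnvelopingAlgebra ℂ 𝔤 ⧸ (augIdeal 𝔤) ^ k))

instance (k : ℕ) : Algebra ℂ (NilQuot 𝔤 k) :=
  inferInstanceAs (Algebra ℂ (UniversalEnvelopingAlgebra ℂ 𝔤 ⧸ (augIdeal 𝔤) ^ k))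

instance (k : ℕ) : Module ℚ (NilQuot 𝔤 k) := Module.compHom _ (algebraMap ℚ ℂ)

/-- The levels of the completion are discrete, so that the completion below carries the
inverse limit topology, in which its infinite sums are taken. -/
instance (k : ℕ) : TopologicalSpace (NilQuot 𝔤 k) := ⊥

/-- The projection of the enveloping algebra onto its `k`-th quotient. -/
def NilQuot.mk (k : ℕ) : UniversalEnvelopingAlgebra ℂ 𝔤 →+* NilQuot 𝔤 k :=
  Ideal.Quotient.mk ((augIdeal 𝔤) ^ k)

/-- The transition map from level `k + 1` to level `k`. -/
def NilQuot.trans (k : ℕ) : NilQuot 𝔤 (k + 1) →+* NilQuot 𝔤 k :=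
  Ideal.Quotient.factor (Ideal.pow_le_pow_right (Nat.le_succ k))

theorem NilQuot.trans_mk (k : ℕ) (u : UniversalEnvelopingAlgebra ℂ 𝔤) :
    NilQuot.trans 𝔤 k (NilQuot.mk 𝔤 (k + 1) u) = NilQuot.mk 𝔤 k u := rfl

theorem NilQuot.algebraMap_eq (k : ℕ) (r : ℂ) :
    algebraMap ℂ (NilQuot 𝔤 k) r = NilQuot.mk 𝔤 k (algebraMap ℂ _ r) := rfl

/-- The image of an element of `𝔤` at level `k`. -/
def lev (k : ℕ) (ξ : 𝔤) : NilQuot 𝔤 k :=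
  NilQuot.mk 𝔤 k (UniversalEnvelopingAlgebra.ι ℂ ξ)

/-- The completed enveloping algebra: the inverse limit of the levels. -/
def Uhat : Subalgebra ℂ (∀ k, NilQuot 𝔤 k) where
  carrier := {u | ∀ k, NilQuot.trans 𝔤 k (u (k + 1)) = u k}
  mul_mem' ha hb k := by simp only [Pi.mul_apply, map_mul, ha k, hb k]
  add_mem' ha hb k := by simp only [Pi.add_apply, map_add, ha k, hb k]
  algebraMap_mem' r k := by
    simp only [Pi.algebraMap_apply, NilQuot.algebraMap_eq, NilQuot.trans_mk]

/-- The `k`-th component of an element of the completed enveloping algebra. -/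
def Uhat.comp (k : ℕ) : Uhat 𝔤 →ₐ[ℂ] NilQuot 𝔤 k :=
  (Pi.evalAlgHom ℂ (fun k => NilQuot 𝔤 k) k).comp (Uhat 𝔤).val

variable {𝔤}

/-- The canonical map from `𝔤` to the completed enveloping algebra. -/
def hat (ξ : 𝔤) : Uhat 𝔤 := ⟨fun k => lev 𝔤 k ξ, fun _ => rfl⟩

/-- The completion `lim 𝔤 / γ_k(𝔤)` of `𝔤`, inside the completed enveloping algebra. -/
def IsLie (u : Uhat 𝔤) : Prop := ∀ k, ∃ ξ : 𝔤, Uhat.comp 𝔤 k u = lev 𝔤 k ξ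

theorem ι_mem_augIdeal (ξ : 𝔤) : UniversalEnvelopingAlgebra.ι ℂ ξ ∈ augIdeal 𝔤 := by
  simp only [augIdeal, RingHom.mem_ker]
  exact UniversalEnvelopingAlgebra.lift_ι_apply ℂ (0 : 𝔤 →ₗ⁅ℂ⁆ ℂ) ξ

theorem isNilpotent_lev (k : ℕ) (ξ : 𝔤) : IsNilpotent (lev 𝔤 k ξ) :=
  ⟨k, by
    rw [lev, ← map_pow]
    exact Ideal.Quotient.eq_zero_iff_mem.2 (Ideal.pow_mem_pow (ι_mem_augIdeal ξ) k)⟩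

theorem lev_neg (k : ℕ) (ξ : 𝔤) : lev 𝔤 k (-ξ) = -lev 𝔤 k ξ := by
  simp only [lev, map_neg]

/-- The exponential series of an element of `𝔤`. -/
def expElt (ξ : 𝔤) : Uhat 𝔤 :=
  ⟨fun k => IsNilpotent.exp (lev 𝔤 k ξ), fun k =>
    IsNilpotent.map_exp (isNilpotent_lev (k + 1) ξ) (NilQuot.trans 𝔤 k)⟩

variable (𝔤) in
/-- The pro-unipotent group attached to `𝔤`: the invertible elements of the completed enveloping
algebra which at every level lie in the group generated by the exponentials of the elements of
`𝔤` (which, by the Baker-Campbell-Hausdorff formula, consists of such exponentials). -/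
def ExpGroup : Subgroup (Uhat 𝔤)ˣ :=
  ⨅ k : ℕ, (Subgroup.closure {v : (NilQuot 𝔤 k)ˣ | ∃ ξ : 𝔤,
    (v : NilQuot 𝔤 k) = IsNilpotent.exp (lev 𝔤 k ξ)}).comap
      (Units.map ((Uhat.comp 𝔤 k : Uhat 𝔤 →* NilQuot 𝔤 k)))

/-- The exponential as an element of the group. -/
def gexp (ξ : 𝔤) : ExpGroup 𝔤 :=
  ⟨⟨expElt ξ, expElt (-ξ),
    Subtype.ext <| funext fun k => by
      have := IsNilpotent.exp_mul_exp_neg_self (isNilpotent_lev k ξ)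
      rw [← lev_neg] at this
      exact this,
    Subtype.ext <| funext fun k => by
      have := IsNilpotent.exp_neg_mul_exp_self (isNilpotent_lev k ξ)
      rw [← lev_neg] at this
      exact this⟩, by
    simp only [ExpGroup, Subgroup.mem_iInf, Subgroup.mem_comap]
    exact fun k => Subgroup.subset_closure ⟨ξ, rfl⟩⟩

/-- The underlying element of the completed enveloping algebra. -/
def gval (g : ExpGroup 𝔤) : Uhat 𝔤 := ((g : (Uhat 𝔤)ˣ) : Uhat 𝔤)

end Completion

section Functoriality

variable {𝔤 𝔥 : Type} [LieRing 𝔤] [LieAlgebra ℂ 𝔤] [LieRing 𝔥] [LieAlgebra ℂ 𝔥]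

/-- The morphism of enveloping algebras induced by a morphism of Lie algebras. -/
def mapU (f : 𝔤 →ₗ⁅ℂ⁆ 𝔥) : UniversalEnvelopingAlgebra ℂ 𝔤 →ₐ[ℂ] UniversalEnvelopingAlgebra ℂ 𝔥 :=
  UniversalEnvelopingAlgebra.lift ℂ ((UniversalEnvelopingAlgebra.ι ℂ).comp f)

theorem mapU_ι (f : 𝔤 →ₗ⁅ℂ⁆ 𝔥) (ξ : 𝔤) :
    mapU f (UniversalEnvelopingAlgebra.ι ℂ ξ) = UniversalEnvelopingAlgebra.ι ℂ (f ξ) :=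
  UniversalEnvelopingAlgebra.lift_ι_apply ℂ ((UniversalEnvelopingAlgebra.ι ℂ).comp f) ξ

theorem mapU_mem (f : 𝔤 →ₗ⁅ℂ⁆ 𝔥) {u : UniversalEnvelopingAlgebra ℂ 𝔤} (hu : u ∈ augIdeal 𝔤) :
    mapU f u ∈ augIdeal 𝔥 := by
  have h : (UniversalEnvelopingAlgebra.lift ℂ (0 : 𝔥 →ₗ⁅ℂ⁆ ℂ)).comp (mapU f) =
      UniversalEnvelopingAlgebra.lift ℂ (0 : 𝔤 →ₗ⁅ℂ⁆ ℂ) := by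
    apply UniversalEnvelopingAlgebra.hom_ext
    ext ξ
    simp only [LieHom.coe_comp, Function.comp_apply, AlgHom.coe_toLieHom, AlgHom.coe_comp, mapU_ι,
      UniversalEnvelopingAlgebra.lift_ι_apply, LieHom.zero_apply]
  simp only [augIdeal, RingHom.mem_ker] at hu ⊢
  rw [← hu, ← h]
  rfl

theorem mapU_mem_pow (f : 𝔤 →ₗ⁅ℂ⁆ 𝔥) (k : ℕ) :
    ∀ {u : UniversalEnvelopingAlgebra ℂ 𝔤}, u ∈ (augIdeal 𝔤) ^ k →
      mapU f u ∈ (augIdeal 𝔥) ^ k := by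
  induction k with
  | zero => intro u _; simp [Submodule.pow_zero, Ideal.one_eq_top]
  | succ k ih =>
    intro u hu
    rw [Submodule.pow_succ] at hu ⊢
    refine Submodule.mul_induction_on hu (fun a ha b hb => ?_) (fun a b ha hb => ?_)
    · rw [map_mul]
      exact Ideal.mul_mem_mul (ih ha) (mapU_mem f hb)
    · rw [map_add]
      exact Ideal.add_mem _ ha hb

/-- The induced map at level `k`. -/
def mapLev (f : 𝔤 →ₗ⁅ℂ⁆ 𝔥) (k : ℕ) : NilQuot 𝔤 k →+* NilQuot 𝔥 k :=
  Ideal.Quotient.lift _ ((NilQuot.mk 𝔥 k).comp (mapU f : _ →+* UniversalEnvelopingAlgebra ℂ 𝔥))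
    fun _ hu => Ideal.Quotient.eq_zero_iff_mem.2 (mapU_mem_pow f k hu)

theorem mapLev_lev (f : 𝔤 →ₗ⁅ℂ⁆ 𝔥) (k : ℕ) (ξ : 𝔤) : mapLev f k (lev 𝔤 k ξ) = lev 𝔥 k (f ξ) :=
  congrArg (NilQuot.mk 𝔥 k) (mapU_ι f ξ)

theorem trans_mapLev (f : 𝔤 →ₗ⁅ℂ⁆ 𝔥) (k : ℕ) (u : NilQuot 𝔤 (k + 1)) :
    NilQuot.trans 𝔥 k (mapLev f (k + 1) u) = mapLev f k (NilQuot.trans 𝔤 k u) := by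
  obtain ⟨u, rfl⟩ := Ideal.Quotient.mk_surjective u
  rfl

/-- The induced map of completed enveloping algebras. -/
def mapHat (f : 𝔤 →ₗ⁅ℂ⁆ 𝔥) : Uhat 𝔤 →+* Uhat 𝔥 where
  toFun u := ⟨fun k => mapLev f k (u.1 k), fun k => by rw [trans_mapLev, u.2 k]⟩
  map_one' := Subtype.ext <| funext fun k => map_one (mapLev f k)
  map_zero' := Subtype.ext <| funext fun k => map_zero (mapLev f k)
  map_mul' u v := Subtype.ext <| funext fun k => map_mul (mapLev f k) (u.1 k) (v.1 k)
  map_add' u v := Subtype.ext <| funext fun k => map_add (mapLev f k) (u.1 k) (v.1 k)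

/-- The induced morphism of pro-unipotent groups. -/
def mapExp (f : 𝔤 →ₗ⁅ℂ⁆ 𝔥) : ExpGroup 𝔤 →* ExpGroup 𝔥 :=
  ((Units.map (mapHat f : Uhat 𝔤 →* Uhat 𝔥)).comp (ExpGroup 𝔤).subtype).codRestrict (ExpGroup 𝔥)
    fun g => by
      have hg := g.2
      simp only [ExpGroup, Subgroup.mem_iInf, Subgroup.mem_comap] at hg ⊢
      intro k
      have hle : Subgroup.closure {v : (NilQuot 𝔤 k)ˣ | ∃ ξ : 𝔤,
          (v : NilQuot 𝔤 k) = IsNilpotent.exp (lev 𝔤 k ξ)} ≤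
          (Subgroup.closure {v : (NilQuot 𝔥 k)ˣ | ∃ ξ : 𝔥,
            (v : NilQuot 𝔥 k) = IsNilpotent.exp (lev 𝔥 k ξ)}).comap
              (Units.map (mapLev f k : NilQuot 𝔤 k →* NilQuot 𝔥 k)) := by
        rw [Subgroup.closure_le]
        rintro v ⟨ξ, hv⟩
        refine Subgroup.subset_closure ⟨f ξ, ?_⟩
        rw [← mapLev_lev, ← IsNilpotent.map_exp (isNilpotent_lev k ξ), ← hv]
        rfl
      exact hle (hg k)

end Functoriality

/-! ## Holomorphic maps, bundles with connection over quotients of `V` -/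

section Bundles

variable {V W : Type} [NormedAddCommGroup V] [NormedSpace ℂ V]
  [NormedAddCommGroup W] [NormedSpace ℂ W]
variable {𝔤 𝔥 : Type} [LieRing 𝔤] [LieAlgebra ℂ 𝔤] [LieRing 𝔥] [LieAlgebra ℂ 𝔥]

/-- `f` is complex differentiable at `v` with derivative `f'`, for maps with values in the
completed enveloping algebra: this holds for every coordinate at every level. -/
def HasHolDeriv (f : V → Uhat 𝔤) (f' : V → Uhat 𝔤) (v : V) : Prop :=
  ∀ (k : ℕ) (l : NilQuot 𝔤 k →ₗ[ℂ] ℂ), ∃ L : V →L[ℂ] ℂ,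
    HasFDerivAt (fun y => l (Uhat.comp 𝔤 k (f y))) L v ∧
      ∀ u, L u = l (Uhat.comp 𝔤 k (f' u))

variable (V 𝔤) in
/-- Data for a principal `exp(𝔤)`-bundle with connection on `U / Γ`, where `U` is an open subset
of `V` and the group `Γ` acts on it by translations: the sections of the bundle are the maps `σ`
on `Γ`-invariant open subsets of `U` with `σ (v + γ) = factor γ v * σ v`, and the connection is
`d + form`, where `form v u` is the value of the one-form `form` at `v` on the tangent vector `u`.
The conditions for this to be a flat bundle are stated in `IsFlatBundle`. -/
structure BundleData where
  Γ : AddSubgroup V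
  U : Set V
  factor : V → V → ExpGroup 𝔤
  form : V → V → Uhat 𝔤

namespace BundleData

/-- The data define a holomorphic principal bundle with a flat holomorphic connection. -/
structure IsFlatBundle (D : BundleData V 𝔤) : Prop where
  isOpen : IsOpen D.U
  stable : ∀ γ ∈ D.Γ, ∀ v ∈ D.U, v + γ ∈ D.U
  cocycle : ∀ γ ∈ D.Γ, ∀ γ' ∈ D.Γ, ∀ v ∈ D.U,
    D.factor (γ + γ') v = D.factor γ (v + γ') * D.factor γ' v
  form_mem : ∀ v ∈ D.U, ∀ u, IsLie (D.form v u)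
  form_linear : ∀ v ∈ D.U, IsLinearMap ℂ (D.form v)
  form_hol : ∀ v ∈ D.U, ∀ u, ∃ f', HasHolDeriv (fun y => D.form y u) f' v
  /-- the connection descends: `d(factor γ) = factor γ * form - (γ^* form) * factor γ` -/
  descends : ∀ γ ∈ D.Γ, ∀ v ∈ D.U, HasHolDeriv (fun y => gval (D.factor γ y))
    (fun u => gval (D.factor γ v) * D.form v u - D.form (v + γ) u * gval (D.factor γ v)) v
  /-- the curvature `d form + [form, form] / 2` vanishes -/
  flat : ∀ v ∈ D.U, ∀ u u' f f', HasHolDeriv (fun y => D.form y u) f v →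
    HasHolDeriv (fun y => D.form y u') f' v →
      f' u - f u' + (D.form v u * D.form v u' - D.form v u' * D.form v u) = 0

/-- The identifications in `U × exp(𝔤)` which define the total space. -/
inductive Rel (D : BundleData V 𝔤) : D.U × ExpGroup 𝔤 → D.U × ExpGroup 𝔤 → Prop
  | glue (γ : V) (hγ : γ ∈ D.Γ) (v : V) (hv : v ∈ D.U) (hv' : v + γ ∈ D.U) (h : ExpGroup 𝔤) :
      Rel D (⟨v, hv⟩, h) (⟨v + γ, hv'⟩, D.factor γ v * h)

/-- The total space of the principal bundle. -/
def Total (D : BundleData V 𝔤) : Type := Quot D.Rel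

/-- The projection of the total space to `V / Γ` (its image is `U / Γ`). -/
def proj (D : BundleData V 𝔤) : D.Total → V ⧸ D.Γ :=
  Quot.lift (fun x => ((x.1 : V) : V ⧸ D.Γ)) (by
    rintro _ _ ⟨γ, hγ, v, hv, hv', h⟩
    exact QuotientAddGroup.eq.2 (by simpa using hγ))

/-- The right action of the structure group. -/
def act (D : BundleData V 𝔤) (h' : ExpGroup 𝔤) : D.Total → D.Total :=
  Quot.map (fun x => (x.1, x.2 * h')) (by
    rintro _ _ ⟨γ, hγ, v, hv, hv', h⟩
    simp only [mul_assoc]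
    exact Rel.glue γ hγ v hv hv' (h * h'))

theorem proj_act (D : BundleData V 𝔤) (h' : ExpGroup 𝔤) (x : D.Total) :
    D.proj (D.act h' x) = D.proj x := by
  induction x using Quot.ind
  rfl

/-- The total space of the pull-back of the bundle under the composition
`W → V → V / Γ` of a linear map with the projection. -/
def Pull (D : BundleData V 𝔤) (f : W →L[ℂ] V) : Type :=
  {x : W × D.Total // D.proj x.2 = ((f x.1 : V) : V ⧸ D.Γ)}

/-- The right action of the structure group on the pull-back. -/
def Pull.act {D : BundleData V 𝔤} {f : W →L[ℂ] V} (x : D.Pull f) (h : ExpGroup 𝔤) : D.Pull f :=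
  ⟨(x.1.1, D.act h x.1.2), by rw [proj_act]; exact x.2⟩

/-- The canonical trivialization of the pull-back. In it, the pull-back of the connection is
`d + f^* form`. -/
def Pull.triv (D : BundleData V 𝔤) (f : W →L[ℂ] V) (w : W) (hw : f w ∈ D.U) (h : ExpGroup 𝔤) :
    D.Pull f :=
  ⟨(w, Quot.mk _ (⟨f w, hw⟩, h)), rfl⟩

/-- The map which in the canonical trivializations is `(w, h) ↦ (w, g w * φ h)` is an isomorphism,
over the identity of `W` and along the isomorphism `φ` of structure groups, from the pull-back of
`D₁` under `f₁` to the pull-back of `D₂` under `f₂`, and it takes the pull-back connection to the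
pull-back connection, that is
`(d + f₂^* form₂) ∘ g = g ∘ (d + φ (f₁^* form₁))`. -/
structure IsPullIso (D₁ : BundleData V 𝔤) {V' : Type} [NormedAddCommGroup V'] [NormedSpace ℂ V']
    (D₂ : BundleData V' 𝔥) (f₁ : W →L[ℂ] V) (f₂ : W →L[ℂ] V') (φ : 𝔤 ≃ₗ⁅ℂ⁆ 𝔥)
    (g : W → ExpGroup 𝔥) : Prop where
  bundle : ∃ ψ : D₁.Pull f₁ ≃ D₂.Pull f₂,
    (∀ x, (ψ x).1.1 = x.1.1) ∧
    (∀ x h, ψ (x.act h) = (ψ x).act (mapExp (φ : 𝔤 →ₗ⁅ℂ⁆ 𝔥) h)) ∧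
    (∀ w (h₁ : f₁ w ∈ D₁.U) (h₂ : f₂ w ∈ D₂.U) h, ψ (Pull.triv D₁ f₁ w h₁ h) =
      Pull.triv D₂ f₂ w h₂ (g w * mapExp (φ : 𝔤 →ₗ⁅ℂ⁆ 𝔥) h))
  domain : ∀ w, f₁ w ∈ D₁.U ↔ f₂ w ∈ D₂.U
  group : Function.Bijective (mapExp (φ : 𝔤 →ₗ⁅ℂ⁆ 𝔥))
  connection : ∀ w, f₁ w ∈ D₁.U → HasHolDeriv (fun y => gval (g y))
    (fun u => gval (g w) * mapHat (φ : 𝔤 →ₗ⁅ℂ⁆ 𝔥) (D₁.form (f₁ w) (f₁ u)) -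
      D₂.form (f₂ w) (f₂ u) * gval (g w)) w

end BundleData

end Bundles

/-! ## Theta function -/

/-- `e(z) = exp(2πiz)`. -/
def ee (z : ℂ) : ℂ := Complex.exp (2 * Real.pi * Complex.I * z)

/-- The odd theta function of `ℂ / (ℤ + τℤ)`, normalized by `θ'(0) = 1`. -/
def theta (τ z : ℂ) : ℂ :=
  (ee (z / 2) - ee (-(z / 2))) / (2 * Real.pi * Complex.I) *
    ∏' j : ℕ, (1 - ee (z + (j + 1) * τ)) * (1 - ee (-z + (j + 1) * τ)) / (1 - ee ((j + 1) * τ)) ^ 2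

/-- The Taylor series of `f` at `p`. -/
def taylor (f : ℂ → ℂ) (p : ℂ) : PowerSeries ℂ :=
  PowerSeries.mk fun k => iteratedDeriv k f p / (k.factorial : ℂ)

/-- The expansion at `z = 0` of `z θ(p + z) e^{-cz} / (θ(z) θ(p))`, as a power series in `z`. -/
def zF (τ p c : ℂ) : PowerSeries ℂ :=
  PowerSeries.C (theta τ p)⁻¹ * taylor (theta τ) p *
    PowerSeries.rescale (-c) (PowerSeries.exp ℂ) *
      (PowerSeries.mk fun k => PowerSeries.coeff (k + 1) (taylor (theta τ) 0))⁻¹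

/-- The coefficient of `z ^ α` in `θ(p + z) e^{-cz} / (θ(z) θ(p)) - 1 / z`. -/
def fcoef (τ : ℂ) (α : ℕ) (p c : ℂ) : ℂ := PowerSeries.coeff (α + 1) (zF τ p c)

/-! ## Configuration spaces, and differential forms on `(E^#)^n` -/

/-- The lattice `ℤ + τℤ`. -/
def lat (τ : ℂ) : AddSubgroup ℂ := AddSubgroup.closure {1, τ}

/-- The lattice `(ℤ + τℤ)^n` in `ℂ^n`, with quotient `E_τ^n`. -/
def latn (n : ℕ) (τ : ℂ) : AddSubgroup (Fin n → ℂ) := AddSubgroup.pi Set.univ fun _ => lat τ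

/-- `ℂ^{2n}`, with coordinates `(p, c)`. -/
abbrev V2 (n : ℕ) : Type := (Fin n → ℂ) × (Fin n → ℂ)

/-- The subgroup of all `(a + bτ, -2πi b)`, `a, b ∈ ℤ^n`, of `ℂ^{2n}`; the quotient is
`(E_τ^#)^n`. -/
def latSharp (n : ℕ) (τ : ℂ) : AddSubgroup (V2 n) where
  carrier := {γ | ∃ a b : Fin n → ℤ, ∀ i, γ.1 i = a i + b i * τ ∧
    γ.2 i = -(2 * Real.pi * Complex.I) * b i}
  zero_mem' := ⟨0, 0, fun i => by simp⟩
  add_mem' := by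
    rintro γ γ' ⟨a, b, h⟩ ⟨a', b', h'⟩
    refine ⟨a + a', b + b', fun i => ?_⟩
    simp only [Prod.fst_add, Prod.snd_add, Pi.add_apply, (h i).1, (h i).2, (h' i).1, (h' i).2,
      Int.cast_add]
    constructor <;> ring
  neg_mem' := by
    rintro γ ⟨a, b, h⟩
    refine ⟨-a, -b, fun i => ?_⟩
    simp only [Prod.fst_neg, Prod.snd_neg, Pi.neg_apply, (h i).1, (h i).2, Int.cast_neg]
    constructor <;> ring

/-- The preimage in `ℂ^n` of the configuration space of `n` points of `E_τ`. -/
def conf (n : ℕ) (τ : ℂ) : Set (Fin n → ℂ) := {p | ∀ i j, i ≠ j → p i - p j ∉ lat τ}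

/-- The preimage in `ℂ^{2n}` of the configuration space. -/
def confSharp (n : ℕ) (τ : ℂ) : Set (V2 n) := {w | w.1 ∈ conf n τ}

/-- One-forms and two-forms on `confSharp`, without regularity condition. -/
abbrev Form1 (n : ℕ) (τ : ℂ) : Type := confSharp n τ → (V2 n →ₗ[ℂ] ℂ)

/-- Two-forms, as functions of a point and two tangent vectors. -/
abbrev Form2 (n : ℕ) (τ : ℂ) : Type := confSharp n τ → V2 n → V2 n → ℂ

section Forms

variable {n : ℕ} {τ : ℂ}

/-- The partial derivative of a function on `confSharp` in the direction `u`. -/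
def pderiv (f : confSharp n τ → ℂ) (u : V2 n) (w : confSharp n τ) : ℂ :=
  open Classical in
  deriv (fun s : ℂ => if h : (w : V2 n) + s • u ∈ confSharp n τ then f ⟨_, h⟩ else 0) 0

/-- The exterior derivative. -/
def dForm (η : Form1 n τ) : Form2 n τ := fun w u v =>
  pderiv (fun y => η y v) u w - pderiv (fun y => η y u) v w

/-- The wedge product. -/
def wedge (η η' : Form1 n τ) : Form2 n τ := fun w u v => η w u * η' w v - η w v * η' w u

/-- `f` becomes an entire function on `ℂ^{2n}` after multiplication by `m`. -/
def EntireTimes (m : V2 n → ℂ) (f : confSharp n τ → ℂ) : Prop :=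
  ∃ H : V2 n → ℂ, Differentiable ℂ H ∧ ∀ w : confSharp n τ, m w * f w = H w

/-- `f` is the lift of a function on `(E_τ^#)^n` which is algebraic along the fibres of
`(E_τ^#)^n → E_τ^n`, that is, polynomial in the coordinates `c`, of bounded degree. For a
holomorphic function with at most poles along the diagonals this means that it is a
rational function on the algebraic variety `(E_τ^#)^n`. -/
def IsAlgFun (f : confSharp n τ → ℂ) : Prop :=
  (∀ γ ∈ latSharp n τ, ∀ w w' : confSharp n τ, (w' : V2 n) = w + γ → f w' = f w) ∧
  ∃ N : ℕ, ∀ p ∈ conf n τ, ∃ P : MvPolynomial (Fin n) ℂ, P.totalDegree ≤ N ∧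
    ∀ w : confSharp n τ, (w : V2 n).1 = p → f w = MvPolynomial.eval (w : V2 n).2 P

/-- The regular algebraic one-forms on `(E_τ^#)^n`. -/
def regForms (n : ℕ) (τ : ℂ) : Set (Form1 n τ) :=
  {η | ∀ u : V2 n, IsAlgFun (fun w => η w u) ∧ EntireTimes (fun _ => 1) (fun w => η w u)}

/-- The algebraic one-forms `η` on `(E_τ^#)^n` with logarithmic poles along the divisor `D_ij`:
`η` and `dη` are regular except for at most a simple pole along `D_ij`, the divisor on `ℂ^{2n}`
of the function `θ(p_i - p_j)`. -/
def logForms (n : ℕ) (τ : ℂ) (i j : Fin n) : Set (Form1 n τ) :=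
  {η | (∀ u : V2 n, IsAlgFun (fun w => η w u) ∧
      EntireTimes (fun w => theta τ (w.1 i - w.1 j)) (fun w => η w u)) ∧
    ∀ u v : V2 n, EntireTimes (fun w => theta τ (w.1 i - w.1 j)) (fun w => dForm η w u v)}

variable (n τ) in
/-- The space `Ω¹`, sum of the spaces of algebraic one-forms on `(E_τ^#)^n` with logarithmic
poles along one of the `D_ij` (these contain the regular forms, which are mentioned separately
for the sake of `n = 1`). -/
def Omega1 : Submodule ℂ (Form1 n τ) :=
  Submodule.span ℂ (regForms n τ ∪ ⋃ (i : Fin n) (j : Fin n) (_ : i < j), logForms n τ i j)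

end Forms

/-- Indices for the basis `dc_i`, `dp_i`, `ω_ij^α` (`i < j`, `α ≥ 0`) of `Ω¹`, and for the dual
basis `X_i`, `Y_i`, `T_ij^α`. -/
inductive Idx (n : ℕ) : Type
  | X (i : Fin n)
  | Y (i : Fin n)
  | T (i j : Fin n) (h : i < j) (α : ℕ)

/-- The degrees of `dc_i`, `dp_i`, `ω_ij^α`. -/
def Idx.deg {n : ℕ} : Idx n → ℕ
  | .X _ => 1
  | .Y _ => 0
  | .T _ _ _ α => α + 1

/-- The coordinate forms `dp_i` and `dc_i`. -/
def dp {n : ℕ} (i : Fin n) : V2 n →ₗ[ℂ] ℂ := LinearMap.proj i ∘ₗ LinearMap.fst ℂ _ _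

/-- See `dp`. -/
def dc {n : ℕ} (i : Fin n) : V2 n →ₗ[ℂ] ℂ := LinearMap.proj i ∘ₗ LinearMap.snd ℂ _ _

/-- The forms `dc_i`, `dp_i`, `ω_ij^α` at a point of `ℂ^{2n}`, where `ω_ij^α` is the coefficient
of `z ^ α` in `(θ(p_ij + z) e^{-c_ij z} / (θ(z) θ(p_ij)) - 1 / z) dp_ij`. -/
def etaAt {n : ℕ} (τ : ℂ) : Idx n → V2 n → (V2 n →ₗ[ℂ] ℂ)
  | .X i, _ => dc i
  | .Y i, _ => dp i
  | .T i j _ α, w => fcoef τ α (w.1 i - w.1 j) (w.2 i - w.2 j) • (dp i - dp j)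

/-- The family `dc_i`, `dp_i`, `ω_ij^α`. -/
def eta (n : ℕ) (τ : ℂ) (a : Idx n) : Form1 n τ := fun w => etaAt τ a w

/-! ## The Lie algebra `𝔊` and its flat connection on `(E^#)^n` -/

/-- `φ` restricts to an element of the graded dual of the image `I` of
`∧ : Λ²(Ω¹) → Ω²`: it vanishes on all but finitely many of the homogeneous components of `I`. -/
def IsGradedDual {n : ℕ} {τ : ℂ} (φ : Form2 n τ →ₗ[ℂ] ℂ) : Prop :=
  ∃ N : ℕ, ∀ a b : Idx n, N ≤ a.deg + b.deg → φ (wedge (eta n τ a) (eta n τ b)) = 0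

/-- The element of the free Lie algebra on the dual basis of `Ω¹` obtained by applying `φ` to
`dω + ½ ω²`, where `ω` is the canonical element; this is `d^*(φ) + ½ ∧^*(φ)`. The sums are
finite if `φ` is in the graded dual. -/
def flatRel {n : ℕ} {τ : ℂ} (φ : Form2 n τ →ₗ[ℂ] ℂ) : FreeLieAlgebra ℂ (Idx n) :=
  (∑ᶠ a : Idx n, φ (dForm (eta n τ a)) • FreeLieAlgebra.of ℂ a) +
    (1 / 2 : ℂ) • ∑ᶠ ab : Idx n × Idx n, φ (wedge (eta n τ ab.1) (eta n τ ab.2)) •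
      ⁅FreeLieAlgebra.of ℂ ab.1, FreeLieAlgebra.of ℂ ab.2⁆

/-- The ideal of the free Lie algebra generated by the image of the graded dual of `I`. -/
def relIdeal (n : ℕ) (τ : ℂ) : LieIdeal ℂ (FreeLieAlgebra ℂ (Idx n)) :=
  LieSubmodule.lieSpan ℂ _ {r | ∃ φ : Form2 n τ →ₗ[ℂ] ℂ, IsGradedDual φ ∧ r = flatRel φ}

/-- The Lie algebra `𝔊`. -/
abbrev GG (n : ℕ) (τ : ℂ) : Type := FreeLieAlgebra ℂ (Idx n) ⧸ relIdeal n τ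

/-- The generators `X_i`, `Y_i`, `T_ij^α` of `𝔊`. -/
def GG.gen (n : ℕ) (τ : ℂ) (a : Idx n) : GG n τ :=
  LieSubmodule.Quotient.mk (FreeLieAlgebra.of ℂ a)

/-- The canonical element `ω = ∑ X_i dc_i + ∑ Y_i dp_i + ∑ T_ij^α ω_ij^α`, as a one-form
on `ℂ^{2n}` with values in the completion of `𝔊`. -/
def omegaForm (n : ℕ) (τ : ℂ) (w u : V2 n) : Uhat (GG n τ) :=
  ∑' a : Idx n, etaAt τ a w u • hat (GG.gen n τ a)

/-- The trivial `exp(𝔊)`-bundle with connection `d + ω` over `(E_τ^#)^n` minus the diagonals. -/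
def omegaBundle (n : ℕ) (τ : ℂ) : BundleData (V2 n) (GG n τ) where
  Γ := latSharp n τ
  U := confSharp n τ
  factor := fun _ _ => 1
  form := omegaForm n τ

/-! ## The Lie algebra `𝔱_{1,n}` and the universal KZB connection -/

/-- Generators of `𝔱_{1,n}`. -/
inductive TGen (n : ℕ) : Type
  | x (i : Fin n)
  | y (i : Fin n)
  | t (i j : Fin n) (h : i ≠ j)

section T1n

variable (n : ℕ)

local notation "fx" => fun i => FreeLieAlgebra.of ℂ (TGen.x (n := n) i)
local notation "fy" => fun i => FreeLieAlgebra.of ℂ (TGen.y (n := n) i)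
local notation "ft" => fun i j h => FreeLieAlgebra.of ℂ (TGen.t (n := n) i j h)

/-- The defining relations of `𝔱_{1,n}`. -/
inductive TRel : FreeLieAlgebra ℂ (TGen n) → Prop
  | xx (i j : Fin n) : TRel ⁅fx i, fx j⁆
  | yy (i j : Fin n) : TRel ⁅fy i, fy j⁆
  | xy (i j : Fin n) (h : i ≠ j) : TRel (⁅fx i, fy j⁆ - ft i j h)
  | symm (i j : Fin n) (h : i ≠ j) : TRel (ft i j h - ft j i h.symm)
  | xy_diag (i : Fin n) : TRel (⁅fx i, fy i⁆ + ∑ j : {j : Fin n // i ≠ j}, ft i j j.2)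
  | xt (i j k : Fin n) (h : i ≠ j) (hi : k ≠ i) (hj : k ≠ j) : TRel ⁅fx k, ft i j h⁆
  | yt (i j k : Fin n) (h : i ≠ j) (hi : k ≠ i) (hj : k ≠ j) : TRel ⁅fy k, ft i j h⁆
  | xxt (i j : Fin n) (h : i ≠ j) : TRel ⁅fx i + fx j, ft i j h⁆
  | yyt (i j : Fin n) (h : i ≠ j) : TRel ⁅fy i + fy j, ft i j h⁆

/-- The Lie algebra `𝔱_{1,n}` over `ℂ`. -/
abbrev TT : Type :=
  FreeLieAlgebra ℂ (TGen n) ⧸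
    (LieSubmodule.lieSpan ℂ (FreeLieAlgebra ℂ (TGen n)) {r | TRel n r} :
      LieIdeal ℂ (FreeLieAlgebra ℂ (TGen n)))

variable {n}

/-- The generators of `𝔱_{1,n}`. -/
def TT.gen (a : TGen n) : TT n := LieSubmodule.Quotient.mk (FreeLieAlgebra.of ℂ a)

/-- The element `x_i`. -/
def TT.x (i : Fin n) : TT n := TT.gen (.x i)

/-- The element `y_i`. -/
def TT.y (i : Fin n) : TT n := TT.gen (.y i)

/-- The element `t_ij`. -/
def TT.t (i j : Fin n) (h : i ≠ j) : TT n := TT.gen (.t i j h)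

end T1n

/-- `(ad x_i)^α (b)`. -/
def adx {n : ℕ} (i : Fin n) (α : ℕ) (b : TT n) : TT n := (fun a => ⁅TT.x i, a⁆)^[α] b

/-- The value of `θ(p + ad x_i) ad x_i / (θ(p) θ(ad x_i)) - 1` on `y_j`. -/
def kzbTerm {n : ℕ} (τ : ℂ) (i j : Fin n) (p : ℂ) : Uhat (TT n) :=
  ∑' α : ℕ, PowerSeries.coeff α (zF τ p 0 - 1) • hat (adx i α (TT.y j))

/-- The one-form `A_KZB = -∑_i (-y_i + ∑_{j ≠ i}
(θ(p_ij + ad x_i) ad x_i / (θ(p_ij) θ(ad x_i)) - 1)(y_j)) dp_i`. -/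
def kzbForm (n : ℕ) (τ : ℂ) (p u : Fin n → ℂ) : Uhat (TT n) :=
  -∑ i, u i • (-hat (TT.y i) + ∑ j ∈ Finset.univ.erase i, kzbTerm τ i j (p i - p j))

/-- The universal KZB bundle with connection over the configuration space of `n` points of `E_τ`:
its sections satisfy `σ(p + e_i) = σ(p)`, `σ(p + τ e_i) = e^{-2πi x_i} σ(p)`, and its connection
is `d + A_KZB`. (For `γ_i = a + bτ` with `a, b` real, one has `b = Im γ_i / Im τ`.) -/
def kzbBundle (n : ℕ) (τ : ℂ) : BundleData (Fin n → ℂ) (TT n) where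
  Γ := latn n τ
  U := conf n τ
  factor := fun γ _ =>
    gexp (∑ i, (-(2 * Real.pi * Complex.I) * (((γ i).im / τ.im : ℝ) : ℂ)) • TT.x i)
  form := kzbForm n τ

/-- The gauge map `(p, c) ↦ exp(∑ c_i x_i)`. -/
def gauge (n : ℕ) (w : V2 n) : ExpGroup (TT n) := gexp (∑ i, w.2 i • TT.x i)

end KZB

end

/-!
The statement rests on two facts about theta functions: an entire function with the
multipliers of `θ` is a multiple of `θ` (`eq_const_mul_theta`), and the three-term identity of Fay
(`fay_theta`). Both follow from `elliptic_eq_const`, which says that entire elliptic functions are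
constant, because the zeros of `θ` are simple and form the lattice. Throughout, `k_m(p, c)` denotes
the coefficient of `z ^ m` in `z θ(p + z) e^{-cz} / (θ(z) θ(p))`, so that `k_0 = 1` and
`f_α = k_(α + 1)` is the function with `ω_ij^α = f_α(p_ij, c_ij) dp_ij`.

*The basis of `Ω¹`.* A function on the universal vector extension of the curve which is polynomial
along the fibres and has at most a simple pole along the zero fibre is a combination of the `k_m`:
the leading coefficient in `c` is constant, and subtracting the corresponding multiple of `k_m`
lowers the degree (`simple_pole_span`). Regular functions are constant (`regular_const`). For a form
`η` with logarithmic poles along `D_ij` this determines the coefficients, and the condition that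
`dη` has at most a simple pole forces the singular part to be a multiple of `dp_ij`, since the
residues `(-c) ^ α / α!` of the functions `f_α` are linearly independent
(`logForms_subset_span`, `linearIndependent_eta`).

*From `𝔊` to `𝔱_{1,n}`.* For elements `x_i, y_i, t_ij` of any Lie algebra which satisfy the
relations of `𝔱_{1,n}`, the connection `d + ∑ x_i dc_i + ∑ y_i dp_i - ∑ ω_ij^α (ad x_i)^α t_ij` is
flat degree by degree (`IsT1n.curv_eq_zero`). In the directions of `p_i` and `p_j`, every bracket
which involves a third index `k` equals `[t_ij, t_jk]` up to the action of the commuting operators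
`ad x_i` and `ad x_j`, and the sum vanishes by the three-term identity, read as an identity of
polynomials in two variables. Evaluating the functionals `φ` on this curvature shows that the
defining relations of `𝔊` hold in `𝔱_{1,n}` (`IsT1n.lift_flatRel`).

*From `𝔱_{1,n}` to `𝔊`.* Conversely, each relation of `𝔱_{1,n}` is obtained from a suitable
functional on two-forms. Those with a factor `X_i` come from the coefficients of `dc_i ∧ dc_j` and
`dc_i ∧ dp_j`, which are combinations of the linearly independent functions `1` and
`f_α(p_jk, c_jk)` (`GG.X_lie_X`, `GG.X_lie_Y`, `GG.X_lie_T`). For `[Y_i, Y_j] = 0` and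
`[Y_i, T_jk^0] = 0` one has to show that the coefficient of `dp_i ∧ dp_j` of one product is not a
combination of those of all the others. This is seen after restriction to three points, where the
three-term identity removes the products of two different poles, respectively on the polar part along
`p_j = p_k`; the remaining functions have simple poles, and a combination of them which is constant
has no residues, hence is zero (`const_mem_twoPole`, `GG.Y_lie_Y`, `GG.Y_lie_T`). The two morphisms
are inverse to each other on generators (`isoTT`).

*The bundles.* A generator of degree `d` lies in the `d`-th power of the augmentation ideal, so at
each level of the completion only finitely many terms of `ω` and of the KZB form matter. The image of
`ω` in the completion of `U(𝔱_{1,n})` is flat (`IsT1n.omHat_flat`), and its restriction to `c = 0` is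
the KZB form (`kzbForm_eq`). Flatness in the directions of `c` implies that conjugation with
`exp(∑ c_i x_i)` carries the form at `(p, c)` to the form at `(p, 0)` (`IsT1n.gauge_mul_omHat`).
As `ω` is invariant under the lattice of `(E^#)^n`, this gives the descent of the KZB connection
(`kzbBundle_isFlatBundle`) as well as the isomorphism of the two pull-backs (`isPullIso`).
-/

noncomputable section

namespace KZB

/-! ### The theta function -/

section Theta

open Complex

theorem ee_zero : ee 0 = 1 := by simp [ee]

theorem ee_add (z w : ℂ) : ee (z + w) = ee z * ee w := by
  rw [ee, ee, ee, ← Complex.exp_add]; ring_nf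

theorem ee_neg (z : ℂ) : ee (-z) = (ee z)⁻¹ := by
  rw [ee, ee, ← Complex.exp_neg]; ring_nf

theorem ee_ne_zero (z : ℂ) : ee z ≠ 0 := Complex.exp_ne_zero _

theorem ee_int (k : ℤ) : ee k = 1 := by
  rw [ee, Complex.exp_eq_one_iff]
  exact ⟨k, by ring⟩

theorem ee_one : ee 1 = 1 := by simpa using ee_int 1

theorem ee_half : ee (1 / 2) = -1 := by
  rw [ee, show 2 * (Real.pi : ℂ) * I * (1 / 2) = Real.pi * I by ring, Complex.exp_pi_mul_I]

theorem ee_eq_one {z : ℂ} : ee z = 1 ↔ ∃ k : ℤ, z = k := by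
  rw [ee, Complex.exp_eq_one_iff]
  have : 2 * (Real.pi : ℂ) * I ≠ 0 := Complex.two_pi_I_ne_zero
  refine exists_congr fun k => ⟨fun h => ?_, fun h => by rw [h]; ring⟩
  rw [mul_comm] at h
  exact mul_right_cancel₀ this h

theorem differentiable_ee : Differentiable ℂ ee := by
  unfold ee; fun_prop

theorem norm_ee (z : ℂ) : ‖ee z‖ = Real.exp (-(2 * Real.pi * z.im)) := by
  rw [ee, Complex.norm_exp]
  congr 1
  simp

/-- The infinite product `∏ (1 - x q ^ j)`, `j ≥ 1`, with `q = e(τ)`. -/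
def qprod (τ x : ℂ) : ℂ := ∏' j : ℕ, (1 - x * ee τ ^ (j + 1))

variable {τ : ℂ}

theorem norm_ee_tau_lt (hτ : 0 < τ.im) : ‖ee τ‖ < 1 := by
  rw [norm_ee, Real.exp_lt_one_iff]
  have := Real.pi_pos
  nlinarith [mul_pos this hτ]

theorem summable_qprod (hτ : 0 < τ.im) (x : ℂ) : Summable fun j : ℕ => ‖-(x * ee τ ^ (j + 1))‖ := by
  have h := (summable_nat_add_iff 1).mpr
    (summable_geometric_of_lt_one (norm_nonneg _) (norm_ee_tau_lt hτ))
  simpa using h.mul_left ‖x‖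

theorem multipliable_qprod (hτ : 0 < τ.im) (x : ℂ) :
    Multipliable fun j : ℕ => (1 - x * ee τ ^ (j + 1)) := by
  simp_rw [sub_eq_add_neg]
  exact multipliable_one_add_of_summable (summable_qprod hτ x)

theorem differentiable_qprod (hτ : 0 < τ.im) : Differentiable ℂ (qprod τ) := by
  have key : HasProdLocallyUniformlyOn (fun (j : ℕ) x => 1 - x * ee τ ^ (j + 1)) (qprod τ)
      Set.univ := by
    simp_rw [sub_eq_add_neg]
    have : qprod τ = fun x => ∏' j : ℕ, (1 + -(x * ee τ ^ (j + 1))) := by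
      ext x; simp [qprod, sub_eq_add_neg]
    rw [this]
    apply hasProdLocallyUniformlyOn_of_forall_compact isOpen_univ
    intro K _ hcK
    obtain ⟨R, hR⟩ := hcK.isBounded.exists_norm_le
    have h := (summable_nat_add_iff 1).mpr
      (summable_geometric_of_lt_one (norm_nonneg _) (norm_ee_tau_lt hτ))
    refine (h.mul_left R).hasProdUniformlyOn_nat_one_add hcK (.of_forall fun n x hx => ?_)
      (fun _ => by fun_prop)
    simp only [norm_neg, norm_mul, norm_pow]
    exact mul_le_mul_of_nonneg_right (hR x hx) (by positivity)
  rw [← differentiableOn_univ]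
  exact key.differentiableOn
    (.of_forall fun _ => by
      simpa [Finset.prod_fn] using! DifferentiableOn.finsetProd (fun _ _ => by fun_prop)) isOpen_univ

theorem qprod_ne_zero (hτ : 0 < τ.im) {x : ℂ} (hx : ∀ j : ℕ, x * ee τ ^ (j + 1) ≠ 1) :
    qprod τ x ≠ 0 := by
  have := tprod_one_add_ne_zero_of_summable (f := fun j : ℕ => -(x * ee τ ^ (j + 1)))
    (fun j => by
      rw [← sub_eq_add_neg, sub_ne_zero]
      exact (hx j).symm) (summable_qprod hτ x)
  simpa [qprod, sub_eq_add_neg] using this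

theorem qprod_shift (hτ : 0 < τ.im) (x : ℂ) :
    qprod τ x = (1 - x * ee τ) * qprod τ (x * ee τ) := by
  have h : Multipliable fun j : ℕ => (1 - x * ee τ ^ (j + 1 + 1)) := by
    refine (multipliable_qprod hτ (x * ee τ)).congr fun j => ?_
    rw [pow_succ' _ (j + 1), mul_assoc]
  rw [qprod, tprod_eq_zero_mul' (f := fun j : ℕ => (1 - x * ee τ ^ (j + 1))) h]
  simp only [zero_add, pow_one, qprod]
  congr 1
  refine tprod_congr fun j => ?_
  rw [pow_succ' _ (j + 1), mul_assoc]

theorem mem_lat {z : ℂ} : z ∈ lat τ ↔ ∃ a b : ℤ, z = a + b * τ := by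
  rw [lat, AddSubgroup.mem_closure_pair]
  simp only [zsmul_eq_mul, mul_one]
  exact exists_congr fun a => exists_congr fun b => eq_comm

theorem ee_tau_pow (j : ℕ) : ee τ ^ j = ee (j * τ) := by
  rw [ee, ee, ← Complex.exp_nat_mul]; ring_nf

theorem qprod_one_ne_zero (hτ : 0 < τ.im) : qprod τ 1 ≠ 0 := by
  refine qprod_ne_zero hτ fun j h => ?_
  have h1 : ‖ee τ ^ (j + 1)‖ < 1 := by
    rw [norm_pow]
    exact pow_lt_one₀ (norm_nonneg _) (norm_ee_tau_lt hτ) (by omega)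
  rw [one_mul] at h
  rw [h, norm_one] at h1
  exact lt_irrefl _ h1

/-- Theta as a quotient of products `qprod`: the product over the pairs of factors splits. -/
theorem theta_eq (hτ : 0 < τ.im) (z : ℂ) :
    theta τ z = (ee (z / 2) - ee (-(z / 2))) / (2 * Real.pi * I) *
      (qprod τ (ee z) * qprod τ (ee (-z)) / qprod τ 1 ^ 2) := by
  have h1 := multipliable_qprod hτ (ee z)
  have h2 := multipliable_qprod hτ (ee (-z))
  have h3 := multipliable_qprod hτ 1
  have h4 : HasProd (fun j : ℕ => (1 - 1 * ee τ ^ (j + 1)) ^ 2) (qprod τ 1 ^ 2) := by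
    simp only [sq]
    exact h3.hasProd.mul h3.hasProd
  have h := (h1.hasProd.mul h2.hasProd).div₀ h4 (pow_ne_zero 2 (qprod_one_ne_zero hτ))
  rw [theta]
  congr 1
  refine Eq.trans (tprod_congr fun j => ?_) h.tprod_eq
  rw [ee_tau_pow, ee_add, ee_add, one_mul]
  push_cast
  rfl

theorem differentiable_theta (hτ : 0 < τ.im) : Differentiable ℂ (theta τ) := by
  have hq := differentiable_qprod hτ
  have he := differentiable_ee
  have : theta τ = fun z => (ee (z / 2) - ee (-(z / 2))) / (2 * Real.pi * I) *
      (qprod τ (ee z) * qprod τ (ee (-z)) / qprod τ 1 ^ 2) := funext (theta_eq hτ)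
  rw [this]
  simp only [div_eq_mul_inv]
  refine Differentiable.mul ?_ ?_
  · exact ((he.comp (by fun_prop)).sub (he.comp (by fun_prop))).mul_const _
  · exact ((hq.comp he).mul (hq.comp (he.comp (by fun_prop)))).mul_const _

theorem theta_neg (hτ : 0 < τ.im) (z : ℂ) : theta τ (-z) = -theta τ z := by
  rw [theta_eq hτ, theta_eq hτ, neg_neg, neg_div, neg_neg]
  ring

theorem theta_zero (hτ : 0 < τ.im) : theta τ 0 = 0 := by
  rw [theta_eq hτ]; simp

theorem theta_add_one (hτ : 0 < τ.im) (z : ℂ) : theta τ (z + 1) = -theta τ z := by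
  have h1 : ee ((z + 1) / 2) = -ee (z / 2) := by
    rw [add_div, ee_add, ee_half]; ring
  have h2 : ee (-((z + 1) / 2)) = -ee (-(z / 2)) := by
    rw [ee_neg, h1, ee_neg, inv_neg]
  have h3 : ee (-(z + 1)) = ee (-z) := by
    rw [ee_neg, ee_add, ee_one, mul_one, ee_neg]
  rw [theta_eq hτ, theta_eq hτ, h1, h2, h3, ee_add, ee_one, mul_one]
  ring

theorem theta_add_tau (hτ : 0 < τ.im) (z : ℂ) :
    theta τ (z + τ) = -ee (-z - τ / 2) * theta τ z := by
  have s1 := qprod_shift hτ (ee z)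
  have s2 := qprod_shift hτ (ee (-(z + τ)))
  have e1 : ee (-(z + τ)) * ee τ = ee (-z) := by rw [← ee_add]; ring_nf
  rw [e1] at s2
  rw [← ee_add] at s1
  rw [theta_eq hτ, theta_eq hτ, s1, s2]
  have hx : ee z = ee (z / 2) ^ 2 := by rw [sq, ← ee_add]; ring_nf
  have ht : ee τ = ee (τ / 2) ^ 2 := by rw [sq, ← ee_add]; ring_nf
  have a1 : ee ((z + τ) / 2) = ee (z / 2) * ee (τ / 2) := by rw [← ee_add]; ring_nf
  have a2 : ee (-z - τ / 2) = (ee z)⁻¹ * (ee (τ / 2))⁻¹ := by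
    rw [← ee_neg, ← ee_neg, ← ee_add]; ring_nf
  rw [ee_neg ((z + τ) / 2), ee_neg (z / 2), ee_neg z, a1, a2, ee_add, ht, hx]
  have hz0 := ee_ne_zero (z / 2)
  have ht0 := ee_ne_zero (τ / 2)
  have hq := qprod_one_ne_zero hτ
  have hpi := Complex.two_pi_I_ne_zero
  generalize ee (z / 2) = x at *
  generalize ee (τ / 2) = t at *
  generalize qprod τ (x ^ 2 * t ^ 2) = A
  generalize qprod τ (x ^ 2)⁻¹ = B
  generalize qprod τ 1 = Q at *
  field_simp
  ring

/-- Every lattice translation multiplies theta by the exponential of an affine function. -/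
theorem exists_theta_add (hτ : 0 < τ.im) {γ : ℂ} (hγ : γ ∈ lat τ) :
    ∃ α β : ℂ, ∀ z, theta τ (z + γ) = ee (α * z + β) * theta τ z := by
  rw [lat] at hγ
  induction hγ using AddSubgroup.closure_induction with
  | mem x hx =>
    rcases hx with rfl | rfl
    · refine ⟨0, 1 / 2, fun z => ?_⟩
      rw [theta_add_one hτ, zero_mul, zero_add, ee_half, neg_one_mul]
    · refine ⟨-1, -x / 2 + 1 / 2, fun z => ?_⟩
      rw [theta_add_tau hτ, ← add_assoc, ee_add, ee_half]
      ring_nf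
  | zero => exact ⟨0, 0, fun z => by simp [ee_zero]⟩
  | add x y _ _ hx hy =>
    obtain ⟨α, β, hx⟩ := hx
    obtain ⟨α', β', hy⟩ := hy
    refine ⟨α + α', β + (α' * x + β'), fun z => ?_⟩
    rw [← add_assoc, hy, hx, ← mul_assoc, ← ee_add]
    ring_nf
  | neg x _ hx =>
    obtain ⟨α, β, hx⟩ := hx
    refine ⟨-α, α * x - β, fun z => ?_⟩
    have := hx (z + -x)
    rw [neg_add_cancel_right] at this
    rw [this, ← mul_assoc, ← ee_add, show -α * z + (α * x - β) + (α * (z + -x) + β) = 0 by ring,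
      ee_zero, one_mul]

/-- The zeros of theta are the points of the lattice. -/
theorem theta_eq_zero_iff (hτ : 0 < τ.im) {z : ℂ} : theta τ z = 0 ↔ z ∈ lat τ := by
  constructor
  · intro h
    have key : ∀ w : ℂ, qprod τ (ee w) = 0 → w ∈ lat τ := by
      intro w hw
      by_contra hn
      refine qprod_ne_zero hτ (fun j hj => hn ?_) hw
      rw [ee_tau_pow, ← ee_add, ee_eq_one] at hj
      obtain ⟨k, hk⟩ := hj
      refine mem_lat.2 ⟨k, -((j + 1 : ℕ) : ℤ), ?_⟩
      rw [← hk]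
      push_cast
      ring
    rw [theta_eq hτ, mul_eq_zero, div_eq_zero_iff, div_eq_zero_iff,
      mul_eq_zero (a := qprod τ (ee z))] at h
    rcases h with (h | h) | (h | h) | h
    · rw [sub_eq_zero, ee_neg, ← mul_eq_one_iff_eq_inv₀ (ee_ne_zero _), ← ee_add, add_halves,
        ee_eq_one] at h
      obtain ⟨k, rfl⟩ := h
      exact mem_lat.2 ⟨k, 0, by simp⟩
    · exact absurd h Complex.two_pi_I_ne_zero
    · exact key z h
    · simpa using key (-z) h
    · exact absurd h (pow_ne_zero 2 (qprod_one_ne_zero hτ))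
  · intro h
    obtain ⟨α, β, h⟩ := exists_theta_add hτ h
    have := h 0
    rwa [theta_zero hτ, mul_zero, zero_add] at this

theorem theta_ne_zero (hτ : 0 < τ.im) {z : ℂ} (hz : z ∉ lat τ) : theta τ z ≠ 0 :=
  fun h => hz ((theta_eq_zero_iff hτ).1 h)

theorem deriv_theta_zero (hτ : 0 < τ.im) : deriv (theta τ) 0 = 1 := by
  have hq := differentiable_qprod hτ
  have h1 : HasDerivAt (fun z => (ee (z / 2) - ee (-(z / 2))) / (2 * Real.pi * I)) 1 0 := by
    have : HasDerivAt ee (2 * Real.pi * I) 0 := by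
      have := ((hasDerivAt_id (0 : ℂ)).const_mul (2 * Real.pi * I)).cexp
      simpa [ee] using! this
    have a : HasDerivAt (fun z : ℂ => z / 2) (1 / 2) 0 := (hasDerivAt_id (0 : ℂ)).div_const 2
    have b : HasDerivAt (fun z : ℂ => ee (z / 2)) (2 * Real.pi * I * (1 / 2)) 0 :=
      HasDerivAt.comp (0 : ℂ) (h₂ := ee) (by simpa using this) a
    have d : HasDerivAt (fun z : ℂ => ee (-(z / 2))) (2 * Real.pi * I * -(1 / 2)) 0 :=
      HasDerivAt.comp (0 : ℂ) (h₂ := ee) (h := fun z => -(z / 2)) (by simpa using this) a.neg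
    have e : (2 * Real.pi * I * (1 / 2) - 2 * Real.pi * I * -(1 / 2)) / (2 * Real.pi * I) = 1 := by
      rw [div_eq_iff Complex.two_pi_I_ne_zero]
      ring
    have h := (b.sub d).div_const (2 * Real.pi * I)
    rw [e] at h
    exact h
  have h2 : DifferentiableAt ℂ
      (fun z => qprod τ (ee z) * qprod τ (ee (-z)) / qprod τ 1 ^ 2) 0 :=
    (((hq.comp differentiable_ee).mul (hq.comp (differentiable_ee.comp differentiable_neg))).div_const
      _).differentiableAt
  have h := h1.mul h2.hasDerivAt
  have : theta τ = fun z => (ee (z / 2) - ee (-(z / 2))) / (2 * Real.pi * I) *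
      (qprod τ (ee z) * qprod τ (ee (-z)) / qprod τ 1 ^ 2) := funext (theta_eq hτ)
  rw [this]
  refine h.deriv.trans ?_
  have := qprod_one_ne_zero hτ
  simp [ee_zero]
  field_simp

theorem deriv_theta_ne_zero (hτ : 0 < τ.im) {γ : ℂ} (hγ : γ ∈ lat τ) : deriv (theta τ) γ ≠ 0 := by
  obtain ⟨α, β, h⟩ := exists_theta_add hτ hγ
  have h1 : HasDerivAt (fun z => ee (α * z + β) * theta τ z) (ee β) 0 := by
    have a : DifferentiableAt ℂ (fun z => ee (α * z + β)) 0 :=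
      (differentiable_ee.comp (by fun_prop : Differentiable ℂ fun z => α * z + β)).differentiableAt
    have b := (differentiable_theta hτ 0).hasDerivAt
    have c := a.hasDerivAt.mul b
    rw [deriv_theta_zero hτ, theta_zero hτ] at c
    simpa using! c
  have h2 : HasDerivAt (fun z => theta τ (z + γ)) (deriv (theta τ) (0 + γ)) 0 :=
    ((differentiable_theta hτ (0 + γ)).hasDerivAt).comp_add_const 0 γ
  have h3 : (fun z => theta τ (z + γ)) = fun z => ee (α * z + β) * theta τ z := funext h
  rw [h3, zero_add] at h2
  rw [h2.unique h1]
  exact ee_ne_zero β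

end Theta

/-! ### Elliptic functions and the three-term identity of theta functions -/

section Elliptic

open Complex

/-- An entire function which vanishes at the zeros of an entire function with simple zeros is
divisible by it. -/
theorem exists_eq_mul_of_simple_zeros {D G : ℂ → ℂ} (hD : Differentiable ℂ D)
    (hG : Differentiable ℂ G) (h : ∀ z, G z = 0 → deriv G z ≠ 0 ∧ D z = 0) :
    ∃ H : ℂ → ℂ, Differentiable ℂ H ∧ ∀ z, D z = G z * H z := by
  classical
  refine ⟨fun z => if G z = 0 then deriv D z / deriv G z else D z / G z, fun z => ?_, fun z => ?_⟩
  · by_cases hz : G z = 0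
    · obtain ⟨h1, h2⟩ := h z hz
      have dG : Differentiable ℂ (dslope G z) := fun w =>
        (Complex.differentiableOn_dslope Filter.univ_mem).2 hG.differentiableOn w (Set.mem_univ w)
          |>.differentiableAt Filter.univ_mem
      have dD : Differentiable ℂ (dslope D z) := fun w =>
        (Complex.differentiableOn_dslope Filter.univ_mem).2 hD.differentiableOn w (Set.mem_univ w)
          |>.differentiableAt Filter.univ_mem
      have hne : dslope G z z ≠ 0 := by rwa [dslope_same]
      have ev : ∀ᶠ w in nhds z, dslope G z w ≠ 0 :=
        dG.continuous.continuousAt.eventually_ne hne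
      refine (((dD z).div (dG z) hne).congr_of_eventuallyEq ?_)
      filter_upwards [ev] with w hw
      by_cases hwz : w = z
      · subst hwz
        simp [hz, dslope_same]
      · have eG : G w = (w - z) * dslope G z w := by
          have := sub_smul_dslope G z w
          simpa [hz] using this.symm
        have eD : D w = (w - z) * dslope D z w := by
          have := sub_smul_dslope D z w
          simpa [h2] using this.symm
        have hs := sub_ne_zero.2 hwz
        have : G w ≠ 0 := by rw [eG]; exact mul_ne_zero hs hw
        rw [if_neg this, Pi.div_apply, eG, eD, mul_div_mul_left _ _ hs]
    · have ev : ∀ᶠ w in nhds z, G w ≠ 0 := hG.continuous.continuousAt.eventually_ne hz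
      refine (((hD z).div (hG z) hz).congr_of_eventuallyEq ?_)
      filter_upwards [ev] with w hw
      rw [if_neg hw, Pi.div_apply]
  · by_cases hz : G z = 0
    · simp [hz, (h z hz).2]
    · simp only [if_neg hz]
      field_simp

/-- A function with simple zeros can be cancelled: at a zero of `G`, differentiate the product. -/
theorem eq_zero_of_simple_zeros_mul {K G : ℂ → ℂ} (hK : Differentiable ℂ K)
    (hG : Differentiable ℂ G) (h : ∀ z, G z = 0 → deriv G z ≠ 0) (h0 : ∀ z, G z * K z = 0) (z : ℂ) :
    K z = 0 := by
  by_cases hz : G z = 0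
  · have h1 := (hG z).hasDerivAt.mul (hK z).hasDerivAt
    have h2 : G * K = fun _ => 0 := funext h0
    rw [h2] at h1
    have h3 := h1.unique (hasDerivAt_const z (0 : ℂ))
    rw [hz, zero_mul, add_zero] at h3
    exact (mul_eq_zero.1 h3).resolve_left (h z hz)
  · exact (mul_eq_zero.1 (h0 z)).resolve_left hz

variable {τ : ℂ}

/-- An entire elliptic function is constant. -/
theorem elliptic_eq_const (hτ : 0 < τ.im) {H : ℂ → ℂ} (hH : Differentiable ℂ H)
    (h1 : ∀ z, H (z + 1) = H z) (h2 : ∀ z, H (z + τ) = H z) (z w : ℂ) : H z = H w := by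
  refine hH.apply_eq_apply_of_bounded ?_ z w
  have hc : IsCompact ((fun x : ℝ × ℝ => H (x.1 + x.2 * τ)) '' (Set.Icc 0 1 ×ˢ Set.Icc 0 1)) := by
    refine (isCompact_Icc.prod isCompact_Icc).image ?_
    exact hH.continuous.comp (by fun_prop)
  refine hc.isBounded.subset ?_
  rintro _ ⟨z, rfl⟩
  set y : ℝ := z.im / τ.im with hy
  set x : ℝ := z.re - y * τ.re with hx
  have hz : z = x + y * τ := by
    apply Complex.ext
    · simp [hx]
    · simp only [add_im, ofReal_im, mul_im, ofReal_re, zero_mul, add_zero, zero_add, hy]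
      field_simp
  refine ⟨(Int.fract x, Int.fract y), ⟨⟨Int.fract_nonneg x, (Int.fract_lt_one x).le⟩,
    ⟨Int.fract_nonneg y, (Int.fract_lt_one y).le⟩⟩, ?_⟩
  have p1 : Function.Periodic H 1 := h1
  have p2 : Function.Periodic H τ := h2
  have e : ((Int.fract x : ℝ) : ℂ) + (Int.fract y : ℝ) * τ = z - ⌊y⌋ * τ - ⌊x⌋ * 1 := by
    rw [hz, Int.fract, Int.fract]
    push_cast
    ring
  simp only
  rw [e, p1.sub_int_mul_eq, p2.sub_int_mul_eq]

/-- Two entire functions with the same multipliers are proportional if one has simple zeros and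
the other one vanishes there. -/
theorem eq_const_mul_of_multipliers (hτ : 0 < τ.im) {D G : ℂ → ℂ} (hD : Differentiable ℂ D)
    (hG : Differentiable ℂ G) (h : ∀ z, G z = 0 → deriv G z ≠ 0 ∧ D z = 0)
    {m m' : ℂ → ℂ} (hm : ∀ z, m z ≠ 0) (hm' : ∀ z, m' z ≠ 0)
    (hD1 : ∀ z, D (z + 1) = m z * D z) (hG1 : ∀ z, G (z + 1) = m z * G z)
    (hD2 : ∀ z, D (z + τ) = m' z * D z) (hG2 : ∀ z, G (z + τ) = m' z * G z) :
    ∃ C : ℂ, ∀ z, D z = C * G z := by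
  obtain ⟨H, hH, hDG⟩ := exists_eq_mul_of_simple_zeros hD hG h
  have aux : ∀ (c : ℂ) (m : ℂ → ℂ), (∀ z, m z ≠ 0) → (∀ z, D (z + c) = m z * D z) →
      (∀ z, G (z + c) = m z * G z) → ∀ z, H (z + c) = H z := by
    intro c m hm e1 e2 z
    rw [← sub_eq_zero]
    refine eq_zero_of_simple_zeros_mul (K := fun z => H (z + c) - H z) (by fun_prop) hG
      (fun z hz => (h z hz).1) (fun w => ?_) z
    have := e1 w
    rw [hDG, hDG, e2, mul_assoc] at this
    have := mul_left_cancel₀ (hm w) this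
    rw [mul_sub, this, sub_self]
  refine ⟨H 0, fun z => ?_⟩
  rw [hDG, elliptic_eq_const hτ hH (aux 1 m hm hD1 hG1) (aux τ m' hm' hD2 hG2) z 0, mul_comm]

/-- The zero set is invariant under the lattice if it is so under the two generators. -/
theorem zero_iff_add_lat {H : ℂ → ℂ} (h1 : ∀ z, H (z + 1) = 0 ↔ H z = 0)
    (h2 : ∀ z, H (z + τ) = 0 ↔ H z = 0) {γ : ℂ} (hγ : γ ∈ lat τ) :
    ∀ z, H (z + γ) = 0 ↔ H z = 0 := by
  rw [lat] at hγ
  induction hγ using AddSubgroup.closure_induction with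
  | mem x hx =>
    rcases hx with rfl | rfl
    · exact h1
    · exact h2
  | zero => simp
  | add x y _ _ hx hy => intro z; rw [← add_assoc, hy, hx]
  | neg x _ hx => intro z; rw [← hx (z + -x), neg_add_cancel_right]

theorem real_coord_unique (hτ : 0 < τ.im) {x y x' y' : ℝ}
    (h : (x : ℂ) + y * τ = x' + y' * τ) : x = x' ∧ y = y' := by
  have h2 := congrArg Complex.im h
  simp only [add_im, ofReal_im, mul_im, ofReal_re, zero_mul, add_zero, zero_add] at h2
  have hy := mul_right_cancel₀ hτ.ne' h2
  subst hy
  have h3 := add_right_cancel h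
  exact ⟨by exact_mod_cast h3, rfl⟩

theorem half_notMem_lat (hτ : 0 < τ.im) {a b : ℤ} (h : Odd a ∨ Odd b) :
    (a : ℂ) / 2 + b / 2 * τ ∉ lat τ := by
  intro hm
  obtain ⟨c, d, hcd⟩ := mem_lat.1 hm
  have := real_coord_unique hτ (x := a / 2) (y := b / 2) (x' := c) (y' := d) (by
    push_cast
    exact hcd)
  have h1 : a = 2 * c := by
    have h := this.1
    rw [div_eq_iff two_ne_zero, mul_comm] at h
    exact_mod_cast h
  have h2 : b = 2 * d := by
    have h := this.2
    rw [div_eq_iff two_ne_zero, mul_comm] at h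
    exact_mod_cast h
  rcases h with ⟨k, h⟩ | ⟨k, h⟩ <;> omega

/-- The multiplier of theta under translation by `τ`. -/
def thetaMul (τ z : ℂ) : ℂ := -ee (-z - τ / 2)

theorem thetaMul_ne_zero (z : ℂ) : thetaMul τ z ≠ 0 := neg_ne_zero.2 (ee_ne_zero _)

theorem theta_add_tau' (hτ : 0 < τ.im) (z : ℂ) : theta τ (z + τ) = thetaMul τ z * theta τ z :=
  theta_add_tau hτ z

theorem thetaMul_mul (a b : ℂ) : thetaMul τ a * thetaMul τ b = ee (-(a + b) - τ) := by
  rw [thetaMul, thetaMul, neg_mul_neg, ← ee_add]; ring_nf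

theorem differentiable_theta_shift (hτ : 0 < τ.im) (w : ℂ) :
    Differentiable ℂ fun z => theta τ (z + w) :=
  (differentiable_theta hτ).comp (by fun_prop)

theorem deriv_theta_shift (hτ : 0 < τ.im) (w z : ℂ) :
    HasDerivAt (fun z => theta τ (z + w)) (deriv (theta τ) (z + w)) z :=
  ((differentiable_theta hτ (z + w)).hasDerivAt).comp_add_const z w

/-- An even entire function with the multipliers of theta vanishes. -/
theorem even_eq_zero (hτ : 0 < τ.im) {E : ℂ → ℂ} (hE : Differentiable ℂ E)
    (h1 : ∀ z, E (z + 1) = -E z) (h2 : ∀ z, E (z + τ) = thetaMul τ z * E z)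
    (hev : ∀ z, E (-z) = E z) (z : ℂ) : E z = 0 := by
  -- `E` vanishes at the three half periods
  have e1 : E (1 / 2) = 0 := by
    have := h1 (-(1 / 2))
    rw [hev] at this
    norm_num at this
    linear_combination (1 / 2 : ℂ) * this
  have e2 : E (τ / 2) = 0 := by
    have := h2 (-(τ / 2))
    rw [hev, show -(τ / 2) + τ = τ / 2 by ring, thetaMul, neg_neg, sub_self, ee_zero] at this
    linear_combination (1 / 2 : ℂ) * this
  have e3 : E ((1 + τ) / 2) = 0 := by
    have := h2 (-((1 + τ) / 2) + 1)
    rw [h1, hev, show -((1 + τ) / 2) + 1 + τ = (1 + τ) / 2 by ring, thetaMul,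
      show -(-((1 + τ) / 2) + 1) - τ / 2 = -(1 / 2) by ring, ee_neg, ee_half] at this
    norm_num at this
    linear_combination (1 / 2 : ℂ) * this
  have inv : ∀ γ ∈ lat τ, ∀ z, E (z + γ) = 0 ↔ E z = 0 := fun γ hγ =>
    zero_iff_add_lat (fun z => by rw [h1, neg_eq_zero])
      (fun z => by rw [h2, mul_eq_zero, or_iff_right (thetaMul_ne_zero z)]) hγ
  have vanish : ∀ w z, E w = 0 → z + -w ∈ lat τ → E z = 0 := by
    intro w z hw hz
    have := (inv _ hz w).2 hw
    rwa [show w + (z + -w) = z by ring] at this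
  have n12 : ∀ z : ℂ, z + -(1 / 2) ∈ lat τ → z + -(τ / 2) ∉ lat τ := fun z ha hb => by
    have := sub_mem hb ha
    refine half_notMem_lat hτ (a := 1) (b := -1) (Or.inl odd_one) ?_
    convert this using 1
    push_cast; ring
  have n13 : ∀ z : ℂ, z + -(1 / 2) ∈ lat τ → z + -((1 + τ) / 2) ∉ lat τ := fun z ha hb => by
    have := sub_mem ha hb
    refine half_notMem_lat hτ (a := 0) (b := 1) (Or.inr odd_one) ?_
    convert this using 1
    push_cast; ring
  have n23 : ∀ z : ℂ, z + -(τ / 2) ∈ lat τ → z + -((1 + τ) / 2) ∉ lat τ := fun z ha hb => by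
    have := sub_mem ha hb
    refine half_notMem_lat hτ (a := 1) (b := 0) (Or.inl odd_one) ?_
    convert this using 1
    push_cast; ring
  have dθ := differentiable_theta hτ
  have hG := fun z => ((deriv_theta_shift hτ (-(1 / 2)) z).fun_mul
    (deriv_theta_shift hτ (-(τ / 2)) z)).fun_mul (deriv_theta_shift hτ (-((1 + τ) / 2)) z)
  -- `E θ² e` and the product of the translates of theta with zeros at the half periods have the
  -- same multipliers; the former vanishes at the half periods, and, with theta, at `0`.
  obtain ⟨C, hC⟩ := eq_const_mul_of_multipliers hτ (D := fun z => E z * theta τ z ^ 2 * ee z)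
    (G := fun z => theta τ (z + -(1 / 2)) * theta τ (z + -(τ / 2)) * theta τ (z + -((1 + τ) / 2)))
    (m := fun _ => -1) (m' := fun z => -ee (-3 * z - 3 * (τ / 2) + τ))
    ((hE.mul (dθ.pow 2)).mul differentiable_ee) (fun z => (hG z).differentiableAt)
    (fun z hz => by
      rw [(hG z).deriv]
      simp only [mul_eq_zero] at hz
      rcases hz with (hz | hz) | hz
      · have hl := (theta_eq_zero_iff hτ).1 hz
        refine ⟨?_, by simp [vanish _ z e1 hl]⟩
        simp only [hz, zero_mul, add_zero]
        exact mul_ne_zero (mul_ne_zero (deriv_theta_ne_zero hτ hl) (theta_ne_zero hτ (n12 z hl)))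
          (theta_ne_zero hτ (n13 z hl))
      · have hl := (theta_eq_zero_iff hτ).1 hz
        refine ⟨?_, by simp [vanish _ z e2 hl]⟩
        simp only [hz, zero_mul, add_zero, mul_zero, zero_add]
        exact mul_ne_zero (mul_ne_zero (theta_ne_zero hτ (fun h => n12 z h hl))
          (deriv_theta_ne_zero hτ hl)) (theta_ne_zero hτ (n23 z hl))
      · have hl := (theta_eq_zero_iff hτ).1 hz
        refine ⟨?_, by simp [vanish _ z e3 hl]⟩
        simp only [hz, mul_zero, zero_add]
        exact mul_ne_zero (mul_ne_zero (theta_ne_zero hτ (fun h => n13 z h hl))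
          (theta_ne_zero hτ (fun h => n23 z h hl))) (deriv_theta_ne_zero hτ hl))
    (fun _ => by norm_num) (fun z => neg_ne_zero.2 (ee_ne_zero _))
    (fun z => by
      simp only [h1, theta_add_one hτ, ee_add, ee_one]; ring)
    (fun z => by
      simp only [add_right_comm z 1, theta_add_one hτ]; ring)
    (fun z => by
      simp only [h2, theta_add_tau' hτ, mul_pow, ee_add z]
      rw [show -ee (-3 * z - 3 * (τ / 2) + τ) = thetaMul τ z * thetaMul τ z ^ 2 * ee τ by
        rw [sq, thetaMul_mul, thetaMul, neg_mul (ee _), neg_mul (_ * _), ← ee_add,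
          ← ee_add,
          show -z - τ / 2 + (-(z + z) - τ) + τ = -3 * z - 3 * (τ / 2) + τ by ring]]
      ring)
    (fun z => by
      simp only [add_right_comm z τ, theta_add_tau' hτ]
      rw [show -ee (-3 * z - 3 * (τ / 2) + τ) = thetaMul τ (z + -(1 / 2)) *
          thetaMul τ (z + -(τ / 2)) * thetaMul τ (z + -((1 + τ) / 2)) by
        rw [thetaMul_mul, thetaMul, mul_neg, ← ee_add,
          show -(z + -(1 / 2) + (z + -(τ / 2))) - τ + (-(z + -((1 + τ) / 2)) - τ / 2) =
            -3 * z - 3 * (τ / 2) + τ + 1 by ring, ee_add _ 1, ee_one, mul_one]]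
      ring)
  -- at `0` the left hand side vanishes, and the product of translates does not
  have hC0 : C = 0 := by
    have h0 := hC 0
    simp only [theta_zero hτ, zero_add] at h0
    have hp : theta τ (-(1 / 2)) * theta τ (-(τ / 2)) * theta τ (-((1 + τ) / 2)) ≠ 0 := by
      refine mul_ne_zero (mul_ne_zero ?_ ?_) ?_ <;> refine theta_ne_zero hτ ?_
      · have := half_notMem_lat hτ (a := -1) (b := 0) (Or.inl (by decide))
        convert this using 1
        push_cast; ring_nf
      · have := half_notMem_lat hτ (a := 0) (b := -1) (Or.inr (by decide))
        convert this using 1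
        push_cast; ring_nf
      · have := half_notMem_lat hτ (a := -1) (b := -1) (Or.inl (by decide))
        convert this using 1
        push_cast; ring_nf
    have : C * (theta τ (-(1 / 2)) * theta τ (-(τ / 2)) * theta τ (-((1 + τ) / 2))) = 0 := by
      rw [← h0]; ring
    exact (mul_eq_zero.1 this).resolve_right hp
  have simple : ∀ z, theta τ z = 0 → deriv (theta τ) z ≠ 0 := fun z hz =>
    deriv_theta_ne_zero hτ ((theta_eq_zero_iff hτ).1 hz)
  refine eq_zero_of_simple_zeros_mul hE dθ simple (fun z => ?_) z
  refine eq_zero_of_simple_zeros_mul (K := fun z => theta τ z * E z) (dθ.mul hE) dθ simple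
    (fun z => ?_) z
  have := hC z
  rw [hC0, zero_mul] at this
  have := (mul_eq_zero.1 this).resolve_right (ee_ne_zero z)
  rw [← this]; ring

/-- Theta is up to a factor the only entire function with its multipliers. In other words, an
elliptic function with at most simple poles, at the points of the lattice, is constant. -/
theorem eq_const_mul_theta (hτ : 0 < τ.im) {H : ℂ → ℂ} (hH : Differentiable ℂ H)
    (h1 : ∀ z, H (z + 1) = -H z) (h2 : ∀ z, H (z + τ) = thetaMul τ z * H z) :
    ∃ C : ℂ, ∀ z, H z = C * theta τ z := by
  -- twice the even part of `H` vanishes, at `0` in particular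
  have h0 : H 0 = 0 := by
    have := even_eq_zero hτ (E := fun z => H z + H (-z)) (by fun_prop)
      (fun z => by
        have := h1 (-(z + 1))
        rw [show -(z + 1) + 1 = -z by ring] at this
        simp only [h1 z, this]; ring)
      (fun z => by
        have := h2 (-(z + τ))
        rw [show -(z + τ) + τ = -z by ring] at this
        have e : thetaMul τ z * thetaMul τ (-(z + τ)) = 1 := by
          rw [thetaMul_mul, show -(z + -(z + τ)) - τ = 0 by ring, ee_zero]
        simp only [h2 z, this]
        linear_combination (-H (-(z + τ))) * e)
      (fun z => by rw [neg_neg, add_comm]) 0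
    rw [neg_zero] at this
    linear_combination (1 / 2 : ℂ) * this
  refine eq_const_mul_of_multipliers hτ hH (differentiable_theta hτ) (fun z hz => ?_)
    (m := fun _ => -1) (m' := thetaMul τ) (fun _ => by norm_num) thetaMul_ne_zero
    (fun z => by rw [h1, neg_one_mul]) (fun z => by rw [theta_add_one hτ, neg_one_mul])
    h2 (theta_add_tau' hτ)
  have hl := (theta_eq_zero_iff hτ).1 hz
  refine ⟨deriv_theta_ne_zero hτ hl, ?_⟩
  have := (zero_iff_add_lat (τ := τ) (H := H) (fun z => by rw [h1, neg_eq_zero])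
      (fun z => by rw [h2, mul_eq_zero, or_iff_right (thetaMul_ne_zero z)]) hl 0).2 h0
  rwa [zero_add] at this

theorem countable_lat : (lat τ : Set ℂ).Countable := by
  have : (lat τ : Set ℂ) = Set.range fun x : ℤ × ℤ => (x.1 : ℂ) + x.2 * τ := by
    ext z
    rw [SetLike.mem_coe, mem_lat]
    simp [eq_comm]
  rw [this]
  exact Set.countable_range _

/-- The three-term identity for parameters in general position. As functions of `q`, the difference
of its two sides and `θ(q + u + v) θ(q + p)` have the same multipliers, and the difference vanishes
at the zeros of this product, which are simple; hence the two are proportional. The difference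
vanishes at `q = 0`, so the factor is zero. -/
theorem fay_theta_generic (hτ : 0 < τ.im) {p u v : ℂ} (hp : p ∉ lat τ) (huv : u + v ∉ lat τ)
    (hpuv : p - (u + v) ∉ lat τ) (q : ℂ) :
    theta τ (p + q + u) * theta τ (q + v) * theta τ (u + v) * theta τ p =
      theta τ (p + u) * theta τ (q + u + v) * theta τ v * theta τ (p + q) -
        theta τ (v - p) * theta τ (p + q + u + v) * theta τ u * theta τ q := by
  have dθ := differentiable_theta hτ
  have hG := fun z => (deriv_theta_shift hτ (u + v) z).fun_mul (deriv_theta_shift hτ p z)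
  have ng := theta_neg hτ
  obtain ⟨C, hC⟩ := eq_const_mul_of_multipliers hτ
    (D := fun q => theta τ (q + (p + u)) * theta τ (q + v) * (theta τ (u + v) * theta τ p) -
      theta τ (q + (u + v)) * theta τ (q + p) * (theta τ (p + u) * theta τ v) +
      theta τ (q + (p + u + v)) * theta τ (q + 0) * (theta τ (v - p) * theta τ u))
    (G := fun q => theta τ (q + (u + v)) * theta τ (q + p))
    (m := fun _ => 1) (m' := fun q => ee (-(2 * q + p + u + v) - τ))
    ((((differentiable_theta_shift hτ _).mul (differentiable_theta_shift hτ _)).mul_const _).sub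
      (((differentiable_theta_shift hτ _).mul (differentiable_theta_shift hτ _)).mul_const _) |>.add
      (((differentiable_theta_shift hτ _).mul (differentiable_theta_shift hτ _)).mul_const _))
    (fun z => (hG z).differentiableAt)
    (fun z hz => by
      rw [(hG z).deriv]
      simp only [mul_eq_zero] at hz
      rcases hz with hz | hz
      · have hl := (theta_eq_zero_iff hτ).1 hz
        refine ⟨?_, ?_⟩
        · simp only [hz, zero_mul, add_zero]
          refine mul_ne_zero (deriv_theta_ne_zero hτ hl) (theta_ne_zero hτ fun h => hpuv ?_)
          convert sub_mem h hl using 1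
          ring
        · -- by quasi-periodicity it suffices to look at `z = -(u + v)`
          obtain ⟨α, β, hm⟩ := exists_theta_add hτ hl
          have e1 := hm (p - v)
          have e2 := hm (-u)
          have e3 := hm p
          have e4 := hm (-(u + v))
          rw [show p - v + (z + (u + v)) = z + (p + u) by ring] at e1
          rw [show -u + (z + (u + v)) = z + v by ring] at e2
          rw [show p + (z + (u + v)) = z + (p + u + v) by ring] at e3
          rw [show -(u + v) + (z + (u + v)) = z + 0 by ring] at e4
          simp only [hz, e1, e2, e3, e4, ng, show v - p = -(p - v) by ring]
          have : ee (α * (p - v) + β) * ee (α * -u + β) =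
              ee (α * p + β) * ee (α * -(u + v) + β) := by
            rw [← ee_add, ← ee_add]; ring_nf
          linear_combination
            (-theta τ (p - v) * theta τ u * theta τ (u + v) * theta τ p) * this
      · have hl := (theta_eq_zero_iff hτ).1 hz
        refine ⟨?_, ?_⟩
        · simp only [hz, mul_zero, zero_add]
          refine mul_ne_zero (theta_ne_zero hτ fun h => hpuv ?_) (deriv_theta_ne_zero hτ hl)
          convert sub_mem hl h using 1
          ring
        · obtain ⟨α, β, hm⟩ := exists_theta_add hτ hl
          have e1 := hm u
          have e2 := hm (v - p)
          have e3 := hm (u + v)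
          have e4 := hm (-p)
          rw [show u + (z + p) = z + (p + u) by ring] at e1
          rw [show v - p + (z + p) = z + v by ring] at e2
          rw [show u + v + (z + p) = z + (p + u + v) by ring] at e3
          rw [show -p + (z + p) = z + 0 by ring] at e4
          simp only [hz, e1, e2, e3, e4, ng]
          have : ee (α * u + β) * ee (α * (v - p) + β) =
              ee (α * (u + v) + β) * ee (α * -p + β) := by
            rw [← ee_add, ← ee_add]; ring_nf
          linear_combination
            (theta τ u * theta τ (v - p) * theta τ (u + v) * theta τ p) * this)
    (fun _ => one_ne_zero) (fun z => ee_ne_zero _)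
    (fun z => by simp only [add_right_comm z 1, theta_add_one hτ]; ring)
    (fun z => by simp only [add_right_comm z 1, theta_add_one hτ]; ring)
    (fun z => by
      simp only [add_right_comm z τ, theta_add_tau' hτ]
      have a1 : thetaMul τ (z + (p + u)) * thetaMul τ (z + v) =
          ee (-(2 * z + p + u + v) - τ) := by rw [thetaMul_mul]; ring_nf
      have a2 : thetaMul τ (z + (u + v)) * thetaMul τ (z + p) =
          ee (-(2 * z + p + u + v) - τ) := by rw [thetaMul_mul]; ring_nf
      have a3 : thetaMul τ (z + (p + u + v)) * thetaMul τ (z + 0) =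
          ee (-(2 * z + p + u + v) - τ) := by rw [thetaMul_mul]; ring_nf
      linear_combination
        (theta τ (z + (p + u)) * theta τ (z + v) * (theta τ (u + v) * theta τ p)) * a1 -
        (theta τ (z + (u + v)) * theta τ (z + p) * (theta τ (p + u) * theta τ v)) * a2 +
        (theta τ (z + (p + u + v)) * theta τ (z + 0) * (theta τ (v - p) * theta τ u)) * a3)
    (fun z => by
      simp only [add_right_comm z τ, theta_add_tau' hτ]
      have a2 : thetaMul τ (z + (u + v)) * thetaMul τ (z + p) =
          ee (-(2 * z + p + u + v) - τ) := by rw [thetaMul_mul]; ring_nf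
      linear_combination (theta τ (z + (u + v)) * theta τ (z + p)) * a2)
  have h0 := hC 0
  simp only [zero_add, theta_zero hτ] at h0
  have hC0 : C * (theta τ (u + v) * theta τ p) = 0 := by rw [← h0]; ring
  have hC0 := (mul_eq_zero.1 hC0).resolve_right
    (mul_ne_zero (theta_ne_zero hτ huv) (theta_ne_zero hτ hp))
  have hq := hC q
  rw [hC0, zero_mul] at hq
  rw [show p + q + u + v = q + (p + u + v) by ring, show p + q + u = q + (p + u) by ring,
    show q + u + v = q + (u + v) by ring, show p + q = q + p by ring]
  rw [add_zero] at hq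
  linear_combination hq

/-- The three-term identity of theta functions. -/
theorem fay_theta (hτ : 0 < τ.im) {p : ℂ} (hp : p ∉ lat τ) (q u v : ℂ) :
    theta τ (p + q + u) * theta τ (q + v) * theta τ (u + v) * theta τ p =
      theta τ (p + u) * theta τ (q + u + v) * theta τ v * theta τ (p + q) -
        theta τ (v - p) * theta τ (p + q + u + v) * theta τ u * theta τ q := by
  have hc := (differentiable_theta hτ).continuous
  have hd : Dense ({u : ℂ | u + v ∈ lat τ} ∪ {u : ℂ | p - (u + v) ∈ lat τ})ᶜ := by
    refine Set.Countable.dense_compl ℂ (Set.Countable.union ?_ ?_)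
    · exact countable_lat.preimage (add_left_injective v)
    · exact countable_lat.preimage fun a b h => by simpa using h
  refine congrFun (Continuous.ext_on (f := fun u => theta τ (p + q + u) * theta τ (q + v) *
    theta τ (u + v) * theta τ p) (g := fun u => theta τ (p + u) * theta τ (q + u + v) * theta τ v *
      theta τ (p + q) - theta τ (v - p) * theta τ (p + q + u + v) * theta τ u * theta τ q) hd
    (by fun_prop) (by fun_prop) fun u hu => ?_) u
  simp only [Set.mem_compl_iff, Set.mem_union, Set.mem_ofPred_eq, not_or] at hu
  exact fay_theta_generic hτ hp hu.1 hu.2 q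

end Elliptic

/-! ### Taylor series of entire functions -/

section Taylor

theorem coeff_taylor (f : ℂ → ℂ) (p : ℂ) (k : ℕ) :
    PowerSeries.coeff k (taylor f p) = iteratedDeriv k f p / (k.factorial : ℂ) :=
  PowerSeries.coeff_mk k _

theorem taylor_mul {f g : ℂ → ℂ} (hf : Differentiable ℂ f) (hg : Differentiable ℂ g) (p : ℂ) :
    taylor (fun z => f z * g z) p = taylor f p * taylor g p := by
  ext k
  rw [PowerSeries.coeff_mul, coeff_taylor, iteratedDeriv_fun_mul hf.contDiff.contDiffAt
    hg.contDiff.contDiffAt, Finset.Nat.sum_antidiagonal_eq_sum_range_succ_mk, Finset.sum_div]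
  refine Finset.sum_congr rfl fun i hi => ?_
  have hi : i ≤ k := Nat.lt_succ_iff.1 (Finset.mem_range.1 hi)
  rw [coeff_taylor, coeff_taylor, Nat.cast_choose ℂ hi]
  have h1 := Nat.cast_ne_zero (R := ℂ).2 (Nat.factorial_ne_zero k)
  have h2 := Nat.cast_ne_zero (R := ℂ).2 (Nat.factorial_ne_zero i)
  have h3 := Nat.cast_ne_zero (R := ℂ).2 (Nat.factorial_ne_zero (k - i))
  field_simp

theorem taylor_sub {f g : ℂ → ℂ} (hf : Differentiable ℂ f) (hg : Differentiable ℂ g) (p : ℂ) :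
    taylor (fun z => f z - g z) p = taylor f p - taylor g p := by
  ext k
  rw [map_sub, coeff_taylor, coeff_taylor, coeff_taylor, iteratedDeriv_fun_sub
    hf.contDiff.contDiffAt hg.contDiff.contDiffAt, sub_div]

theorem taylor_const_mul (a : ℂ) (f : ℂ → ℂ) (p : ℂ) :
    taylor (fun z => a * f z) p = PowerSeries.C a * taylor f p := by
  ext k
  rw [PowerSeries.coeff_C_mul, coeff_taylor, coeff_taylor, iteratedDeriv_const_mul_field,
    mul_div_assoc]

theorem taylor_neg (f : ℂ → ℂ) (p : ℂ) : taylor (fun z => -f z) p = -taylor f p := by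
  have := taylor_const_mul (-1) f p
  simpa using this

theorem taylor_comp_line {f : ℂ → ℂ} (hf : Differentiable ℂ f) (p a : ℂ) :
    taylor (fun s => f (p + a * s)) 0 = PowerSeries.rescale a (taylor f p) := by
  ext k
  have h : (fun s => f (p + a * s)) = fun s => (fun x => f (p + x)) (a * s) := rfl
  have hf' : Differentiable ℂ (fun x => f (p + x)) := by fun_prop
  rw [PowerSeries.coeff_rescale, coeff_taylor, coeff_taylor, h,
    iteratedDeriv_comp_const_mul hf'.contDiff, iteratedDeriv_comp_const_add]
  simp [mul_div_assoc]

theorem taylor_shift (f : ℂ → ℂ) (p w : ℂ) :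
    taylor (fun s => f (s + w)) p = taylor f (p + w) := by
  ext k
  rw [coeff_taylor, coeff_taylor, iteratedDeriv_comp_add_const]

theorem taylor_exp (a b : ℂ) :
    taylor (fun s => Complex.exp (b + a * s)) 0 =
      PowerSeries.C (Complex.exp b) * PowerSeries.rescale a (PowerSeries.exp ℂ) := by
  rw [taylor_comp_line Complex.differentiable_exp]
  ext k
  rw [PowerSeries.coeff_C_mul, PowerSeries.coeff_rescale, PowerSeries.coeff_rescale, coeff_taylor,
    iteratedDeriv_eq_iterate, Complex.iter_deriv_exp, PowerSeries.coeff_exp]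
  simp
  ring

end Taylor

/-! ### The coefficients of the Kronecker function -/

section Kronecker

variable {τ : ℂ}

/-- The power series `θ(z) / z`. -/
def sigmaSeries (τ : ℂ) : PowerSeries ℂ :=
  PowerSeries.mk fun k => PowerSeries.coeff (k + 1) (taylor (theta τ) 0)

/-- The expansion of `z θ(p + z) e^{-cz} / θ(z)`; its coefficients are entire functions. -/
def zN (τ p c : ℂ) : PowerSeries ℂ :=
  taylor (theta τ) p * PowerSeries.rescale (-c) (PowerSeries.exp ℂ) * (sigmaSeries τ)⁻¹

/-- The coefficients of `z θ(p + z) e^{-cz} / θ(z)`. -/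
def numCoef (τ : ℂ) (m : ℕ) (p c : ℂ) : ℂ := PowerSeries.coeff m (zN τ p c)

/-- The coefficients of `z θ(p + z) e^{-cz} / (θ(z) θ(p))`. -/
def kcoef (τ : ℂ) (m : ℕ) (p c : ℂ) : ℂ := PowerSeries.coeff m (zF τ p c)

theorem zF_eq (p c : ℂ) : zF τ p c = PowerSeries.C (theta τ p)⁻¹ * zN τ p c := by
  rw [zF, zN, sigmaSeries]; ring

theorem kcoef_eq (m : ℕ) (p c : ℂ) : kcoef τ m p c = (theta τ p)⁻¹ * numCoef τ m p c := by
  rw [kcoef, zF_eq, PowerSeries.coeff_C_mul, numCoef]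

theorem fcoef_eq_kcoef (α : ℕ) (p c : ℂ) : fcoef τ α p c = kcoef τ (α + 1) p c := rfl

theorem constantCoeff_sigmaSeries (hτ : 0 < τ.im) :
    PowerSeries.constantCoeff (sigmaSeries τ) = 1 := by
  rw [← PowerSeries.coeff_zero_eq_constantCoeff_apply, sigmaSeries, PowerSeries.coeff_mk,
    coeff_taylor]
  simp [iteratedDeriv_one, deriv_theta_zero hτ]

theorem sigmaSeries_mul_inv (hτ : 0 < τ.im) : sigmaSeries τ * (sigmaSeries τ)⁻¹ = 1 :=
  PowerSeries.mul_inv_cancel _ (by rw [constantCoeff_sigmaSeries hτ]; exact one_ne_zero)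

theorem taylor_theta_zero (hτ : 0 < τ.im) :
    taylor (theta τ) 0 = PowerSeries.X * sigmaSeries τ := by
  ext k
  cases k with
  | zero => rw [coeff_taylor, PowerSeries.coeff_zero_X_mul]; simp [theta_zero hτ]
  | succ k => rw [PowerSeries.coeff_succ_X_mul, sigmaSeries, PowerSeries.coeff_mk]

/-- The coefficients of the factor of `zN` which depends on `p` only. -/
def pCoef (τ : ℂ) (m : ℕ) (p : ℂ) : ℂ :=
  PowerSeries.coeff m (taylor (theta τ) p * (sigmaSeries τ)⁻¹)

theorem numCoef_eq_sum (m : ℕ) (p c : ℂ) :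
    numCoef τ m p c = ∑ x ∈ Finset.HasAntidiagonal.antidiagonal m, (-c) ^ x.1 / (x.1.factorial : ℂ) *
      pCoef τ x.2 p := by
  rw [numCoef, zN, mul_right_comm, mul_comm, PowerSeries.coeff_mul]
  refine Finset.sum_congr rfl fun x _ => ?_
  rw [PowerSeries.coeff_rescale, PowerSeries.coeff_exp, pCoef]
  simp [div_eq_mul_inv]

theorem differentiable_pCoef (hτ : 0 < τ.im) (m : ℕ) : Differentiable ℂ (pCoef τ m) := by
  have : pCoef τ m = fun p => ∑ x ∈ Finset.HasAntidiagonal.antidiagonal m,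
      iteratedDeriv x.1 (theta τ) p / (x.1.factorial : ℂ) *
        PowerSeries.coeff x.2 (sigmaSeries τ)⁻¹ := by
    ext p
    rw [pCoef, PowerSeries.coeff_mul]
    simp only [coeff_taylor]
  rw [this]
  refine Differentiable.fun_sum fun x _ => ((?_ : Differentiable ℂ _).div_const _).mul_const _
  exact (differentiable_theta hτ).contDiff.differentiable_iteratedDeriv (n := ⊤) x.1
    (by exact_mod_cast WithTop.coe_lt_top _)

theorem differentiable_numCoef (hτ : 0 < τ.im) (m : ℕ) :
    Differentiable ℂ fun x : ℂ × ℂ => numCoef τ m x.1 x.2 := by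
  simp only [numCoef_eq_sum]
  refine Differentiable.fun_sum fun x _ => ?_
  have h := (differentiable_pCoef hτ x.2).comp (differentiable_fst (𝕜 := ℂ) (E := ℂ) (F := ℂ))
  refine Differentiable.mul (by fun_prop) h

theorem differentiableAt_kcoef (hτ : 0 < τ.im) (m : ℕ) {x : ℂ × ℂ} (hx : x.1 ∉ lat τ) :
    DifferentiableAt ℂ (fun x : ℂ × ℂ => kcoef τ m x.1 x.2) x := by
  simp only [kcoef_eq]
  refine DifferentiableAt.mul ?_ (differentiable_numCoef hτ m x)
  refine DifferentiableAt.inv ?_ (theta_ne_zero hτ hx)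
  exact ((differentiable_theta hτ).comp (differentiable_fst (𝕜 := ℂ) (E := ℂ) (F := ℂ))) x

theorem numCoef_zero (hτ : 0 < τ.im) (p c : ℂ) : numCoef τ 0 p c = theta τ p := by
  rw [numCoef_eq_sum]
  simp [pCoef, constantCoeff_sigmaSeries hτ]
  rw [← PowerSeries.coeff_zero_eq_constantCoeff_apply, coeff_taylor]
  simp

theorem kcoef_zero (hτ : 0 < τ.im) {p : ℂ} (hp : p ∉ lat τ) (c : ℂ) : kcoef τ 0 p c = 1 := by
  rw [kcoef_eq, numCoef_zero hτ, inv_mul_cancel₀ (theta_ne_zero hτ hp)]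

theorem theta_mul_kcoef (hτ : 0 < τ.im) {p : ℂ} (hp : p ∉ lat τ) (m : ℕ) (c : ℂ) :
    theta τ p * kcoef τ m p c = numCoef τ m p c := by
  rw [kcoef_eq, ← mul_assoc, mul_inv_cancel₀ (theta_ne_zero hτ hp), one_mul]

theorem hasDerivAt_numCoef_succ (m : ℕ) (p c : ℂ) :
    HasDerivAt (fun c => numCoef τ (m + 1) p c) (-numCoef τ m p c) c := by
  have h : (fun c => numCoef τ (m + 1) p c) = fun c => pCoef τ (m + 1) p +
      ∑ x ∈ Finset.HasAntidiagonal.antidiagonal m, (-c) ^ (x.1 + 1) / ((x.1 + 1).factorial : ℂ) *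
        pCoef τ x.2 p := by
    ext c
    rw [numCoef_eq_sum, Finset.Nat.sum_antidiagonal_succ]
    simp
  rw [h, numCoef_eq_sum, ← Finset.sum_neg_distrib]
  refine HasDerivAt.const_add _ (HasDerivAt.fun_sum fun x _ => ?_)
  have h1 := (((hasDerivAt_id c).neg.pow (x.1 + 1)).div_const
    ((x.1 + 1).factorial : ℂ)).mul_const (pCoef τ x.2 p)
  refine h1.congr_deriv ?_
  have h2 := Nat.cast_ne_zero (R := ℂ).2 (Nat.factorial_ne_zero x.1)
  have h3 : (x.1 + 1 : ℂ) ≠ 0 := by exact_mod_cast Nat.succ_ne_zero x.1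
  rw [Nat.factorial_succ]
  simp
  field_simp

theorem hasDerivAt_kcoef_succ (m : ℕ) (p c : ℂ) :
    HasDerivAt (fun c => kcoef τ (m + 1) p c) (-kcoef τ m p c) c := by
  simp only [kcoef_eq]
  rw [← mul_neg]
  exact (hasDerivAt_numCoef_succ m p c).const_mul _

/-- The residue of `f_α` along `p = 0`. -/
theorem numCoef_succ_zero_left (hτ : 0 < τ.im) (α : ℕ) (c : ℂ) :
    numCoef τ (α + 1) 0 c = (-c) ^ α / (α.factorial : ℂ) := by
  have : zN τ 0 c = PowerSeries.X * PowerSeries.rescale (-c) (PowerSeries.exp ℂ) := by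
    rw [zN, taylor_theta_zero hτ]
    linear_combination (PowerSeries.X * PowerSeries.rescale (-c) (PowerSeries.exp ℂ)) *
      sigmaSeries_mul_inv hτ
  rw [numCoef, this, PowerSeries.coeff_succ_X_mul, PowerSeries.coeff_rescale, PowerSeries.coeff_exp]
  simp [div_eq_mul_inv]

/-- The members of a sequence of functions of which each one is up to sign the derivative of the
next one are linearly independent. -/
theorem appell_independent {P : ℕ → ℂ → ℂ} {κ : ℂ} (hκ : κ ≠ 0) (h0 : ∀ c, P 0 c = κ)
    (h : ∀ m c, HasDerivAt (P (m + 1)) (-P m c) c) (M : ℕ) :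
    ∀ s : ℕ → ℂ, (∀ c, ∑ m ∈ Finset.range M, s m * P m c = 0) → ∀ m < M, s m = 0 := by
  induction M with
  | zero => intro s _ m hm; omega
  | succ M ih =>
    intro s hs
    have key : ∀ m < M, s (m + 1) = 0 := by
      refine ih (fun m => s (m + 1)) fun c => ?_
      have e : (fun c => ∑ m ∈ Finset.range (M + 1), s m * P m c) = fun _ => 0 := funext hs
      have e2 : (fun c => ∑ m ∈ Finset.range (M + 1), s m * P m c) = fun c =>
          (∑ m ∈ Finset.range M, s (m + 1) * P (m + 1) c) + s 0 * κ := by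
        ext c
        rw [Finset.sum_range_succ', h0]
      have d : HasDerivAt (fun c => (∑ m ∈ Finset.range M, s (m + 1) * P (m + 1) c) + s 0 * κ)
          (∑ m ∈ Finset.range M, s (m + 1) * -P m c) c :=
        (HasDerivAt.fun_sum fun m _ => (h m c).const_mul _).add_const _
      rw [← e2, e] at d
      have := d.unique (hasDerivAt_const c 0)
      rw [← neg_eq_zero, ← this, ← Finset.sum_neg_distrib]
      exact Finset.sum_congr rfl fun m _ => by ring
    intro m hm
    cases m with
    | succ m => exact key m (by omega)
    | zero =>
      have := hs 0
      rw [Finset.sum_range_succ', Finset.sum_eq_zero fun m hm => by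
        rw [key m (Finset.mem_range.1 hm), zero_mul], zero_add, h0] at this
      exact (mul_eq_zero.1 this).resolve_right hκ

/-- The functions `k_m(p, c)` of `c` are linearly independent, for every `p` outside of the lattice.
-/
theorem kcoef_independent (hτ : 0 < τ.im) {p : ℂ} (hp : p ∉ lat τ) (M : ℕ) (s : ℕ → ℂ)
    (hs : ∀ c, ∑ m ∈ Finset.range M, s m * kcoef τ m p c = 0) : ∀ m < M, s m = 0 :=
  appell_independent (P := fun m c => kcoef τ m p c) one_ne_zero (kcoef_zero hτ hp)
    (fun m c => hasDerivAt_kcoef_succ m p c) M s hs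

/-- The residues of the functions `f_α` along `p = 0` are linearly independent functions of `c`. -/
theorem residue_independent (hτ : 0 < τ.im) (M : ℕ) (s : ℕ → ℂ)
    (hs : ∀ c, ∑ m ∈ Finset.range M, s m * numCoef τ (m + 1) 0 c = 0) : ∀ m < M, s m = 0 :=
  appell_independent (P := fun m c => numCoef τ (m + 1) 0 c) (κ := 1) one_ne_zero
    (fun c => by rw [numCoef_succ_zero_left hτ]; simp)
    (fun m c => hasDerivAt_numCoef_succ (m + 1) 0 c) M s hs

theorem taylor_theta_neg (hτ : 0 < τ.im) (p : ℂ) :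
    taylor (theta τ) (-p) = -PowerSeries.rescale (-1) (taylor (theta τ) p) := by
  have h := taylor_comp_line (differentiable_theta hτ) p (-1)
  have h2 := taylor_comp_line (differentiable_theta hτ) (-p) 1
  rw [PowerSeries.rescale_one, RingHom.id_apply] at h2
  rw [← h, ← h2, ← taylor_neg]
  congr 1
  ext s
  rw [show -p + 1 * s = -(p + -1 * s) by ring, theta_neg hτ]

theorem rescale_sigmaSeries (hτ : 0 < τ.im) :
    PowerSeries.rescale (-1) (sigmaSeries τ) = sigmaSeries τ := by
  have h := taylor_theta_neg hτ 0
  rw [neg_zero, taylor_theta_zero hτ, map_mul, PowerSeries.rescale_X, map_neg, map_one] at h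
  have : PowerSeries.X * (PowerSeries.rescale (-1) (sigmaSeries τ)) =
      PowerSeries.X * sigmaSeries τ := by
    rw [h]; ring
  exact mul_left_cancel₀ PowerSeries.X_ne_zero this

theorem zF_neg (hτ : 0 < τ.im) (p c : ℂ) :
    zF τ (-p) (-c) = PowerSeries.rescale (-1) (zF τ p c) := by
  have hs := sigmaSeries_mul_inv hτ
  have hs' := congrArg (PowerSeries.rescale (-1 : ℂ)) hs
  rw [map_mul, rescale_sigmaSeries hτ, map_one] at hs'
  have hinv : PowerSeries.rescale (-1) (sigmaSeries τ)⁻¹ = (sigmaSeries τ)⁻¹ := by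
    linear_combination (sigmaSeries τ)⁻¹ * hs' - PowerSeries.rescale (-1) (sigmaSeries τ)⁻¹ * hs
  have hC : PowerSeries.rescale (-1) (PowerSeries.C (theta τ p)⁻¹) =
      PowerSeries.C (theta τ p)⁻¹ := by
    ext k
    rw [PowerSeries.coeff_rescale, PowerSeries.coeff_C]
    split_ifs with h <;> simp [h]
  rw [zF_eq, zF_eq, zN, zN, theta_neg hτ, taylor_theta_neg hτ, map_mul, map_mul, map_mul, hinv, hC,
    inv_neg, map_neg, PowerSeries.rescale_rescale]
  simp only [mul_neg, mul_one, neg_mul, neg_neg]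

theorem fcoef_neg (hτ : 0 < τ.im) (α : ℕ) (p c : ℂ) :
    fcoef τ α (-p) (-c) = (-1) ^ (α + 1) * fcoef τ α p c := by
  rw [fcoef, zF_neg hτ, PowerSeries.coeff_rescale, fcoef]

theorem rescale_exp_mul (a b : ℂ) : PowerSeries.rescale a (PowerSeries.exp ℂ) *
    PowerSeries.rescale b (PowerSeries.exp ℂ) = PowerSeries.rescale (a + b) (PowerSeries.exp ℂ) :=
  PowerSeries.exp_mul_exp_eq_exp_add a b

theorem zN_add_one (hτ : 0 < τ.im) (p c : ℂ) : zN τ (p + 1) c = -zN τ p c := by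
  have h : taylor (theta τ) (p + 1) = -taylor (theta τ) p := by
    rw [← taylor_shift, ← taylor_neg]
    congr 1
    ext s
    rw [theta_add_one hτ]
  rw [zN, zN, h]
  ring

theorem zN_add_tau (hτ : 0 < τ.im) (p c : ℂ) :
    zN τ (p + τ) (c - 2 * Real.pi * Complex.I) = PowerSeries.C (thetaMul τ p) * zN τ p c := by
  have h : taylor (theta τ) (p + τ) = PowerSeries.C (thetaMul τ p) *
      PowerSeries.rescale (-(2 * Real.pi * Complex.I)) (PowerSeries.exp ℂ) *
        taylor (theta τ) p := by
    have e1 := taylor_comp_line (differentiable_theta hτ) (p + τ) 1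
    have e2 := taylor_comp_line (differentiable_theta hτ) p 1
    have e3 := taylor_exp (-(2 * Real.pi * Complex.I)) (2 * Real.pi * Complex.I * (-p - τ / 2))
    rw [PowerSeries.rescale_one, RingHom.id_apply] at e1 e2
    rw [thetaMul, map_neg, neg_mul, neg_mul, ee, ← e3, ← e1, ← e2, ← taylor_mul (f := fun s =>
      Complex.exp (2 * Real.pi * Complex.I * (-p - τ / 2) + -(2 * Real.pi * Complex.I) * s))
      (g := fun s => theta τ (p + 1 * s)) (by fun_prop)
      ((differentiable_theta hτ).comp (by fun_prop)), ← taylor_neg]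
    congr 1
    ext s
    rw [show p + τ + 1 * s = (p + 1 * s) + τ by ring, theta_add_tau hτ, ee]
    ring_nf
  have h2 := rescale_exp_mul (-(2 * Real.pi * Complex.I)) (-(c - 2 * Real.pi * Complex.I))
  rw [show -(2 * Real.pi * Complex.I) + -(c - 2 * Real.pi * Complex.I) = -c by ring] at h2
  rw [zN, zN, h, ← h2]
  ring

theorem numCoef_add_one (hτ : 0 < τ.im) (m : ℕ) (p c : ℂ) :
    numCoef τ m (p + 1) c = -numCoef τ m p c := by
  rw [numCoef, zN_add_one hτ, map_neg, numCoef]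

theorem numCoef_add_tau (hτ : 0 < τ.im) (m : ℕ) (p c : ℂ) :
    numCoef τ m (p + τ) (c - 2 * Real.pi * Complex.I) = thetaMul τ p * numCoef τ m p c := by
  rw [numCoef, zN_add_tau hτ, PowerSeries.coeff_C_mul, numCoef]

theorem zF_add_one (hτ : 0 < τ.im) (p c : ℂ) : zF τ (p + 1) c = zF τ p c := by
  rw [zF_eq, zF_eq, zN_add_one hτ, theta_add_one hτ, inv_neg, map_neg, neg_mul_neg]

theorem zF_add_tau (hτ : 0 < τ.im) (p c : ℂ) :
    zF τ (p + τ) (c - 2 * Real.pi * Complex.I) = zF τ p c := by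
  rw [zF_eq, zF_eq, zN_add_tau hτ, theta_add_tau' hτ, mul_inv, map_mul]
  have h1 : PowerSeries.C (thetaMul τ p)⁻¹ * PowerSeries.C (thetaMul τ p) = 1 := by
    rw [← map_mul, inv_mul_cancel₀ (thetaMul_ne_zero p), map_one]
  linear_combination (PowerSeries.C (theta τ p)⁻¹ * zN τ p c) * h1

theorem zF_add_lat (hτ : 0 < τ.im) (p c : ℂ) (a b : ℤ) :
    zF τ (p + (a + b * τ)) (c + -(2 * Real.pi * Complex.I) * b) = zF τ p c := by
  have h1 : ∀ (c : ℂ) (k : ℤ), ∀ p, zF τ (p + k * 1) c = zF τ p c := fun c k p =>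
    (show Function.Periodic (fun p => zF τ p c) 1 from fun p => zF_add_one hτ p c).int_mul k p
  have h2 : Function.Periodic (fun x : ℂ × ℂ => zF τ x.1 x.2) (τ, -(2 * Real.pi * Complex.I)) :=
    fun x => by
      have := zF_add_tau hτ x.1 x.2
      rwa [sub_eq_add_neg] at this
  have h3 := h2.zsmul b (p + a * 1, c)
  simp only [Prod.smul_mk, Prod.mk_add_mk, zsmul_eq_mul] at h3
  rw [← h1 c a p, ← h3]
  congr 1 <;> ring

/-- Fay's identity for Kronecker functions, on the line `u = as`, `v = bs`. -/
theorem fay_zF (hτ : 0 < τ.im) {p q : ℂ} (hp : p ∉ lat τ) (hq : q ∉ lat τ) (hpq : p + q ∉ lat τ)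
    (c d a b : ℂ) :
    PowerSeries.C (a + b) * (PowerSeries.rescale a (zF τ (p + q) (c + d)) *
        PowerSeries.rescale b (zF τ q d)) =
      PowerSeries.C b * (PowerSeries.rescale a (zF τ p c) *
        PowerSeries.rescale (a + b) (zF τ q d)) +
      PowerSeries.C a * (PowerSeries.rescale b (zF τ (-p) (-c)) *
        PowerSeries.rescale (a + b) (zF τ (p + q) (c + d))) := by
  have dθ := differentiable_theta hτ
  have dl : ∀ x y : ℂ, Differentiable ℂ fun s => theta τ (x + y * s) := fun x y =>
    dθ.comp (by fun_prop)
  -- the Taylor expansion of the identity of theta functions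
  have hT : PowerSeries.C (theta τ p) * (PowerSeries.rescale a (taylor (theta τ) (p + q)) *
        PowerSeries.rescale b (taylor (theta τ) q) *
          PowerSeries.rescale (a + b) (taylor (theta τ) 0)) =
      PowerSeries.C (theta τ (p + q)) * (PowerSeries.rescale a (taylor (theta τ) p) *
        PowerSeries.rescale (a + b) (taylor (theta τ) q) *
          PowerSeries.rescale b (taylor (theta τ) 0)) -
      PowerSeries.C (theta τ q) * (PowerSeries.rescale b (taylor (theta τ) (-p)) *
        PowerSeries.rescale (a + b) (taylor (theta τ) (p + q)) *
          PowerSeries.rescale a (taylor (theta τ) 0)) := by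
    simp only [← taylor_comp_line dθ]
    rw [← taylor_mul (dl _ _) (dl _ _), ← taylor_mul ((dl _ _).fun_mul (dl _ _)) (dl _ _),
      ← taylor_mul (dl _ _) (dl _ _), ← taylor_mul ((dl _ _).fun_mul (dl _ _)) (dl _ _),
      ← taylor_mul (dl _ _) (dl _ _), ← taylor_mul ((dl _ _).fun_mul (dl _ _)) (dl _ _),
      ← taylor_const_mul, ← taylor_const_mul, ← taylor_const_mul,
      ← taylor_sub (((dl _ _).fun_mul (dl _ _)).fun_mul (dl _ _) |>.const_mul _)
        (((dl _ _).fun_mul (dl _ _)).fun_mul (dl _ _) |>.const_mul _)]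
    congr 1
    ext s
    have := fay_theta hτ hp q (a * s) (b * s)
    rw [show 0 + (a + b) * s = a * s + b * s by ring, show q + (a + b) * s = q + a * s + b * s by ring,
      show p + q + (a + b) * s = p + q + a * s + b * s by ring,
      show -p + b * s = b * s - p by ring, zero_add, zero_add]
    linear_combination this
  have hK : ∀ {p : ℂ} (c : ℂ), p ∉ lat τ →
      taylor (theta τ) p * PowerSeries.rescale (-c) (PowerSeries.exp ℂ) =
        PowerSeries.C (theta τ p) * zF τ p c * sigmaSeries τ := by
    intro p c hp
    rw [zF_eq, zN]
    have h1 : PowerSeries.C (theta τ p) * PowerSeries.C (theta τ p)⁻¹ = 1 := by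
      rw [← map_mul, mul_inv_cancel₀ (theta_ne_zero hτ hp), map_one]
    have h2 := sigmaSeries_mul_inv hτ
    linear_combination (-taylor (theta τ) p * PowerSeries.rescale (-c) (PowerSeries.exp ℂ)) * h2 -
      (taylor (theta τ) p * PowerSeries.rescale (-c) (PowerSeries.exp ℂ) * (sigmaSeries τ)⁻¹ *
        sigmaSeries τ) * h1
  have hR : ∀ {p : ℂ} (c a : ℂ), p ∉ lat τ → PowerSeries.rescale a (taylor (theta τ) p) *
      PowerSeries.rescale (-(c * a)) (PowerSeries.exp ℂ) =
        PowerSeries.C (theta τ p) * PowerSeries.rescale a (zF τ p c) *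
          PowerSeries.rescale a (sigmaSeries τ) := by
    intro p c a hp
    have := congrArg (PowerSeries.rescale a) (hK c hp)
    rw [map_mul, map_mul, map_mul, PowerSeries.rescale_rescale, neg_mul] at this
    rw [this]
    congr 2
    ext k
    rw [PowerSeries.coeff_rescale, PowerSeries.coeff_C]
    split_ifs with h <;> simp [h]
  have hp' : -p ∉ lat τ := fun h => hp (by simpa using neg_mem h)
  have r1 := hR (c + d) a hpq
  have r2 := hR d b hq
  have r3 := hR c a hp
  have r4 := hR d (a + b) hq
  have r5 := hR (-c) b hp'
  have r6 := hR (c + d) (a + b) hpq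
  have r0 : ∀ a : ℂ, PowerSeries.rescale a (taylor (theta τ) 0) = PowerSeries.C a *
      PowerSeries.X * PowerSeries.rescale a (sigmaSeries τ) := fun a => by
    rw [taylor_theta_zero hτ, map_mul, PowerSeries.rescale_X]
  have ex1 := rescale_exp_mul (-((c + d) * a)) (-(d * b))
  have ex2 := rescale_exp_mul (-(c * a)) (-(d * (a + b)))
  have ex3 := rescale_exp_mul (-(-c * b)) (-((c + d) * (a + b)))
  rw [show -(c * a) + -(d * (a + b)) = -((c + d) * a) + -(d * b) by ring, ← ex1] at ex2
  rw [show -(-c * b) + -((c + d) * (a + b)) = -((c + d) * a) + -(d * b) by ring, ← ex1] at ex3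
  have hunit : ∀ a : ℂ, PowerSeries.rescale a (sigmaSeries τ) ≠ 0 := fun a h => by
    have := congrArg (PowerSeries.coeff 0) h
    rw [PowerSeries.coeff_rescale, PowerSeries.coeff_zero_eq_constantCoeff_apply,
      constantCoeff_sigmaSeries hτ] at this
    simp at this
  have hC : ∀ x : ℂ, x ≠ 0 → (PowerSeries.C x : PowerSeries ℂ) ≠ 0 := fun x hx h =>
    hx (by simpa using congrArg (PowerSeries.coeff 0) h)
  have hne : PowerSeries.C (theta τ p) * PowerSeries.C (theta τ q) *
      PowerSeries.C (theta τ (p + q)) * PowerSeries.X * PowerSeries.rescale a (sigmaSeries τ) *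
      PowerSeries.rescale b (sigmaSeries τ) * PowerSeries.rescale (a + b) (sigmaSeries τ) ≠ 0 := by
    simp only [ne_eq, mul_eq_zero, not_or]
    exact ⟨⟨⟨⟨⟨⟨hC _ (theta_ne_zero hτ hp), hC _ (theta_ne_zero hτ hq)⟩,
      hC _ (theta_ne_zero hτ hpq)⟩, PowerSeries.X_ne_zero⟩, hunit a⟩, hunit b⟩, hunit (a + b)⟩
  refine mul_left_cancel₀ hne ?_
  rw [r0, r0, r0] at hT
  rw [theta_neg hτ, map_neg] at r5
  generalize PowerSeries.rescale (-((c + d) * a)) (PowerSeries.exp ℂ) = E1 at *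
  generalize PowerSeries.rescale (-(d * b)) (PowerSeries.exp ℂ) = E2 at *
  generalize PowerSeries.rescale (-(c * a)) (PowerSeries.exp ℂ) = E3 at *
  generalize PowerSeries.rescale (-(d * (a + b))) (PowerSeries.exp ℂ) = E4 at *
  generalize PowerSeries.rescale (-(-c * b)) (PowerSeries.exp ℂ) = E5 at *
  generalize PowerSeries.rescale (-((c + d) * (a + b))) (PowerSeries.exp ℂ) = E6 at *
  generalize PowerSeries.rescale a (taylor (theta τ) (p + q)) = T1 at *
  generalize PowerSeries.rescale b (taylor (theta τ) q) = T2 at *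
  generalize PowerSeries.rescale a (taylor (theta τ) p) = T3 at *
  generalize PowerSeries.rescale (a + b) (taylor (theta τ) q) = T4 at *
  generalize PowerSeries.rescale b (taylor (theta τ) (-p)) = T5 at *
  generalize PowerSeries.rescale (a + b) (taylor (theta τ) (p + q)) = T6 at *
  generalize PowerSeries.rescale a (zF τ (p + q) (c + d)) = Z1 at *
  generalize PowerSeries.rescale b (zF τ q d) = Z2 at *
  generalize PowerSeries.rescale a (zF τ p c) = Z3 at *
  generalize PowerSeries.rescale (a + b) (zF τ q d) = Z4 at *
  generalize PowerSeries.rescale b (zF τ (-p) (-c)) = Z5 at *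
  generalize PowerSeries.rescale (a + b) (zF τ (p + q) (c + d)) = Z6 at *
  generalize PowerSeries.rescale a (sigmaSeries τ) = A at *
  generalize PowerSeries.rescale b (sigmaSeries τ) = B at *
  generalize PowerSeries.rescale (a + b) (sigmaSeries τ) = D at *
  generalize PowerSeries.C (theta τ p) = P at *
  generalize PowerSeries.C (theta τ q) = Q at *
  generalize PowerSeries.C (theta τ (p + q)) = R at *
  generalize PowerSeries.C (a + b) = ab at *
  generalize PowerSeries.C a = a' at *
  generalize PowerSeries.C b = b' at *
  generalize (PowerSeries.X : PowerSeries ℂ) = X at *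
  have l1 : T1 * E1 * (T2 * E2) = R * Z1 * A * (Q * Z2 * B) := by rw [r1, r2]
  have l2 : T3 * T4 * (E1 * E2) = P * Z3 * A * (Q * Z4 * D) := by rw [← ex2, ← r3, ← r4]; ring
  have l3 : T5 * T6 * (E1 * E2) = -P * Z5 * B * (R * Z6 * D) := by rw [← ex3, ← r5, ← r6]; ring
  linear_combination (E1 * E2) * hT - (P * ab * X * D) * l1 + (R * b' * X * B) * l2 -
    (Q * a' * X * A) * l3

theorem coeff_rescale_mul (a b : ℂ) (f g : PowerSeries ℂ) (n : ℕ) :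
    PowerSeries.coeff n (PowerSeries.rescale a f * PowerSeries.rescale b g) =
      ∑ x ∈ Finset.HasAntidiagonal.antidiagonal n,
        PowerSeries.coeff x.1 f * PowerSeries.coeff x.2 g * (a ^ x.1 * b ^ x.2) := by
  rw [PowerSeries.coeff_mul]
  refine Finset.sum_congr rfl fun x _ => ?_
  rw [PowerSeries.coeff_rescale, PowerSeries.coeff_rescale]
  ring

/-- The complete homogeneous polynomial `∑ x ^ r y ^ s`, `r + s = e`. -/
def hpoly {R : Type} [Semiring R] (e : ℕ) (x y : R) : R :=
  ∑ r ∈ Finset.HasAntidiagonal.antidiagonal e, x ^ r.1 * y ^ r.2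

theorem hpoly_mul_sub {R : Type} [CommRing R] (e : ℕ) (x y : R) :
    hpoly e x y * (x - y) = x ^ (e + 1) - y ^ (e + 1) := by
  rw [hpoly, Finset.Nat.sum_antidiagonal_eq_sum_range_succ (fun i j => x ^ i * y ^ j),
    ← Commute.geom_sum₂_mul (Commute.all x y)]
  congr 1

/-- Fay's identity for the coefficients of the Kronecker functions, in degree `e`. -/
theorem fay_coef (hτ : 0 < τ.im) {p q : ℂ} (hp : p ∉ lat τ) (hq : q ∉ lat τ) (hpq : p + q ∉ lat τ)
    (c d : ℂ) (e : ℕ) (a b : ℂ) (ha : a ≠ 0) (hb : b ≠ 0) (hab : a + b ≠ 0) :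
    ∑ x ∈ Finset.HasAntidiagonal.antidiagonal e,
        fcoef τ x.1 (p + q) (c + d) * fcoef τ x.2 q d * (a ^ x.1 * b ^ x.2) =
      ∑ x ∈ Finset.HasAntidiagonal.antidiagonal e,
        fcoef τ x.1 p c * fcoef τ x.2 q d * (a ^ x.1 * (a + b) ^ x.2) +
      ∑ x ∈ Finset.HasAntidiagonal.antidiagonal e,
        fcoef τ x.1 (-p) (-c) * fcoef τ x.2 (p + q) (c + d) * (b ^ x.1 * (a + b) ^ x.2) +
      fcoef τ (e + 1) q d * hpoly e (a + b) b + fcoef τ (e + 1) (p + q) (c + d) * hpoly e (a + b) a +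
      fcoef τ (e + 1) p c * hpoly e a (-b) := by
  have h := congrArg (PowerSeries.coeff (e + 2)) (fay_zF hτ hp hq hpq c d a b)
  rw [PowerSeries.coeff_C_mul, map_add, PowerSeries.coeff_C_mul, PowerSeries.coeff_C_mul,
    coeff_rescale_mul, coeff_rescale_mul, coeff_rescale_mul] at h
  have hp' : -p ∉ lat τ := fun h => hp (by simpa using neg_mem h)
  have split : ∀ (f g : PowerSeries ℂ) (hf : PowerSeries.coeff 0 f = 1)
      (hg : PowerSeries.coeff 0 g = 1) (x y : ℂ),
      ∑ r ∈ Finset.HasAntidiagonal.antidiagonal (e + 2),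
        PowerSeries.coeff r.1 f * PowerSeries.coeff r.2 g * (x ^ r.1 * y ^ r.2) =
      PowerSeries.coeff (e + 2) g * y ^ (e + 2) + PowerSeries.coeff (e + 2) f * x ^ (e + 2) +
        x * y * ∑ r ∈ Finset.HasAntidiagonal.antidiagonal e,
          PowerSeries.coeff (r.1 + 1) f * PowerSeries.coeff (r.2 + 1) g * (x ^ r.1 * y ^ r.2) := by
    intro f g hf hg x y
    rw [Finset.Nat.sum_antidiagonal_succ, Finset.Nat.sum_antidiagonal_succ', hf, hg,
      Finset.mul_sum]
    have : ∀ r ∈ Finset.HasAntidiagonal.antidiagonal e,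
        PowerSeries.coeff (r.1 + 1) f * PowerSeries.coeff (r.2 + 1) g *
          (x ^ (r.1 + 1) * y ^ (r.2 + 1)) =
        x * y * (PowerSeries.coeff (r.1 + 1) f * PowerSeries.coeff (r.2 + 1) g *
          (x ^ r.1 * y ^ r.2)) := fun r _ => by ring
    rw [Finset.sum_congr rfl this]
    ring
  have k0 : ∀ {p : ℂ}, p ∉ lat τ → ∀ c, PowerSeries.coeff 0 (zF τ p c) = 1 := fun h c =>
    kcoef_zero hτ h c
  rw [split _ _ (k0 hpq _) (k0 hq _), split _ _ (k0 hp _) (k0 hq _),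
    split _ _ (k0 hp' _) (k0 hpq _)] at h
  have hneg : PowerSeries.coeff (e + 2) (zF τ (-p) (-c)) =
      (-1) ^ (e + 2) * PowerSeries.coeff (e + 2) (zF τ p c) := by
    rw [zF_neg hτ, PowerSeries.coeff_rescale]
  rw [hneg] at h
  have g1 := hpoly_mul_sub e (a + b) b
  have g2 := hpoly_mul_sub e (a + b) a
  have g3 := hpoly_mul_sub e a (-b)
  rw [add_sub_cancel_right] at g1
  rw [add_sub_cancel_left] at g2
  have g3' : hpoly e a (-b) * (a + b) = a ^ (e + 1) + (-1) ^ e * b ^ (e + 1) := by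
    rw [sub_neg_eq_add] at g3
    rw [g3, neg_pow]
    ring
  refine mul_left_cancel₀ (mul_ne_zero (mul_ne_zero ha hb) hab) ?_
  simp only [fcoef]
  linear_combination h - (PowerSeries.coeff (e + 2) (zF τ q d) * b * (a + b)) * g1 -
    (PowerSeries.coeff (e + 2) (zF τ (p + q) (c + d)) * a * (a + b)) * g2 -
    (PowerSeries.coeff (e + 2) (zF τ p c) * a * b) * g3'

/-- Fay's identity as an identity of polynomials. -/
theorem fay_mvPolynomial (hτ : 0 < τ.im) {p q : ℂ} (hp : p ∉ lat τ) (hq : q ∉ lat τ)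
    (hpq : p + q ∉ lat τ) (c d : ℂ) (e : ℕ) (a b : MvPolynomial (Fin 2) ℂ)
    (ha : a = MvPolynomial.X 0) (hb : b = MvPolynomial.X 1) :
    ∑ x ∈ Finset.HasAntidiagonal.antidiagonal e,
        (fcoef τ x.1 (p + q) (c + d) * fcoef τ x.2 q d) • (a ^ x.1 * b ^ x.2) =
      ∑ x ∈ Finset.HasAntidiagonal.antidiagonal e,
        (fcoef τ x.1 p c * fcoef τ x.2 q d) • (a ^ x.1 * (a + b) ^ x.2) +
      ∑ x ∈ Finset.HasAntidiagonal.antidiagonal e,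
        (fcoef τ x.1 (-p) (-c) * fcoef τ x.2 (p + q) (c + d)) • (b ^ x.1 * (a + b) ^ x.2) +
      fcoef τ (e + 1) q d • hpoly e (a + b) b + fcoef τ (e + 1) (p + q) (c + d) • hpoly e (a + b) a +
      fcoef τ (e + 1) p c • hpoly e a (-b) := by
  have hne : a * b * (a + b) ≠ 0 := by
    have h2 : a + b ≠ 0 := fun h => by
      have := congrArg (MvPolynomial.eval fun _ => (1 : ℂ)) h
      rw [ha, hb] at this
      norm_num at this
    rw [ha, hb] at *
    exact mul_ne_zero (mul_ne_zero (MvPolynomial.X_ne_zero _) (MvPolynomial.X_ne_zero _)) h2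
  refine mul_left_cancel₀ hne (MvPolynomial.funext fun x => ?_)
  by_cases h0 : x 0 * x 1 * (x 0 + x 1) = 0
  · rw [map_mul, map_mul (MvPolynomial.eval x) (a * b * (a + b))]
    have : MvPolynomial.eval x (a * b * (a + b)) = 0 := by
      rw [ha, hb, map_mul, map_mul, map_add, MvPolynomial.eval_X, MvPolynomial.eval_X, h0]
    rw [this, zero_mul, zero_mul]
  · simp only [mul_eq_zero, not_or] at h0
    rw [map_mul, map_mul (MvPolynomial.eval x) (a * b * (a + b))]
    congr 1
    have := fay_coef hτ hp hq hpq c d e (x 0) (x 1) h0.1.1 h0.1.2 h0.2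
    simpa [hpoly, ha, hb, MvPolynomial.smul_eval, map_sum] using this

end Kronecker

/-! ### Functions on the universal vector extension of the elliptic curve -/

section AlgFun

variable {τ : ℂ}

/-- The leading coefficient of a polynomial is not changed by a translation of the variable. -/
theorem top_coeff_eq {N : ℕ} {a b : ℕ → ℂ} {r : ℂ}
    (h : ∀ c, ∑ m ∈ Finset.range (N + 1), a m * (c + r) ^ m =
      ∑ m ∈ Finset.range (N + 1), b m * c ^ m) : a N = b N := by
  have key : ∑ m ∈ Finset.range (N + 1), Polynomial.C (a m) *
      (Polynomial.X + Polynomial.C r) ^ m =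
      ∑ m ∈ Finset.range (N + 1), Polynomial.C (b m) * Polynomial.X ^ m := by
    refine Polynomial.funext fun c => ?_
    simpa [Polynomial.eval_finsetSum] using h c
  have := congrArg (fun P => Polynomial.coeff P N) key
  simp only [Polynomial.finsetSum_coeff, Polynomial.coeff_C_mul, Polynomial.coeff_X_add_C_pow,
    Polynomial.coeff_X_pow] at this
  rw [Finset.sum_range_succ, Finset.sum_range_succ, Finset.sum_eq_zero, Finset.sum_eq_zero] at this
  · simpa using this
  · intro m hm
    rw [if_neg (by have := Finset.mem_range.1 hm; omega), mul_zero]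
  · intro m hm
    rw [Nat.choose_eq_zero_of_lt (Finset.mem_range.1 hm)]
    simp

/-- The functions on the universal vector extension which are polynomial along the fibres and have
at most a simple pole along the zero fibre: after multiplication by theta these are the linear
combinations of the functions `numCoef`. The leading coefficient in `c` is constant, which allows
one to descend in the degree. -/
theorem simple_pole_span (hτ : 0 < τ.im) (N : ℕ) : ∀ (H : ℂ → ℂ → ℂ) (a : ℕ → ℂ → ℂ),
    (∀ m, Differentiable ℂ (a m)) → (∀ p c, H p c = ∑ m ∈ Finset.range N, a m p * c ^ m) →
    (∀ p c, H (p + 1) c = -H p c) →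
    (∀ p c, H (p + τ) (c - 2 * Real.pi * Complex.I) = thetaMul τ p * H p c) →
    ∃ s : ℕ → ℂ, ∀ p c, H p c = ∑ m ∈ Finset.range N, s m * numCoef τ m p c := by
  induction N with
  | zero =>
    intro H a _ hH _ _
    exact ⟨0, fun p c => by rw [hH]; simp⟩
  | succ N ih =>
    intro H a ha hH h1 h2
    obtain ⟨C, hC⟩ := eq_const_mul_theta hτ (ha N)
      (fun p => top_coeff_eq (a := fun m => a m (p + 1)) (b := fun m => -a m p) (r := 0) fun c => by
        rw [add_zero, ← hH, h1, hH, ← Finset.sum_neg_distrib]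
        exact Finset.sum_congr rfl fun m _ => by ring)
      (fun p => top_coeff_eq (a := fun m => a m (p + τ)) (b := fun m => thetaMul τ p * a m p)
        (r := -(2 * Real.pi * Complex.I)) fun c => by
        rw [← sub_eq_add_neg, ← hH, h2, hH, Finset.mul_sum]
        exact Finset.sum_congr rfl fun m _ => by ring)
    -- the multiple of `numCoef τ N` with the same leading coefficient
    set K : ℂ := C * (-1) ^ N * (N.factorial : ℂ) with hK
    obtain ⟨s, hs⟩ := ih (fun p c => H p c - K * numCoef τ N p c)
      (fun m p => a m p - K * ((-1) ^ m / (m.factorial : ℂ) * pCoef τ (N - m) p))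
      (fun m => (ha m).sub (((differentiable_pCoef hτ _).const_mul _).const_mul _))
      (fun p c => by
        have hN : numCoef τ N p c = ∑ m ∈ Finset.range N,
            (-1) ^ m / (m.factorial : ℂ) * pCoef τ (N - m) p * c ^ m +
              (-1) ^ N / (N.factorial : ℂ) * theta τ p * c ^ N := by
          rw [numCoef_eq_sum, Finset.Nat.sum_antidiagonal_eq_sum_range_succ
            (fun i j => (-c) ^ i / (i.factorial : ℂ) * pCoef τ j p), Finset.sum_range_succ]
          congr 1
          · refine Finset.sum_congr rfl fun m _ => ?_
            rw [neg_pow]; ring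
          · have e := numCoef_zero hτ p 0
            rw [numCoef_eq_sum] at e
            simp at e
            rw [Nat.sub_self, e, neg_pow]; ring
        have hKC : K * ((-1) ^ N / (N.factorial : ℂ)) = C := by
          have h3 := Nat.cast_ne_zero (R := ℂ).2 (Nat.factorial_ne_zero N)
          have h4 : ((-1 : ℂ) ^ N) * (-1) ^ N = 1 := by
            rw [← mul_pow]; norm_num
          rw [hK]
          field_simp
          linear_combination C * h4
        rw [hH, Finset.sum_range_succ, hN, hC, mul_add, Finset.mul_sum]
        have : K * ((-1) ^ N / (N.factorial : ℂ) * theta τ p * c ^ N) = C * theta τ p * c ^ N := by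
          rw [← hKC]; ring
        rw [this, add_sub_add_right_eq_sub, ← Finset.sum_sub_distrib]
        exact Finset.sum_congr rfl fun m _ => by ring)
      (fun p c => by rw [h1, numCoef_add_one hτ]; ring)
      (fun p c => by rw [h2, numCoef_add_tau hτ]; ring)
    refine ⟨fun m => if m = N then K else s m, fun p c => ?_⟩
    simp only []
    rw [Finset.sum_range_succ, if_pos rfl, Finset.sum_congr rfl fun m hm => by
      rw [if_neg (Finset.mem_range.1 hm).ne], ← hs]
    ring

/-- Regular functions on the universal vector extension are constant. -/
theorem regular_const (hτ : 0 < τ.im) {N : ℕ} {h : ℂ → ℂ → ℂ} {a : ℕ → ℂ → ℂ}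
    (ha : ∀ m, Differentiable ℂ (a m)) (hh : ∀ p c, h p c = ∑ m ∈ Finset.range N, a m p * c ^ m)
    (h1 : ∀ p c, h (p + 1) c = h p c)
    (h2 : ∀ p c, h (p + τ) (c - 2 * Real.pi * Complex.I) = h p c) (p c p' c' : ℂ) :
    h p c = h p' c' := by
  have dθ := differentiable_theta hτ
  obtain ⟨s, hs⟩ := simple_pole_span hτ N (fun p c => theta τ p * h p c)
    (fun m p => theta τ p * a m p) (fun m => dθ.mul (ha m))
    (fun p c => by
      rw [hh, Finset.mul_sum]
      exact Finset.sum_congr rfl fun m _ => by ring)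
    (fun p c => by rw [h1, theta_add_one hτ]; ring)
    (fun p c => by rw [h2, theta_add_tau' hτ]; ring)
  -- the residues along the zero fibre vanish
  have hres : ∀ m < N - 1, s (m + 1) = 0 := by
    refine residue_independent hτ (N - 1) (fun m => s (m + 1)) fun c => ?_
    have := hs 0 c
    rw [theta_zero hτ, zero_mul] at this
    cases N with
    | zero => simp
    | succ N =>
      rw [Finset.sum_range_succ', numCoef_zero hτ, theta_zero hτ, mul_zero, add_zero] at this
      exact this.symm
  have hconst : ∀ p c, h p c = s 0 ∨ N = 0 := by
    intro p c
    rcases Nat.eq_zero_or_pos N with hN | hN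
    · exact Or.inr hN
    · left
      rw [← sub_eq_zero]
      have dh : Differentiable ℂ fun p => h p c := by
        simp only [hh]
        exact Differentiable.fun_sum fun m _ => (ha m).mul_const _
      refine eq_zero_of_simple_zeros_mul (K := fun p => h p c - s 0) (dh.sub_const _)
        dθ (fun z hz => deriv_theta_ne_zero hτ ((theta_eq_zero_iff hτ).1 hz)) (fun z => ?_) p
      obtain ⟨M, rfl⟩ : ∃ M, N = M + 1 := ⟨N - 1, by omega⟩
      rw [mul_sub, hs, Finset.sum_range_succ', numCoef_zero hτ, Finset.sum_eq_zero fun m hm => by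
        rw [hres m (by simpa using hm), zero_mul]]
      ring
  rcases hconst p c with e | e
  · rcases hconst p' c' with e' | e'
    · rw [e, e']
    · rw [hh, hh, e']; simp
  · rw [hh, hh, e]; simp

/-- The coefficients of a polynomial of degree at most `N` are linear in its values
at `0, …, N`. -/
theorem exists_interpolation (N : ℕ) : ∃ B : ℕ → ℕ → ℂ, ∀ P : Polynomial ℂ, P.natDegree ≤ N → ∀ t,
    P.eval t = ∑ m ∈ Finset.range (N + 1),
      (∑ i ∈ Finset.range (N + 1), P.eval (i : ℂ) * B i m) * t ^ m := by
  have hinj : Set.InjOn (fun i : ℕ => (i : ℂ)) (Finset.range (N + 1)) :=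
    fun a _ b _ h => by simpa using h
  refine ⟨fun i m => (Lagrange.basis (Finset.range (N + 1)) (fun i : ℕ => (i : ℂ)) i).coeff m,
    fun P hP t => ?_⟩
  have hPI := Lagrange.eq_interpolate_of_eval_eq (s := Finset.range (N + 1))
    (v := fun i : ℕ => (i : ℂ)) (fun i => P.eval (i : ℂ)) (f := P) hinj
    (by
      rw [Finset.card_range]
      exact lt_of_le_of_lt Polynomial.degree_le_natDegree (by exact_mod_cast Nat.lt_succ_of_le hP))
    (fun i _ => rfl)
  have hev := Polynomial.eval_eq_sum_range' (Nat.lt_succ_of_le hP) t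
  rw [hev]
  refine Finset.sum_congr rfl fun m _ => ?_
  congr 1
  conv_lhs => rw [hPI, Lagrange.interpolate_apply, Polynomial.finsetSum_coeff]
  exact Finset.sum_congr rfl fun i _ => by rw [Polynomial.coeff_C_mul]

variable {n : ℕ}

theorem theta_ne_zero_of_mem_conf (hτ : 0 < τ.im) {p : Fin n → ℂ} (hp : p ∈ conf n τ) {i j : Fin n}
    (h : i ≠ j) : theta τ (p i - p j) ≠ 0 := theta_ne_zero hτ (hp i j h)

theorem isOpen_conf (hτ : 0 < τ.im) : IsOpen (conf n τ) := by
  have : conf n τ = ⋂ (i : Fin n) (j : Fin n) (_ : i ≠ j), {p | theta τ (p i - p j) ≠ 0} := by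
    ext p
    simp only [conf, Set.mem_iInter, Set.mem_ofPred_eq, ne_eq, theta_eq_zero_iff hτ]
  rw [this]
  have hc := (differentiable_theta hτ).continuous
  refine isOpen_iInter_of_finite fun i => isOpen_iInter_of_finite fun j =>
    isOpen_iInter_of_finite fun _ => isOpen_ne_fun (by fun_prop) continuous_const

theorem isOpen_confSharp (hτ : 0 < τ.im) : IsOpen (confSharp n τ) :=
  (isOpen_conf hτ).preimage continuous_fst

theorem dense_conf : Dense (conf n τ) := by
  intro p
  set bad : Set ℂ := ⋃ (i : Fin n) (j : Fin n) (_ : i ≠ j),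
    {s : ℂ | p i - p j + s * ((i : ℕ) - (j : ℕ)) ∈ lat τ} with hbad
  have hc : bad.Countable := by
    refine Set.countable_iUnion fun i => Set.countable_iUnion fun j => Set.countable_iUnion
      fun hij => countable_lat.preimage fun a b h => ?_
    have hne : ((i : ℕ) : ℂ) - (j : ℕ) ≠ 0 := by
      rw [sub_ne_zero]
      exact_mod_cast fun h => hij (Fin.ext h)
    have := add_left_cancel h
    exact mul_right_cancel₀ hne this
  have h0 : (0 : ℂ) ∈ closure badᶜ := hc.dense_compl ℂ 0
  have := map_mem_closure (f := fun s : ℂ => fun i : Fin n => p i + s * ((i : ℕ) : ℂ))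
    (t := conf n τ) (by fun_prop) h0 (fun s hs i j hij hm => hs ?_)
  · simpa using this
  · simp only [hbad, Set.mem_iUnion]
    refine ⟨i, j, hij, ?_⟩
    change p i - p j + s * ((i : ℕ) - (j : ℕ)) ∈ lat τ
    convert hm using 1
    ring

theorem dense_confSharp : Dense (confSharp n τ) :=
  dense_conf.preimage isOpenMap_fst

theorem add_mem_conf {p γ : Fin n → ℂ} (hp : p ∈ conf n τ) (hγ : ∀ i, γ i ∈ lat τ) :
    p + γ ∈ conf n τ := by
  intro i j hij h
  refine hp i j hij ?_
  have := sub_mem h (sub_mem (hγ i) (hγ j))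
  simpa [Pi.add_apply, add_sub_add_comm] using this

theorem fst_mem_lat_of_mem_latSharp {γ : V2 n} (hγ : γ ∈ latSharp n τ) (i : Fin n) :
    γ.1 i ∈ lat τ := by
  obtain ⟨a, b, h⟩ := hγ
  exact mem_lat.2 ⟨a i, b i, (h i).1⟩

theorem add_mem_confSharp {w γ : V2 n} (hw : w ∈ confSharp n τ) (hγ : γ ∈ latSharp n τ) :
    w + γ ∈ confSharp n τ :=
  add_mem_conf hw (fst_mem_lat_of_mem_latSharp hγ)

/-- The direction in `ℂ^{2n}` attached to a vector `v` of `ℂ^n` and a point `(s, t)` of `ℂ²`. -/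
def dir (v : Fin n → ℂ) (s t : ℂ) : V2 n := (fun k => s * v k, fun k => t * v k)

theorem dir_mem_latSharp (v : Fin n → ℤ) (a b : ℤ) :
    dir (fun k => (v k : ℂ)) (a + b * τ) (-(2 * Real.pi * Complex.I) * b) ∈ latSharp n τ :=
  ⟨fun k => a * v k, fun k => b * v k, fun k => ⟨by simp only [dir]; push_cast; ring,
    by simp only [dir]; push_cast; ring⟩⟩

section Restrict

variable {f : confSharp n τ → ℂ} {m H : V2 n → ℂ}

/-- Along the fibres, an algebraic function is a polynomial, with coefficients which are linear in
finitely many of its values. -/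
theorem polynomial_on_lines (hf : IsAlgFun f) (hm : ∀ p c c', m (p, c) = m (p, c'))
    (hH : Continuous H) (hfH : ∀ w : confSharp n τ, m w * f w = H w) :
    ∃ (N : ℕ) (B : ℕ → ℕ → ℂ), ∀ p c v t, H (p, c + t • v) =
      ∑ k ∈ Finset.range N, (∑ i ∈ Finset.range N, H (p, c + (i : ℂ) • v) * B i k) * t ^ k := by
  obtain ⟨N, hN⟩ := hf.2
  obtain ⟨B, hB⟩ := exists_interpolation N
  refine ⟨N + 1, B, fun p c v t => ?_⟩
  refine congrFun (Continuous.ext_on (f := fun p => H (p, c + t • v)) (g := fun p =>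
    ∑ k ∈ Finset.range (N + 1), (∑ i ∈ Finset.range (N + 1), H (p, c + (i : ℂ) • v) * B i k) * t ^ k)
    (dense_conf (τ := τ)) (by fun_prop) (by fun_prop) fun p hp => ?_) p
  obtain ⟨P, hP, hPe⟩ := hN p hp
  have e : ∀ t : ℂ, H (p, c + t • v) = m (p, 0) * (MvPolynomial.aeval (fun k => Polynomial.C (c k) +
      Polynomial.X * Polynomial.C (v k)) P : Polynomial ℂ).eval t := by
    intro t
    rw [← hfH ⟨(p, c + t • v), hp⟩, hPe ⟨(p, c + t • v), hp⟩ rfl, hm p _ 0]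
    congr 1
    rw [← Polynomial.coe_evalRingHom, MvPolynomial.aeval_def, MvPolynomial.hom_eval₂]
    rw [MvPolynomial.eval, MvPolynomial.coe_eval₂Hom]
    congr 1
    · ext x; simp
    · ext k; simp only [Pi.add_apply, Pi.smul_apply, smul_eq_mul]; simp; ring
  have hdeg := MvPolynomial.aeval_natDegree_le P hP (fun k => Polynomial.C (c k) +
      Polynomial.X * Polynomial.C (v k)) (n := 1) (fun k => by compute_degree)
  rw [mul_one] at hdeg
  simp only [e]
  rw [hB _ hdeg t, Finset.mul_sum]
  refine Finset.sum_congr rfl fun k _ => ?_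
  rw [← mul_assoc, Finset.mul_sum]
  congr 1
  exact Finset.sum_congr rfl fun i _ => by ring

/-- The invariance of `f` under the lattice, extended by continuity to the numerator `H` of `f = H /
m`. -/
theorem translate_of_algFun (hf : IsAlgFun f) (hm : Continuous m)
    (hH : Continuous H) (hfH : ∀ w : confSharp n τ, m w * f w = H w) {γ : V2 n}
    (hγ : γ ∈ latSharp n τ) (w : V2 n) : m w * H (w + γ) = m (w + γ) * H w := by
  refine congrFun (Continuous.ext_on (f := fun w => m w * H (w + γ))
    (g := fun w => m (w + γ) * H w) (dense_confSharp (τ := τ)) (by fun_prop) (by fun_prop)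
    fun w hw => ?_) w
  simp only
  rw [← hfH ⟨w, hw⟩, ← hfH ⟨w + γ, add_mem_confSharp hw hγ⟩,
    hf.1 γ hγ ⟨w, hw⟩ ⟨w + γ, add_mem_confSharp hw hγ⟩ rfl]
  ring

/-- If the divisor is invariant in the direction of the integral vector `v`, so is the function. -/
theorem const_on_dir (hτ : 0 < τ.im) (hf : IsAlgFun f) (hm : ∀ p c c', m (p, c) = m (p, c'))
    (hmc : Continuous m) (hm0 : ∀ w ∈ confSharp n τ, m w ≠ 0)
    (hH : Differentiable ℂ H) (hfH : ∀ w : confSharp n τ, m w * f w = H w) (v : Fin n → ℤ)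
    (hv : ∀ w s t, m (w + dir (fun k => (v k : ℂ)) s t) = m w) (w : V2 n) (s t : ℂ) :
    H (w + dir (fun k => (v k : ℂ)) s t) = H w := by
  obtain ⟨N, B, hB⟩ := polynomial_on_lines hf hm hH.continuous hfH
  have inv : ∀ w (a b : ℤ), H (w + dir (fun k => (v k : ℂ)) (a + b * τ)
      (-(2 * Real.pi * Complex.I) * b)) = H w := by
    intro w a b
    refine congrFun (Continuous.ext_on (f := fun w => H (w + dir (fun k => (v k : ℂ)) (a + b * τ)
      (-(2 * Real.pi * Complex.I) * b))) (g := H) (dense_confSharp (τ := τ))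
      (by have := hH.continuous; fun_prop) hH.continuous fun w hw => ?_) w
    have := translate_of_algFun hf hmc hH.continuous hfH (dir_mem_latSharp v a b) w
    rw [hv] at this
    exact mul_left_cancel₀ (hm0 w hw) this
  have key := regular_const hτ (N := N) (h := fun s t => H (w + dir (fun k => (v k : ℂ)) s t))
    (a := fun k s => ∑ i ∈ Finset.range N,
      H (w.1 + s • (fun k => (v k : ℂ)), w.2 + (i : ℂ) • (fun k => (v k : ℂ))) * B i k)
    (fun k => Differentiable.fun_sum fun i _ => by
      refine Differentiable.mul_const (hH.comp ?_) _
      fun_prop)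
    (fun s t => hB (w.1 + s • (fun k => (v k : ℂ))) w.2 (fun k => (v k : ℂ)) t)
    (fun s t => by
      have := inv (w + dir (fun k => (v k : ℂ)) s t) 1 0
      rw [← this]
      congr 1
      rw [add_assoc]
      congr 1
      ext k <;> simp [dir, add_mul])
    (fun s t => by
      have := inv (w + dir (fun k => (v k : ℂ)) s t) 0 1
      rw [← this]
      congr 1
      rw [add_assoc]
      congr 1
      ext k <;> simp [dir] <;> ring)
    s t 0 0
  rw [key]
  congr 1
  ext k <;> simp [dir]

end Restrict

/-- Regular functions on `(E^#)^n` are constant. -/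
theorem algFun_regular_const (hτ : 0 < τ.im) {f : confSharp n τ → ℂ} (hf : IsAlgFun f)
    (h : EntireTimes (fun _ => 1) f) : ∃ C : ℂ, ∀ w, f w = C := by
  obtain ⟨H, hH, hfH⟩ := h
  have hdir : ∀ (k : Fin n) (s t : ℂ) w, H (w + dir (Pi.single k 1) s t) = H w := fun k s t w => by
    have := const_on_dir hτ hf (fun _ _ _ => rfl) continuous_const (fun _ _ => one_ne_zero) hH hfH
      (Pi.single k 1) (fun _ _ _ => rfl) w s t
    convert this using 4
    ext l
    by_cases hl : l = k
    · subst hl; simp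
    · simp [hl]
  have hsum : ∀ (S : Finset (Fin n)) (x : V2 n) w,
      H (w + ∑ k ∈ S, dir (Pi.single k 1) (x.1 k) (x.2 k)) = H w := by
    intro S x
    induction S using Finset.induction_on with
    | empty => simp
    | insert k S hk ih => intro w; rw [Finset.sum_insert hk, ← add_assoc, ih, hdir]
  refine ⟨H 0, fun w => ?_⟩
  rw [← hsum Finset.univ w 0, ← one_mul (f w), hfH, zero_add]
  congr 1
  ext k <;> simp [dir, Finset.sum_apply, Prod.fst_sum, Prod.snd_sum, Pi.single_apply]

/-- The functions on `(E^#)^n` with at most a simple pole along `D_ij`. -/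
theorem algFun_simple_pole (hτ : 0 < τ.im) {i j : Fin n} (hij : i ≠ j) {f : confSharp n τ → ℂ}
    (hf : IsAlgFun f) (h : EntireTimes (fun w => theta τ (w.1 i - w.1 j)) f) :
    ∃ (M : ℕ) (s : ℕ → ℂ), ∀ w : confSharp n τ, f w = ∑ m ∈ Finset.range M,
      s m * kcoef τ m ((w : V2 n).1 i - (w : V2 n).1 j) ((w : V2 n).2 i - (w : V2 n).2 j) := by
  obtain ⟨H, hH, hfH⟩ := h
  have dθ := differentiable_theta hτ
  have hmc : Continuous fun w : V2 n => theta τ (w.1 i - w.1 j) := by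
    have := dθ.continuous; fun_prop
  have hconst := const_on_dir hτ (m := fun w => theta τ (w.1 i - w.1 j)) hf (fun _ _ _ => rfl) hmc
    (fun w hw => theta_ne_zero_of_mem_conf hτ hw hij) hH hfH
  have hdir : ∀ k : Fin n, k ≠ i → k ≠ j → ∀ (s t : ℂ) w,
      H (w + dir (Pi.single k 1) s t) = H w := fun k hi hj s t w => by
    have := hconst (Pi.single k 1) (fun w s t => by simp [dir, hi.symm, hj.symm]) w s t
    convert this using 4
    ext l
    by_cases hl : l = k
    · subst hl; simp
    · simp [hl]
  have hdiag : ∀ (s t : ℂ) w, H (w + dir (Pi.single i 1 + Pi.single j 1) s t) = H w :=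
    fun s t w => by
    have := hconst (Pi.single i 1 + Pi.single j 1) (fun w s t => by
      simp [dir, hij, hij.symm]) w s t
    convert this using 4
    ext l
    simp [Pi.single_apply]
  have hsum : ∀ (S : Finset (Fin n)) (_ : ∀ k ∈ S, k ≠ i ∧ k ≠ j) (x : V2 n) w,
      H (w + ∑ k ∈ S, dir (Pi.single k 1) (x.1 k) (x.2 k)) = H w := by
    intro S
    induction S using Finset.induction_on with
    | empty => simp
    | insert k S hk ih =>
      intro hS x w
      rw [Finset.sum_insert hk, ← add_assoc, ih fun l hl => hS l (Finset.mem_insert_of_mem hl),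
        hdir k (hS k (Finset.mem_insert_self k S)).1 (hS k (Finset.mem_insert_self k S)).2]
  -- `H` depends on `p_i - p_j` and `c_i - c_j` only
  have hred : ∀ w : V2 n, H w = H (dir (Pi.single i 1) (w.1 i - w.1 j) (w.2 i - w.2 j)) := by
    intro w
    rw [← hdiag (w.1 j) (w.2 j) (dir (Pi.single i 1) (w.1 i - w.1 j) (w.2 i - w.2 j)),
      ← hsum ((Finset.univ.erase i).erase j) (by simp +contextual) w
        (dir (Pi.single i 1) (w.1 i - w.1 j) (w.2 i - w.2 j) +
          dir (Pi.single i 1 + Pi.single j 1) (w.1 j) (w.2 j))]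
    congr 1
    have e : ∀ x : Fin n → ℂ, ∀ l, (∑ k ∈ (Finset.univ.erase i).erase j,
        x k * (Pi.single k 1 : Fin n → ℂ) l) = if l = i ∨ l = j then 0 else x l := by
      intro x l
      by_cases hl : l = i ∨ l = j
      · rw [if_pos hl]
        refine Finset.sum_eq_zero fun k hk => ?_
        have hk' : k ≠ j ∧ k ≠ i := by simpa using hk
        rcases hl with rfl | rfl
        · simp [hk'.2.symm]
        · simp [hk'.1.symm]
      · rw [if_neg hl]
        push Not at hl
        rw [Finset.sum_eq_single_of_mem l (by simp [hl.1, hl.2])]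
        · simp
        · intro k _ hk; simp [hk.symm]
    ext l
    · simp only [dir, Prod.fst_add, Prod.fst_sum, Pi.add_apply, Finset.sum_apply, e]
      by_cases h1 : l = i
      · subst h1; simp [hij]
      · by_cases h2 : l = j
        · subst h2; simp [h1]
        · simp [h1, h2]
    · simp only [dir, Prod.snd_add, Prod.snd_sum, Pi.add_apply, Finset.sum_apply, e]
      by_cases h1 : l = i
      · subst h1; simp [hij]
      · by_cases h2 : l = j
        · subst h2; simp [h1]
        · simp [h1, h2]
  obtain ⟨N, B, hB⟩ := polynomial_on_lines (m := fun w => theta τ (w.1 i - w.1 j)) hf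
    (fun _ _ _ => rfl) hH.continuous hfH
  have hcast : (fun k => ((Pi.single i 1 : Fin n → ℤ) k : ℂ)) = Pi.single i 1 := by
    ext l
    by_cases hl : l = i
    · subst hl; simp
    · simp [hl]
  have hdd : ∀ t, Differentiable ℂ fun s => H (dir (Pi.single i 1) s t) := fun t =>
    hH.comp (by unfold dir; fun_prop)
  have htr : ∀ (a b : ℤ) (μ : ℂ → ℂ), Differentiable ℂ μ →
      (∀ s, theta τ (s + (a + b * τ)) = μ s * theta τ s) → ∀ s t,
      H (dir (Pi.single i 1) (s + (a + b * τ)) (t + -(2 * Real.pi * Complex.I) * b)) =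
        μ s * H (dir (Pi.single i 1) s t) := by
    intro a b μ hμ h s t
    rw [← sub_eq_zero]
    refine eq_zero_of_simple_zeros_mul (K := fun s => H (dir (Pi.single i 1) (s + (a + b * τ))
      (t + -(2 * Real.pi * Complex.I) * b)) - μ s * H (dir (Pi.single i 1) s t))
      (((hdd _).comp (f := fun s => s + (a + b * τ)) (by fun_prop)).sub (hμ.mul (hdd t))) dθ
      (fun z hz => deriv_theta_ne_zero hτ ((theta_eq_zero_iff hτ).1 hz)) (fun s => ?_) s
    have := translate_of_algFun hf hmc hH.continuous hfH (dir_mem_latSharp (Pi.single i 1) a b)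
      (dir (Pi.single i 1) s t)
    rw [hcast] at this
    have e1 : dir (Pi.single i 1) s t + dir (Pi.single i 1) (a + b * τ)
        (-(2 * Real.pi * Complex.I) * b) = dir (n := n) (Pi.single i 1) (s + (a + b * τ))
        (t + -(2 * Real.pi * Complex.I) * b) := by
      ext k <;> simp [dir] <;> ring
    rw [e1] at this
    simp only [dir, Pi.single_eq_same, Pi.single_eq_of_ne hij.symm, mul_one, mul_zero, sub_zero,
      h] at this ⊢
    linear_combination this
  obtain ⟨s, hs⟩ := simple_pole_span hτ N (fun s t => H (dir (Pi.single i 1) s t))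
    (fun k s => ∑ l ∈ Finset.range N,
      H (0 + s • (Pi.single i 1), 0 + (l : ℂ) • (Pi.single i 1)) * B l k)
    (fun k => Differentiable.fun_sum fun l _ => by
      refine Differentiable.mul_const (hH.comp ?_) _
      fun_prop)
    (fun s t => by
      rw [← hB]
      congr 1
      ext k <;> simp [dir])
    (fun s t => by
      have := htr 1 0 (fun _ => -1) (by fun_prop) (fun s => by simp [theta_add_one hτ]) s t
      simpa using this)
    (fun s t => by
      have := htr 0 1 (thetaMul τ) (by
        unfold thetaMul
        exact (differentiable_ee.comp (by fun_prop)).neg) (fun s => by simp [theta_add_tau' hτ]) s t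
      simpa [sub_eq_add_neg] using this)
  refine ⟨N, s, fun w => ?_⟩
  have hne := theta_ne_zero_of_mem_conf hτ w.2 hij
  refine mul_left_cancel₀ hne ?_
  have := hfH w
  simp only at this
  rw [this, hred, hs, Finset.mul_sum]
  refine Finset.sum_congr rfl fun m _ => ?_
  rw [← theta_mul_kcoef hτ (w.2 i j hij)]
  ring

end AlgFun

/-! ### The basis of the space of one-forms -/

section Index

variable {n : ℕ}

/-- The pairs `(i, j)` with `i < j`. -/
abbrev Pairs (n : ℕ) : Type := {x : Fin n × Fin n // x.1 < x.2}

/-- The index set as a disjoint union. -/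
def idxEquiv (n : ℕ) : Fin n ⊕ Fin n ⊕ (Pairs n × ℕ) ≃ Idx n where
  toFun x := match x with
    | .inl i => .X i
    | .inr (.inl i) => .Y i
    | .inr (.inr (x, α)) => .T x.1.1 x.1.2 x.2 α
  invFun a := match a with
    | .X i => .inl i
    | .Y i => .inr (.inl i)
    | .T i j h α => .inr (.inr (⟨(i, j), h⟩, α))
  left_inv x := by rcases x with i | i | ⟨x, α⟩ <;> rfl
  right_inv a := by cases a <;> rfl

/-- The indices `X_i`, `Y_i` and `T_ij^α` with `α < N`. -/
def idxFin (n N : ℕ) : Finset (Idx n) :=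
  (Finset.univ.disjSum (Finset.univ.disjSum (Finset.univ ×ˢ Finset.range N))).map
    (idxEquiv n).toEmbedding

theorem sum_idxFin {M : Type*} [AddCommMonoid M] (N : ℕ) (h : Idx n → M) :
    ∑ a ∈ idxFin n N, h a = ∑ i, h (.X i) + (∑ i, h (.Y i) +
      ∑ x : Pairs n, ∑ α ∈ Finset.range N, h (.T x.1.1 x.1.2 x.2 α)) := by
  rw [idxFin, Finset.sum_map, Finset.sum_disjSum, Finset.sum_disjSum, Finset.sum_product]
  rfl

@[simp] theorem X_mem_idxFin (N : ℕ) (i : Fin n) : Idx.X i ∈ idxFin n N := by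
  simp only [idxFin, Finset.mem_map_equiv]
  simp [idxEquiv]

@[simp] theorem Y_mem_idxFin (N : ℕ) (i : Fin n) : Idx.Y i ∈ idxFin n N := by
  simp only [idxFin, Finset.mem_map_equiv]
  simp [idxEquiv]

@[simp] theorem T_mem_idxFin (N : ℕ) (i j : Fin n) (h : i < j) (α : ℕ) :
    Idx.T i j h α ∈ idxFin n N ↔ α < N := by
  simp only [idxFin, Finset.mem_map_equiv]
  simp [idxEquiv]

theorem exists_subset_idxFin (S : Finset (Idx n)) : ∃ N, S ⊆ idxFin n N := by
  refine ⟨S.sup Idx.deg, fun a ha => ?_⟩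
  have := Finset.le_sup (f := Idx.deg) ha
  cases a with
  | X i => simp
  | Y i => simp
  | T i j h α => rw [T_mem_idxFin]; exact this

end Index

section Derivatives

variable {n : ℕ} {τ : ℂ}

theorem fderiv_fcoef_apply (hτ : 0 < τ.im) (α : ℕ) {p : ℂ} (hp : p ∉ lat τ) (c x y : ℂ) :
    fderiv ℂ (fun z : ℂ × ℂ => fcoef τ α z.1 z.2) (p, c) (x, y) =
      x * deriv (fun p => fcoef τ α p c) p - y * kcoef τ α p c := by
  have hd : HasFDerivAt (fun z : ℂ × ℂ => fcoef τ α z.1 z.2)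
      (fderiv ℂ (fun z : ℂ × ℂ => fcoef τ α z.1 z.2) (p, c)) (p, c) :=
    (differentiableAt_kcoef hτ (α + 1) (x := (p, c)) hp).hasFDerivAt
  set L := fderiv ℂ (fun z : ℂ × ℂ => fcoef τ α z.1 z.2) (p, c)
  have h1 : HasDerivAt (fun p => fcoef τ α p c) (L (1, 0)) p :=
    HasFDerivAt.comp_hasDerivAt (f := fun q : ℂ => (q, c)) p hd
      ((hasDerivAt_id p).prodMk (hasDerivAt_const p c))
  have h2 : HasDerivAt (fun c => fcoef τ α p c) (L (0, 1)) c :=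
    HasFDerivAt.comp_hasDerivAt (f := fun q : ℂ => (p, q)) c hd
      ((hasDerivAt_const c p).prodMk (hasDerivAt_id c))
  have h3 : L (0, 1) = -kcoef τ α p c := h2.unique (hasDerivAt_kcoef_succ α p c)
  have : ((x, y) : ℂ × ℂ) = x • ((1, 0) : ℂ × ℂ) + y • ((0, 1) : ℂ × ℂ) := by ext <;> simp
  rw [this, map_add, map_smul, map_smul, h1.deriv, h3]
  simp only [smul_eq_mul]
  ring

/-- The map `(p, c) ↦ (p_i - p_j, c_i - c_j)`. -/
def diffMap (i j : Fin n) : V2 n →L[ℂ] ℂ × ℂ :=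
  (((ContinuousLinearMap.proj i : (Fin n → ℂ) →L[ℂ] ℂ) - (ContinuousLinearMap.proj j : (Fin n → ℂ) →L[ℂ] ℂ)).comp
    (ContinuousLinearMap.fst ℂ _ _)).prod
  (((ContinuousLinearMap.proj i : (Fin n → ℂ) →L[ℂ] ℂ) - (ContinuousLinearMap.proj j : (Fin n → ℂ) →L[ℂ] ℂ)).comp
    (ContinuousLinearMap.snd ℂ _ _))

theorem diffMap_apply (i j : Fin n) (w : V2 n) :
    diffMap i j w = (w.1 i - w.1 j, w.2 i - w.2 j) := rfl

/-- The function `f_α(p_i - p_j, c_i - c_j)`. -/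
def fij (τ : ℂ) (α : ℕ) (i j : Fin n) (w : V2 n) : ℂ :=
  fcoef τ α (w.1 i - w.1 j) (w.2 i - w.2 j)

/-- The derivative of `fij`. -/
def dfij (τ : ℂ) (α : ℕ) (i j : Fin n) (w : V2 n) : V2 n →L[ℂ] ℂ :=
  (fderiv ℂ (fun z : ℂ × ℂ => fcoef τ α z.1 z.2) (diffMap i j w)).comp (diffMap i j)

theorem hasFDerivAt_fij (hτ : 0 < τ.im) (α : ℕ) {i j : Fin n} (hij : i ≠ j) {w : V2 n}
    (hw : w ∈ confSharp n τ) : HasFDerivAt (fij τ α i j) (dfij τ α i j w) w :=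
  HasFDerivAt.comp (f := diffMap i j) (g := fun z : ℂ × ℂ => fcoef τ α z.1 z.2) w
    (differentiableAt_kcoef hτ (α + 1) (x := diffMap i j w) (hw i j hij)).hasFDerivAt
    (diffMap i j).hasFDerivAt

theorem dfij_apply (hτ : 0 < τ.im) (α : ℕ) {i j : Fin n} (hij : i ≠ j) {w : V2 n}
    (hw : w ∈ confSharp n τ) (u : V2 n) : dfij τ α i j w u =
      (u.1 i - u.1 j) * deriv (fun p => fcoef τ α p (w.2 i - w.2 j)) (w.1 i - w.1 j) -
        (u.2 i - u.2 j) * kcoef τ α (w.1 i - w.1 j) (w.2 i - w.2 j) :=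
  fderiv_fcoef_apply hτ α (hw i j hij) _ _ _

theorem pderiv_eq (hτ : 0 < τ.im) {f : confSharp n τ → ℂ} {g : V2 n → ℂ} {L : V2 n →L[ℂ] ℂ}
    {w : confSharp n τ} (hfg : ∀ w : confSharp n τ, f w = g w) (hg : HasFDerivAt g L w) (u : V2 n) :
    pderiv f u w = L u := by
  have hl : HasDerivAt (fun s : ℂ => (w : V2 n) + s • u) u 0 := by
    simpa using ((hasDerivAt_id (0 : ℂ)).smul_const u).const_add (w : V2 n)
  have h : HasDerivAt (fun s : ℂ => g (w + s • u)) (L u) 0 :=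
    HasFDerivAt.comp_hasDerivAt (0 : ℂ) (by simpa using hg) hl
  rw [pderiv, ← h.deriv]
  refine Filter.EventuallyEq.deriv_eq ?_
  have hc : ContinuousAt (fun s : ℂ => (w : V2 n) + s • u) 0 := by fun_prop
  have : ∀ᶠ s : ℂ in nhds 0, (w : V2 n) + s • u ∈ confSharp n τ :=
    hc.eventually_mem ((isOpen_confSharp hτ).mem_nhds (by simp))
  filter_upwards [this] with s hs
  rw [dif_pos hs, hfg]

theorem pderiv_const (hτ : 0 < τ.im) {f : confSharp n τ → ℂ} {C : ℂ} (h : ∀ w, f w = C) (u : V2 n)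
    (w : confSharp n τ) : pderiv f u w = 0 :=
  (pderiv_eq (g := fun _ => C) (L := 0) hτ h (hasFDerivAt_const C _) u)

theorem eta_X (i : Fin n) (w : confSharp n τ) (u : V2 n) : eta n τ (.X i) w u = u.2 i := rfl

theorem eta_Y (i : Fin n) (w : confSharp n τ) (u : V2 n) : eta n τ (.Y i) w u = u.1 i := rfl

theorem eta_T (i j : Fin n) (h : i < j) (α : ℕ) (w : confSharp n τ) (u : V2 n) :
    eta n τ (.T i j h α) w u = fij τ α i j w * (u.1 i - u.1 j) := rfl

theorem dForm_eta_X (hτ : 0 < τ.im) (i : Fin n) : dForm (eta n τ (.X i)) = 0 := by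
  funext w u v
  have h (u v : V2 n) : pderiv (fun y => eta n τ (.X i) y v) u w = 0 :=
    pderiv_const hτ (C := v.2 i) (fun _ => rfl) u w
  rw [dForm, h, h, sub_zero]
  rfl

theorem dForm_eta_Y (hτ : 0 < τ.im) (i : Fin n) : dForm (eta n τ (.Y i)) = 0 := by
  funext w u v
  have h (u v : V2 n) : pderiv (fun y => eta n τ (.Y i) y v) u w = 0 :=
    pderiv_const hτ (C := v.1 i) (fun _ => rfl) u w
  rw [dForm, h, h, sub_zero]
  rfl

/-- `dω_ij^α = -k_α dc_ij ∧ dp_ij`, where `k_0 = 1` and `k_{α + 1} dp_ij = ω_ij^α`. -/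
theorem dForm_eta_T (hτ : 0 < τ.im) {i j : Fin n} (h : i < j) (α : ℕ) (w : confSharp n τ)
    (u v : V2 n) : dForm (eta n τ (.T i j h α)) w u v =
      -kcoef τ α ((w : V2 n).1 i - (w : V2 n).1 j) ((w : V2 n).2 i - (w : V2 n).2 j) *
        ((u.2 i - u.2 j) * (v.1 i - v.1 j) - (v.2 i - v.2 j) * (u.1 i - u.1 j)) := by
  have hd := hasFDerivAt_fij hτ α h.ne w.2
  have h1 (u v : V2 n) : pderiv (fun y => eta n τ (.T i j h α) y v) u w =
      ((v.1 i - v.1 j) • dfij τ α i j w) u :=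
    pderiv_eq (g := fun w => fij τ α i j w * (v.1 i - v.1 j)) hτ (fun _ => rfl)
      (hd.mul_const _) u
  rw [dForm, h1, h1]
  simp only [smul_apply, dfij_apply hτ α h.ne w.2, smul_eq_mul]
  ring

end Derivatives

section Basis

variable {n : ℕ} {τ : ℂ}

/-- The basis vectors of `ℂ^{2n}` dual to `dp_i` and `dc_i`. -/
def ep (i : Fin n) : V2 n := (Pi.single i 1, 0)

/-- See `ep`. -/
def ec (i : Fin n) : V2 n := (0, Pi.single i 1)

@[simp] theorem ep_fst (i k : Fin n) : (ep i).1 k = if k = i then (1 : ℂ) else 0 := by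
  simp [ep, Pi.single_apply]
@[simp] theorem ep_snd (i k : Fin n) : (ep i).2 k = (0 : ℂ) := rfl
@[simp] theorem ec_snd (i k : Fin n) : (ec i).2 k = if k = i then (1 : ℂ) else 0 := by
  simp [ec, Pi.single_apply]
@[simp] theorem ec_fst (i k : Fin n) : (ec i).1 k = (0 : ℂ) := rfl

theorem sum_ep_ec (u : V2 n) : u = ∑ i, u.1 i • ep i + ∑ i, u.2 i • ec i := by
  ext k
  · simp [Prod.fst_sum, Finset.sum_apply, ep, ec, Pi.single_apply]
  · simp [Prod.snd_sum, Finset.sum_apply, ep, ec, Pi.single_apply]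

/-- Evaluation on the vectors `ec i` isolates the coefficients of `dc_i`, variation of `c_j` alone
those of the forms `ω_ij^α`, and what remains is a combination of the `dp_i`. -/
theorem linearIndependent_eta (hτ : 0 < τ.im) : LinearIndependent ℂ (eta n τ) := by
  rw [linearIndependent_iff]
  intro g hg
  obtain ⟨N, hN⟩ := exists_subset_idxFin g.support
  rw [Finsupp.linearCombination_apply, Finsupp.sum_of_support_subset g hN _ (by simp)] at hg
  have key : ∀ (w : confSharp n τ) (u : V2 n), ∑ i, g (.X i) * u.2 i + (∑ i, g (.Y i) * u.1 i +
      ∑ x : Pairs n, ∑ α ∈ Finset.range N, g (.T x.1.1 x.1.2 x.2 α) *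
        (fij τ α x.1.1 x.1.2 w * (u.1 x.1.1 - u.1 x.1.2))) = 0 := by
    intro w u
    have h := congrFun hg w
    have h := congrArg (fun L : V2 n →ₗ[ℂ] ℂ => L u) h
    simp only [Finset.sum_apply, LinearMap.sum_apply, Pi.smul_apply, LinearMap.smul_apply,
      smul_eq_mul] at h
    rw [sum_idxFin] at h
    simpa [eta_X, eta_Y, eta_T] using h
  obtain ⟨p, hp⟩ := (dense_conf (n := n) (τ := τ)).nonempty
  have hX : ∀ i, g (.X i) = 0 := fun i => by
    have := key ⟨(p, 0), hp⟩ (ec i)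
    simpa using this
  have hT : ∀ (i j : Fin n) (h : i < j) (α : ℕ), g (.T i j h α) = 0 := by
    intro i j h α
    by_cases hα : α < N
    swap
    · by_contra hne
      exact hα ((T_mem_idxFin N i j h α).1 (hN (Finsupp.mem_support_iff.2 hne)))
    -- only the forms `ω_ij^α` contribute to the variation with `c_j` of the coefficient of `dp_i`
    have hdiff : ∀ t : ℂ, ∑ α ∈ Finset.range N, g (.T i j h α) *
        (fcoef τ α (p i - p j) t - fcoef τ α (p i - p j) 0) = 0 := by
      intro t
      have h1 := key ⟨(p, Pi.single j (-t)), hp⟩ (ep i)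
      have h2 := key ⟨(p, 0), hp⟩ (ep i)
      refine Eq.trans ?_ (sub_eq_zero.2 (h1.trans h2.symm))
      symm
      rw [add_sub_add_left_eq_sub, add_sub_add_left_eq_sub, ← Finset.sum_sub_distrib,
        Finset.sum_eq_single (⟨(i, j), h⟩ : Pairs n)]
      · rw [← Finset.sum_sub_distrib]
        refine Finset.sum_congr rfl fun α _ => ?_
        simp [fij, h.ne, h.ne']
        ring
      · rintro ⟨⟨k, l⟩, hkl⟩ _ hne
        rw [← Finset.sum_sub_distrib]
        refine Finset.sum_eq_zero fun α _ => ?_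
        by_cases hj : k = j ∨ l = j
        · have hki : k ≠ i := by
            rintro rfl
            rcases hj with rfl | rfl
            · exact lt_irrefl _ h
            · exact hne rfl
          have hli : l ≠ i := by
            rintro rfl
            rcases hj with rfl | rfl
            · exact lt_asymm h hkl
            · exact lt_irrefl _ h
          simp [hki, hli]
        · push Not at hj
          simp [fij, hj.1, hj.2]
      · simp
    have := kcoef_independent hτ (hp i j h.ne) (N + 1) (fun m => match m with
        | 0 => -∑ α ∈ Finset.range N, g (.T i j h α) * fcoef τ α (p i - p j) 0
        | m + 1 => g (.T i j h m)) (fun t => by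
      rw [Finset.sum_range_succ', kcoef_zero hτ (hp i j h.ne), mul_one, ← sub_eq_add_neg,
        ← Finset.sum_sub_distrib]
      refine Eq.trans (Finset.sum_congr rfl fun α _ => ?_) (hdiff t)
      rw [← fcoef_eq_kcoef]
      ring) (α + 1) (by omega)
    exact this
  have hY : ∀ i, g (.Y i) = 0 := fun i => by
    have := key ⟨(p, 0), hp⟩ (ep i)
    simpa [hX, hT] using this
  ext a
  cases a with
  | X i => exact hX i
  | Y i => exact hY i
  | T i j h α => exact hT i j h α

theorem isAlgFun_const (C : ℂ) : IsAlgFun (n := n) (τ := τ) fun _ => C :=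
  ⟨fun _ _ _ _ _ => rfl, 0, fun _ _ => ⟨MvPolynomial.C C, by simp, fun w _ => by simp⟩⟩

theorem zF_add_latSharp (hτ : 0 < τ.im) {γ : V2 n} (hγ : γ ∈ latSharp n τ) (w : V2 n)
    (i j : Fin n) : zF τ ((w + γ).1 i - (w + γ).1 j) ((w + γ).2 i - (w + γ).2 j) =
      zF τ (w.1 i - w.1 j) (w.2 i - w.2 j) := by
  obtain ⟨a, b, h⟩ := hγ
  rw [← zF_add_lat hτ (w.1 i - w.1 j) (w.2 i - w.2 j) (a i - a j) (b i - b j)]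
  simp only [Prod.fst_add, Prod.snd_add, Pi.add_apply, (h i).1, (h i).2, (h j).1, (h j).2]
  push_cast
  congr 1 <;> ring

theorem fij_add_latSharp (hτ : 0 < τ.im) {γ : V2 n} (hγ : γ ∈ latSharp n τ) (w : V2 n)
    (α : ℕ) (i j : Fin n) : fij τ α i j (w + γ) = fij τ α i j w := by
  rw [fij, fcoef, zF_add_latSharp hτ hγ, fij, fcoef]

theorem isAlgFun_fij (hτ : 0 < τ.im) (α : ℕ) (i j : Fin n) (x : ℂ) :
    IsAlgFun (n := n) (τ := τ) fun w => fij τ α i j w * x := by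
  refine ⟨fun γ hγ w w' h => by simp only [h, fij_add_latSharp hτ hγ], α + 1, fun p _ => ?_⟩
  refine ⟨∑ r ∈ Finset.HasAntidiagonal.antidiagonal (α + 1),
    MvPolynomial.C ((theta τ (p i - p j))⁻¹ * (1 / (r.1.factorial : ℂ)) * pCoef τ r.2 (p i - p j) *
      x) * (MvPolynomial.X j - MvPolynomial.X i) ^ r.1, ?_, fun w hw => ?_⟩
  · refine MvPolynomial.totalDegree_finsetSum_le fun r hr => ?_
    refine (MvPolynomial.totalDegree_mul _ _).trans ?_
    rw [MvPolynomial.totalDegree_C, zero_add]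
    refine (MvPolynomial.totalDegree_pow _ _).trans ?_
    have h1 : (MvPolynomial.X j - MvPolynomial.X i : MvPolynomial (Fin n) ℂ).totalDegree ≤ 1 := by
      refine (MvPolynomial.totalDegree_sub _ _).trans ?_
      rw [MvPolynomial.totalDegree_X, MvPolynomial.totalDegree_X, max_self]
    have h2 : r.1 ≤ α + 1 := Finset.HasAntidiagonal.antidiagonal.fst_le hr
    calc r.1 * _ ≤ r.1 * 1 := Nat.mul_le_mul_left _ h1
      _ ≤ α + 1 := by omega
  · simp only [fij]
    rw [fcoef_eq_kcoef, kcoef_eq, numCoef_eq_sum, hw, map_sum, Finset.mul_sum, Finset.sum_mul]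
    refine Finset.sum_congr rfl fun r _ => ?_
    simp
    ring

theorem differentiable_numCoef_comp (hτ : 0 < τ.im) (m : ℕ) (i j : Fin n) :
    Differentiable ℂ fun w : V2 n => numCoef τ m (w.1 i - w.1 j) (w.2 i - w.2 j) := by
  have h := Differentiable.comp (g := fun x : ℂ × ℂ => numCoef τ m x.1 x.2)
    (differentiable_numCoef hτ m) (diffMap i j).differentiable
  simpa only [Function.comp_def, diffMap_apply] using h

theorem continuous_numCoef (hτ : 0 < τ.im) (m : ℕ) (i j : Fin n) :
    Continuous fun w : V2 n => numCoef τ m (w.1 i - w.1 j) (w.2 i - w.2 j) :=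
  (differentiable_numCoef_comp hτ m i j).continuous

theorem eta_T_mem_logForms (hτ : 0 < τ.im) {i j : Fin n} (h : i < j) (α : ℕ) :
    eta n τ (.T i j h α) ∈ logForms n τ i j := by
  refine ⟨fun u => ⟨isAlgFun_fij hτ α i j _, fun w => numCoef τ (α + 1) (w.1 i - w.1 j)
    (w.2 i - w.2 j) * (u.1 i - u.1 j), (differentiable_numCoef_comp hτ _ i j).mul_const _,
    fun w => ?_⟩, fun u v => ⟨fun w => -numCoef τ α (w.1 i - w.1 j) (w.2 i - w.2 j) *
      ((u.2 i - u.2 j) * (v.1 i - v.1 j) - (v.2 i - v.2 j) * (u.1 i - u.1 j)),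
      (differentiable_numCoef_comp hτ _ i j).neg.mul_const _, fun w => ?_⟩⟩
  · simp only [eta_T, fij]
    rw [← theta_mul_kcoef hτ (w.2 i j h.ne), ← fcoef_eq_kcoef, mul_assoc]
  · simp only [dForm_eta_T hτ]
    rw [← theta_mul_kcoef hτ (w.2 i j h.ne)]
    ring

theorem const_mem_regForms (L : V2 n →ₗ[ℂ] ℂ) : (fun _ => L : Form1 n τ) ∈ regForms n τ :=
  fun u => ⟨isAlgFun_const (L u), fun _ => L u, differentiable_const _, fun _ => one_mul _⟩

theorem eta_mem_Omega1 (hτ : 0 < τ.im) (a : Idx n) : eta n τ a ∈ Omega1 n τ := by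
  refine Submodule.subset_span ?_
  cases a with
  | X i => exact Or.inl (const_mem_regForms (dc i))
  | Y i => exact Or.inl (const_mem_regForms (dp i))
  | T i j h α =>
    refine Or.inr ?_
    simp only [Set.mem_iUnion]
    exact ⟨i, j, h, eta_T_mem_logForms hτ h α⟩

theorem const_mem_span (L : V2 n →ₗ[ℂ] ℂ) :
    (fun _ => L : Form1 n τ) ∈ Submodule.span ℂ (Set.range (eta n τ)) := by
  have : (fun _ => L : Form1 n τ) = ∑ i, L (ep i) • eta n τ (.Y i) +
      ∑ i, L (ec i) • eta n τ (.X i) := by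
    funext w
    refine LinearMap.ext fun u => ?_
    conv_lhs => rw [sum_ep_ec u]
    simp only [map_add, map_sum, map_smul, Pi.add_apply, Finset.sum_apply, LinearMap.add_apply,
      LinearMap.sum_apply, Pi.smul_apply, LinearMap.smul_apply, eta_X, eta_Y, smul_eq_mul]
    simp only [mul_comm]
  rw [this]
  exact add_mem (sum_mem fun i _ => Submodule.smul_mem _ _ (Submodule.subset_span ⟨_, rfl⟩))
    (sum_mem fun i _ => Submodule.smul_mem _ _ (Submodule.subset_span ⟨_, rfl⟩))

/-- The coefficients of a regular form are regular functions, hence constants. -/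
theorem regForms_subset_span (hτ : 0 < τ.im) {η : Form1 n τ} (hη : η ∈ regForms n τ) :
    η ∈ Submodule.span ℂ (Set.range (eta n τ)) := by
  obtain ⟨p, hp⟩ := (dense_conf (n := n) (τ := τ)).nonempty
  have : η = fun _ => η ⟨(p, 0), hp⟩ := by
    funext w
    refine LinearMap.ext fun u => ?_
    obtain ⟨C, hC⟩ := algFun_regular_const hτ (hη u).1 (hη u).2
    rw [hC w, hC]
  rw [this]
  exact const_mem_span _

/-- The derivative of `numCoef` in its first variable. -/
def dnumCoef (τ : ℂ) (m : ℕ) (p c : ℂ) : ℂ :=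
  ∑ x ∈ Finset.HasAntidiagonal.antidiagonal m, (-c) ^ x.1 / (x.1.factorial : ℂ) *
    deriv (pCoef τ x.2) p

theorem hasDerivAt_numCoef_left (hτ : 0 < τ.im) (m : ℕ) (p c : ℂ) :
    HasDerivAt (fun p => numCoef τ m p c) (dnumCoef τ m p c) p := by
  simp only [numCoef_eq_sum]
  exact HasDerivAt.fun_sum fun x _ =>
    ((differentiable_pCoef hτ x.2) p).hasDerivAt.const_mul _

theorem continuous_dnumCoef (hτ : 0 < τ.im) (m : ℕ) :
    Continuous fun x : ℂ × ℂ => dnumCoef τ m x.1 x.2 := by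
  unfold dnumCoef
  refine continuous_finsetSum _ fun x _ => Continuous.mul (by fun_prop) ?_
  exact ((differentiable_pCoef hτ x.2).contDiff.continuous_deriv (n := 1) le_rfl).comp continuous_fst

theorem deriv_fcoef (hτ : 0 < τ.im) (α : ℕ) {p : ℂ} (hp : p ∉ lat τ) (c : ℂ) :
    theta τ p ^ 2 * deriv (fun p => fcoef τ α p c) p =
      dnumCoef τ (α + 1) p c * theta τ p - numCoef τ (α + 1) p c * deriv (theta τ) p := by
  have hne := theta_ne_zero hτ hp
  have h : HasDerivAt (fun p => numCoef τ (α + 1) p c / theta τ p) _ p :=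
    (hasDerivAt_numCoef_left hτ (α + 1) p c).div (differentiable_theta hτ p).hasDerivAt hne
  have e : (fun p => fcoef τ α p c) = fun p => numCoef τ (α + 1) p c / theta τ p := by
    ext p
    rw [fcoef_eq_kcoef, kcoef_eq, div_eq_mul_inv, mul_comm]
  rw [e, h.deriv]
  field_simp

/-- The coefficients of a form with logarithmic poles along `D_ij` are combinations of the functions
`k_m(p_ij, c_ij)`, so the form is `ξ_0 + ∑ f_α(p_ij, c_ij) ξ_(α + 1)` with constant forms `ξ_m`. As
`dη` has at most a simple pole, the forms `ξ_(α + 1)` vanish on the vectors tangent to `D_ij`, that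
is, they are multiples of `dp_ij`. -/
theorem logForms_subset_span (hτ : 0 < τ.im) {i j : Fin n} (h : i < j) {η : Form1 n τ}
    (hη : η ∈ logForms n τ i j) : η ∈ Submodule.span ℂ (Set.range (eta n τ)) := by
  obtain ⟨h1, h2⟩ := hη
  have hex := fun u => algFun_simple_pole hτ h.ne (h1 u).1 (h1 u).2
  choose M s hs using hex
  -- a common bound for the coordinate vectors
  obtain ⟨N, hN⟩ : ∃ N, (∀ k, M (ep k) ≤ N) ∧ ∀ k, M (ec k) ≤ N :=
    ⟨(Finset.univ.sup fun k => M (ep k)) + Finset.univ.sup fun k => M (ec k),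
      fun k => (Finset.le_sup (f := fun k => M (ep k)) (Finset.mem_univ k)).trans (by omega),
      fun k => (Finset.le_sup (f := fun k => M (ec k)) (Finset.mem_univ k)).trans (by omega)⟩
  set s' : V2 n → ℕ → ℂ := fun u m => if m < M u then s u m else 0 with hs'
  have hs2 : ∀ u, M u ≤ N → ∀ w : confSharp n τ, η w u = ∑ m ∈ Finset.range (N + 1), s' u m *
      kcoef τ m ((w : V2 n).1 i - (w : V2 n).1 j) ((w : V2 n).2 i - (w : V2 n).2 j) := by
    intro u hu w
    rw [hs u w]
    rw [← Finset.sum_subset (Finset.range_subset_range.2 (by omega : M u ≤ N + 1))]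
    · refine Finset.sum_congr rfl fun m hm => ?_
      simp only [hs', if_pos (Finset.mem_range.1 hm)]
    · intro m _ hm
      simp only [hs', if_neg (fun h => hm (Finset.mem_range.2 h)), zero_mul]
  set ξ : ℕ → (V2 n →ₗ[ℂ] ℂ) := fun m => ∑ k, s' (ep k) m • dp k + ∑ k, s' (ec k) m • dc k with hξ
  have hηξ : ∀ (w : confSharp n τ) u, η w u = ξ 0 u + ∑ α ∈ Finset.range N,
      fij τ α i j w * ξ (α + 1) u := by
    intro w u
    have e : ∀ m, ξ m u = ∑ k, u.1 k * s' (ep k) m + ∑ k, u.2 k * s' (ec k) m := fun m => by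
      simp only [hξ, LinearMap.add_apply, LinearMap.sum_apply, LinearMap.smul_apply, smul_eq_mul, dp,
        dc, LinearMap.comp_apply, LinearMap.proj_apply, LinearMap.fst_apply, LinearMap.snd_apply]
      simp only [mul_comm]
    have e2 : η w u = ∑ m ∈ Finset.range (N + 1), kcoef τ m ((w : V2 n).1 i - (w : V2 n).1 j)
        ((w : V2 n).2 i - (w : V2 n).2 j) * ξ m u := by
      conv_lhs => rw [sum_ep_ec u]
      simp only [map_add, map_sum, map_smul, smul_eq_mul, hs2 _ (hN.1 _), hs2 _ (hN.2 _), e,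
        Finset.mul_sum, mul_add, Finset.sum_add_distrib]
      rw [Finset.sum_comm]
      congr 1
      · exact Finset.sum_congr rfl fun _ _ => Finset.sum_congr rfl fun _ _ => by ring
      · rw [Finset.sum_comm]
        exact Finset.sum_congr rfl fun _ _ => Finset.sum_congr rfl fun _ _ => by ring
    rw [e2, Finset.sum_range_succ', kcoef_zero hτ (w.2 i j h.ne), one_mul, add_comm]
    rfl
  -- the condition on `dη`: the double poles of `dη` cancel
  have hker : ∀ α < N, ∀ v : V2 n, v.1 i = v.1 j → ξ (α + 1) v = 0 := by
    intro α hα v hv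
    refine residue_independent hτ N (fun α => ξ (α + 1) v) (fun c => ?_) α hα
    obtain ⟨H, hH, hHe⟩ := h2 (ep i) v
    have hd : ∀ (w : confSharp n τ) (x y : V2 n), pderiv (fun w => η w x) y w =
        ∑ α ∈ Finset.range N, dfij τ α i j w y * ξ (α + 1) x := by
      intro w x y
      rw [pderiv_eq (g := fun w => ξ 0 x + ∑ α ∈ Finset.range N, fij τ α i j w * ξ (α + 1) x)
        (L := ∑ α ∈ Finset.range N, ξ (α + 1) x • dfij τ α i j w) hτ (fun w => hηξ w x)
        (HasFDerivAt.const_add _ (HasFDerivAt.fun_sum fun α _ =>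
          (hasFDerivAt_fij hτ α h.ne w.2).mul_const _))]
      simp [mul_comm]
    have key : ∀ w : V2 n, ∑ α ∈ Finset.range N, ξ (α + 1) v *
        (dnumCoef τ (α + 1) (w.1 i - w.1 j) (w.2 i - w.2 j) * theta τ (w.1 i - w.1 j) -
          numCoef τ (α + 1) (w.1 i - w.1 j) (w.2 i - w.2 j) * deriv (theta τ) (w.1 i - w.1 j)) =
        theta τ (w.1 i - w.1 j) * (H w - (v.2 i - v.2 j) * ∑ α ∈ Finset.range N,
          numCoef τ α (w.1 i - w.1 j) (w.2 i - w.2 j) * ξ (α + 1) (ep i)) := by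
      have c1 := (differentiable_theta hτ).continuous
      have c2 : Continuous (deriv (theta τ)) :=
        (differentiable_theta hτ).contDiff.continuous_deriv (n := 1) le_rfl
      have c3 := fun m => continuous_numCoef hτ m i j
      have c4 : ∀ m, Continuous fun w : V2 n =>
          dnumCoef τ m (w.1 i - w.1 j) (w.2 i - w.2 j) := fun m => by
        have h := (continuous_dnumCoef hτ m).comp (diffMap i j).continuous
        simpa only [Function.comp_def, diffMap_apply] using h
      have c5 := hH.continuous
      refine congrFun (Continuous.ext_on (dense_confSharp (τ := τ)) ?_ ?_ fun w hw => ?_)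
      · refine continuous_finsetSum _ fun m _ => ?_
        have := c3 (m + 1)
        have := c4 (m + 1)
        fun_prop
      · refine Continuous.mul (by fun_prop) (c5.sub (continuous_const.mul
          (continuous_finsetSum _ fun m _ => (c3 m).mul_const _)))
      · have hl := hw i j h.ne
        have hHw : theta τ (w.1 i - w.1 j) * dForm η ⟨w, hw⟩ (ep i) v = H w := hHe ⟨w, hw⟩
        rw [← hHw, dForm, hd, hd]
        simp only [dfij_apply hτ _ h.ne hw, ← theta_mul_kcoef hτ hl]
        simp only [ep_fst, ep_snd, if_pos, if_neg h.ne', hv, sub_self, sub_zero, zero_mul, zero_sub,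
          one_mul, neg_mul, Finset.sum_neg_distrib, sub_neg_eq_add, mul_add, Finset.mul_sum, mul_sub]
        rw [← Finset.sum_add_distrib, ← Finset.sum_sub_distrib]
        refine Finset.sum_congr rfl fun m _ => ?_
        have hm := deriv_fcoef hτ m hl (w.2 i - w.2 j)
        rw [← theta_mul_kcoef hτ hl] at hm
        linear_combination (-ξ (m + 1) v) * hm
    -- on `D_ij` the right hand side vanishes, and the left hand side is a combination of residues
    have := key (0, Pi.single i c)
    simp only [Pi.zero_apply, sub_self, Pi.single_eq_same, Pi.single_eq_of_ne h.ne', sub_zero,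
      theta_zero hτ, mul_zero, zero_mul, deriv_theta_zero hτ, mul_one, zero_sub, mul_neg,
      Finset.sum_neg_distrib, neg_eq_zero] at this
    exact this
  have hmul : ∀ α < N, ∀ u, ξ (α + 1) u = ξ (α + 1) (ep i) * (u.1 i - u.1 j) := by
    intro α hα u
    have := hker α hα (u - (u.1 i - u.1 j) • ep i) (by simp [h.ne'])
    rw [map_sub, map_smul, smul_eq_mul, sub_eq_zero] at this
    rw [this, mul_comm]
  have hfin : η = (fun _ => ξ 0) + ∑ α ∈ Finset.range N, ξ (α + 1) (ep i) • eta n τ (.T i j h α) := by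
    funext w
    refine LinearMap.ext fun u => ?_
    rw [hηξ]
    simp only [Pi.add_apply, Finset.sum_apply, LinearMap.add_apply, LinearMap.sum_apply,
      Pi.smul_apply, LinearMap.smul_apply, eta_T, smul_eq_mul]
    congr 1
    refine Finset.sum_congr rfl fun α hα => ?_
    rw [hmul α (Finset.mem_range.1 hα)]
    ring
  rw [hfin]
  exact add_mem (const_mem_span _) (sum_mem fun α _ =>
    Submodule.smul_mem _ _ (Submodule.subset_span ⟨_, rfl⟩))

theorem span_eta (hτ : 0 < τ.im) : Submodule.span ℂ (Set.range (eta n τ)) = Omega1 n τ := by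
  apply le_antisymm
  · rw [Submodule.span_le]
    rintro _ ⟨a, rfl⟩
    exact eta_mem_Omega1 hτ a
  · rw [Omega1, Submodule.span_le]
    rintro η (hη | hη)
    · exact regForms_subset_span hτ hη
    · simp only [Set.mem_iUnion] at hη
      obtain ⟨i, j, h, hη⟩ := hη
      exact logForms_subset_span hτ h hη

end Basis

/-! ### Relations in `𝔱_{1,n}` -/

section FayOperators

/-- The three-term identity of the Kronecker coefficients, for two commuting elements of an
algebra. -/
theorem fay_commute {τ : ℂ} (hτ : 0 < τ.im) {p q : ℂ} (hp : p ∉ lat τ) (hq : q ∉ lat τ)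
    (hpq : p + q ∉ lat τ) (c d : ℂ) (e : ℕ) {R : Type} [Ring R] [Algebra ℂ R] {a b : R}
    (h : a * b = b * a) :
    ∑ x ∈ Finset.HasAntidiagonal.antidiagonal e,
        (fcoef τ x.1 (p + q) (c + d) * fcoef τ x.2 q d) • (a ^ x.1 * b ^ x.2) =
      ∑ x ∈ Finset.HasAntidiagonal.antidiagonal e,
        (fcoef τ x.1 p c * fcoef τ x.2 q d) • (a ^ x.1 * (a + b) ^ x.2) +
      ∑ x ∈ Finset.HasAntidiagonal.antidiagonal e,
        (fcoef τ x.1 (-p) (-c) * fcoef τ x.2 (p + q) (c + d)) • (b ^ x.1 * (a + b) ^ x.2) +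
      fcoef τ (e + 1) q d • hpoly e (a + b) b + fcoef τ (e + 1) (p + q) (c + d) • hpoly e (a + b) a +
      fcoef τ (e + 1) p c • hpoly e a (-b) := by
  have hcomm : ∀ x ∈ ({a, b} : Set R), ∀ y ∈ ({a, b} : Set R), x * y = y * x := by
    rintro x (rfl | rfl) y (rfl | rfl)
    exacts [rfl, h, h.symm, rfl]
  have := Algebra.isMulCommutative_adjoin ℂ hcomm
  let _ : CommRing (Algebra.adjoin ℂ ({a, b} : Set R)) :=
    { (inferInstance : Ring (Algebra.adjoin ℂ ({a, b} : Set R))) with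
      mul_comm := fun u v => this.is_comm.comm u v }
  have ha : a ∈ Algebra.adjoin ℂ ({a, b} : Set R) := Algebra.subset_adjoin (Or.inl rfl)
  have hb : b ∈ Algebra.adjoin ℂ ({a, b} : Set R) := Algebra.subset_adjoin (Or.inr rfl)
  let ρ : MvPolynomial (Fin 2) ℂ →ₐ[ℂ] R := (Algebra.adjoin ℂ ({a, b} : Set R)).val.comp
    (MvPolynomial.aeval (S₁ := Algebra.adjoin ℂ ({a, b} : Set R)) ![⟨a, ha⟩, ⟨b, hb⟩])
  have h0 : ρ (MvPolynomial.X 0) = a := by simp [ρ]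
  have h1 : ρ (MvPolynomial.X 1) = b := by simp [ρ]
  have key := congrArg ρ (fay_mvPolynomial hτ hp hq hpq c d e _ _ rfl rfl)
  simpa only [hpoly, map_add, map_sum, map_smul, map_mul, map_pow, map_neg, h0, h1] using key

end FayOperators

section Ad

variable {L : Type} [LieRing L] [LieAlgebra ℂ L]

theorem ad_mul_comm {ξ ζ : L} (h : ⁅ξ, ζ⁆ = 0) :
    LieAlgebra.ad ℂ L ξ * LieAlgebra.ad ℂ L ζ = LieAlgebra.ad ℂ L ζ * LieAlgebra.ad ℂ L ξ := by
  have := (LieAlgebra.ad ℂ L).map_lie ξ ζ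
  rw [h, map_zero, Ring.lie_def] at this
  exact (sub_eq_zero.1 this.symm)

theorem ad_pow_comm {ξ ζ : L} (h : ⁅ξ, ζ⁆ = 0) (a b : ℕ) (z : L) :
    (LieAlgebra.ad ℂ L ξ ^ a) ((LieAlgebra.ad ℂ L ζ ^ b) z) =
      (LieAlgebra.ad ℂ L ζ ^ b) ((LieAlgebra.ad ℂ L ξ ^ a) z) := by
  rw [← Module.End.mul_apply, ((Commute.pow_pow (ad_mul_comm h) a b :))]
  rfl

theorem pow_apply_eq_of_comm {M : Type} [AddCommGroup M] [Module ℂ M] {A B : Module.End ℂ M}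
    (h : A * B = B * A) {z : M} (hz : A z = B z) (a : ℕ) : (A ^ a) z = (B ^ a) z := by
  induction a with
  | zero => rfl
  | succ a ih =>
    rw [pow_succ', Module.End.mul_apply, ih, ← Module.End.mul_apply,
      (Commute.pow_right h a).eq, Module.End.mul_apply, hz, ← Module.End.mul_apply, ← pow_succ]

theorem pow_apply_of_apply_eq_zero {M : Type} [AddCommGroup M] [Module ℂ M] {A B : Module.End ℂ M}
    (h : A * B = B * A) {z : M} (hz : A z = 0) (a : ℕ) : A ((B ^ a) z) = 0 := by
  rw [← Module.End.mul_apply, (Commute.pow_right h a).eq, Module.End.mul_apply, hz, map_zero]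

theorem lie_ad_pow_eq_zero {ξ ζ z : L} (h : ⁅ξ, ζ⁆ = 0) (hz : ⁅ξ, z⁆ = 0) (a : ℕ) :
    ⁅ξ, (LieAlgebra.ad ℂ L ζ ^ a) z⁆ = 0 :=
  pow_apply_of_apply_eq_zero (ad_mul_comm h) hz a

theorem ad_pow_lie {ξ z e : L} (h : ⁅ξ, e⁆ = 0) (a : ℕ) :
    ⁅(LieAlgebra.ad ℂ L ξ ^ a) z, e⁆ = (LieAlgebra.ad ℂ L ξ ^ a) ⁅z, e⁆ := by
  induction a with
  | zero => rfl
  | succ a ih =>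
    rw [pow_succ', Module.End.mul_apply, Module.End.mul_apply, ← ih, LieAlgebra.ad_apply,
      LieAlgebra.ad_apply, leibniz_lie ξ, h, lie_zero, add_zero]

theorem lie_ad_pow {ξ z e : L} (h : ⁅ξ, e⁆ = 0) (a : ℕ) :
    ⁅e, (LieAlgebra.ad ℂ L ξ ^ a) z⁆ = (LieAlgebra.ad ℂ L ξ ^ a) ⁅e, z⁆ := by
  rw [← lie_skew, ad_pow_lie h, ← lie_skew e z, map_neg]

theorem ad_pow_lie_ad_pow {ξ ζ z e : L} (h : ⁅ξ, ζ⁆ = 0) (hz : ⁅ζ, z⁆ = 0) (he : ⁅ξ, e⁆ = 0)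
    (a b : ℕ) : ⁅(LieAlgebra.ad ℂ L ξ ^ a) z, (LieAlgebra.ad ℂ L ζ ^ b) e⁆ =
      (LieAlgebra.ad ℂ L ξ ^ a) ((LieAlgebra.ad ℂ L ζ ^ b) ⁅z, e⁆) := by
  rw [ad_pow_lie (lie_ad_pow_eq_zero h he b), lie_ad_pow hz]

/-- Expansion of `[η, (ad ξ)^(e+1) z]` for `η` commuting with `z`. -/
theorem lie_ad_pow_succ {η ξ z : L} (h : ⁅η, z⁆ = 0) (e : ℕ) :
    ⁅η, (LieAlgebra.ad ℂ L ξ ^ (e + 1)) z⁆ =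
      ∑ r ∈ Finset.HasAntidiagonal.antidiagonal e,
        (LieAlgebra.ad ℂ L ξ ^ r.1) ⁅⁅η, ξ⁆, (LieAlgebra.ad ℂ L ξ ^ r.2) z⁆ := by
  induction e with
  | zero => simp [h]
  | succ e ih =>
    rw [Finset.Nat.sum_antidiagonal_succ, pow_succ' _ (e + 1), Module.End.mul_apply,
      LieAlgebra.ad_apply, leibniz_lie η, ih]
    simp only [pow_succ', pow_zero, Module.End.mul_apply, Module.End.one_apply, LieAlgebra.ad_apply,
      lie_sum]

end Ad

/-- The defining relations of `𝔱_{1,n}`, for elements of a Lie algebra. -/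
structure IsT1n {n : ℕ} {L : Type} [LieRing L] [LieAlgebra ℂ L] (x y : Fin n → L)
    (t : Fin n → Fin n → L) : Prop where
  xx : ∀ i j, ⁅x i, x j⁆ = 0
  yy : ∀ i j, ⁅y i, y j⁆ = 0
  xy : ∀ i j, i ≠ j → ⁅x i, y j⁆ = t i j
  symm : ∀ i j, i ≠ j → t i j = t j i
  xy_diag : ∀ i, ⁅x i, y i⁆ = -∑ j ∈ Finset.univ.erase i, t i j
  xt : ∀ i j k, i ≠ j → k ≠ i → k ≠ j → ⁅x k, t i j⁆ = 0
  yt : ∀ i j k, i ≠ j → k ≠ i → k ≠ j → ⁅y k, t i j⁆ = 0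
  xxt : ∀ i j, i ≠ j → ⁅x i + x j, t i j⁆ = 0
  yyt : ∀ i j, i ≠ j → ⁅y i + y j, t i j⁆ = 0

namespace IsT1n

variable {n : ℕ} {L : Type} [LieRing L] [LieAlgebra ℂ L] {x y : Fin n → L}
  {t : Fin n → Fin n → L}

theorem tt (h : IsT1n x y t) {i j k l : Fin n} (hij : i ≠ j) (hkl : k ≠ l) (hik : i ≠ k)
    (hil : i ≠ l) (hjk : j ≠ k) (hjl : j ≠ l) : ⁅t i j, t k l⁆ = 0 := by
  rw [← h.xy i j hij, lie_lie, h.yt k l j hkl hjk hjl, h.xt k l i hkl hik hil, lie_zero, lie_zero,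
    sub_zero]

/-- The infinitesimal braid relation. -/
theorem braid (h : IsT1n x y t) {i j k : Fin n} (hij : i ≠ j) (hik : i ≠ k) (hjk : j ≠ k) :
    ⁅t i k, t j k⁆ = -⁅t i j, t j k⁆ := by
  rw [eq_neg_iff_add_eq_zero, ← add_lie, ← h.xy i j hij, ← h.xy i k hik, ← lie_add, lie_lie,
    add_comm (y k), h.yyt j k hjk, h.xt j k i hjk hij hik, lie_zero, lie_zero, sub_zero]

theorem braid' (h : IsT1n x y t) {i j k : Fin n} (hij : i ≠ j) (hik : i ≠ k) (hjk : j ≠ k) :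
    ⁅t i k, t i j⁆ = ⁅t i j, t j k⁆ := by
  calc ⁅t i k, t i j⁆ = -⁅t i j, t i k⁆ := (lie_skew _ _).symm
    _ = ⁅t j k, t i k⁆ := by rw [h.braid hij.symm hjk hik, h.symm j i hij.symm]
    _ = -⁅t i k, t j k⁆ := (lie_skew _ _).symm
    _ = ⁅t i j, t j k⁆ := by rw [h.braid hij hik hjk, neg_neg]

theorem xt_pow (h : IsT1n x y t) {i k : Fin n} (hik : i ≠ k) (a : ℕ) :
    (LieAlgebra.ad ℂ L (x i) ^ a) (t i k) = (LieAlgebra.ad ℂ L (-x k) ^ a) (t i k) := by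
  refine pow_apply_eq_of_comm (ad_mul_comm (by rw [lie_neg, h.xx, neg_zero])) ?_ a
  have := h.xxt i k hik
  rw [add_lie] at this
  rw [LieAlgebra.ad_apply, LieAlgebra.ad_apply, neg_lie]
  exact eq_neg_of_add_eq_zero_left this

/-- On `[t_ij, t_jk]` the operator `-ad x_k` acts as `ad x_i + ad x_j`, because `x_i + x_j + x_k`
commutes with `t_ij` and `t_jk`. -/
theorem braid_pow (h : IsT1n x y t) {i j k : Fin n} (hij : i ≠ j) (hik : i ≠ k) (hjk : j ≠ k)
    (a : ℕ) : (LieAlgebra.ad ℂ L (-x k) ^ a) ⁅t i j, t j k⁆ =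
      ((LieAlgebra.ad ℂ L (x i) + LieAlgebra.ad ℂ L (x j)) ^ a) ⁅t i j, t j k⁆ := by
  rw [← map_add]
  refine pow_apply_eq_of_comm (ad_mul_comm ?_) ?_ a
  · rw [neg_lie, lie_add, h.xx, h.xx, add_zero, neg_zero]
  · have h1 : ⁅x i + x j, t j k⁆ = -⁅x k, t j k⁆ := by
      have := h.xxt j k hjk
      rw [add_lie] at this
      rw [add_lie, h.xt j k i hjk hij hik, zero_add]
      exact eq_neg_of_add_eq_zero_left this
    rw [LieAlgebra.ad_apply, LieAlgebra.ad_apply, leibniz_lie (-x k), leibniz_lie (x i + x j), h1, h.xxt i j hij,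
      neg_lie, neg_lie, h.xt i j k hij hik.symm hjk.symm, zero_lie, neg_zero, neg_lie]

/-- This lemma and the next ones express the brackets which occur in the curvature through `[t_ij,
t_jk]` and the operators `ad x_i`, `ad x_j`. -/
theorem lie_ik_jk (h : IsT1n x y t) {i j k : Fin n} (hij : i ≠ j) (hik : i ≠ k) (hjk : j ≠ k)
    (a b : ℕ) : ⁅(LieAlgebra.ad ℂ L (x i) ^ a) (t i k), (LieAlgebra.ad ℂ L (x j) ^ b) (t j k)⁆ =
      -(LieAlgebra.ad ℂ L (x i) ^ a * LieAlgebra.ad ℂ L (x j) ^ b) ⁅t i j, t j k⁆ := by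
  rw [ad_pow_lie_ad_pow (h.xx i j) (h.xt i k j hik hij.symm hjk) (h.xt j k i hjk hij hik),
    h.braid hij hik hjk, map_neg, map_neg, Module.End.mul_apply]

theorem lie_ij_jk (h : IsT1n x y t) {i j k : Fin n} (hij : i ≠ j) (hik : i ≠ k) (hjk : j ≠ k)
    (a b : ℕ) : ⁅(LieAlgebra.ad ℂ L (x i) ^ a) (t i j), (LieAlgebra.ad ℂ L (x j) ^ b) (t j k)⁆ =
      (LieAlgebra.ad ℂ L (x i) ^ a *
        (LieAlgebra.ad ℂ L (x i) + LieAlgebra.ad ℂ L (x j)) ^ b) ⁅t i j, t j k⁆ := by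
  rw [h.xt_pow hjk, ad_pow_lie_ad_pow (by rw [lie_neg, h.xx, neg_zero])
    (by rw [neg_lie, h.xt i j k hij hik.symm hjk.symm, neg_zero]) (h.xt j k i hjk hij hik),
    h.braid_pow hij hik hjk, Module.End.mul_apply]

theorem lie_ik_ij (h : IsT1n x y t) {i j k : Fin n} (hij : i ≠ j) (hik : i ≠ k) (hjk : j ≠ k)
    (a b : ℕ) : ⁅(LieAlgebra.ad ℂ L (x i) ^ a) (t i k), (LieAlgebra.ad ℂ L (x j) ^ b) (t i j)⁆ =
      (LieAlgebra.ad ℂ L (x j) ^ b *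
        (LieAlgebra.ad ℂ L (x i) + LieAlgebra.ad ℂ L (x j)) ^ a) ⁅t i j, t j k⁆ := by
  have hkj : ⁅-x k, x j⁆ = 0 := by rw [neg_lie, h.xx, neg_zero]
  rw [h.xt_pow hik, ad_pow_lie_ad_pow hkj (h.xt i k j hik hij.symm hjk)
    (by rw [neg_lie, h.xt i j k hij hik.symm hjk.symm, neg_zero]),
    ad_pow_comm hkj, h.braid' hij hik hjk, h.braid_pow hij hik hjk, Module.End.mul_apply]

theorem lie_ik_jl (h : IsT1n x y t) {i j k l : Fin n} (hij : i ≠ j) (hik : i ≠ k) (hjk : j ≠ k)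
    (hil : i ≠ l) (hjl : j ≠ l) (hkl : k ≠ l) (a b : ℕ) :
    ⁅(LieAlgebra.ad ℂ L (x i) ^ a) (t i k), (LieAlgebra.ad ℂ L (x j) ^ b) (t j l)⁆ = 0 := by
  rw [ad_pow_lie_ad_pow (h.xx i j) (h.xt i k j hik hij.symm hjk) (h.xt j l i hjl hij hil),
    h.tt hik hjl hij hil hjk.symm hkl, map_zero, map_zero]

theorem y_lie_jk (h : IsT1n x y t) {i j k : Fin n} (hij : i ≠ j) (hik : i ≠ k) (hjk : j ≠ k)
    (e : ℕ) : ⁅y i, (LieAlgebra.ad ℂ L (x j) ^ (e + 1)) (t j k)⁆ =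
      -hpoly e (LieAlgebra.ad ℂ L (x i) + LieAlgebra.ad ℂ L (x j)) (LieAlgebra.ad ℂ L (x j))
        ⁅t i j, t j k⁆ := by
  have hc : Commute (LieAlgebra.ad ℂ L (x i) + LieAlgebra.ad ℂ L (x j)) (LieAlgebra.ad ℂ L (x j)) :=
    Commute.add_left (ad_mul_comm (h.xx i j)) (Commute.refl _)
  rw [lie_ad_pow_succ (h.yt j k i hjk hij hik), ← lie_skew, h.xy j i hij.symm, h.symm j i hij.symm,
    hpoly, LinearMap.sum_apply, ← Finset.sum_neg_distrib, ← Finset.Nat.sum_antidiagonal_swap]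
  refine Finset.sum_congr rfl fun r _ => ?_
  have h1 := h.lie_ij_jk hij hik hjk 0 r.1
  rw [pow_zero, one_mul, Module.End.one_apply] at h1
  rw [Prod.fst_swap, Prod.snd_swap, neg_lie, h1, map_neg, ← Module.End.mul_apply,
    (hc.pow_pow r.1 r.2).eq]

theorem y_lie_ik (h : IsT1n x y t) {i j k : Fin n} (hij : i ≠ j) (hik : i ≠ k) (hjk : j ≠ k)
    (e : ℕ) : ⁅y j, (LieAlgebra.ad ℂ L (x i) ^ (e + 1)) (t i k)⁆ =
      hpoly e (LieAlgebra.ad ℂ L (x i) + LieAlgebra.ad ℂ L (x j)) (LieAlgebra.ad ℂ L (x i))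
        ⁅t i j, t j k⁆ := by
  rw [h.y_lie_jk hij.symm hjk hik, add_comm, h.symm j i hij.symm, ← lie_skew, h.braid' hij hik hjk,
    map_neg, neg_neg]

theorem y_lie_ij (h : IsT1n x y t) {i j : Fin n} (hij : i ≠ j) (e : ℕ) :
    ⁅y i + y j, (LieAlgebra.ad ℂ L (x i) ^ (e + 1)) (t i j)⁆ =
      ∑ k ∈ (Finset.univ.erase i).erase j,
        hpoly e (LieAlgebra.ad ℂ L (x i)) (-LieAlgebra.ad ℂ L (x j)) ⁅t i j, t j k⁆ := by
  have hyx : ⁅y i + y j, x i⁆ = ∑ k ∈ (Finset.univ.erase i).erase j, t i k := by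
    rw [← lie_skew, lie_add, h.xy_diag, h.xy i j hij, ← Finset.add_sum_erase _ _
      (Finset.mem_erase.2 ⟨hij.symm, Finset.mem_univ j⟩)]
    abel
  rw [lie_ad_pow_succ (h.yyt i j hij), hyx]
  simp only [hpoly, LinearMap.sum_apply]
  rw [Finset.sum_comm]
  refine Finset.sum_congr rfl fun r _ => ?_
  rw [sum_lie, map_sum]
  refine Finset.sum_congr rfl fun k hk => ?_
  simp only [Finset.mem_erase, Finset.mem_univ, and_true] at hk
  rw [h.xt_pow hij, lie_ad_pow (by rw [neg_lie, h.xt i k j hk.2.symm hij.symm hk.1.symm, neg_zero]),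
    h.braid' hij hk.2.symm hk.1.symm, map_neg, Module.End.mul_apply]

/-- The degree `α + 1` part of the coefficient of `dp_i` in the KZB form, up to sign. -/
def W (x : Fin n → L) (t : Fin n → Fin n → L) (F : Fin n → Fin n → ℕ → ℂ) (i : Fin n) (α : ℕ) : L :=
  ∑ k ∈ Finset.univ.erase i, F i k α • (LieAlgebra.ad ℂ L (x i) ^ α) (t i k)

/-- For an antisymmetric family of functions, the terms of `W` are antisymmetric in the two indices.
-/
theorem flip (h : IsT1n x y t) {F : Fin n → Fin n → ℕ → ℂ} {i j : Fin n} (hij : i ≠ j)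
    (hF : ∀ α, F j i α = (-1) ^ (α + 1) * F i j α) (α : ℕ) :
    F j i α • (LieAlgebra.ad ℂ L (x j) ^ α) (t j i) =
      -(F i j α • (LieAlgebra.ad ℂ L (x i) ^ α) (t i j)) := by
  rw [h.xt_pow hij.symm, h.symm j i hij.symm, map_neg, neg_pow, hF, Module.End.mul_apply, pow_succ]
  have : ((-1 : Module.End ℂ L) ^ α) = ((-1 : ℂ) ^ α) • (1 : Module.End ℂ L) := by
    rcases Nat.even_or_odd α with ha | ha <;> simp [ha.neg_one_pow]
  rw [this, LinearMap.smul_apply, Module.End.one_apply, smul_smul]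
  have h2 : ((-1 : ℂ) ^ α) * (-1) ^ α = 1 := by rw [← mul_pow]; simp
  rw [← neg_smul]
  congr 1
  linear_combination (-F i j α) * h2

theorem W_eq {F : Fin n → Fin n → ℕ → ℂ} {i j : Fin n} (hij : i ≠ j) (α : ℕ) :
    W x t F i α = F i j α • (LieAlgebra.ad ℂ L (x i) ^ α) (t i j) +
      ∑ k ∈ (Finset.univ.erase i).erase j, F i k α • (LieAlgebra.ad ℂ L (x i) ^ α) (t i k) :=
  (Finset.add_sum_erase _ _ (Finset.mem_erase.2 ⟨hij.symm, Finset.mem_univ j⟩)).symm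

theorem W_eq' (h : IsT1n x y t) {F : Fin n → Fin n → ℕ → ℂ} {i j : Fin n} (hij : i ≠ j)
    (hF : ∀ α, F j i α = (-1) ^ (α + 1) * F i j α) (α : ℕ) :
    W x t F j α = -(F i j α • (LieAlgebra.ad ℂ L (x i) ^ α) (t i j)) +
      ∑ k ∈ (Finset.univ.erase i).erase j, F j k α • (LieAlgebra.ad ℂ L (x j) ^ α) (t j k) := by
  rw [W_eq hij.symm, h.flip hij hF, Finset.erase_right_comm]

/-- The case of lowest degree of `lie_y_W_succ`. -/
theorem lie_y_W_zero (h : IsT1n x y t) {F : Fin n → Fin n → ℕ → ℂ} {i j : Fin n} (hij : i ≠ j)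
    (hF : ∀ α, F j i α = (-1) ^ (α + 1) * F i j α) : -⁅y i, W x t F j 0⁆ + ⁅y j, W x t F i 0⁆ = 0 := by
  have h1 : ∀ k ∈ (Finset.univ.erase i).erase j, ⁅y i, F j k 0 • t j k⁆ = 0 := fun k hk => by
    simp only [Finset.mem_erase, Finset.mem_univ, and_true] at hk
    rw [lie_smul, h.yt j k i hk.1.symm hij hk.2.symm, smul_zero]
  have h2 : ∀ k ∈ (Finset.univ.erase i).erase j, ⁅y j, F i k 0 • t i k⁆ = 0 := fun k hk => by
    simp only [Finset.mem_erase, Finset.mem_univ, and_true] at hk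
    rw [lie_smul, h.yt i k j hk.2.symm hij.symm hk.1.symm, smul_zero]
  rw [h.W_eq' hij hF, W_eq hij]
  simp only [pow_zero, Module.End.one_apply]
  rw [lie_add, lie_add, lie_sum, lie_sum, Finset.sum_eq_zero h1, Finset.sum_eq_zero h2, lie_neg,
    add_zero, add_zero, neg_neg, ← add_lie, lie_smul, h.yyt i j hij, smul_zero]

/-- The component of the curvature in the directions of `p_i` and `p_j` vanishes, as a consequence
of the three-term identity. -/
theorem lie_y_W_succ (h : IsT1n x y t) {F : Fin n → Fin n → ℕ → ℂ} {i j : Fin n} (hij : i ≠ j)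
    (hF : ∀ α, F j i α = (-1) ^ (α + 1) * F i j α) (e : ℕ)
    (fay : ∀ k, k ≠ i → k ≠ j → ∀ a b : Module.End ℂ L, a = LieAlgebra.ad ℂ L (x i) →
      b = LieAlgebra.ad ℂ L (x j) →
      ∑ r ∈ Finset.HasAntidiagonal.antidiagonal e, (F i k r.1 * F j k r.2) • (a ^ r.1 * b ^ r.2) =
        ∑ r ∈ Finset.HasAntidiagonal.antidiagonal e,
          (F i j r.1 * F j k r.2) • (a ^ r.1 * (a + b) ^ r.2) +
        ∑ r ∈ Finset.HasAntidiagonal.antidiagonal e,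
          (F j i r.1 * F i k r.2) • (b ^ r.1 * (a + b) ^ r.2) +
        F j k (e + 1) • hpoly e (a + b) b + F i k (e + 1) • hpoly e (a + b) a +
        F i j (e + 1) • hpoly e a (-b)) :
    -⁅y i, W x t F j (e + 1)⁆ + ⁅y j, W x t F i (e + 1)⁆ +
      ∑ r ∈ Finset.HasAntidiagonal.antidiagonal e, ⁅W x t F i r.1, W x t F j r.2⁆ = 0 := by
  -- the sums over the third index `k` are taken over `K`; the term of `W` attached to the pair `i,
  -- j` is `P`
  set K := (Finset.univ.erase i).erase j with hK
  have hk : ∀ k ∈ K, i ≠ k ∧ j ≠ k := fun k hk => by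
    simp only [hK, Finset.mem_erase, Finset.mem_univ, and_true] at hk
    exact ⟨hk.2.symm, hk.1.symm⟩
  set a := LieAlgebra.ad ℂ L (x i) with ha
  set b := LieAlgebra.ad ℂ L (x j) with hb
  set P : ℕ → L := fun α => F i j α • (a ^ α) (t i j) with hP
  have hP' : ∀ α, -P α = F j i α • (b ^ α) (t i j) := fun α => by
    rw [hP, ← h.flip hij hF, h.symm j i hij.symm]
  -- the terms with the pair `i, j` in both factors cancel by antisymmetry
  have hPP : ∑ r ∈ Finset.HasAntidiagonal.antidiagonal e, ⁅P r.1, P r.2⁆ = 0 := by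
    have h1 : ∑ r ∈ Finset.HasAntidiagonal.antidiagonal e, ⁅P r.1, P r.2⁆ =
        -∑ r ∈ Finset.HasAntidiagonal.antidiagonal e, ⁅P r.1, P r.2⁆ := by
      conv_lhs => rw [← Finset.Nat.sum_antidiagonal_swap]
      rw [← Finset.sum_neg_distrib]
      exact Finset.sum_congr rfl fun r _ => (lie_skew _ _).symm
    have h2 : (2 : ℂ) • ∑ r ∈ Finset.HasAntidiagonal.antidiagonal e, ⁅P r.1, P r.2⁆ = 0 := by
      rw [two_smul]
      nth_rewrite 1 [h1]
      exact neg_add_cancel _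
    exact (smul_eq_zero.1 h2).resolve_left two_ne_zero
  have hyi : ⁅y i, ∑ k ∈ K, F j k (e + 1) • (b ^ (e + 1)) (t j k)⁆ =
      -∑ k ∈ K, (F j k (e + 1) • hpoly e (a + b) b) ⁅t i j, t j k⁆ := by
    rw [lie_sum, ← Finset.sum_neg_distrib]
    refine Finset.sum_congr rfl fun k hkK => ?_
    rw [lie_smul, h.y_lie_jk hij (hk k hkK).1 (hk k hkK).2, smul_neg]
    rfl
  have hyj : ⁅y j, ∑ k ∈ K, F i k (e + 1) • (a ^ (e + 1)) (t i k)⁆ =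
      ∑ k ∈ K, (F i k (e + 1) • hpoly e (a + b) a) ⁅t i j, t j k⁆ := by
    rw [lie_sum]
    refine Finset.sum_congr rfl fun k hkK => ?_
    rw [lie_smul, h.y_lie_ik hij (hk k hkK).1 (hk k hkK).2]
    rfl
  have hyy : ⁅y i + y j, P (e + 1)⁆ =
      ∑ k ∈ K, (F i j (e + 1) • hpoly e a (-b)) ⁅t i j, t j k⁆ := by
    rw [hP, lie_smul, h.y_lie_ij hij, Finset.smul_sum]
    rfl
  have hPQ : ∀ r s : ℕ, ⁅P r, ∑ k ∈ K, F j k s • (b ^ s) (t j k)⁆ =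
      ∑ k ∈ K, ((F i j r * F j k s) • (a ^ r * (a + b) ^ s)) ⁅t i j, t j k⁆ := fun r s => by
    rw [lie_sum]
    refine Finset.sum_congr rfl fun k hkK => ?_
    rw [hP, lie_smul, smul_lie, h.lie_ij_jk hij (hk k hkK).1 (hk k hkK).2, smul_smul,
      mul_comm (F j k s)]
    rfl
  have hQP : ∀ r s : ℕ, ⁅∑ k ∈ K, F i k r • (a ^ r) (t i k), -P s⁆ =
      ∑ k ∈ K, ((F j i s * F i k r) • (b ^ s * (a + b) ^ r)) ⁅t i j, t j k⁆ := fun r s => by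
    rw [sum_lie]
    refine Finset.sum_congr rfl fun k hkK => ?_
    rw [hP', lie_smul, smul_lie, h.lie_ik_ij hij (hk k hkK).1 (hk k hkK).2, smul_smul]
    rfl
  have hQQ : ∀ r s : ℕ, ⁅∑ k ∈ K, F i k r • (a ^ r) (t i k), ∑ k ∈ K, F j k s • (b ^ s) (t j k)⁆ =
      -∑ k ∈ K, ((F i k r * F j k s) • (a ^ r * b ^ s)) ⁅t i j, t j k⁆ := fun r s => by
    rw [sum_lie, ← Finset.sum_neg_distrib]
    refine Finset.sum_congr rfl fun k hkK => ?_
    rw [lie_sum, Finset.sum_eq_single k]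
    · rw [lie_smul, smul_lie, h.lie_ik_jk hij (hk k hkK).1 (hk k hkK).2, smul_smul, smul_neg,
        mul_comm (F j k s)]
      rfl
    · intro l hl hlk
      rw [lie_smul, smul_lie, h.lie_ik_jl hij (hk k hkK).1 (hk k hkK).2 (hk l hl).1 (hk l hl).2
        hlk.symm, smul_zero, smul_zero]
    · exact fun hne => absurd hkK hne
  have hsum : ∑ r ∈ Finset.HasAntidiagonal.antidiagonal e, ⁅W x t F i r.1, W x t F j r.2⁆ =
      ∑ k ∈ K, ((∑ r ∈ Finset.HasAntidiagonal.antidiagonal e,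
          (F i j r.1 * F j k r.2) • (a ^ r.1 * (a + b) ^ r.2)) ⁅t i j, t j k⁆ +
        (∑ r ∈ Finset.HasAntidiagonal.antidiagonal e,
          (F j i r.1 * F i k r.2) • (b ^ r.1 * (a + b) ^ r.2)) ⁅t i j, t j k⁆ -
        (∑ r ∈ Finset.HasAntidiagonal.antidiagonal e,
          (F i k r.1 * F j k r.2) • (a ^ r.1 * b ^ r.2)) ⁅t i j, t j k⁆) := by
    have h1 : ∀ r ∈ Finset.HasAntidiagonal.antidiagonal e, ⁅W x t F i r.1, W x t F j r.2⁆ =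
        -⁅P r.1, P r.2⁆ +
        ((∑ k ∈ K, ((F i j r.1 * F j k r.2) • (a ^ r.1 * (a + b) ^ r.2)) ⁅t i j, t j k⁆) +
        (∑ k ∈ K, ((F j i r.2 * F i k r.1) • (b ^ r.2 * (a + b) ^ r.1)) ⁅t i j, t j k⁆) -
        ∑ k ∈ K, ((F i k r.1 * F j k r.2) • (a ^ r.1 * b ^ r.2)) ⁅t i j, t j k⁆) := fun r _ => by
      rw [W_eq hij, h.W_eq' hij hF, add_lie, lie_add, lie_add, hPQ, hQP, hQQ, lie_neg]
      abel
    rw [Finset.sum_congr rfl h1, Finset.sum_add_distrib, Finset.sum_neg_distrib, hPP, neg_zero,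
      zero_add, Finset.sum_sub_distrib, Finset.sum_add_distrib, Finset.sum_sub_distrib,
      Finset.sum_add_distrib]
    simp only [LinearMap.sum_apply]
    congr 1
    · congr 1
      · exact Finset.sum_comm
      · rw [← Finset.Nat.sum_antidiagonal_swap, Finset.sum_comm]
        rfl
    · exact Finset.sum_comm
  -- for each `k` the three-term identity applies to the operators `ad x_i` and `ad x_j`
  have hfin : ∀ k ∈ K, ((∑ r ∈ Finset.HasAntidiagonal.antidiagonal e,
          (F i j r.1 * F j k r.2) • (a ^ r.1 * (a + b) ^ r.2)) ⁅t i j, t j k⁆ +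
        (∑ r ∈ Finset.HasAntidiagonal.antidiagonal e,
          (F j i r.1 * F i k r.2) • (b ^ r.1 * (a + b) ^ r.2)) ⁅t i j, t j k⁆ -
        (∑ r ∈ Finset.HasAntidiagonal.antidiagonal e,
          (F i k r.1 * F j k r.2) • (a ^ r.1 * b ^ r.2)) ⁅t i j, t j k⁆) =
      -((F j k (e + 1) • hpoly e (a + b) b) ⁅t i j, t j k⁆ +
        (F i k (e + 1) • hpoly e (a + b) a) ⁅t i j, t j k⁆ +
        (F i j (e + 1) • hpoly e a (-b)) ⁅t i j, t j k⁆) := fun k hkK => by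
    rw [fay k (hk k hkK).1.symm (hk k hkK).2.symm a b rfl rfl]
    simp only [LinearMap.add_apply]
    abel
  rw [hsum, Finset.sum_congr rfl hfin, Finset.sum_neg_distrib, Finset.sum_add_distrib,
    Finset.sum_add_distrib, ← hyy, ← hyj, h.W_eq' hij hF, W_eq hij]
  have hyi' := neg_eq_iff_eq_neg.1 hyi.symm
  rw [hyi', lie_add, lie_add, lie_neg, add_lie]
  simp only [hP]
  abel

end IsT1n

/-! ### Flatness, degree by degree -/

section DegSum

variable {n : ℕ} {M M' : Type*} [AddCommGroup M] [AddCommGroup M']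

/-- The sum of the values of `h` on the indices of a given degree. -/
def degSum {M : Type*} [AddCommMonoid M] (h : Idx n → M) : ℕ → M
  | 0 => ∑ i, h (.Y i)
  | m + 1 => (if m = 0 then ∑ i, h (.X i) else 0) + ∑ x : Pairs n, h (.T x.1.1 x.1.2 x.2 m)

theorem sum_idxFin_eq_sum_degSum {N : ℕ} (hN : 1 ≤ N) (h : Idx n → M) :
    ∑ a ∈ idxFin n N, h a = ∑ d ∈ Finset.range (N + 1), degSum h d := by
  rw [sum_idxFin, Finset.sum_range_succ']
  simp only [degSum]
  rw [Finset.sum_add_distrib, Finset.sum_ite_eq' (Finset.range N) 0, if_pos (Finset.mem_range.2 hN),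
    Finset.sum_comm]
  abel

theorem map_degSum [Module ℂ M] [Module ℂ M'] (f : M →ₗ[ℂ] M') (h : Idx n → M) (d : ℕ) :
    f (degSum h d) = degSum (fun a => f (h a)) d := by
  cases d with
  | zero => simp [degSum]
  | succ m => by_cases hm : m = 0 <;> simp [degSum, hm]

theorem degSum_apply {ι : Type*} {M : ι → Type*} [∀ i, AddCommMonoid (M i)] (h : Idx n → ∀ i, M i)
    (d : ℕ) (i : ι) : degSum h d i = degSum (fun a => h a i) d := by
  cases d with
  | zero => simp [degSum]
  | succ m => by_cases hm : m = 0 <;> simp [degSum, hm]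

theorem degSum_eq_zero (h : Idx n → M) (d : ℕ) (h0 : ∀ a, a.deg = d → h a = 0) :
    degSum h d = 0 := by
  cases d with
  | zero => exact Finset.sum_eq_zero fun i _ => h0 _ rfl
  | succ m =>
    have h1 : ∑ x : Pairs n, h (.T x.1.1 x.1.2 x.2 m) = 0 :=
      Finset.sum_eq_zero fun x _ => h0 _ rfl
    rw [degSum, h1, add_zero]
    split_ifs with hm
    · subst hm
      exact Finset.sum_eq_zero fun i _ => h0 _ rfl
    · rfl

/-- A sum over a square equals the sum over a triangle if the other terms vanish. -/
theorem sum_range_mul_range (N : ℕ) (g : ℕ → ℕ → M) (hg : ∀ a b, N < a + b → g a b = 0) :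
    ∑ a ∈ Finset.range (N + 1), ∑ b ∈ Finset.range (N + 1), g a b =
      ∑ d ∈ Finset.range (N + 1), ∑ r ∈ Finset.HasAntidiagonal.antidiagonal d, g r.1 r.2 := by
  have hz : ∑ r ∈ Finset.range (N + 1) ×ˢ Finset.range (N + 1) with ¬r.1 + r.2 ≤ N,
      g r.1 r.2 = 0 := by
    refine Finset.sum_eq_zero fun r hr => ?_
    simp only [Finset.mem_filter, not_le] at hr
    exact hg _ _ hr.2
  rw [← Finset.sum_product', Finset.sum_sigma', ← Finset.sum_filter_add_sum_filter_not _
    (fun r : ℕ × ℕ => r.1 + r.2 ≤ N), hz, add_zero]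
  refine Finset.sum_bij' (fun r _ => ⟨r.1 + r.2, r⟩) (fun r _ => r.2) ?_ ?_ ?_ ?_ ?_
  · intro r hr
    simp only [Finset.mem_filter] at hr
    simp only [Finset.mem_sigma, Finset.mem_range, Finset.HasAntidiagonal.mem_antidiagonal,
      and_true]
    omega
  · rintro ⟨d, r⟩ hr
    simp only [Finset.mem_sigma, Finset.mem_range, Finset.HasAntidiagonal.mem_antidiagonal] at hr
    simp only [Finset.mem_filter, Finset.mem_product, Finset.mem_range]
    omega
  · intro r _; rfl
  · rintro ⟨d, r⟩ hr
    simp only [Finset.mem_sigma, Finset.HasAntidiagonal.mem_antidiagonal] at hr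
    simp only [hr.2]
  · intro r _; rfl

theorem sum_pairs (h : Fin n → Fin n → M) :
    ∑ x : Pairs n, h x.1.1 x.1.2 = ∑ k, ∑ l, if k < l then h k l else 0 := by
  rw [← Finset.sum_product', ← Finset.sum_filter]
  exact (Finset.sum_subtype _ (fun x => by simp) (fun x : Fin n × Fin n => h x.1 x.2)).symm

/-- The pairing of an antisymmetric family with the differential of a coordinate. -/
theorem sum_pairs_delta [Module ℂ M] (G : Fin n → Fin n → M) (hG : ∀ k l, k ≠ l → G l k = -G k l) (i : Fin n) :
    ∑ x : Pairs n, ((if x.1.1 = i then (1 : ℂ) else 0) - (if x.1.2 = i then (1 : ℂ) else 0)) •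
      G x.1.1 x.1.2 = ∑ k ∈ Finset.univ.erase i, G i k := by
  rw [sum_pairs (fun k l => ((if k = i then (1 : ℂ) else 0) - (if l = i then (1 : ℂ) else 0)) •
    G k l)]
  have h1 : ∀ k l, (if k < l then ((if k = i then (1 : ℂ) else 0) -
      (if l = i then (1 : ℂ) else 0)) • G k l else 0) =
      (if k = i then if k < l then G k l else 0 else 0) +
        (if l = i then if k < l then G l k else 0 else 0) := fun k l => by
    by_cases hkl : k < l
    · rw [hG k l hkl.ne]
      by_cases hk : k = i
      · by_cases hl : l = i
        · exact absurd (hk.trans hl.symm) hkl.ne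
        · simp [hk, hl]
      · by_cases hl : l = i <;> simp [hk, hl]
    · simp [hkl]
  simp only [h1, Finset.sum_add_distrib]
  rw [Finset.sum_comm]
  simp only [Finset.sum_ite_eq', Finset.mem_univ, if_true]
  rw [← Finset.sum_add_distrib]
  refine (Finset.sum_erase Finset.univ (a := i) (by simp)).symm.trans
    (Finset.sum_congr rfl fun k hk => ?_)
  rcases lt_or_gt_of_ne (Finset.ne_of_mem_erase hk) with h | h
  · simp [h, h.not_gt]
  · simp [h, h.not_gt]

/-- The pairing of a symmetric family with the differentials of two coordinates. -/
theorem sum_pairs_delta_delta [Module ℂ M] (H : Fin n → Fin n → M)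
    (hH : ∀ k l, k ≠ l → H l k = H k l) (i j : Fin n) :
    ∑ x : Pairs n, (((if x.1.1 = i then (1 : ℂ) else 0) - (if x.1.2 = i then (1 : ℂ) else 0)) *
      ((if x.1.1 = j then (1 : ℂ) else 0) - (if x.1.2 = j then (1 : ℂ) else 0))) • H x.1.1 x.1.2 =
      if i = j then ∑ k ∈ Finset.univ.erase i, H i k else -H i j := by
  simp only [mul_smul]
  rw [sum_pairs_delta (fun k l => ((if k = j then (1 : ℂ) else 0) -
    (if l = j then (1 : ℂ) else 0)) • H k l) (fun k l hkl => by
      rw [hH k l hkl, ← neg_smul, neg_sub]) i]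
  split_ifs with hij
  · refine Finset.sum_congr rfl fun k hk => ?_
    rw [if_neg (fun hkj => Finset.ne_of_mem_erase hk (hkj.trans hij.symm)), sub_zero, one_smul]
  · rw [Finset.sum_eq_single j]
    · simp
    · intro k _ hk
      simp [hk]
    · intro hj
      exact absurd (Finset.mem_erase.2 ⟨Ne.symm hij, Finset.mem_univ j⟩) hj

end DegSum

namespace IsT1n

variable {n : ℕ} {τ : ℂ} {L : Type} [LieRing L] [LieAlgebra ℂ L] {x y : Fin n → L}
  {t : Fin n → Fin n → L}

/-- The elements `x_i`, `y_i`, `-(ad x_i)^α t_ij` which correspond to `X_i`, `Y_i`, `T_ij^α`. -/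
def gen (x y : Fin n → L) (t : Fin n → Fin n → L) : Idx n → L
  | .X i => x i
  | .Y i => y i
  | .T i j _ α => -(LieAlgebra.ad ℂ L (x i) ^ α) (t i j)

/-- The degree `d` part of `∑_a η_a ⊗ gen_a` at a point. -/
def om (x y : Fin n → L) (t : Fin n → Fin n → L) (τ : ℂ) (w : V2 n) (d : ℕ) : V2 n →ₗ[ℂ] L :=
  degSum (fun a => (etaAt τ a w).smulRight (gen x y t a)) d

/-- The bilinear form `dη_a` at a point. -/
def dEta (τ : ℂ) (w : V2 n) : Idx n → (V2 n →ₗ[ℂ] V2 n →ₗ[ℂ] ℂ)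
  | .X _ => 0
  | .Y _ => 0
  | .T i j _ α => (-kcoef τ α (w.1 i - w.1 j) (w.2 i - w.2 j)) •
      ((LinearMap.mul ℂ ℂ).compl₁₂ (dc i - dc j) (dp i - dp j) -
        (LinearMap.mul ℂ ℂ).compl₁₂ (dp i - dp j) (dc i - dc j))

theorem dForm_eta (hτ : 0 < τ.im) (a : Idx n) (w : confSharp n τ) (u v : V2 n) :
    dForm (eta n τ a) w u v = dEta τ w a u v := by
  cases a with
  | X i => rw [dForm_eta_X hτ]; rfl
  | Y i => rw [dForm_eta_Y hτ]; rfl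
  | T i j h α =>
    rw [dForm_eta_T hτ h]
    simp only [dEta, LinearMap.smul_apply, LinearMap.sub_apply, LinearMap.compl₁₂_apply,
      LinearMap.mul_apply', dp, dc, LinearMap.comp_apply, LinearMap.proj_apply, LinearMap.fst_apply,
      LinearMap.snd_apply, smul_eq_mul]
    ring

theorem dEta_swap (w : V2 n) (a : Idx n) (u v : V2 n) : dEta τ w a u v = -dEta τ w a v u := by
  cases a with
  | X i => simp [dEta]
  | Y i => simp [dEta]
  | T i j h α => simp [dEta]; ring

/-- The degree `d` part of `∑_a dη_a ⊗ gen_a` at a point. -/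
def dom (x y : Fin n → L) (t : Fin n → Fin n → L) (τ : ℂ) (w : V2 n) (d : ℕ) :
    V2 n →ₗ[ℂ] V2 n →ₗ[ℂ] L :=
  degSum (fun a => (dEta τ w a).compr₂ (LinearMap.toSpanSingleton ℂ L (gen x y t a))) d

/-- The degree `d` part of the curvature at a point. -/
def curv (x y : Fin n → L) (t : Fin n → Fin n → L) (τ : ℂ) (w : V2 n) (d : ℕ) :
    V2 n →ₗ[ℂ] V2 n →ₗ[ℂ] L :=
  dom x y t τ w d + ∑ r ∈ Finset.HasAntidiagonal.antidiagonal d,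
    (LieAlgebra.ad ℂ L : L →ₗ[ℂ] Module.End ℂ L).compl₁₂ (om x y t τ w r.1) (om x y t τ w r.2)

theorem om_apply (w : V2 n) (d : ℕ) (u : V2 n) :
    om x y t τ w d u = degSum (fun a => etaAt τ a w u • gen x y t a) d :=
  map_degSum (LinearMap.applyₗ u) _ d

theorem dom_apply (w : V2 n) (d : ℕ) (u v : V2 n) :
    dom x y t τ w d u v = degSum (fun a => dEta τ w a u v • gen x y t a) d :=
  map_degSum ((LinearMap.applyₗ v).comp (LinearMap.applyₗ u)) _ d

theorem curv_apply (w : V2 n) (d : ℕ) (u v : V2 n) :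
    curv x y t τ w d u v = dom x y t τ w d u v + ∑ r ∈ Finset.HasAntidiagonal.antidiagonal d,
      ⁅om x y t τ w r.1 u, om x y t τ w r.2 v⁆ := by
  simp [curv, LinearMap.sum_apply]

theorem curv_swap (w : V2 n) (d : ℕ) (u v : V2 n) :
    curv x y t τ w d u v = -curv x y t τ w d v u := by
  rw [curv_apply, curv_apply, neg_add, ← Finset.sum_neg_distrib,
    ← Finset.Nat.sum_antidiagonal_swap]
  congr 1
  · rw [dom_apply, dom_apply]
    have := map_degSum (-LinearMap.id : L →ₗ[ℂ] L) (fun a => dEta τ w a v u • gen x y t a) d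
    simp only [LinearMap.neg_apply, LinearMap.id_apply] at this
    rw [this]
    simp only [← neg_smul, ← dEta_swap]
  · exact Finset.sum_congr rfl fun r _ => (lie_skew _ _).symm

/-- A bilinear form which vanishes on the standard basis is zero. -/
theorem eq_zero_of_basis {B : V2 n →ₗ[ℂ] V2 n →ₗ[ℂ] L} (h1 : ∀ i j, B (ep i) (ep j) = 0)
    (h2 : ∀ i j, B (ep i) (ec j) = 0) (h3 : ∀ i j, B (ec i) (ep j) = 0)
    (h4 : ∀ i j, B (ec i) (ec j) = 0) : B = 0 := by
  refine LinearMap.ext fun u => LinearMap.ext fun v => ?_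
  rw [sum_ep_ec u, sum_ep_ec v]
  simp only [map_add, map_sum, map_smul, LinearMap.add_apply, LinearMap.sum_apply,
    LinearMap.smul_apply, h1, h2, h3, h4, smul_zero, Finset.sum_const_zero, add_zero,
    LinearMap.zero_apply]

theorem om_zero_ep (w : V2 n) (i : Fin n) : om x y t τ w 0 (ep i) = y i := by
  simp [om_apply, degSum, etaAt, dp, gen]

theorem om_ec (w : V2 n) (d : ℕ) (i : Fin n) :
    om x y t τ w d (ec i) = if d = 1 then x i else 0 := by
  rw [om_apply]
  match d with
  | 0 => simp [degSum, etaAt, dp]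
  | 1 => simp [degSum, etaAt, dp, dc, gen]
  | d + 2 => simp [degSum, etaAt, dp]

theorem flip_fij (h : IsT1n x y t) (hτ : 0 < τ.im) (w : V2 n) (m : ℕ) (k l : Fin n) (hkl : k ≠ l) :
    fij τ m l k w • (LieAlgebra.ad ℂ L (x l) ^ m) (t l k) =
      -(fij τ m k l w • (LieAlgebra.ad ℂ L (x k) ^ m) (t k l)) :=
  h.flip (F := fun i j m => fij τ m i j w) hkl (fun α => by
    simp only [fij]
    rw [← fcoef_neg hτ, neg_sub, neg_sub]) m

theorem om_succ_ep (h : IsT1n x y t) (hτ : 0 < τ.im) (w : V2 n) (m : ℕ) (i : Fin n) :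
    om x y t τ w (m + 1) (ep i) = -W x t (fun i j m => fij τ m i j w) i m := by
  rw [om_apply, degSum]
  have h0 : (if m = 0 then ∑ k, etaAt τ (.X k) w (ep i) • gen x y t (.X k) else 0) = 0 := by
    split_ifs <;> simp [etaAt, dc]
  rw [h0, zero_add, W, ← sum_pairs_delta _ (h.flip_fij hτ w m) i, ← Finset.sum_neg_distrib]
  refine Finset.sum_congr rfl fun z _ => ?_
  simp only [etaAt, gen, LinearMap.smul_apply, LinearMap.sub_apply, dp, LinearMap.comp_apply,
    LinearMap.proj_apply, LinearMap.fst_apply, ep_fst, smul_neg, smul_eq_mul, fij, smul_smul]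
  rw [mul_comm]

theorem dom_eq_zero (w : V2 n) (d : ℕ) (u v : V2 n) (h : ∀ a : Idx n, dEta τ w a u v = 0) :
    dom x y t τ w d u v = 0 := by
  rw [dom_apply]
  exact degSum_eq_zero _ _ fun a _ => by rw [h, zero_smul]

theorem kcoef_neg (hτ : 0 < τ.im) (m : ℕ) (p c : ℂ) :
    kcoef τ m (-p) (-c) = (-1) ^ m * kcoef τ m p c := by
  rw [kcoef, zF_neg hτ, PowerSeries.coeff_rescale, kcoef]

/-- The elements `k_m(p_ij, c_ij) (ad x_i)^m t_ij`. -/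
def kT (x : Fin n → L) (t : Fin n → Fin n → L) (τ : ℂ) (w : V2 n) (m : ℕ) (i j : Fin n) : L :=
  kcoef τ m (w.1 i - w.1 j) (w.2 i - w.2 j) • (LieAlgebra.ad ℂ L (x i) ^ m) (t i j)

theorem kT_symm (h : IsT1n x y t) (hτ : 0 < τ.im) (w : V2 n) (m : ℕ) (i j : Fin n) (hij : i ≠ j) :
    kT x t τ w m j i = kT x t τ w m i j := by
  have := h.flip (F := fun i j m => -kcoef τ m (w.1 i - w.1 j) (w.2 i - w.2 j) *
    (if i < j then 1 else -1)) hij (fun α => by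
      rw [← neg_sub (w.1 i), ← neg_sub (w.2 i), kcoef_neg hτ]
      rcases lt_or_gt_of_ne hij with h | h
      · simp [h, h.not_gt]; ring
      · simp [h, h.not_gt]; ring) m
  rcases lt_or_gt_of_ne hij with h | h
  · simpa [h, h.not_gt, kT] using this
  · simpa [h, h.not_gt, kT] using this

theorem dom_succ_ec_ep (h : IsT1n x y t) (hτ : 0 < τ.im) (w : V2 n) (m : ℕ) (i j : Fin n) :
    dom x y t τ w (m + 1) (ec i) (ep j) =
      if i = j then ∑ k ∈ Finset.univ.erase i, kT x t τ w m i k else -kT x t τ w m i j := by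
  rw [dom_apply, degSum]
  have h0 : (if m = 0 then ∑ k, dEta τ w (.X k) (ec i) (ep j) • gen x y t (.X k) else 0) = 0 := by
    split_ifs <;> simp [dEta]
  rw [h0, zero_add]
  rw [← sum_pairs_delta_delta _ (h.kT_symm hτ w m) i j]
  refine Finset.sum_congr rfl fun z _ => ?_
  simp only [dEta, gen, kT, LinearMap.smul_apply, LinearMap.sub_apply, LinearMap.compl₁₂_apply,
    LinearMap.mul_apply', dp, dc, LinearMap.comp_apply, LinearMap.proj_apply, LinearMap.fst_apply,
    LinearMap.snd_apply, ep_fst, ep_snd, ec_fst, ec_snd, smul_neg, smul_eq_mul, smul_smul,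
    ← neg_smul]
  congr 1
  ring

theorem x_lie_W (h : IsT1n x y t) {F : Fin n → Fin n → ℕ → ℂ} {i j : Fin n} (hij : i ≠ j)
    (hF : ∀ α, F j i α = (-1) ^ (α + 1) * F i j α) (m : ℕ) :
    ⁅x i, W x t F j m⁆ = -(F i j m • (LieAlgebra.ad ℂ L (x i) ^ (m + 1)) (t i j)) := by
  rw [h.W_eq' hij hF, lie_add, lie_neg, lie_smul, pow_succ', Module.End.mul_apply,
    LieAlgebra.ad_apply, lie_sum, Finset.sum_eq_zero, add_zero]
  intro k hk
  simp only [Finset.mem_erase, Finset.mem_univ, and_true] at hk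
  rw [lie_smul, lie_ad_pow_eq_zero (h.xx i j) (h.xt j k i hk.1.symm hij hk.2.symm), smul_zero]

theorem x_lie_W_self (F : Fin n → Fin n → ℕ → ℂ) (i : Fin n) (m : ℕ) :
    ⁅x i, W x t F i m⁆ = ∑ k ∈ Finset.univ.erase i,
      F i k m • (LieAlgebra.ad ℂ L (x i) ^ (m + 1)) (t i k) := by
  simp only [W, lie_sum, lie_smul, pow_succ', Module.End.mul_apply, LieAlgebra.ad_apply]

/-- The component in the directions of `c_i` and `p_j`: the derivative of the form cancels against
`[x_i, y_j]` in the lowest degree, and against `[x_i, W_j]` in the higher ones. -/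
theorem curv_ec_ep (h : IsT1n x y t) (hτ : 0 < τ.im) {w : V2 n} (hw : w ∈ confSharp n τ) (d : ℕ)
    (i j : Fin n) : curv x y t τ w d (ec i) (ep j) = 0 := by
  rw [curv_apply]
  simp only [om_ec]
  cases d with
  | zero => simp [dom_apply, degSum, dEta]
  | succ m =>
    rw [Finset.sum_eq_single (1, m)]
    rotate_left
    · intro r hr hne
      rw [if_neg, zero_lie]
      rintro h1
      rw [Finset.HasAntidiagonal.mem_antidiagonal] at hr
      exact hne (Prod.ext h1 (by simp only; omega))
    · intro hne
      exact absurd (Finset.HasAntidiagonal.mem_antidiagonal.2 (add_comm _ _)) hne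
    rw [if_pos rfl, h.dom_succ_ec_ep hτ]
    cases m with
    | zero =>
      rw [om_zero_ep]
      split_ifs with hij
      · subst hij
        rw [h.xy_diag, ← sub_eq_add_neg, sub_eq_zero]
        refine Finset.sum_congr rfl fun k hk => ?_
        rw [kT, kcoef_zero hτ (hw i k (Finset.ne_of_mem_erase hk).symm), one_smul]
        rfl
      · rw [h.xy i j hij, kT, kcoef_zero hτ (hw i j hij), one_smul]
        exact neg_add_cancel _
    | succ m =>
      rw [h.om_succ_ep hτ, lie_neg]
      split_ifs with hij
      · subst hij
        rw [x_lie_W_self]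
        exact add_neg_cancel _
      · rw [h.x_lie_W hij (fun α => by
          simp only [fij]
          rw [← fcoef_neg hτ, neg_sub, neg_sub]), neg_neg]
        exact neg_add_cancel _

/-- The curvature of `d + ∑_a η_a ⊗ gen_a` vanishes. -/
theorem curv_eq_zero (h : IsT1n x y t) (hτ : 0 < τ.im) {w : V2 n} (hw : w ∈ confSharp n τ)
    (d : ℕ) : curv x y t τ w d = 0 := by
  refine eq_zero_of_basis (fun i j => ?_) (fun i j => ?_) (fun i j => h.curv_ec_ep hτ hw d i j)
    (fun i j => ?_)
  · by_cases hij : i = j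
    · subst hij
      have h1 := curv_swap (x := x) (y := y) (t := t) (τ := τ) w d (ep i) (ep i)
      have h2 : (2 : ℂ) • curv x y t τ w d (ep i) (ep i) = 0 := by
        rw [two_smul]
        nth_rewrite 1 [h1]
        exact neg_add_cancel _
      exact (smul_eq_zero.1 h2).resolve_left two_ne_zero
    have hF : ∀ i j : Fin n, ∀ α, fij τ α j i w = (-1) ^ (α + 1) * fij τ α i j w := fun i j α => by
      simp only [fij]
      rw [← fcoef_neg hτ, neg_sub, neg_sub]
    rw [curv_apply, dom_eq_zero, zero_add]
    swap
    · intro a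
      cases a <;> simp [dEta, dc]
    match d with
    | 0 => simp [om_zero_ep, h.yy]
    | 1 =>
      have := h.lie_y_W_zero (F := fun i j m => fij τ m i j w) hij (hF i j)
      rw [Finset.Nat.sum_antidiagonal_succ, Finset.Nat.antidiagonal_zero, Finset.sum_singleton]
      simp only [om_zero_ep, h.om_succ_ep hτ]
      rw [← this, lie_neg, neg_lie, lie_skew (y j)]
    | e + 2 =>
      have := h.lie_y_W_succ (F := fun i j m => fij τ m i j w) hij (hF i j) e
        (fun k hki hkj a b ha hb => by
          have hf := fay_commute hτ (hw i j hij) (hw j k hkj.symm)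
            (by rw [sub_add_sub_cancel]; exact hw i k hki.symm) (w.2 i - w.2 j) (w.2 j - w.2 k) e
            (a := a) (b := b) (by rw [ha, hb]; exact ad_mul_comm (h.xx i j))
          simpa only [sub_add_sub_cancel, neg_sub, fij] using hf)
      rw [Finset.Nat.sum_antidiagonal_succ, Finset.Nat.sum_antidiagonal_succ']
      simp only [om_zero_ep, h.om_succ_ep hτ]
      rw [← this]
      simp only [lie_neg, neg_lie, neg_neg]
      rw [lie_skew (y j)]
      abel
  · rw [curv_swap, h.curv_ec_ep hτ hw, neg_zero]
  · rw [curv_apply, dom_eq_zero, zero_add]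
    · refine Finset.sum_eq_zero fun r _ => ?_
      rw [om_ec, om_ec]
      split_ifs <;> simp [h.xx]
    · intro a
      cases a <;> simp [dEta, dp]

end IsT1n

/-! ### The morphism from `𝔊` to `𝔱_{1,n}` -/

section Quotients

variable {𝔤 L : Type} [LieRing 𝔤] [LieAlgebra ℂ 𝔤] [LieRing L] [LieAlgebra ℂ L]

/-- The morphism from a quotient of a Lie algebra induced by a morphism which vanishes on a set of
generators of the ideal. -/
def liftSpan (s : Set 𝔤) (f : 𝔤 →ₗ⁅ℂ⁆ L) (h : ∀ r ∈ s, f r = 0) :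
    (𝔤 ⧸ (LieSubmodule.lieSpan ℂ 𝔤 s : LieIdeal ℂ 𝔤)) →ₗ⁅ℂ⁆ L where
  toLinearMap := Submodule.liftQ (LieSubmodule.lieSpan ℂ 𝔤 s : LieIdeal ℂ 𝔤).toSubmodule
    (f : 𝔤 →ₗ[ℂ] L) (by
      have h1 : LieSubmodule.lieSpan ℂ 𝔤 s ≤ f.ker := LieSubmodule.lieSpan_le.2 fun r hr =>
        LieHom.mem_ker.2 (h r hr)
      exact fun r hr => LieHom.mem_ker.1 (h1 hr))
  map_lie' := by
    rintro ⟨u⟩ ⟨v⟩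
    exact f.map_lie u v

/-- The projection to a quotient Lie algebra, as a morphism of Lie algebras. -/
def mkHom (I : LieIdeal ℂ 𝔤) : 𝔤 →ₗ⁅ℂ⁆ 𝔤 ⧸ I :=
  { (LieSubmodule.Quotient.mk' I : 𝔤 →ₗ[ℂ] 𝔤 ⧸ I) with
    map_lie' := rfl }

theorem mkHom_eq_zero {s : Set 𝔤} {u : 𝔤} (h : u ∈ s) :
    mkHom (LieSubmodule.lieSpan ℂ 𝔤 s : LieIdeal ℂ 𝔤) u = 0 :=
  LieSubmodule.Quotient.mk_eq_zero'.2 (LieSubmodule.subset_lieSpan h)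

theorem freeQuot_hom_ext {X : Type} {I : LieIdeal ℂ (FreeLieAlgebra ℂ X)}
    {f g : (FreeLieAlgebra ℂ X ⧸ I) →ₗ⁅ℂ⁆ L}
    (h : ∀ a, f (mkHom I (FreeLieAlgebra.of ℂ a)) = g (mkHom I (FreeLieAlgebra.of ℂ a))) :
    f = g := by
  have h1 : f.comp (mkHom I) = g.comp (mkHom I) := FreeLieAlgebra.hom_ext h
  ext u
  obtain ⟨u, rfl⟩ := LieSubmodule.Quotient.surjective_mk' I u
  exact LieHom.congr_fun h1 u

end Quotients

namespace TT

variable {n : ℕ}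

/-- The elements `t_ij` of `𝔱_{1,n}`, set to zero for `i = j`. -/
def tt (i j : Fin n) : TT n := if h : i ≠ j then TT.t i j h else 0

theorem tt_eq {i j : Fin n} (h : i ≠ j) : tt i j = TT.t i j h := dif_pos h

theorem sum_subtype_ne {M : Type} [AddCommMonoid M] (i : Fin n) (f : Fin n → M) :
    ∑ j : {j : Fin n // i ≠ j}, f j = ∑ j ∈ Finset.univ.erase i, f j :=
  (Finset.sum_subtype _ (fun j => by simp [eq_comm]) f).symm

theorem isT1n : IsT1n (TT.x (n := n)) TT.y tt where
  xx i j := mkHom_eq_zero (TRel.xx i j)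
  yy i j := mkHom_eq_zero (TRel.yy i j)
  xy i j h := by
    rw [tt_eq h]
    exact sub_eq_zero.1 (mkHom_eq_zero (TRel.xy i j h))
  symm i j h := by
    rw [tt_eq h, tt_eq h.symm]
    exact sub_eq_zero.1 (mkHom_eq_zero (TRel.symm i j h))
  xy_diag i := by
    have h : mkHom _ _ = 0 := mkHom_eq_zero (TRel.xy_diag i)
    rw [map_add, map_sum] at h
    rw [eq_neg_iff_add_eq_zero, ← h, ← sum_subtype_ne]
    congr 1
    exact Finset.sum_congr rfl fun (j : {j : Fin n // i ≠ j}) _ => tt_eq j.2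
  xt i j k h hi hj := by
    rw [tt_eq h]
    exact mkHom_eq_zero (TRel.xt i j k h hi hj)
  yt i j k h hi hj := by
    rw [tt_eq h]
    exact mkHom_eq_zero (TRel.yt i j k h hi hj)
  xxt i j h := by
    rw [tt_eq h]
    exact mkHom_eq_zero (TRel.xxt i j h)
  yyt i j h := by
    rw [tt_eq h]
    exact mkHom_eq_zero (TRel.yyt i j h)

/-- The value on generators of the morphism from `𝔱_{1,n}` attached to elements which satisfy its
relations. -/
def genMap {L : Type} (x y : Fin n → L) (t : Fin n → Fin n → L) : TGen n → L
  | .x i => x i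
  | .y i => y i
  | .t i j _ => t i j

/-- The universal property of `𝔱_{1,n}`. -/
def lift {L : Type} [LieRing L] [LieAlgebra ℂ L] {x y : Fin n → L} {t : Fin n → Fin n → L}
    (h : IsT1n x y t) : TT n →ₗ⁅ℂ⁆ L :=
  liftSpan _ (FreeLieAlgebra.lift ℂ (genMap x y t)) (by
    rintro r hr
    have hr' : TRel n r := hr
    cases hr' with
    | xx i j => simpa [genMap] using h.xx i j
    | yy i j => simpa [genMap] using h.yy i j
    | xy i j hij => simpa [genMap, sub_eq_zero] using h.xy i j hij
    | symm i j hij => simpa [genMap, sub_eq_zero] using h.symm i j hij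
    | xy_diag i =>
      rw [map_add, map_sum, LieHom.map_lie]
      simp only [FreeLieAlgebra.lift_of_apply, genMap]
      rw [h.xy_diag, sum_subtype_ne i (fun j => t i j), neg_add_cancel]
    | xt i j k hij hi hj => simpa [genMap] using h.xt i j k hij hi hj
    | yt i j k hij hi hj => simpa [genMap] using h.yt i j k hij hi hj
    | xxt i j hij => simpa [genMap] using h.xxt i j hij
    | yyt i j hij => simpa [genMap] using h.yyt i j hij)

theorem lift_gen {L : Type} [LieRing L] [LieAlgebra ℂ L] {x y : Fin n → L} {t : Fin n → Fin n → L}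
    (h : IsT1n x y t) (a : TGen n) : lift h (TT.gen a) = genMap x y t a :=
  FreeLieAlgebra.lift_of_apply _ a

end TT

theorem adx_eq {n : ℕ} (i : Fin n) (α : ℕ) (b : TT n) :
    adx i α b = (LieAlgebra.ad ℂ (TT n) (TT.x i) ^ α) b := by
  rw [adx, Module.End.pow_apply]
  rfl

section FlatRel

variable {n : ℕ} {τ : ℂ}

theorem lt_deg_of_notMem_idxFin {N : ℕ} {a : Idx n} (h : a ∉ idxFin n N) : N < a.deg := by
  cases a with
  | X i => exact absurd (X_mem_idxFin N i) h
  | Y i => exact absurd (Y_mem_idxFin N i) h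
  | T i j hij α =>
    rw [T_mem_idxFin, not_lt] at h
    exact Nat.lt_succ_of_le h

/-- The differentials of the forms `ω_ij^α` lie in the image of the wedge product. -/
theorem dForm_eta_T_succ (hτ : 0 < τ.im) {i j : Fin n} (h : i < j) (α : ℕ) :
    dForm (eta n τ (.T i j h (α + 1))) = wedge (eta n τ (.X j)) (eta n τ (.T i j h α)) -
      wedge (eta n τ (.X i)) (eta n τ (.T i j h α)) := by
  funext w u v
  rw [dForm_eta_T hτ h]
  simp only [Pi.sub_apply, wedge, eta_X, eta_T, ← fcoef_eq_kcoef, fij]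
  ring

theorem map_dForm_eq_zero (hτ : 0 < τ.im) {φ : Form2 n τ →ₗ[ℂ] ℂ} {N : ℕ} (hN : 2 ≤ N)
    (h : ∀ a b : Idx n, N ≤ a.deg + b.deg → φ (wedge (eta n τ a) (eta n τ b)) = 0) (a : Idx n)
    (ha : N ≤ a.deg) : φ (dForm (eta n τ a)) = 0 := by
  match a with
  | .X i => simp only [Idx.deg] at ha; omega
  | .Y i => simp only [Idx.deg] at ha; omega
  | .T i j hij 0 => simp only [Idx.deg] at ha; omega
  | .T i j hij (α + 1) =>
    simp only [Idx.deg] at ha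
    rw [dForm_eta_T_succ hτ, map_sub, h _ _ (by simp only [Idx.deg]; omega),
      h _ _ (by simp only [Idx.deg]; omega), sub_zero]

/-- The defining relation attached to `φ` as a combination of two finite sums: only the indices of
degree at most `N` contribute. -/
theorem flatRel_eq (hτ : 0 < τ.im) {φ : Form2 n τ →ₗ[ℂ] ℂ} {N : ℕ} (hN : 2 ≤ N)
    (h : ∀ a b : Idx n, N ≤ a.deg + b.deg → φ (wedge (eta n τ a) (eta n τ b)) = 0) :
    flatRel φ = ∑ a ∈ idxFin n N, φ (dForm (eta n τ a)) • FreeLieAlgebra.of ℂ a +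
      (1 / 2 : ℂ) • ∑ a ∈ idxFin n N, ∑ b ∈ idxFin n N,
        φ (wedge (eta n τ a) (eta n τ b)) • ⁅FreeLieAlgebra.of ℂ a, FreeLieAlgebra.of ℂ b⁆ := by
  rw [flatRel, finsum_eq_sum_of_support_subset (s := idxFin n N),
    finsum_eq_sum_of_support_subset (s := idxFin n N ×ˢ idxFin n N), Finset.sum_product]
  · rintro ⟨a, b⟩ hab
    by_contra hne
    refine hab ?_
    simp only [Finset.coe_product, Set.mem_prod, Finset.mem_coe, not_and_or] at hne
    have h0 : φ (wedge (eta n τ a) (eta n τ b)) = 0 := h a b (by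
      rcases hne with hne | hne <;> have := lt_deg_of_notMem_idxFin hne <;> omega)
    simp only [h0, zero_smul]
  · intro a ha
    by_contra hne
    refine ha ?_
    simp only [map_dForm_eq_zero hτ hN h a (lt_deg_of_notMem_idxFin hne).le, zero_smul]

theorem degSum_sub {M : Type*} [AddCommGroup M] (h h' : Idx n → M) (d : ℕ) :
    degSum (fun a => h a - h' a) d = degSum h d - degSum h' d := by
  cases d with
  | zero => simp [degSum]
  | succ m =>
    by_cases hm : m = 0
    · simp [degSum, hm]
      abel
    · simp [degSum, hm]

namespace IsT1n

variable {L : Type} [LieRing L] [LieAlgebra ℂ L] {x y : Fin n → L} {t : Fin n → Fin n → L}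

theorem lie_om_om (w : V2 n) (u v : V2 n) (d e : ℕ) (ℓ : L →ₗ[ℂ] ℂ) :
    ℓ ⁅om x y t τ w d u, om x y t τ w e v⁆ = degSum (fun a => degSum (fun b =>
      ℓ ⁅gen x y t a, gen x y t b⁆ * (etaAt τ a w u * etaAt τ b w v)) e) d := by
  have h1 : ∀ a, ℓ ⁅gen x y t a, om x y t τ w e v⁆ = degSum (fun b =>
      ℓ ⁅gen x y t a, gen x y t b⁆ * etaAt τ b w v) e := fun a => by
    rw [om_apply, ← LieAlgebra.ad_apply (R := ℂ), ← LinearMap.comp_apply, map_degSum]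
    simp [mul_comm]
  have h2 := map_degSum (ℓ ∘ₗ ((LieAlgebra.ad ℂ L : L →ₗ[ℂ] Module.End ℂ L).flip
    (om x y t τ w e v))) (fun a => etaAt τ a w u • gen x y t a) d
  rw [← om_apply] at h2
  simp only [LinearMap.comp_apply, LinearMap.flip_apply, map_smul] at h2
  refine h2.trans ?_
  congr 1
  funext a
  have h3 := map_degSum (LinearMap.lsmul ℂ ℂ (etaAt τ a w u)) (fun b =>
      ℓ ⁅gen x y t a, gen x y t b⁆ * etaAt τ b w v) e
  rw [← h1] at h3
  refine h3.trans ?_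
  congr 1
  funext b
  simp only [LinearMap.lsmul_apply, smul_eq_mul]
  ring

/-- The defining relations of `𝔊` hold for elements constructed from a solution of the relations
of `𝔱_{1,n}`. -/
theorem lift_flatRel (h : IsT1n x y t) (hτ : 0 < τ.im) {φ : Form2 n τ →ₗ[ℂ] ℂ}
    (hφ : IsGradedDual φ) : FreeLieAlgebra.lift ℂ (gen x y t) (flatRel φ) = 0 := by
  obtain ⟨N₀, hN₀⟩ := hφ
  set N := max N₀ 2 with hN
  have h2 : 2 ≤ N := le_max_right _ _
  have hw : ∀ a b : Idx n, N ≤ a.deg + b.deg → φ (wedge (eta n τ a) (eta n τ b)) = 0 :=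
    fun a b hab => hN₀ a b ((le_max_left _ _).trans hab)
  rw [flatRel_eq hτ h2 hw]
  simp only [map_add, map_sum, map_smul, LieHom.map_lie, FreeLieAlgebra.lift_of_apply]
  refine (Module.forall_dual_apply_eq_zero_iff ℂ _).1 fun ℓ => ?_
  simp only [map_add, map_sum, map_smul, smul_eq_mul]
  -- the component of degree `d` is the value of `φ` at a component of the curvature
  have key : ∀ d, degSum (fun a => φ (dForm (eta n τ a)) * ℓ (gen x y t a)) d + 1 / 2 *
      ∑ r ∈ Finset.HasAntidiagonal.antidiagonal d, degSum (fun a => degSum (fun b =>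
        φ (wedge (eta n τ a) (eta n τ b)) * ℓ ⁅gen x y t a, gen x y t b⁆) r.2) r.1 = 0 := by
    intro d
    have hG : degSum (fun a => ℓ (gen x y t a) • dForm (eta n τ a)) d + (1 / 2 : ℂ) •
        ∑ r ∈ Finset.HasAntidiagonal.antidiagonal d, degSum (fun a => degSum (fun b =>
          ℓ ⁅gen x y t a, gen x y t b⁆ • wedge (eta n τ a) (eta n τ b)) r.2) r.1 =
        (0 : Form2 n τ) := by
      funext w u v
      simp only [Pi.add_apply, Pi.smul_apply, Finset.sum_apply, degSum_apply, wedge, mul_sub,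
        smul_eq_mul, degSum_sub, Pi.zero_apply, eta, Finset.sum_sub_distrib]
      have c1 := congrArg ℓ (curv_apply (x := x) (y := y) (t := t) (τ := τ) w d u v)
      have c2 := congrArg ℓ (curv_apply (x := x) (y := y) (t := t) (τ := τ) w d v u)
      rw [h.curv_eq_zero hτ w.2] at c1 c2
      simp only [LinearMap.zero_apply, map_zero, map_add, map_sum, lie_om_om, dom_apply,
        map_degSum, map_smul, smul_eq_mul] at c1 c2
      have hd : degSum (fun a => dEta τ w a v u * ℓ (gen x y t a)) d =
          -degSum (fun a => dEta τ w a u v * ℓ (gen x y t a)) d := by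
        have := map_degSum (-LinearMap.id : ℂ →ₗ[ℂ] ℂ)
          (fun a => dEta τ w a u v * ℓ (gen x y t a)) d
        simp only [LinearMap.neg_apply, LinearMap.id_apply] at this
        rw [this]
        simp only [← neg_mul, ← dEta_swap]
      have hd' : degSum (fun a => ℓ (gen x y t a) * dForm (eta n τ a) w u v) d =
          degSum (fun a => dEta τ w a u v * ℓ (gen x y t a)) d := by
        congr 1
        funext a
        rw [dForm_eta hτ, mul_comm]
      rw [hd] at c2
      rw [hd']
      linear_combination (-1 / 2 : ℂ) * c1 + (1 / 2 : ℂ) * c2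
    have := congrArg φ hG
    simp only [map_add, map_degSum, map_smul, map_sum, map_zero, smul_eq_mul] at this
    simpa only [mul_comm] using this
  rw [sum_idxFin_eq_sum_degSum (by omega)]
  simp only [sum_idxFin_eq_sum_degSum (show 1 ≤ N by omega)]
  have e1 : ∑ d ∈ Finset.range (N + 1), degSum (fun a => ∑ e ∈ Finset.range (N + 1), degSum (fun b =>
        φ (wedge (eta n τ a) (eta n τ b)) * ℓ ⁅gen x y t a, gen x y t b⁆) e) d =
      ∑ d ∈ Finset.range (N + 1), ∑ e ∈ Finset.range (N + 1), degSum (fun a => degSum (fun b =>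
        φ (wedge (eta n τ a) (eta n τ b)) * ℓ ⁅gen x y t a, gen x y t b⁆) e) d := by
    refine Finset.sum_congr rfl fun d _ => ?_
    cases d with
    | zero => exact Finset.sum_comm
    | succ m =>
      by_cases hm : m = 0
      · simp only [degSum, if_pos hm, Finset.sum_add_distrib]
        congr 1 <;> exact Finset.sum_comm
      · simp only [degSum, if_neg hm, zero_add]
        exact Finset.sum_comm
  rw [e1, sum_range_mul_range N _ (fun d e hde => degSum_eq_zero _ _ fun a ha =>
    degSum_eq_zero _ _ fun b hb => by rw [hw a b (by omega), zero_mul]), Finset.mul_sum,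
    ← Finset.sum_add_distrib]
  exact Finset.sum_eq_zero fun d _ => key d

end IsT1n

/-- The morphism `𝔊 → 𝔱_{1,n}`. -/
def toTT (hτ : 0 < τ.im) : GG n τ →ₗ⁅ℂ⁆ TT n :=
  liftSpan _ (FreeLieAlgebra.lift ℂ (IsT1n.gen TT.x TT.y TT.tt)) (by
    rintro _ ⟨φ, hφ, rfl⟩
    exact TT.isT1n.lift_flatRel hτ hφ)

theorem toTT_gen (hτ : 0 < τ.im) (a : Idx n) :
    toTT hτ (GG.gen n τ a) = IsT1n.gen TT.x TT.y TT.tt a :=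
  FreeLieAlgebra.lift_of_apply _ a

end FlatRel

/-! ### Relations in `𝔊` from linear functionals -/

section Functionals

variable {n : ℕ} {τ : ℂ}

instance : DecidableEq (Idx n) := Classical.decEq _

/-- The values of a two-form on two constant vector fields. -/
def eval2 (τ : ℂ) (u v : V2 n) : Form2 n τ →ₗ[ℂ] (confSharp n τ → ℂ) where
  toFun ψ w := ψ w u v
  map_add' _ _ := rfl
  map_smul' _ _ := rfl

/-- The relation of `𝔊` attached to the functional `l` of the coefficient of `u ∧ v`. -/
theorem rel_of_functional (hτ : 0 < τ.im) (l : (confSharp n τ → ℂ) →ₗ[ℂ] ℂ) (u v : V2 n) {N : ℕ}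
    (hN : 2 ≤ N)
    (h : ∀ a b : Idx n, N ≤ a.deg + b.deg → l (eval2 τ u v (wedge (eta n τ a) (eta n τ b))) = 0) :
    ∑ a ∈ idxFin n N, l (eval2 τ u v (dForm (eta n τ a))) • GG.gen n τ a +
      (1 / 2 : ℂ) • ∑ a ∈ idxFin n N, ∑ b ∈ idxFin n N,
        l (eval2 τ u v (wedge (eta n τ a) (eta n τ b))) • ⁅GG.gen n τ a, GG.gen n τ b⁆ = 0 := by
  have h0 : mkHom (relIdeal n τ) (flatRel (l ∘ₗ eval2 τ u v)) = 0 :=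
    mkHom_eq_zero ⟨_, ⟨N, h⟩, rfl⟩
  rw [flatRel_eq hτ hN h] at h0
  simp only [map_add, map_sum, map_smul, LieHom.map_lie] at h0
  exact h0

/-- A functional which detects a single product of forms gives a commutation relation. -/
theorem lie_gen_eq_zero (hτ : 0 < τ.im) (l : (confSharp n τ → ℂ) →ₗ[ℂ] ℂ) (u v : V2 n) (A B : Idx n)
    (hd : ∀ a, l (eval2 τ u v (dForm (eta n τ a))) = 0)
    (hw : ∀ a b, l (eval2 τ u v (wedge (eta n τ a) (eta n τ b))) =
      (if a = A ∧ b = B then 1 else 0) - (if a = B ∧ b = A then 1 else 0)) :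
    ⁅GG.gen n τ A, GG.gen n τ B⁆ = 0 := by
  obtain ⟨N₀, hN₀⟩ := exists_subset_idxFin ({A, B} : Finset (Idx n))
  set N := N₀ + A.deg + B.deg + 2
  have hmem : ∀ C ∈ ({A, B} : Finset (Idx n)), C ∈ idxFin n N := fun C hC => by
    by_contra hne
    have h1 := lt_deg_of_notMem_idxFin hne
    simp only [Finset.mem_insert, Finset.mem_singleton] at hC
    rcases hC with rfl | rfl <;> omega
  have hA := hmem A (by simp)
  have hB := hmem B (by simp)
  have h := rel_of_functional hτ l u v (N := N) (by omega) (fun a b hab => by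
    rw [hw, if_neg, if_neg, sub_zero]
    · rintro ⟨rfl, rfl⟩; omega
    · rintro ⟨rfl, rfl⟩; omega)
  simp only [hd, hw, zero_smul, Finset.sum_const_zero, zero_add, sub_smul, Finset.sum_sub_distrib,
    ite_smul, one_smul] at h
  have e : ∀ A B : Idx n, A ∈ idxFin n N → B ∈ idxFin n N → ∑ a ∈ idxFin n N, ∑ b ∈ idxFin n N,
      (if a = A ∧ b = B then ⁅GG.gen n τ a, GG.gen n τ b⁆ else 0) =
      ⁅GG.gen n τ A, GG.gen n τ B⁆ := fun A B hA hB => by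
    rw [Finset.sum_eq_single A, Finset.sum_eq_single B]
    · simp
    · intro b _ hb
      simp [hb]
    · exact fun hne => absurd hB hne
    · intro a _ ha
      simp [ha]
    · exact fun hne => absurd hA hne
  rw [e A B hA hB, e B A hB hA, ← lie_skew (GG.gen n τ B), sub_neg_eq_add, ← two_smul ℂ, smul_smul]
    at h
  norm_num at h
  exact h

theorem exists_functional {V : Type*} [AddCommGroup V] [Module ℂ V] {S : Submodule ℂ V} {v : V}
    (hv : v ∉ S) : ∃ l : V →ₗ[ℂ] ℂ, l v = 1 ∧ ∀ s ∈ S, l s = 0 := by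
  obtain ⟨f, hf, hS⟩ := Submodule.exists_le_ker_of_notMem hv
  refine ⟨(f v)⁻¹ • f, by simp [hf], fun s hs => ?_⟩
  have : f s = 0 := hS hs
  simp [this]

/-- The functional is the value at a point of the coefficient of `dc_i ∧ dc_j`: only the product of
`dc_i` and `dc_j` contributes. -/
theorem GG.X_lie_X (hτ : 0 < τ.im) (i j : Fin n) :
    ⁅GG.gen n τ (.X i), GG.gen n τ (.X j)⁆ = 0 := by
  by_cases hij : i = j
  · rw [hij, lie_self]
  obtain ⟨p, hp⟩ := (dense_conf (n := n) (τ := τ)).nonempty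
  refine lie_gen_eq_zero hτ (LinearMap.proj ⟨(p, 0), hp⟩) (ec i) (ec j) _ _ (fun a => ?_)
    fun a b => ?_
  · change dForm (eta n τ a) _ (ec i) (ec j) = 0
    rw [IsT1n.dForm_eta hτ]
    cases a <;> simp [IsT1n.dEta, dp]
  · change wedge (eta n τ a) (eta n τ b) _ (ec i) (ec j) = _
    have h1 : ∀ (w : confSharp n τ) (a : Idx n) (i : Fin n), eta n τ a w (ec i) =
        if a = .X i then 1 else 0 := fun w a i => by
      cases a with
      | X k => simp [eta_X]
      | Y k => simp [eta_Y]
      | T k l h α => simp [eta_T]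
    simp only [wedge, h1]
    split_ifs <;> simp_all

/-- A two-fold sum with antisymmetric brackets. -/
theorem half_sum_lie {L : Type} [LieRing L] [LieAlgebra ℂ L] (S : Finset (Idx n)) (g : Idx n → L)
    (A B : Idx n → ℂ) : (1 / 2 : ℂ) • ∑ a ∈ S, ∑ b ∈ S, (A a * B b - A b * B a) • ⁅g a, g b⁆ =
      ⁅∑ a ∈ S, A a • g a, ∑ b ∈ S, B b • g b⁆ := by
  have h1 : ∀ A B : Idx n → ℂ, ⁅∑ a ∈ S, A a • g a, ∑ b ∈ S, B b • g b⁆ =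
      ∑ a ∈ S, ∑ b ∈ S, (A a * B b) • ⁅g a, g b⁆ := fun A B => by
    rw [sum_lie]
    refine Finset.sum_congr rfl fun a _ => ?_
    rw [lie_sum]
    refine Finset.sum_congr rfl fun b _ => ?_
    rw [smul_lie, lie_smul, smul_smul]
  have h2 : ∑ a ∈ S, ∑ b ∈ S, (A b * B a) • ⁅g a, g b⁆ =
      -⁅∑ a ∈ S, A a • g a, ∑ b ∈ S, B b • g b⁆ := by
    rw [lie_skew, h1]
    simp only [mul_comm]
  simp only [sub_smul, Finset.sum_sub_distrib]
  rw [h2, ← h1, sub_neg_eq_add, ← two_smul ℂ, smul_smul]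
  norm_num

/-- The elements `T_ij^α`, extended to all `i ≠ j` by symmetry. -/
def gT (n : ℕ) (τ : ℂ) (i j : Fin n) (α : ℕ) : GG n τ :=
  if h : i < j then GG.gen n τ (.T i j h α)
  else if h : j < i then ((-1 : ℂ) ^ α) • GG.gen n τ (.T j i h α) else 0

theorem gT_of_lt {i j : Fin n} (h : i < j) (α : ℕ) : gT n τ i j α = GG.gen n τ (.T i j h α) :=
  dif_pos h

theorem gT_swap {i j : Fin n} (hij : i ≠ j) (α : ℕ) : gT n τ j i α = ((-1 : ℂ) ^ α) • gT n τ i j α := by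
  rcases lt_or_gt_of_ne hij with h | h
  · rw [gT, dif_neg h.not_gt, dif_pos h, gT_of_lt h]
  · rw [gT_of_lt h, gT, dif_neg h.not_gt, dif_pos h, smul_smul, ← mul_pow]
    simp

/-- The function `f_α(p_i - p_j, c_i - c_j)` on the configuration space. -/
def fS (n : ℕ) (τ : ℂ) (α : ℕ) (i j : Fin n) : confSharp n τ → ℂ := fun w => fij τ α i j w

theorem fS_swap (hτ : 0 < τ.im) (α : ℕ) (i j : Fin n) :
    fS n τ α j i = ((-1 : ℂ) ^ (α + 1)) • fS n τ α i j := by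
  funext w
  simp only [fS, fij, Pi.smul_apply, smul_eq_mul]
  rw [← fcoef_neg hτ, neg_sub, neg_sub]

/-- The function `k_α(p_i - p_j, c_i - c_j)` on the configuration space. -/
def kS (n : ℕ) (τ : ℂ) (α : ℕ) (i j : Fin n) : confSharp n τ → ℂ := fun w =>
  kcoef τ α ((w : V2 n).1 i - (w : V2 n).1 j) ((w : V2 n).2 i - (w : V2 n).2 j)

theorem kS_succ (α : ℕ) (i j : Fin n) : kS n τ (α + 1) i j = fS n τ α i j := rfl

theorem kS_zero (hτ : 0 < τ.im) {i j : Fin n} (hij : i ≠ j) : kS n τ 0 i j = 1 := by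
  funext w
  exact kcoef_zero hτ (w.2 i j hij) _

theorem kS_swap (hτ : 0 < τ.im) (α : ℕ) (i j : Fin n) :
    kS n τ α j i = ((-1 : ℂ) ^ α) • kS n τ α i j := by
  funext w
  simp only [kS, Pi.smul_apply, smul_eq_mul]
  rw [← IsT1n.kcoef_neg hτ, neg_sub, neg_sub]

theorem neg_one_pow_mul_self (m : ℕ) : ((-1 : ℂ) ^ m) * (-1) ^ m = 1 := by
  rw [← mul_pow]
  simp

/-- The relation in the directions of `c_i` and `p_j`. -/
theorem rel_ec_ep (hτ : 0 < τ.im) (l : (confSharp n τ → ℂ) →ₗ[ℂ] ℂ) (i j : Fin n) {N : ℕ}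
    (h : ∀ k, k ≠ j → ∀ α, N ≤ α → l (fS n τ α j k) = 0) :
    ⁅GG.gen n τ (.X i), l 1 • GG.gen n τ (.Y j) + ∑ α ∈ Finset.range (N + 2),
      ∑ k ∈ Finset.univ.erase j, l (fS n τ α j k) • gT n τ j k α⁆ =
      ∑ α ∈ Finset.range (N + 2), if i = j then ∑ k ∈ Finset.univ.erase i,
        l (kS n τ α i k) • gT n τ i k α else -(l (kS n τ α i j) • gT n τ i j α) := by
  set A : Idx n → ℂ := fun a => if a = .X i then 1 else 0 with hA
  set B : Idx n → ℂ := fun a => l (fun w => eta n τ a w (ep j)) with hB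
  have hAw : ∀ a (w : confSharp n τ), eta n τ a w (ec i) = A a := fun a w => by
    cases a with
    | X k => simp [eta_X, hA]
    | Y k => simp [eta_Y, hA]
    | T k l h α => simp [eta_T, hA]
  have hw : ∀ a b, l (eval2 τ (ec i) (ep j) (wedge (eta n τ a) (eta n τ b))) =
      A a * B b - A b * B a := fun a b => by
    have : eval2 τ (ec i) (ep j) (wedge (eta n τ a) (eta n τ b)) =
        A a • (fun w => eta n τ b w (ep j)) - A b • (fun w => eta n τ a w (ep j)) := by
      funext w
      simp only [eval2, LinearMap.coe_mk, AddHom.coe_mk, wedge, hAw, Pi.sub_apply, Pi.smul_apply,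
        smul_eq_mul]
      ring
    rw [this, map_sub, map_smul, map_smul, smul_eq_mul, smul_eq_mul]
  have hBT : ∀ k m (hkm : k < m) α, B (.T k m hkm α) =
      ((if k = j then (1 : ℂ) else 0) - (if m = j then (1 : ℂ) else 0)) * l (fS n τ α k m) :=
    fun k m hkm α => by
      rw [← smul_eq_mul, ← map_smul]
      refine congrArg l (funext fun w => ?_)
      simp only [eta_T, ep_fst, Pi.smul_apply, smul_eq_mul, fS]
      ring
  have hBX : ∀ k, B (.X k) = 0 := fun k => by
    rw [hB]
    exact map_zero l
  have hBY : ∀ k, B (.Y k) = if k = j then l 1 else 0 := fun k => by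
    simp only [hB, eta_Y, ep_fst]
    split_ifs
    · rfl
    · exact map_zero l
  have hBbig : ∀ b : Idx n, N + 1 ≤ b.deg → B b = 0 := by
    intro b hb
    match b with
    | .X k => exact hBX k
    | .Y k => simp only [Idx.deg] at hb; omega
    | .T k m hkm α =>
      simp only [Idx.deg] at hb
      rw [hBT]
      by_cases hk : k = j
      · subst hk
        rw [h m hkm.ne' α (by omega), mul_zero]
      · by_cases hm : m = j
        · subst hm
          rw [fS_swap hτ, map_smul, h k hkm.ne α (by omega), smul_zero, mul_zero]
        · simp [hk, hm]
  have hrel := rel_of_functional hτ l (ec i) (ep j) (N := N + 2) (by omega) (fun a b hab => by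
    rw [hw]
    have hz : ∀ a b : Idx n, N + 2 ≤ a.deg + b.deg → A a * B b = 0 := fun a b hab => by
      by_cases ha : a = .X i
      · subst ha
        have h1 : (Idx.X i).deg = 1 := rfl
        rw [hBbig b (by omega), mul_zero]
      · simp [hA, ha]
    rw [hz a b hab, hz b a (by omega), sub_zero])
  simp only [hw] at hrel
  rw [half_sum_lie] at hrel
  have h1 : ∑ a ∈ idxFin n (N + 2), A a • GG.gen n τ a = GG.gen n τ (.X i) := by
    rw [sum_idxFin]
    simp [hA]
  have h2 : ∑ b ∈ idxFin n (N + 2), B b • GG.gen n τ b = l 1 • GG.gen n τ (.Y j) +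
      ∑ α ∈ Finset.range (N + 2), ∑ k ∈ Finset.univ.erase j, l (fS n τ α j k) • gT n τ j k α := by
    rw [sum_idxFin]
    simp only [hBX, hBY, hBT, zero_smul, Finset.sum_const_zero, zero_add, ite_smul,
      Finset.sum_ite_eq', Finset.mem_univ, if_true]
    rw [Finset.sum_comm]
    congr 1
    refine Finset.sum_congr rfl fun α _ => ?_
    rw [← sum_pairs_delta (fun k m => l (fS n τ α k m) • gT n τ k m α) (fun k m hkm => by
      rw [fS_swap hτ, gT_swap hkm, map_smul, smul_eq_mul, smul_smul, ← neg_smul]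
      congr 1
      linear_combination (-l (fS n τ α k m)) * neg_one_pow_mul_self α) j]
    refine Finset.sum_congr rfl fun z _ => ?_
    rw [gT_of_lt z.2, mul_smul]
  have h3 : ∑ a ∈ idxFin n (N + 2), l (eval2 τ (ec i) (ep j) (dForm (eta n τ a))) • GG.gen n τ a =
      -∑ α ∈ Finset.range (N + 2), if i = j then ∑ k ∈ Finset.univ.erase i,
        l (kS n τ α i k) • gT n τ i k α else -(l (kS n τ α i j) • gT n τ i j α) := by
    rw [sum_idxFin]
    simp only [dForm_eta_X hτ, dForm_eta_Y hτ, map_zero, zero_smul, Finset.sum_const_zero, zero_add]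
    rw [Finset.sum_comm, ← Finset.sum_neg_distrib]
    refine Finset.sum_congr rfl fun α _ => ?_
    rw [← sum_pairs_delta_delta (fun k m => l (kS n τ α k m) • gT n τ k m α) (fun k m hkm => by
      rw [kS_swap hτ, gT_swap hkm, map_smul, smul_eq_mul, smul_smul]
      congr 1
      linear_combination (l (kS n τ α k m)) * neg_one_pow_mul_self α) i j, ← Finset.sum_neg_distrib]
    refine Finset.sum_congr rfl fun z _ => ?_
    rw [gT_of_lt z.2, smul_smul, ← neg_smul]
    congr 1
    rw [← neg_mul, ← smul_eq_mul, ← map_smul]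
    congr 1
    funext w
    simp only [eval2, LinearMap.coe_mk, AddHom.coe_mk, dForm_eta_T hτ z.2, ep_fst, ep_snd, ec_fst,
      ec_snd, Pi.smul_apply, smul_eq_mul, kS]
    ring
  rw [h1, h2, h3, neg_add_eq_zero] at hrel
  exact hrel.symm

/-- The functions `1` and `f_α(p_j - p_k, c_j - c_k)`, `k ≠ j`. -/
def famJ (n : ℕ) (τ : ℂ) (j : Fin n) : Option ({k : Fin n // k ≠ j} × ℕ) → (confSharp n τ → ℂ)
  | none => 1
  | some (k, α) => fS n τ α j k

/-- As for the forms `eta`, variation of the single variable `c_k` isolates the functions attached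
to `k`. -/
theorem linearIndependent_famJ (hτ : 0 < τ.im) (j : Fin n) :
    LinearIndependent ℂ (famJ n τ j) := by
  rw [linearIndependent_iff]
  intro g hg
  obtain ⟨p, hp⟩ := (dense_conf (n := n) (τ := τ)).nonempty
  set N := (g.support.sup fun o => o.elim 0 fun x => x.2 + 1) with hN
  have hbig : ∀ k α, N ≤ α → g (some (k, α)) = 0 := fun k α hα => by
    by_contra hne
    have := Finset.le_sup (f := fun o : Option ({k : Fin n // k ≠ j} × ℕ) =>
      o.elim 0 fun x => x.2 + 1) (Finsupp.mem_support_iff.2 hne)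
    simp only [Option.elim_some] at this
    omega
  have key : ∀ w : confSharp n τ, g none + ∑ k : {k : Fin n // k ≠ j}, ∑ α ∈ Finset.range N,
      g (some (k, α)) * fij τ α j k w = 0 := by
    intro w
    have h1 := congrFun hg w
    have hsub : g.support ⊆ Finset.insertNone (Finset.univ ×ˢ Finset.range N) := by
      intro o ho
      match o with
      | none => simp
      | some (k, α) =>
        simp only [Finset.some_mem_insertNone, Finset.mem_product, Finset.mem_univ,
          Finset.mem_range, true_and]
        by_contra hne
        exact (Finsupp.mem_support_iff.1 ho) (hbig k α (not_lt.1 hne))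
    rw [Finsupp.linearCombination_apply, Finsupp.sum_of_support_subset g hsub _ (by simp),
      Finset.sum_insertNone, Finset.sum_product] at h1
    simpa [famJ, fS] using h1
  have hT : ∀ (k : {k : Fin n // k ≠ j}) α, g (some (k, α)) = 0 := by
    intro k α
    by_cases hα : N ≤ α
    · exact hbig k α hα
    -- the variation with `c_k` isolates the functions attached to `k`
    have hdiff : ∀ s : ℂ, ∑ α ∈ Finset.range N, g (some (k, α)) *
        (fcoef τ α (p j - p k) s - fcoef τ α (p j - p k) 0) = 0 := by
      intro s
      have e1 := key ⟨(p, Pi.single k.1 (-s)), hp⟩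
      have e2 := key ⟨(p, 0), hp⟩
      refine Eq.trans ?_ (sub_eq_zero.2 (e1.trans e2.symm))
      rw [add_sub_add_left_eq_sub, ← Finset.sum_sub_distrib, Finset.sum_eq_single k]
      · rw [← Finset.sum_sub_distrib]
        refine Finset.sum_congr rfl fun α _ => ?_
        simp [fij, k.2.symm]
        ring
      · intro m _ hm
        rw [← Finset.sum_sub_distrib]
        refine Finset.sum_eq_zero fun α _ => ?_
        have hm' : (m : Fin n) ≠ k := fun h => hm (Subtype.ext h)
        simp [fij, k.2.symm, hm']
      · simp
    have := kcoef_independent hτ (hp j k k.2.symm) (N + 1) (fun m => match m with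
        | 0 => -∑ α ∈ Finset.range N, g (some (k, α)) * fcoef τ α (p j - p k) 0
        | m + 1 => g (some (k, m))) (fun s => by
      rw [Finset.sum_range_succ', kcoef_zero hτ (hp j k k.2.symm), mul_one, ← sub_eq_add_neg,
        ← Finset.sum_sub_distrib]
      refine Eq.trans (Finset.sum_congr rfl fun α _ => ?_) (hdiff s)
      rw [← fcoef_eq_kcoef]
      ring) (α + 1) (by omega)
    exact this
  ext o
  match o with
  | none =>
    have := key ⟨(p, 0), hp⟩
    simpa [hT] using this
  | some (k, α) => exact hT k α

theorem exists_dual_famJ (hτ : 0 < τ.im) (j : Fin n) (o : Option ({k : Fin n // k ≠ j} × ℕ)) :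
    ∃ l : (confSharp n τ → ℂ) →ₗ[ℂ] ℂ, l (famJ n τ j o) = 1 ∧
      ∀ o', o' ≠ o → l (famJ n τ j o') = 0 := by
  obtain ⟨l, h1, h2⟩ := exists_functional
    ((linearIndependent_famJ hτ j).notMem_span_image (s := {o}ᶜ) (x := o) (by simp))
  exact ⟨l, h1, fun o' ho' => h2 _ (Submodule.subset_span ⟨o', ho', rfl⟩)⟩

/-- The functional takes the coefficient of the function `1` in the coefficient of `dc_i ∧ dp_j`. -/
theorem GG.X_lie_Y (hτ : 0 < τ.im) (i j : Fin n) : ⁅GG.gen n τ (.X i), GG.gen n τ (.Y j)⁆ =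
    if i = j then ∑ k ∈ Finset.univ.erase i, gT n τ i k 0 else -gT n τ i j 0 := by
  obtain ⟨l, h1, h2⟩ := exists_dual_famJ (n := n) hτ j none
  have h3 : ∀ k, k ≠ j → ∀ α, l (fS n τ α j k) = 0 := fun k hk α =>
    h2 (some (⟨k, hk⟩, α)) (by simp)
  have h4 : l 1 = 1 := h1
  have h := rel_ec_ep hτ l i j (N := 0) (fun k hk α _ => h3 k hk α)
  rw [h4, one_smul, Finset.sum_eq_zero (fun α _ => Finset.sum_eq_zero fun k hk => by
    rw [h3 k (Finset.ne_of_mem_erase hk), zero_smul]), add_zero, Finset.sum_eq_single 0] at h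
  · rw [h]
    split_ifs with hij
    · refine Finset.sum_congr rfl fun k hk => ?_
      rw [kS_zero hτ (Finset.ne_of_mem_erase hk).symm, h4, one_smul]
    · rw [kS_zero hτ hij, h4, one_smul]
  · intro α _ hα
    obtain ⟨α, rfl⟩ := Nat.exists_eq_succ_of_ne_zero hα
    split_ifs with hij
    · subst hij
      refine Finset.sum_eq_zero fun k hk => ?_
      rw [Nat.succ_eq_add_one, kS_succ, h3 k (Finset.ne_of_mem_erase hk), zero_smul]
    · rw [Nat.succ_eq_add_one, kS_succ, fS_swap hτ, map_smul, h3 i hij, smul_zero, zero_smul,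
        neg_zero]
  · simp

/-- The functional takes the coefficient of `f_α(p_j - p_k, c_j - c_k)` in the coefficient of `dc_i
∧ dp_j`. -/
theorem GG.X_lie_T (hτ : 0 < τ.im) (i j k : Fin n) (hkj : k ≠ j) (α : ℕ) :
    ⁅GG.gen n τ (.X i), gT n τ j k α⁆ =
      if i = j then gT n τ j k (α + 1) else if i = k then -gT n τ j k (α + 1) else 0 := by
  obtain ⟨l, h1, h2⟩ := exists_dual_famJ (n := n) hτ j (some (⟨k, hkj⟩, α))
  have h3 : ∀ m, m ≠ j → ∀ β, l (fS n τ β j m) = if m = k ∧ β = α then 1 else 0 := by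
    intro m hm β
    split_ifs with h
    · obtain ⟨rfl, rfl⟩ := h
      exact h1
    · exact h2 (some (⟨m, hm⟩, β)) (fun he => h (by
        simp only [Option.some.injEq, Prod.mk.injEq, Subtype.mk.injEq] at he
        exact he))
  have h4 : l 1 = 0 := h2 none (by simp)
  have h := rel_ec_ep hτ l i j (N := α + 1) (fun m hm β hβ => by
    rw [h3 m hm, if_neg (fun he => by omega)])
  have e1 : ∑ β ∈ Finset.range (α + 1 + 2), ∑ m ∈ Finset.univ.erase j,
      l (fS n τ β j m) • gT n τ j m β = gT n τ j k α := by
    rw [Finset.sum_eq_single α, Finset.sum_eq_single k]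
    · rw [h3 k hkj, if_pos ⟨rfl, rfl⟩, one_smul]
    · intro m hm hmk
      rw [h3 m (Finset.ne_of_mem_erase hm), if_neg (fun he => hmk he.1), zero_smul]
    · exact fun hne => absurd (Finset.mem_erase.2 ⟨hkj, Finset.mem_univ k⟩) hne
    · intro β _ hβ
      refine Finset.sum_eq_zero fun m hm => ?_
      rw [h3 m (Finset.ne_of_mem_erase hm), if_neg (fun he => hβ he.2), zero_smul]
    · exact fun hne => absurd (Finset.mem_range.2 (by omega)) hne
  rw [h4, zero_smul, zero_add, e1] at h
  rw [h, Finset.sum_range_succ']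
  have e0 : (if i = j then ∑ m ∈ Finset.univ.erase i, l (kS n τ 0 i m) • gT n τ i m 0
      else -(l (kS n τ 0 i j) • gT n τ i j 0)) = 0 := by
    split_ifs with hij
    · refine Finset.sum_eq_zero fun m hm => ?_
      rw [kS_zero hτ (Finset.ne_of_mem_erase hm).symm, h4, zero_smul]
    · rw [kS_zero hτ hij, h4, zero_smul, neg_zero]
  rw [e0, add_zero]
  simp only [kS_succ]
  by_cases hij : i = j
  · subst hij
    simp only [if_true]
    rw [Finset.sum_eq_single α, Finset.sum_eq_single k]
    · rw [h3 k hkj, if_pos ⟨rfl, rfl⟩, one_smul]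
    · intro m hm hmk
      rw [h3 m (Finset.ne_of_mem_erase hm), if_neg (fun he => hmk he.1), zero_smul]
    · exact fun hne => absurd (Finset.mem_erase.2 ⟨hkj, Finset.mem_univ k⟩) hne
    · intro β _ hβ
      refine Finset.sum_eq_zero fun m hm => ?_
      rw [h3 m (Finset.ne_of_mem_erase hm), if_neg (fun he => hβ he.2), zero_smul]
    · exact fun hne => absurd (Finset.mem_range.2 (by omega)) hne
  · simp only [if_neg hij, fS_swap hτ _ j i, map_smul, h3 i hij, smul_eq_mul]
    by_cases hik : i = k
    · subst hik
      rw [if_pos rfl, Finset.sum_eq_single α]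
      · rw [if_pos ⟨rfl, rfl⟩, mul_one, gT_swap (Ne.symm hij), smul_smul, neg_one_pow_mul_self,
          one_smul]
      · intro β _ hβ
        simp [hβ]
      · exact fun hne => absurd (Finset.mem_range.2 (by omega)) hne
    · simp [hik]

end Functionals

/-! ### Three points on the curve -/

section ThreePoints

variable {τ : ℂ}

theorem exists_range_of_mem_span {V : Type*} [AddCommGroup V] [Module ℂ V] {f : ℕ → V} {v : V}
    (h : v ∈ Submodule.span ℂ (Set.range f)) :
    ∃ (N : ℕ) (s : ℕ → ℂ), v = ∑ m ∈ Finset.range N, s m • f m := by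
  obtain ⟨c, rfl⟩ := Finsupp.mem_span_range_iff_exists_finsupp.1 h
  exact ⟨_, c, Finsupp.sum_of_support_subset c (Finset.subset_range_sup_succ _) _ (by simp)⟩

/-- The points `(p, c)` with `p` and `p + x` outside of the lattice. -/
abbrev Good (τ x : ℂ) : Type := {z : ℂ × ℂ // z.1 ∉ lat τ ∧ z.1 + x ∉ lat τ}

/-- The span of the functions `f_β(p, c)` and `f_β(p + x, c + r)`. -/
def twoPole (τ x r : ℂ) : Submodule ℂ (Good τ x → ℂ) :=
  Submodule.span ℂ (Set.range fun β z => fcoef τ β z.1.1 z.1.2) ⊔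
    Submodule.span ℂ (Set.range fun β z => fcoef τ β (z.1.1 + x) (z.1.2 + r))

theorem left_mem_twoPole (x r : ℂ) (β : ℕ) :
    (fun z : Good τ x => fcoef τ β z.1.1 z.1.2) ∈ twoPole τ x r :=
  Submodule.mem_sup_left (Submodule.subset_span ⟨β, rfl⟩)

theorem right_mem_twoPole (x r : ℂ) (β : ℕ) :
    (fun z : Good τ x => fcoef τ β (z.1.1 + x) (z.1.2 + r)) ∈ twoPole τ x r :=
  Submodule.mem_sup_right (Submodule.subset_span ⟨β, rfl⟩)

theorem dense_good (x : ℂ) : Dense {p : ℂ | p ∉ lat τ ∧ p + x ∉ lat τ} := by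
  have h : {p : ℂ | p ∉ lat τ ∧ p + x ∉ lat τ} =
      ((lat τ : Set ℂ) ∪ (fun p => p + x) ⁻¹' (lat τ : Set ℂ))ᶜ := by
    ext p
    simp
  rw [h]
  exact Set.Countable.dense_compl ℂ (countable_lat.union
    (countable_lat.preimage_of_injOn (add_left_injective x).injOn))

/-- The span of the functions `f_β(p, c)` and `f_β(p + x, c + r)` contains no constants: the
residues of a constant are zero. -/
theorem const_mem_twoPole (hτ : 0 < τ.im) {x : ℂ} (hx : x ∉ lat τ) (r : ℂ) {C : ℂ}
    (h : (fun _ => C : Good τ x → ℂ) ∈ twoPole τ x r) : C = 0 := by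
  obtain ⟨y, hy, y', hy', he⟩ := Submodule.mem_sup.1 h
  obtain ⟨N, s, rfl⟩ := exists_range_of_mem_span hy
  obtain ⟨N', s', rfl⟩ := exists_range_of_mem_span hy'
  have hval : ∀ z : Good τ x, ∑ m ∈ Finset.range N, s m * fcoef τ m z.1.1 z.1.2 +
      ∑ m ∈ Finset.range N', s' m * fcoef τ m (z.1.1 + x) (z.1.2 + r) = C := fun z => by
    have := congrFun he z
    simpa [Finset.sum_apply] using this
  have key : ∀ p c : ℂ, theta τ (p + x) * ∑ m ∈ Finset.range N, s m * numCoef τ (m + 1) p c +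
      theta τ p * ∑ m ∈ Finset.range N', s' m * numCoef τ (m + 1) (p + x) (c + r) =
      theta τ p * theta τ (p + x) * C := by
    intro p c
    have c1 := (differentiable_theta hτ).continuous
    have c3 : ∀ (m : ℕ) (y s : ℂ), Continuous fun p => numCoef τ m (p + y) s := fun m y s => by
      have h := Continuous.comp (g := fun z : ℂ × ℂ => numCoef τ m z.1 z.2)
        (f := fun p : ℂ => ((p + y, s) : ℂ × ℂ)) (differentiable_numCoef hτ m).continuous
        (by fun_prop)
      simpa only [Function.comp_def] using h
    have c2 : ∀ m, Continuous fun p : ℂ => numCoef τ m p c := fun m => by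
      simpa only [add_zero] using c3 m 0 c
    refine congrFun (Continuous.ext_on (f := fun p => theta τ (p + x) *
        ∑ m ∈ Finset.range N, s m * numCoef τ (m + 1) p c +
        theta τ p * ∑ m ∈ Finset.range N', s' m * numCoef τ (m + 1) (p + x) (c + r))
      (g := fun p => theta τ p * theta τ (p + x) * C) (dense_good (τ := τ) x) ?_ ?_
      fun p hp => ?_) p
    · refine Continuous.add (Continuous.mul (by fun_prop) ?_) (Continuous.mul (by fun_prop) ?_)
      · exact continuous_finsetSum _ fun m _ => (c2 (m + 1)).const_mul _
      · exact continuous_finsetSum _ fun m _ => (c3 (m + 1) x (c + r)).const_mul _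
    · fun_prop
    · simp only
      rw [← hval ⟨(p, c), hp⟩]
      simp only [← theta_mul_kcoef hτ hp.1, ← theta_mul_kcoef hτ hp.2, fcoef_eq_kcoef, mul_add,
        Finset.mul_sum]
      congr 1 <;> exact Finset.sum_congr rfl fun m _ => by ring
  have hs : ∀ m < N, s m = 0 := residue_independent hτ N s fun c => by
    have := key 0 c
    rw [theta_zero hτ, zero_mul, zero_mul, zero_mul, add_zero, zero_add] at this
    exact (mul_eq_zero.1 this).resolve_left (theta_ne_zero hτ hx)
  have hs' : ∀ m < N', s' m = 0 := residue_independent hτ N' s' fun c => by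
    have := key (-x) (c - r)
    rw [neg_add_cancel, theta_zero hτ, zero_mul, mul_zero, zero_mul, zero_add,
      sub_add_cancel] at this
    exact (mul_eq_zero.1 this).resolve_left (theta_ne_zero hτ (fun h => hx (by simpa using h)))
  obtain ⟨p, hp⟩ := (dense_good (τ := τ) x).nonempty
  rw [← hval ⟨(p, 0), hp⟩, Finset.sum_eq_zero, Finset.sum_eq_zero, add_zero]
  · intro m hm
    rw [hs' m (Finset.mem_range.1 hm), zero_mul]
  · intro m hm
    rw [hs m (Finset.mem_range.1 hm), zero_mul]

theorem coeff_X_pow_mul_X_pow (a b α β : ℕ) :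
    MvPolynomial.coeff (Finsupp.single 0 α + Finsupp.single 1 β)
      (MvPolynomial.X 0 ^ a * MvPolynomial.X 1 ^ b : MvPolynomial (Fin 2) ℂ) =
      if (a, b) = (α, β) then 1 else 0 := by
  rw [MvPolynomial.X_pow_eq_monomial, MvPolynomial.X_pow_eq_monomial, MvPolynomial.monomial_mul,
    MvPolynomial.coeff_monomial, mul_one]
  congr 1
  rw [eq_iff_iff]
  constructor
  · intro h
    have h0 := DFunLike.congr_fun h 0
    have h1 := DFunLike.congr_fun h 1
    simp at h0 h1
    rw [h0, h1]
  · intro h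
    simp only [Prod.mk.injEq] at h
    rw [h.1, h.2]

theorem exists_coeff_functional (α β : ℕ) : ∃ φ : MvPolynomial (Fin 2) ℂ →ₗ[ℂ] ℂ, ∀ x : ℕ × ℕ,
    φ (MvPolynomial.X 0 ^ x.1 * MvPolynomial.X 1 ^ x.2) = if x = (α, β) then 1 else 0 :=
  ⟨MvPolynomial.lcoeff ℂ (Finsupp.single 0 α + Finsupp.single 1 β),
    fun x => coeff_X_pow_mul_X_pow x.1 x.2 α β⟩

/-- The three-term identity expresses the product `f_α(p + q) f_β(q)` through products in which
one factor is a function of `p`. -/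
theorem fay_product (hτ : 0 < τ.im) (α β : ℕ) : ∃ (u v : ℕ × ℕ → ℂ) (s₁ s₂ s₃ : ℂ),
    ∀ p q c d : ℂ, p ∉ lat τ → q ∉ lat τ → p + q ∉ lat τ →
      fcoef τ α (p + q) (c + d) * fcoef τ β q d =
        ∑ x ∈ Finset.HasAntidiagonal.antidiagonal (α + β),
          (fcoef τ x.1 p c * u x) * fcoef τ x.2 q d +
        ∑ x ∈ Finset.HasAntidiagonal.antidiagonal (α + β),
          (fcoef τ x.1 (-p) (-c) * v x) * fcoef τ x.2 (p + q) (c + d) +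
        s₁ * fcoef τ (α + β + 1) q d + s₂ * fcoef τ (α + β + 1) (p + q) (c + d) +
        s₃ * fcoef τ (α + β + 1) p c := by
  obtain ⟨φ, hφ⟩ := exists_coeff_functional α β
  have hf := fun p q c d hp hq hpq => fay_mvPolynomial (τ := τ) hτ (p := p) (q := q) hp hq hpq c d
    (α + β) (MvPolynomial.X 0) (MvPolynomial.X 1) rfl rfl
  generalize (MvPolynomial.X 0 : MvPolynomial (Fin 2) ℂ) = a,
    (MvPolynomial.X 1 : MvPolynomial (Fin 2) ℂ) = b at hf hφ
  refine ⟨fun x => φ (a ^ x.1 * (a + b) ^ x.2), fun x => φ (b ^ x.1 * (a + b) ^ x.2),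
    φ (hpoly (α + β) (a + b) b), φ (hpoly (α + β) (a + b) a), φ (hpoly (α + β) a (-b)),
    fun p q c d hp hq hpq => ?_⟩
  have h := congrArg φ (hf p q c d hp hq hpq)
  simp only [map_add, map_sum, map_smul, smul_eq_mul, hφ, mul_ite, mul_one, mul_zero,
    Finset.sum_ite_eq', Finset.HasAntidiagonal.mem_antidiagonal, if_true] at h
  rw [h]
  simp only [mul_right_comm _ (φ _), mul_comm (φ _)]

end ThreePoints

section PairRelations

variable {n : ℕ} {τ : ℂ}

theorem continuousAt_fij (hτ : 0 < τ.im) (α : ℕ) {i j : Fin n} {w : V2 n}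
    (hw : w.1 i - w.1 j ∉ lat τ) : ContinuousAt (fij τ α i j) w :=
  ContinuousAt.comp (f := diffMap i j) (g := fun z : ℂ × ℂ => fcoef τ α z.1 z.2)
    (differentiableAt_kcoef hτ (α + 1) (x := diffMap i j w) hw).continuousAt
    (diffMap i j).continuous.continuousAt

/-- The coefficient of `dp_i` in a form of the basis. -/
def coefP (n : ℕ) (τ : ℂ) (i : Fin n) (a : Idx n) : confSharp n τ → ℂ := fun w => eta n τ a w (ep i)

theorem eval2_wedge (i j : Fin n) (a b : Idx n) :
    eval2 τ (ep i) (ep j) (wedge (eta n τ a) (eta n τ b)) =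
      coefP n τ i a * coefP n τ j b - coefP n τ i b * coefP n τ j a := by
  funext w
  simp only [eval2, LinearMap.coe_mk, AddHom.coe_mk, wedge, coefP, Pi.sub_apply, Pi.mul_apply]
  ring

/-- The form `a` is `ω_ij^α` or `ω_ji^α`. -/
def IsPair (i j : Fin n) (α : ℕ) (a : Idx n) : Prop :=
  (∃ h : i < j, a = .T i j h α) ∨ ∃ h : j < i, a = .T j i h α

/-- The coefficient of `dp_i` in a form of the basis is zero, or `1` for `dp_i`, or a multiple of
some `f_α(p_i - p_l, c_i - c_l)`. -/
theorem coefP_cases (hτ : 0 < τ.im) (i : Fin n) (a : Idx n) :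
    coefP n τ i a = 0 ∨ (a = .Y i ∧ coefP n τ i a = 1) ∨
      ∃ (l : Fin n) (α : ℕ) (s : ℂ), l ≠ i ∧ coefP n τ i a = s • fS n τ α i l ∧ IsPair i l α a := by
  cases a with
  | X k => exact Or.inl rfl
  | Y k =>
    by_cases hk : k = i
    · subst hk
      exact Or.inr (Or.inl ⟨rfl, funext fun w => by simp [coefP, eta_Y]⟩)
    · exact Or.inl (funext fun w => by simp [coefP, eta_Y, hk])
  | T k l h α =>
    by_cases hk : k = i
    · subst hk
      exact Or.inr (Or.inr ⟨l, α, 1, h.ne', funext fun w => by simp [coefP, eta_T, h.ne', fS],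
        Or.inl ⟨h, rfl⟩⟩)
    · by_cases hl : l = i
      · subst hl
        refine Or.inr (Or.inr ⟨k, α, -(-1) ^ (α + 1), hk, ?_, Or.inr ⟨h, rfl⟩⟩)
        rw [fS_swap hτ, smul_smul, neg_mul, neg_one_pow_mul_self]
        funext w
        simp [coefP, eta_T, hk, fS]
      · exact Or.inl (funext fun w => by simp [coefP, eta_T, hk, hl])

/-- Products of two forms attached to the same pair vanish, as both are multiples of `dp_ij`. -/
theorem eval2_wedge_pair (i j : Fin n) {a b : Idx n} {α β : ℕ} (ha : IsPair i j α a)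
    (hb : IsPair i j β b) : eval2 τ (ep i) (ep j) (wedge (eta n τ a) (eta n τ b)) = 0 := by
  funext w
  rcases ha with ⟨h, rfl⟩ | ⟨h, rfl⟩ <;> rcases hb with ⟨h', rfl⟩ | ⟨h', rfl⟩
  · simp only [eval2, LinearMap.coe_mk, AddHom.coe_mk, wedge, eta_T, Pi.zero_apply]
    ring
  · exact absurd h h'.not_gt
  · exact absurd h h'.not_gt
  · simp only [eval2, LinearMap.coe_mk, AddHom.coe_mk, wedge, eta_T, Pi.zero_apply]
    ring

/-- If a product of two forms of the basis has a coefficient of `dp_i ∧ dp_j` which is independent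
of those of all other products, then the corresponding elements of the dual basis commute. -/
theorem lie_gen_of_notMem (hτ : 0 < τ.im) (i j : Fin n) {A B : Idx n} (hAB : A ≠ B)
    {P : Submodule ℂ (confSharp n τ → ℂ)}
    (hT : eval2 τ (ep i) (ep j) (wedge (eta n τ A) (eta n τ B)) ∉ P)
    (hP : ∀ a b, ¬(a = A ∧ b = B) → ¬(a = B ∧ b = A) →
      eval2 τ (ep i) (ep j) (wedge (eta n τ a) (eta n τ b)) ∈ P) :
    ⁅GG.gen n τ A, GG.gen n τ B⁆ = 0 := by
  obtain ⟨l, h1, h2⟩ := exists_functional hT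
  refine lie_gen_eq_zero hτ l (ep i) (ep j) A B (fun a => ?_) fun a b => ?_
  · have : eval2 τ (ep i) (ep j) (dForm (eta n τ a)) = 0 := by
      funext w
      change dForm (eta n τ a) w (ep i) (ep j) = 0
      rw [IsT1n.dForm_eta hτ]
      cases a <;> simp [IsT1n.dEta, dc]
    rw [this, map_zero]
  · by_cases hab : a = A ∧ b = B
    · obtain ⟨rfl, rfl⟩ := hab
      rw [h1, if_pos ⟨rfl, rfl⟩, if_neg (fun h => hAB h.1), sub_zero]
    · by_cases hba : a = B ∧ b = A
      · obtain ⟨rfl, rfl⟩ := hba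
        have : eval2 τ (ep i) (ep j) (wedge (eta n τ a) (eta n τ b)) =
            -eval2 τ (ep i) (ep j) (wedge (eta n τ b) (eta n τ a)) := by
          rw [eval2_wedge, eval2_wedge, neg_sub]
        rw [this, map_neg, h1, if_neg hab, if_pos ⟨rfl, rfl⟩, zero_sub]
      · rw [h2 _ (hP a b hab hba), if_neg hab, if_neg hba, sub_zero]

/-- The restriction of functions to the configuration space. -/
def restr (n : ℕ) (τ : ℂ) : (V2 n → ℂ) →ₗ[ℂ] (confSharp n τ → ℂ) :=
  LinearMap.funLeft ℂ ℂ Subtype.val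

/-- The points with `p_i` and `p_j` different from all other coordinates. -/
def nearConf (n : ℕ) (τ : ℂ) (i j : Fin n) : Set (V2 n) :=
  {w | (∀ l, l ≠ i → w.1 i - w.1 l ∉ lat τ) ∧ ∀ l, l ≠ j → w.1 j - w.1 l ∉ lat τ}

/-- The points with all coordinates but those with indices `i` and `j` at the origin. -/
def locus (n : ℕ) (i j : Fin n) (x r : ℂ) (z : ℂ × ℂ) : V2 n :=
  (fun k => if k = i then z.1 + x else if k = j then z.1 else 0,
    fun k => if k = i then z.2 + r else if k = j then z.2 else 0)

theorem locus_mem_nearConf {i j : Fin n} (hij : i ≠ j) {x : ℂ} (hx : x ∉ lat τ) (r : ℂ)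
    (z : Good τ x) : locus n i j x r z.1 ∈ nearConf n τ i j := by
  have hx' : -x ∉ lat τ := fun h => hx (by simpa using h)
  refine ⟨fun l hl => ?_, fun l hl => ?_⟩
  · by_cases hlj : l = j
    · simpa [locus, hlj, hij.symm] using hx
    · simpa [locus, hlj, hl] using z.2.2
  · by_cases hli : l = i
    · simpa [locus, hli, hij.symm] using hx'
    · simpa [locus, hli, hl, hij.symm] using z.2.1

/-- Continuous functions which for three points become sums of functions with a simple pole at
one of the first two points and of a combination of the functions `f_γ` of their difference. -/
def repHat (n : ℕ) (τ : ℂ) (i j : Fin n) : Submodule ℂ (V2 n → ℂ) where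
  carrier := {G | ContinuousOn G (nearConf n τ i j) ∧
    ∃ A ∈ Submodule.span ℂ (Set.range fun γ (z : ℂ × ℂ) => fcoef τ γ z.1 z.2),
      ∀ x, x ∉ lat τ → ∀ r,
        (fun z : Good τ x => G (locus n i j x r z.1) - A (x, r)) ∈ twoPole τ x r}
  zero_mem' := ⟨continuousOn_const, 0, zero_mem _, fun x _ r => by
    convert zero_mem (twoPole τ x r) using 1; funext z; simp⟩
  add_mem' := by
    rintro G G' ⟨hG, A, hA, h⟩ ⟨hG', A', hA', h'⟩
    refine ⟨hG.add hG', A + A', add_mem hA hA', fun x hx r => ?_⟩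
    convert add_mem (h x hx r) (h' x hx r) using 1
    funext z
    simp only [Pi.add_apply]
    ring
  smul_mem' := by
    rintro s G ⟨hG, A, hA, h⟩
    refine ⟨hG.const_smul s, s • A, Submodule.smul_mem _ s hA, fun x hx r => ?_⟩
    convert Submodule.smul_mem _ s (h x hx r) using 1
    funext z
    simp only [Pi.smul_apply, smul_eq_mul]
    ring

theorem fij_locus_left {i j : Fin n} (hij : i ≠ j) (α : ℕ) {l : Fin n} (hl : l ≠ i) (x r : ℂ)
    (z : ℂ × ℂ) : fij τ α i l (locus n i j x r z) =
      if l = j then fcoef τ α x r else fcoef τ α (z.1 + x) (z.2 + r) := by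
  by_cases hlj : l = j
  · simp [fij, locus, hlj, hij.symm]
  · simp [fij, locus, hlj, hl]

theorem fij_locus_right (hτ : 0 < τ.im) {i j : Fin n} (hij : i ≠ j) (α : ℕ) {l : Fin n} (hl : l ≠ j)
    (x r : ℂ) (z : ℂ × ℂ) : fij τ α j l (locus n i j x r z) =
      if l = i then (-1) ^ (α + 1) * fcoef τ α x r else fcoef τ α z.1 z.2 := by
  by_cases hli : l = i
  · rw [if_pos hli, ← fcoef_neg hτ]
    simp [fij, locus, hli, hij.symm]
  · simp [fij, locus, hli, hl, hij.symm]

theorem fij_left_mem_repHat (hτ : 0 < τ.im) {i j : Fin n} (hij : i ≠ j) (α : ℕ) {l : Fin n}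
    (hl : l ≠ i) : fij τ α i l ∈ repHat n τ i j := by
  refine ⟨fun w hw => (continuousAt_fij hτ α (hw.1 l hl)).continuousWithinAt, ?_⟩
  simp only [fij_locus_left hij α hl]
  split_ifs with hlj
  · refine ⟨_, Submodule.subset_span ⟨α, rfl⟩, fun x _ r => ?_⟩
    convert zero_mem (twoPole τ x r) using 1; funext z; simp
  · refine ⟨0, zero_mem _, fun x _ r => ?_⟩
    simpa using! right_mem_twoPole x r α

theorem fij_right_mem_repHat (hτ : 0 < τ.im) {i j : Fin n} (hij : i ≠ j) (α : ℕ) {l : Fin n}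
    (hl : l ≠ j) : fij τ α j l ∈ repHat n τ i j := by
  refine ⟨fun w hw => (continuousAt_fij hτ α (hw.2 l hl)).continuousWithinAt, ?_⟩
  simp only [fij_locus_right hτ hij α hl]
  split_ifs with hlj
  · refine ⟨_, Submodule.smul_mem _ ((-1) ^ (α + 1)) (Submodule.subset_span ⟨α, rfl⟩),
      fun x _ r => ?_⟩
    convert zero_mem (twoPole τ x r) using 1; funext z; simp
  · refine ⟨0, zero_mem _, fun x _ r => ?_⟩
    simpa using! left_mem_twoPole x r α

/-- If both factors have a pole at one of the other points, the three-term identity removes the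
product of two poles; in all other cases one factor is constant along the locus. -/
theorem fij_mul_fij_mem_repHat (hτ : 0 < τ.im) {i j : Fin n} (hij : i ≠ j) (α β : ℕ) {l m : Fin n}
    (hl : l ≠ i) (hm : m ≠ j) (hlm : ¬(l = j ∧ m = i)) :
    fij τ α i l * fij τ β j m ∈ repHat n τ i j := by
  refine ⟨fun w hw => ((continuousAt_fij hτ α (hw.1 l hl)).mul
    (continuousAt_fij hτ β (hw.2 m hm))).continuousWithinAt, ?_⟩
  simp only [Pi.mul_apply, fij_locus_left hij α hl, fij_locus_right hτ hij β hm]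
  split_ifs with hlj hmi hmi
  · exact absurd ⟨hlj, hmi⟩ hlm
  · refine ⟨0, zero_mem _, fun x _ r => ?_⟩
    simpa using! Submodule.smul_mem _ (fcoef τ α x r) (left_mem_twoPole x r β)
  · refine ⟨0, zero_mem _, fun x _ r => ?_⟩
    convert Submodule.smul_mem _ ((-1) ^ (β + 1) * fcoef τ β x r)
      (right_mem_twoPole (τ := τ) x r α) using 1
    funext z
    simp only [Pi.zero_apply, sub_zero, Pi.smul_apply, smul_eq_mul]
    ring
  · obtain ⟨u, v, s₁, s₂, s₃, h⟩ := fay_product hτ α β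
    refine ⟨_, Submodule.smul_mem _ s₃ (Submodule.subset_span ⟨α + β + 1, rfl⟩), fun x hx r => ?_⟩
    have hmem : (∑ y ∈ Finset.HasAntidiagonal.antidiagonal (α + β), (fcoef τ y.1 x r * u y) •
        (fun z : Good τ x => fcoef τ y.2 z.1.1 z.1.2)) +
        (∑ y ∈ Finset.HasAntidiagonal.antidiagonal (α + β), (fcoef τ y.1 (-x) (-r) * v y) •
        (fun z : Good τ x => fcoef τ y.2 (z.1.1 + x) (z.1.2 + r))) +
        s₁ • (fun z : Good τ x => fcoef τ (α + β + 1) z.1.1 z.1.2) +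
        s₂ • (fun z : Good τ x => fcoef τ (α + β + 1) (z.1.1 + x) (z.1.2 + r)) ∈ twoPole τ x r :=
      add_mem (add_mem (add_mem
        (sum_mem fun y _ => Submodule.smul_mem _ _ (left_mem_twoPole x r _))
        (sum_mem fun y _ => Submodule.smul_mem _ _ (right_mem_twoPole x r _)))
        (Submodule.smul_mem _ _ (left_mem_twoPole x r _)))
        (Submodule.smul_mem _ _ (right_mem_twoPole x r _))
    convert hmem using 1
    funext z
    have hz := h x z.1.1 r z.1.2 hx z.2.1 (by rw [add_comm]; exact z.2.2)
    rw [add_comm x, add_comm r] at hz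
    rw [hz]
    simp only [Pi.add_apply, Finset.sum_apply, Pi.smul_apply, smul_eq_mul]
    ring

/-- Functions which agree on the configuration space agree on every larger set on which both are
continuous. -/
theorem eqOn_of_restr {S : Set (V2 n)} (hS : confSharp n τ ⊆ S) {G G' : V2 n → ℂ}
    (hG : ContinuousOn G S) (hG' : ContinuousOn G' S) (h : restr n τ G = restr n τ G') :
    Set.EqOn G G' S :=
  Set.EqOn.of_subset_closure (s := confSharp n τ) (fun w hw => congrFun h ⟨w, hw⟩) hG hG' hS
    (fun w _ => dense_confSharp w)

/-- A representation of `1` would, for all `x`, express `1 - A(x, r)` through functions of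
`twoPole`, so that `A = 1`; but `1` and the functions `f_γ` are linearly independent. -/
theorem one_notMem_repHat (hτ : 0 < τ.im) {i j : Fin n} (hij : i ≠ j) :
    (1 : confSharp n τ → ℂ) ∉ (repHat n τ i j).map (restr n τ) := by
  rintro ⟨G, ⟨hG, A, hA, h⟩, hG1⟩
  have hone : Set.EqOn G (fun _ => 1) (nearConf n τ i j) :=
    eqOn_of_restr (S := nearConf n τ i j)
      (fun w hw => ⟨fun l hl => hw i l hl.symm, fun l hl => hw j l hl.symm⟩) hG
      continuousOn_const hG1
  have hA1 : ∀ x, x ∉ lat τ → ∀ r, A (x, r) = 1 := fun x hx r => by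
    have h1 : (fun _ => 1 - A (x, r) : Good τ x → ℂ) ∈ twoPole τ x r := by
      convert h x hx r using 1
      funext z
      rw [hone (locus_mem_nearConf hij hx r z)]
    exact (sub_eq_zero.1 (const_mem_twoPole hτ hx r h1)).symm
  obtain ⟨N, s, rfl⟩ := exists_range_of_mem_span hA
  obtain ⟨x, hx⟩ := (Set.Countable.dense_compl ℂ (countable_lat (τ := τ))).nonempty
  have := kcoef_independent hτ hx (N + 1) (fun m => match m with
    | 0 => -1
    | m + 1 => s m) (fun r => by
      rw [Finset.sum_range_succ', kcoef_zero hτ hx, mul_one, ← sub_eq_add_neg, sub_eq_zero,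
        ← hA1 x hx r]
      simp [Finset.sum_apply, fcoef_eq_kcoef]) 0 (by omega)
  norm_num at this

/-- The coefficient of `dp_i ∧ dp_j` of the product of `dp_i` and `dp_j` is `1`, which is not a
combination of the coefficients of the other products. -/
theorem GG.Y_lie_Y (hτ : 0 < τ.im) (i j : Fin n) :
    ⁅GG.gen n τ (.Y i), GG.gen n τ (.Y j)⁆ = 0 := by
  by_cases hij : i = j
  · rw [hij, lie_self]
  have hprod : ∀ a b : Idx n, ¬(a = .Y i ∧ b = .Y j) →
      (∀ α β, ¬(IsPair i j α a ∧ IsPair i j β b)) →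
      coefP n τ i a * coefP n τ j b ∈ (repHat n τ i j).map (restr n τ) := by
    intro a b h1 h2
    rcases coefP_cases hτ i a with ha | ⟨ha, ha'⟩ | ⟨l, α, s, hl, ha, haT⟩
    · rw [ha, zero_mul]
      exact zero_mem _
    · rcases coefP_cases hτ j b with hb | ⟨hb, hb'⟩ | ⟨m, β, s', hm, hb, hbT⟩
      · rw [hb, mul_zero]
        exact zero_mem _
      · exact absurd ⟨ha, hb⟩ h1
      · rw [ha', one_mul, hb]
        exact Submodule.smul_mem _ _ ⟨_, fij_right_mem_repHat hτ hij β hm, rfl⟩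
    · rcases coefP_cases hτ j b with hb | ⟨hb, hb'⟩ | ⟨m, β, s', hm, hb, hbT⟩
      · rw [hb, mul_zero]
        exact zero_mem _
      · rw [hb', mul_one, ha]
        exact Submodule.smul_mem _ _ ⟨_, fij_left_mem_repHat hτ hij α hl, rfl⟩
      · rw [ha, hb, smul_mul_smul_comm]
        refine Submodule.smul_mem _ _ ⟨_, fij_mul_fij_mem_repHat hτ hij α β hl hm ?_, rfl⟩
        rintro ⟨rfl, rfl⟩
        exact h2 α β ⟨haT, hbT.symm⟩
  refine lie_gen_of_notMem hτ i j (fun h => hij (Idx.Y.inj h))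
    (P := (repHat n τ i j).map (restr n τ)) ?_ fun a b hab hba => ?_
  · have : eval2 τ (ep i) (ep j) (wedge (eta n τ (.Y i)) (eta n τ (.Y j))) = 1 := by
      funext w
      simp [eval2, wedge, eta_Y, hij]
    rw [this]
    exact one_notMem_repHat hτ hij
  · by_cases hp : ∃ α β, IsPair i j α a ∧ IsPair i j β b
    · obtain ⟨α, β, ha, hb⟩ := hp
      rw [eval2_wedge_pair i j ha hb]
      exact zero_mem _
    · push Not at hp
      rw [eval2_wedge]
      exact sub_mem (hprod a b hab fun α β h => hp α β h.1 h.2)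
        (hprod b a (fun h => hba ⟨h.2, h.1⟩) fun α β h => hp β α h.2 h.1)

/-- The points with `p_i` different from all other coordinates, and `p_j` different from all
coordinates except possibly `p_k`. -/
def nearDiag (n : ℕ) (τ : ℂ) (i j k : Fin n) : Set (V2 n) :=
  {w | (∀ l, l ≠ i → w.1 i - w.1 l ∉ lat τ) ∧ ∀ l, l ≠ j → l ≠ k → w.1 j - w.1 l ∉ lat τ}

/-- Points of the diagonal `p_j = p_k = 0`, with all coordinates except `p_i` fixed. -/
def diagLocus (n : ℕ) (i j k : Fin n) (q : ℂ) (z : ℂ × ℂ) : V2 n :=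
  (fun l => if l = i then z.1 else if l = j ∨ l = k then 0 else q, fun l => if l = i then z.2 else 0)

theorem diagLocus_mem_nearDiag {i j k : Fin n} (hij : i ≠ j) {q : ℂ}
    (hq : q ∉ lat τ) (z : Good τ (-q)) : diagLocus n i j k q z.1 ∈ nearDiag n τ i j k := by
  have hq' : -q ∉ lat τ := fun h => hq (by simpa using h)
  refine ⟨fun l hl => ?_, fun l hl hlk => ?_⟩
  · by_cases hlj : l = j ∨ l = k
    · simpa [diagLocus, hlj, hl] using z.2.1
    · simpa [diagLocus, hlj, hl, sub_eq_add_neg] using z.2.2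
  · by_cases hli : l = i
    · have := z.2.1
      simpa [diagLocus, hli, hij.symm] using this
    · simpa [diagLocus, hli, hij.symm, hl, hlk] using hq

/-- Continuous functions which on the above points of the diagonal have simple poles only. -/
def diagHat (n : ℕ) (τ : ℂ) (i j k : Fin n) (q : ℂ) : Submodule ℂ (V2 n → ℂ) where
  carrier := {G | ContinuousOn G (nearDiag n τ i j k) ∧
    (fun z : Good τ (-q) => G (diagLocus n i j k q z.1)) ∈ twoPole τ (-q) 0}
  zero_mem' := ⟨continuousOn_const, zero_mem _⟩
  add_mem' := by
    rintro G G' ⟨hG, h⟩ ⟨hG', h'⟩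
    exact ⟨hG.add hG', add_mem h h'⟩
  smul_mem' := by
    rintro s G ⟨hG, h⟩
    exact ⟨hG.const_smul s, Submodule.smul_mem _ s h⟩

/-- The function `θ(p_j - p_k)`. -/
def thetaFun (n : ℕ) (τ : ℂ) (j k : Fin n) : V2 n → ℂ := fun w => theta τ (w.1 j - w.1 k)

/-- The functions which after multiplication by `θ(p_j - p_k)` belong to `diagHat`. -/
def diagSpace (n : ℕ) (τ : ℂ) (i j k : Fin n) (q : ℂ) : Submodule ℂ (confSharp n τ → ℂ) :=
  ((diagHat n τ i j k q).map (restr n τ)).comap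
    (LinearMap.mulLeft ℂ (restr n τ (thetaFun n τ j k)))

theorem mem_diagSpace {i j k : Fin n} {q : ℂ} {F : confSharp n τ → ℂ} (G : V2 n → ℂ)
    (hG : ∀ w : confSharp n τ, theta τ ((w : V2 n).1 j - (w : V2 n).1 k) * F w = G w)
    (hc : ∀ w ∈ nearDiag n τ i j k, ContinuousAt G w)
    (h : (fun z : Good τ (-q) => G (diagLocus n i j k q z.1)) ∈ twoPole τ (-q) 0) :
    F ∈ diagSpace n τ i j k q :=
  ⟨G, ⟨fun w hw => (hc w hw).continuousWithinAt, h⟩, funext fun w => (hG w).symm⟩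

theorem continuous_thetaFun (hτ : 0 < τ.im) (j k : Fin n) : Continuous (thetaFun n τ j k) := by
  have := (differentiable_theta hτ).continuous
  unfold thetaFun
  fun_prop

/-- A function without pole on the diagonal `p_j = p_k` belongs to `diagSpace`. -/
theorem mem_diagSpace_of_continuous (hτ : 0 < τ.im) {i j k : Fin n} (hij : i ≠ j) (hik : i ≠ k)
    {q : ℂ} (G : V2 n → ℂ) (hc : ∀ w ∈ nearDiag n τ i j k, ContinuousAt G w) :
    restr n τ G ∈ diagSpace n τ i j k q := by
  refine mem_diagSpace (thetaFun n τ j k * G) (fun w => rfl)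
    (fun w hw => (continuous_thetaFun hτ j k).continuousAt.mul (hc w hw)) ?_
  convert zero_mem (twoPole τ (-q) 0) using 1
  funext z
  simp [thetaFun, diagLocus, hij.symm, hik.symm, theta_zero hτ]

theorem fij_mem_twoPole {i j k : Fin n} (q : ℂ) (α : ℕ) {l : Fin n} (hl : l ≠ i) :
    (fun z : Good τ (-q) => fij τ α i l (diagLocus n i j k q z.1)) ∈ twoPole τ (-q) 0 := by
  by_cases hlj : l = j ∨ l = k
  · convert left_mem_twoPole (τ := τ) (-q) 0 α using 1
    funext z
    simp [fij, diagLocus, hl, hlj]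
  · convert right_mem_twoPole (τ := τ) (-q) 0 α using 1
    funext z
    simp [fij, diagLocus, hl, hlj, sub_eq_add_neg]

/-- On the diagonal `p_j = p_k`, `c_j = c_k` only `f_0(p_j - p_k, c_j - c_k)` has a residue, and it
equals `1`. -/
theorem numCoef_diagLocus (hτ : 0 < τ.im) {i j k : Fin n} (hij : i ≠ j) (hik : i ≠ k) (q : ℂ)
    (β : ℕ) (z : ℂ × ℂ) : numCoef τ (β + 1)
      ((diagLocus n i j k q z).1 j - (diagLocus n i j k q z).1 k)
      ((diagLocus n i j k q z).2 j - (diagLocus n i j k q z).2 k) = if β = 0 then 1 else 0 := by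
  simp only [diagLocus, hij.symm, hik.symm, if_false, true_or, or_true, if_true, sub_self,
    numCoef_succ_zero_left hτ, neg_zero]
  split_ifs with hβ
  · simp [hβ]
  · simp [hβ]

/-- The coefficient of `dp_i ∧ dp_j` of the product of `dp_i` and `ω_jk^0` has residue `1` along the
diagonal `p_j = p_k`, while the residues of the other coefficients belong to `twoPole`, which
contains no non-zero constants. -/
theorem GG.Y_lie_T (hτ : 0 < τ.im) {i j k : Fin n} (hij : i ≠ j) (hik : i ≠ k) (hjk : j ≠ k) :
    ⁅GG.gen n τ (.Y i), gT n τ j k 0⁆ = 0 := by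
  obtain ⟨q, hq⟩ := (Set.Countable.dense_compl ℂ (countable_lat (τ := τ))).nonempty
  have hq' : -q ∉ lat τ := fun h => hq (by simpa using h)
  obtain ⟨B, hB, hBp⟩ : ∃ B, gT n τ j k 0 = GG.gen n τ B ∧ IsPair j k 0 B := by
    rcases lt_or_gt_of_ne hjk with h | h
    · exact ⟨_, gT_of_lt h 0, Or.inl ⟨h, rfl⟩⟩
    · refine ⟨_, ?_, Or.inr ⟨h, rfl⟩⟩
      rw [gT_swap h.ne, pow_zero, one_smul, gT_of_lt h]
  have hBuniq : ∀ b, IsPair j k 0 b → b = B := fun b hb => by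
    rcases hb with ⟨h, rfl⟩ | ⟨h, rfl⟩ <;> rcases hBp with ⟨h', rfl⟩ | ⟨h', rfl⟩
    · rfl
    · exact absurd h h'.not_gt
    · exact absurd h h'.not_gt
    · rfl
  have hprod : ∀ a b : Idx n, ¬(a = .Y i ∧ b = B) →
      coefP n τ i a * coefP n τ j b ∈ diagSpace n τ i j k q := by
    intro a b h1
    have hcl : ∀ (α : ℕ) (l : Fin n), l ≠ i → ∀ w ∈ nearDiag n τ i j k,
        ContinuousAt (fij τ α i l) w := fun α l hl w hw => continuousAt_fij hτ α (hw.1 l hl)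
    have hcm : ∀ (β : ℕ) (m : Fin n), m ≠ j → m ≠ k → ∀ w ∈ nearDiag n τ i j k,
        ContinuousAt (fij τ β j m) w := fun β m hm hmk w hw => continuousAt_fij hτ β (hw.2 m hm hmk)
    have hth : ∀ β (w : confSharp n τ), theta τ ((w : V2 n).1 j - (w : V2 n).1 k) *
        fS n τ β j k w = numCoef τ (β + 1) ((w : V2 n).1 j - (w : V2 n).1 k)
          ((w : V2 n).2 j - (w : V2 n).2 k) := fun β w => theta_mul_kcoef hτ (w.2 j k hjk) _ _
    rcases coefP_cases hτ i a with ha | ⟨ha, ha'⟩ | ⟨l, α, s, hl, ha, -⟩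
    · rw [ha, zero_mul]
      exact zero_mem _
    · rcases coefP_cases hτ j b with hb | ⟨hb, hb'⟩ | ⟨m, β, s', hm, hb, hbT⟩
      · rw [hb, mul_zero]
        exact zero_mem _
      · rw [ha', hb', mul_one]
        exact mem_diagSpace_of_continuous hτ hij hik (fun _ => 1) fun w _ => continuousAt_const
      · rw [ha', one_mul, hb]
        refine Submodule.smul_mem _ _ ?_
        by_cases hmk : m = k
        · subst hmk
          have hβ : β ≠ 0 := by
            rintro rfl
            exact h1 ⟨ha, hBuniq b hbT⟩
          refine mem_diagSpace _ (hth β) (fun w _ => (continuous_numCoef hτ _ j m).continuousAt) ?_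
          simp only [numCoef_diagLocus hτ hij hik, if_neg hβ]
          exact zero_mem _
        · exact mem_diagSpace_of_continuous hτ hij hik _ (hcm β m hm hmk)
    · rcases coefP_cases hτ j b with hb | ⟨hb, hb'⟩ | ⟨m, β, s', hm, hb, hbT⟩
      · rw [hb, mul_zero]
        exact zero_mem _
      · rw [hb', mul_one, ha]
        exact Submodule.smul_mem _ _ (mem_diagSpace_of_continuous hτ hij hik _ (hcl α l hl))
      · rw [ha, hb, smul_mul_smul_comm]
        refine Submodule.smul_mem _ _ ?_
        by_cases hmk : m = k
        · subst hmk
          refine mem_diagSpace (fun w => fij τ α i l w * numCoef τ (β + 1) (w.1 j - w.1 m)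
            (w.2 j - w.2 m)) (fun w => ?_) (fun w hw => (hcl α l hl w hw).mul
              (continuous_numCoef hτ _ j m).continuousAt) ?_
          · rw [← hth, Pi.mul_apply]
            simp only [fS]
            ring
          · simp only [numCoef_diagLocus hτ hij hik]
            split_ifs
            · simpa only [mul_one] using fij_mem_twoPole q α hl
            · simp only [mul_zero]
              exact zero_mem _
        · exact mem_diagSpace_of_continuous hτ hij hik (fij τ α i l * fij τ β j m)
            fun w hw => (hcl α l hl w hw).mul (hcm β m hm hmk w hw)
  rw [hB]
  refine lie_gen_of_notMem hτ i j (P := diagSpace n τ i j k q) ?_ ?_ fun a b hab hba => ?_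
  · rintro rfl
    rcases hBp with ⟨h, h'⟩ | ⟨h, h'⟩ <;> cases h'
  · have : eval2 τ (ep i) (ep j) (wedge (eta n τ (.Y i)) (eta n τ B)) = fS n τ 0 j k := by
      rcases hBp with ⟨h, rfl⟩ | ⟨h, rfl⟩
      · funext w
        simp [eval2, wedge, eta_Y, eta_T, hij.symm, hij, hik.symm, hjk.symm, fS]
      · rw [fS_swap hτ]
        funext w
        simp [eval2, wedge, eta_Y, eta_T, hij.symm, hij, hik.symm, hjk.symm, fS]
    rw [this]
    rintro ⟨G, ⟨hG, h⟩, hG1⟩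
    have hnum : Set.EqOn G (fun w => numCoef τ 1 (w.1 j - w.1 k) (w.2 j - w.2 k))
        (nearDiag n τ i j k) :=
      eqOn_of_restr (S := nearDiag n τ i j k)
        (fun w hw => ⟨fun l hl => hw i l hl.symm, fun l hl _ => hw j l hl.symm⟩) hG
        (continuous_numCoef hτ 1 j k).continuousOn (hG1.trans (funext fun w =>
          theta_mul_kcoef hτ (w.2 j k hjk) _ _))
    have h1 : (fun _ => 1 : Good τ (-q) → ℂ) ∈ twoPole τ (-q) 0 := by
      convert h using 1
      funext z
      rw [hnum (diagLocus_mem_nearDiag hij hq z)]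
      exact (numCoef_diagLocus hτ hij hik q 0 z.1).symm
    exact one_ne_zero (const_mem_twoPole hτ hq' 0 h1)
  · rw [eval2_wedge]
    exact sub_mem (hprod a b hab) (hprod b a fun h => hba ⟨h.2, h.1⟩)

end PairRelations

section Isomorphism

variable {n : ℕ} {τ : ℂ}

/-- The generators of `𝔊` satisfy the relations of `𝔱_{1,n}`. The relation for `[Y_i + Y_j, T_ij^0]`
follows from the others. -/
theorem GG.isT1n (hτ : 0 < τ.im) : IsT1n (fun i => GG.gen n τ (.X i)) (fun i => GG.gen n τ (.Y i))
    (fun i j => -gT n τ i j 0) := by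
  have hyt : ∀ i j k : Fin n, i ≠ j → k ≠ i → k ≠ j → ⁅GG.gen n τ (.Y k), -gT n τ i j 0⁆ = 0 :=
    fun i j k hij hki hkj => by rw [lie_neg, GG.Y_lie_T hτ hki hkj hij, neg_zero]
  have hsymm : ∀ i j : Fin n, i ≠ j → -gT n τ i j 0 = -gT n τ j i 0 := fun i j hij => by
    rw [gT_swap hij, pow_zero, one_smul]
  have hxy : ∀ i j : Fin n, i ≠ j → ⁅GG.gen n τ (.X i), GG.gen n τ (.Y j)⁆ = -gT n τ i j 0 :=
    fun i j hij => by rw [GG.X_lie_Y hτ, if_neg hij]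
  have hdiag : ∀ i : Fin n, ⁅GG.gen n τ (.X i), GG.gen n τ (.Y i)⁆ =
      -∑ j ∈ Finset.univ.erase i, -gT n τ i j 0 := fun i => by
    rw [GG.X_lie_Y hτ, if_pos rfl, Finset.sum_neg_distrib, neg_neg]
  refine ⟨GG.X_lie_X hτ, GG.Y_lie_Y hτ, hxy, hsymm, hdiag, fun i j k hij hki hkj => ?_, hyt,
    fun i j hij => ?_, fun i j hij => ?_⟩
  · rw [lie_neg, GG.X_lie_T hτ k i j hij.symm, if_neg hki, if_neg hkj, neg_zero]
  · rw [lie_neg, add_lie, GG.X_lie_T hτ i i j hij.symm, GG.X_lie_T hτ j i j hij.symm, if_pos rfl,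
      if_neg hij.symm, if_pos rfl, add_neg_cancel, neg_zero]
  · -- apply `ad X_i` to `[Y_i, Y_j] = 0`
    have h := leibniz_lie (GG.gen n τ (.X i)) (GG.gen n τ (.Y i)) (GG.gen n τ (.Y j))
    rw [GG.Y_lie_Y hτ, lie_zero, hxy i j hij, hdiag, neg_lie, sum_lie, Finset.sum_eq_single j] at h
    · rw [add_lie, h, ← lie_skew (GG.gen n τ (.Y j))]
      abel
    · intro k hk hkj
      rw [← lie_skew, hyt i k j (Finset.ne_of_mem_erase hk).symm hij.symm hkj.symm, neg_zero]
    · exact fun hne => absurd (Finset.mem_erase.2 ⟨hij.symm, Finset.mem_univ j⟩) hne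

/-- The morphism `𝔱_{1,n} → 𝔊`. -/
def fromTT (hτ : 0 < τ.im) : TT n →ₗ⁅ℂ⁆ GG n τ := TT.lift (GG.isT1n hτ)

theorem ad_pow_gT (hτ : 0 < τ.im) {i j : Fin n} (hij : i ≠ j) (α : ℕ) :
    (LieAlgebra.ad ℂ (GG n τ) (GG.gen n τ (.X i)) ^ α) (gT n τ i j 0) = gT n τ i j α := by
  induction α with
  | zero => rfl
  | succ α ih =>
    rw [pow_succ', Module.End.mul_apply, ih, LieAlgebra.ad_apply, GG.X_lie_T hτ i i j hij.symm,
      if_pos rfl]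

theorem map_ad_pow {L L' : Type} [LieRing L] [LieAlgebra ℂ L] [LieRing L'] [LieAlgebra ℂ L']
    (f : L →ₗ⁅ℂ⁆ L') (u v : L) (α : ℕ) :
    f ((LieAlgebra.ad ℂ L u ^ α) v) = (LieAlgebra.ad ℂ L' (f u) ^ α) (f v) := by
  induction α with
  | zero => rfl
  | succ α ih =>
    rw [pow_succ', pow_succ', Module.End.mul_apply, Module.End.mul_apply, ← ih,
      LieAlgebra.ad_apply, LieAlgebra.ad_apply, LieHom.map_lie]

theorem fromTT_x (hτ : 0 < τ.im) (i : Fin n) : fromTT hτ (TT.x i) = GG.gen n τ (.X i) :=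
  TT.lift_gen _ _

theorem fromTT_y (hτ : 0 < τ.im) (i : Fin n) : fromTT hτ (TT.y i) = GG.gen n τ (.Y i) :=
  TT.lift_gen _ _

theorem fromTT_t (hτ : 0 < τ.im) {i j : Fin n} (h : i ≠ j) :
    fromTT hτ (TT.tt i j) = -gT n τ i j 0 := by
  rw [TT.tt_eq h]
  exact TT.lift_gen _ _

/-- The isomorphism of `𝔊` with `𝔱_{1,n}`. -/
def isoTT (hτ : 0 < τ.im) : GG n τ ≃ₗ⁅ℂ⁆ TT n :=
  { toTT hτ with
    invFun := fromTT hτ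
    left_inv := fun u => by
      have h : (fromTT hτ).comp (toTT hτ) = (LieHom.id : GG n τ →ₗ⁅ℂ⁆ GG n τ) :=
        freeQuot_hom_ext fun a => by
          change fromTT hτ (toTT hτ (GG.gen n τ a)) = GG.gen n τ a
          rw [toTT_gen]
          cases a with
          | X i => exact fromTT_x hτ i
          | Y i => exact fromTT_y hτ i
          | T i j h α =>
            rw [IsT1n.gen, map_neg, map_ad_pow, fromTT_x, fromTT_t hτ h.ne, map_neg, neg_neg,
              ad_pow_gT hτ h.ne, gT_of_lt h]
      exact LieHom.congr_fun h u
    right_inv := fun u => by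
      have h : (toTT hτ).comp (fromTT hτ) = (LieHom.id : TT n →ₗ⁅ℂ⁆ TT n) :=
        freeQuot_hom_ext fun a => by
          change toTT hτ (fromTT hτ (TT.gen a)) = TT.gen a
          have hT : ∀ (i j : Fin n) (h : i < j), toTT hτ (-gT n τ i j 0) = TT.tt i j :=
            fun i j h => by
              rw [gT_of_lt h, map_neg, toTT_gen, IsT1n.gen, neg_neg]
              rfl
          cases a with
          | x i => exact (congrArg _ (fromTT_x hτ i)).trans (toTT_gen hτ _)
          | y i => exact (congrArg _ (fromTT_y hτ i)).trans (toTT_gen hτ _)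
          | t i j h =>
            have h1 : fromTT hτ (TT.gen (.t i j h)) = -gT n τ i j 0 := TT.lift_gen _ _
            have h2 : TT.gen (.t i j h) = TT.tt i j := (TT.tt_eq h).symm
            rw [h1, h2]
            rcases lt_or_gt_of_ne h with hlt | hlt
            · exact hT i j hlt
            · rw [gT_swap hlt.ne, pow_zero, one_smul, hT j i hlt, TT.isT1n.symm i j h]
      exact LieHom.congr_fun h u }

theorem isoTT_gen (hτ : 0 < τ.im) (a : Idx n) :
    isoTT hτ (GG.gen n τ a) = IsT1n.gen TT.x TT.y TT.tt a := toTT_gen hτ a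

end Isomorphism

/-! ### Differentiation in completed enveloping algebras -/

section FiniteExpansions

variable {V : Type} [NormedAddCommGroup V] [NormedSpace ℂ V] {A : Type} [Ring A] [Algebra ℂ A]

/-- `F` is a finite sum of products of a scalar function which is differentiable at `v` and a
constant element of `A`, and the corresponding sum of the derivatives is `F'`. No topology on `A`
is involved, and the product rule holds. -/
inductive HasFinDeriv (v : V) : (V → A) → (V → A) → Prop
  | zero : HasFinDeriv v (fun _ => 0) (fun _ => 0)
  | smul_add (f : V → ℂ) (f' : V →L[ℂ] ℂ) (hf : HasFDerivAt f f' v) (a : A) (G G' : V → A)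
      (hG : HasFinDeriv v G G') :
      HasFinDeriv v (fun y => f y • a + G y) (fun u => f' u • a + G' u)

namespace HasFinDeriv

variable {v : V} {F F' G G' : V → A}

theorem congr {F₁ F₁' : V → A} (h : HasFinDeriv v F F') (h1 : ∀ y, F₁ y = F y)
    (h2 : ∀ u, F₁' u = F' u) : HasFinDeriv v F₁ F₁' := by
  rw [funext h1, funext h2]
  exact h

theorem smul_const {f : V → ℂ} {f' : V →L[ℂ] ℂ} (hf : HasFDerivAt f f' v) (a : A) :
    HasFinDeriv v (fun y => f y • a) (fun u => f' u • a) :=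
  (smul_add f f' hf a _ _ zero).congr (fun _ => (add_zero _).symm) fun _ => (add_zero _).symm

theorem const (a : A) : HasFinDeriv v (fun _ => a) (fun _ => 0) :=
  (smul_const (hasFDerivAt_const (1 : ℂ) v) a).congr (fun _ => (one_smul ℂ a).symm)
    fun u => by simp

theorem add (hF : HasFinDeriv v F F') (hG : HasFinDeriv v G G') :
    HasFinDeriv v (fun y => F y + G y) (fun u => F' u + G' u) := by
  induction hF with
  | zero => exact hG.congr (fun _ => zero_add _) fun _ => zero_add _
  | smul_add f f' hf a H H' _ ih =>
    exact (smul_add f f' hf a _ _ ih).congr (fun _ => add_assoc _ _ _) fun _ => add_assoc _ _ _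

theorem sum {ι : Type*} (S : Finset ι) {F F' : ι → V → A}
    (h : ∀ i ∈ S, HasFinDeriv v (F i) (F' i)) :
    HasFinDeriv v (fun y => ∑ i ∈ S, F i y) (fun u => ∑ i ∈ S, F' i u) := by
  classical
  induction S using Finset.induction_on with
  | empty => simpa using zero
  | insert i S hi ih =>
    refine ((h i (Finset.mem_insert_self i S)).add
      (ih fun j hj => h j (Finset.mem_insert_of_mem hj))).congr
      (fun _ => Finset.sum_insert hi) fun _ => Finset.sum_insert hi

theorem smul_mul {f : V → ℂ} {f' : V →L[ℂ] ℂ} (hf : HasFDerivAt f f' v) (a : A)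
    (hG : HasFinDeriv v G G') : HasFinDeriv v (fun y => f y • a * G y)
      (fun u => f' u • a * G v + f v • a * G' u) := by
  induction hG with
  | zero => exact zero.congr (fun _ => mul_zero _) fun _ => by rw [mul_zero, mul_zero, add_zero]
  | smul_add g g' hg b H H' _ ih =>
    refine (smul_add _ _ (hf.mul hg) (a * b) _ _ ih).congr (fun y => ?_) fun u => ?_
    · rw [mul_add, smul_mul_smul_comm, Pi.mul_apply]
    · simp only [add_apply, smul_apply, smul_eq_mul,
        mul_add, smul_mul_smul_comm, add_smul, mul_comm (g v)]
      abel

theorem mul (hF : HasFinDeriv v F F') (hG : HasFinDeriv v G G') :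
    HasFinDeriv v (fun y => F y * G y) (fun u => F' u * G v + F v * G' u) := by
  induction hF with
  | zero => exact zero.congr (fun _ => zero_mul _) fun _ => by rw [zero_mul, zero_mul, add_zero]
  | smul_add f f' hf a H H' _ ih =>
    refine ((smul_mul hf a hG).add ih).congr (fun y => add_mul _ _ _) fun u => ?_
    rw [add_mul, add_mul]
    abel

/-- The derivative of a power, at a point where `F` commutes with its derivatives. -/
theorem pow (hF : HasFinDeriv v F F') (hc : ∀ u, Commute (F v) (F' u)) (m : ℕ) :
    HasFinDeriv v (fun y => F y ^ (m + 1)) (fun u => ((m : ℂ) + 1) • (F' u * F v ^ m)) := by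
  induction m with
  | zero => exact hF.congr (fun y => by rw [zero_add, pow_one]) fun u => by simp
  | succ m ih =>
    refine (hF.mul ih).congr (fun y => pow_succ' _ _) fun u => ?_
    rw [mul_smul_comm, ← mul_assoc, (hc u).eq, mul_assoc, ← pow_succ', Nat.cast_succ,
      add_smul ((m : ℂ) + 1), one_smul, add_comm]

/-- The derivative of the exponential, at a point where `F` commutes with its derivatives. -/
theorem exp [Module ℚ A] (hq : ∀ (q : ℚ) (a : A), q • a = (q : ℂ) • a) (hF : HasFinDeriv v F F')
    (hc : ∀ u, Commute (F v) (F' u)) {k : ℕ} (hk : ∀ y, F y ^ k = 0) :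
    HasFinDeriv v (fun y => IsNilpotent.exp (F y)) (fun u => F' u * IsNilpotent.exp (F v)) := by
  have h1 := (const (v := v) (1 : A)).add (sum (Finset.range k) fun m _ =>
    (const (v := v) (((((m + 1).factorial : ℚ)⁻¹ : ℚ) : ℂ) • (1 : A))).mul (hF.pow hc m))
  refine h1.congr (fun y => ?_) fun u => ?_
  · have hk' : F y ^ (k + 1) = 0 := by rw [pow_succ, hk, zero_mul]
    rw [IsNilpotent.exp_eq_sum hk', Finset.sum_range_succ']
    simp only [hq, smul_mul_assoc, one_mul]
    simp [add_comm]
  · rw [IsNilpotent.exp_eq_sum (hk v), zero_add, Finset.mul_sum]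
    refine Finset.sum_congr rfl fun m _ => ?_
    rw [zero_mul, zero_add, hq, smul_mul_assoc, one_mul, smul_smul, mul_smul_comm]
    congr 1
    rw [Nat.factorial_succ]
    push_cast
    have : ((m : ℂ) + 1) ≠ 0 := Nat.cast_add_one_ne_zero m
    field_simp

theorem exists_hasFDerivAt (h : HasFinDeriv v F F') (l : A →ₗ[ℂ] ℂ) :
    ∃ L : V →L[ℂ] ℂ, HasFDerivAt (fun y => l (F y)) L v ∧ ∀ u, L u = l (F' u) := by
  induction h with
  | zero => exact ⟨0, by simpa using hasFDerivAt_const (0 : ℂ) v, fun u => by simp⟩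
  | smul_add f f' hf a G G' _ ih =>
    obtain ⟨L, hL, hL'⟩ := ih
    refine ⟨f'.smulRight (l a) + L, ?_, fun u => by simp [hL']⟩
    simp only [map_add, map_smul]
    exact (hf.smul_const (l a)).add hL

end HasFinDeriv

end FiniteExpansions

section Completed

variable {V : Type} [NormedAddCommGroup V] [NormedSpace ℂ V]
variable {𝔤 : Type} [LieRing 𝔤] [LieAlgebra ℂ 𝔤]

theorem Uhat.ext_comp {u v : Uhat 𝔤} (h : ∀ k, Uhat.comp 𝔤 k u = Uhat.comp 𝔤 k v) : u = v :=
  Subtype.ext (funext h)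

/-- `f` has at every level a finite expansion near `v`, and its derivative is `f'`. -/
def HasHatDeriv (f f' : V → Uhat 𝔤) (v : V) : Prop :=
  ∀ k, ∃ F F' : V → NilQuot 𝔤 k, HasFinDeriv v F F' ∧
    (∀ᶠ y in nhds v, Uhat.comp 𝔤 k (f y) = F y) ∧ ∀ u, Uhat.comp 𝔤 k (f' u) = F' u

namespace HasHatDeriv

variable {v : V} {f f' g g' : V → Uhat 𝔤}

theorem const (a : Uhat 𝔤) : HasHatDeriv (fun _ : V => a) (fun _ => 0) v := fun k =>
  ⟨_, _, HasFinDeriv.const (Uhat.comp 𝔤 k a), Filter.Eventually.of_forall fun _ => rfl,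
    fun _ => map_zero _⟩

theorem mul (hf : HasHatDeriv f f' v) (hg : HasHatDeriv g g' v) :
    HasHatDeriv (fun y => f y * g y) (fun u => f' u * g v + f v * g' u) v := fun k => by
  obtain ⟨F, F', h, h1, h2⟩ := hf k
  obtain ⟨G, G', e, e1, e2⟩ := hg k
  refine ⟨_, _, h.mul e, ?_, fun u => ?_⟩
  · filter_upwards [h1, e1] with y hy hy'
    rw [map_mul, hy, hy']
  · rw [map_add, map_mul, map_mul, h2, e2, h1.self_of_nhds, e1.self_of_nhds]

theorem congr {f₁ f₁' : V → Uhat 𝔤} (hf : HasHatDeriv f f' v) (h1 : ∀ᶠ y in nhds v, f₁ y = f y)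
    (h2 : ∀ u, f₁' u = f' u) : HasHatDeriv f₁ f₁' v := fun k => by
  obtain ⟨F, F', h, e1, e2⟩ := hf k
  refine ⟨F, F', h, ?_, fun u => by rw [h2, e2]⟩
  filter_upwards [h1, e1] with y hy hy'
  rw [hy, hy']

theorem hasHolDeriv (hf : HasHatDeriv f f' v) : HasHolDeriv f f' v := fun k l => by
  obtain ⟨F, F', h, h1, h2⟩ := hf k
  obtain ⟨L, hL, hL'⟩ := h.exists_hasFDerivAt l
  refine ⟨L, hL.congr_of_eventuallyEq ?_, fun u => by rw [h2, hL']⟩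
  filter_upwards [h1] with y hy
  rw [hy]

end HasHatDeriv

theorem HasHolDeriv.unique {f f₁ f₂ : V → Uhat 𝔤} {v : V} (h₁ : HasHolDeriv f f₁ v)
    (h₂ : HasHolDeriv f f₂ v) (u : V) : f₁ u = f₂ u := by
  refine Uhat.ext_comp fun k => ?_
  rw [← sub_eq_zero, ← Module.forall_dual_apply_eq_zero_iff ℂ]
  intro l
  obtain ⟨L₁, hL₁, e₁⟩ := h₁ k l
  obtain ⟨L₂, hL₂, e₂⟩ := h₂ k l
  rw [map_sub, ← e₁, ← e₂, hL₁.unique hL₂, sub_self]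

/-- A map whose derivatives along a line vanish takes the same values at its two ends. -/
theorem eq_of_hasHolDeriv_zero {f : V → Uhat 𝔤} {v u : V}
    (h : ∀ s : ℂ, ∃ f', HasHolDeriv f f' (v + s • u) ∧ f' u = 0) : f (v + u) = f v := by
  refine Uhat.ext_comp fun k => ?_
  rw [← sub_eq_zero, ← Module.forall_dual_apply_eq_zero_iff ℂ]
  intro l
  have hd : ∀ s : ℂ, HasDerivAt (fun s : ℂ => l (Uhat.comp 𝔤 k (f (v + s • u)))) 0 s := fun s => by
    obtain ⟨f', h1, h2⟩ := h s
    obtain ⟨L, hL, e⟩ := h1 k l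
    have hline : HasDerivAt (fun s : ℂ => v + s • u) u s := by
      simpa using ((hasDerivAt_id s).smul_const u).const_add v
    have := hL.comp_hasDerivAt s hline
    rwa [e, h2, map_zero, map_zero] at this
  have hc := is_const_of_deriv_eq_zero (fun s => (hd s).differentiableAt) (fun s => (hd s).deriv) 1 0
  simp only [one_smul, zero_smul, add_zero] at hc
  rw [map_sub, hc, sub_self]

instance (k : ℕ) : DiscreteTopology (NilQuot 𝔤 k) := ⟨rfl⟩

/-- A family of which at every level only finitely many members are non-zero is summable, and the
sum is computed level by level. -/
theorem exists_hasSum {ι : Type*} (f : ι → Uhat 𝔤) (S : ℕ → Finset ι)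
    (h : ∀ k, ∀ a ∉ S k, Uhat.comp 𝔤 k (f a) = 0) :
    ∃ s, HasSum f s ∧ ∀ k, Uhat.comp 𝔤 k s = ∑ a ∈ S k, Uhat.comp 𝔤 k (f a) := by
  classical
  refine ⟨⟨fun k => ∑ a ∈ S k, Uhat.comp 𝔤 k (f a), fun k => ?_⟩, ?_, fun k => rfl⟩
  · have h1 : ∀ a, NilQuot.trans 𝔤 k (Uhat.comp 𝔤 (k + 1) (f a)) = Uhat.comp 𝔤 k (f a) :=
      fun a => (f a).2 k
    rw [map_sum]
    simp only [h1]
    rw [Finset.sum_subset Finset.subset_union_left (s₂ := S (k + 1) ∪ S k) fun a _ ha => ?_,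
      ← Finset.sum_subset Finset.subset_union_right fun a _ ha => h k a ha]
    rw [← h1, h (k + 1) a ha, map_zero]
  · rw [HasSum, Topology.IsInducing.subtypeVal.tendsto_nhds_iff, tendsto_pi_nhds]
    intro k
    have h2 := hasSum_sum_of_ne_finset_zero (f := fun a => Uhat.comp 𝔤 k (f a)) (s := S k)
      (L := .unconditional ι) fun a ha => h k a ha
    refine h2.congr fun T => ?_
    exact (map_sum (Uhat.comp 𝔤 k) f T).symm

theorem summable_of_finite {ι : Type*} {f : ι → Uhat 𝔤} {S : ℕ → Finset ι}
    (h : ∀ k, ∀ a ∉ S k, Uhat.comp 𝔤 k (f a) = 0) : Summable f :=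
  let ⟨s, hs, _⟩ := exists_hasSum f S h
  ⟨s, hs⟩

theorem comp_tsum {ι : Type*} {f : ι → Uhat 𝔤} {S : ℕ → Finset ι}
    (h : ∀ k, ∀ a ∉ S k, Uhat.comp 𝔤 k (f a) = 0) (k : ℕ) :
    Uhat.comp 𝔤 k (∑' a, f a) = ∑ a ∈ S k, Uhat.comp 𝔤 k (f a) := by
  obtain ⟨s, hs, hs'⟩ := exists_hasSum f S h
  rw [hs.tsum_eq, hs']

end Completed

section Levels

variable {𝔤 𝔥 : Type} [LieRing 𝔤] [LieAlgebra ℂ 𝔤] [LieRing 𝔥] [LieAlgebra ℂ 𝔥]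

/-- The map from `𝔤` to a level of the completion, as a linear map. -/
def levL (𝔤 : Type) [LieRing 𝔤] [LieAlgebra ℂ 𝔤] (k : ℕ) : 𝔤 →ₗ[ℂ] NilQuot 𝔤 k :=
  (Ideal.Quotient.mkₐ ℂ ((augIdeal 𝔤) ^ k)).toLinearMap ∘ₗ
    (UniversalEnvelopingAlgebra.ι ℂ : 𝔤 →ₗ⁅ℂ⁆ UniversalEnvelopingAlgebra ℂ 𝔤).toLinearMap

theorem levL_apply (k : ℕ) (ξ : 𝔤) : levL 𝔤 k ξ = lev 𝔤 k ξ := rfl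

theorem lev_lie (k : ℕ) (ξ η : 𝔤) :
    lev 𝔤 k ⁅ξ, η⁆ = lev 𝔤 k ξ * lev 𝔤 k η - lev 𝔤 k η * lev 𝔤 k ξ := by
  simp only [lev, LieHom.map_lie, LieRing.of_associative_ring_bracket, map_sub, map_mul]

/-- An iterated bracket of `α + 1` elements lies in the power `α + 1` of the augmentation ideal. -/
theorem ι_ad_pow_mem (ξ η : 𝔤) (α : ℕ) :
    UniversalEnvelopingAlgebra.ι ℂ ((LieAlgebra.ad ℂ 𝔤 ξ ^ α) η) ∈ augIdeal 𝔤 ^ (α + 1) := by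
  induction α with
  | zero => rw [zero_add, Submodule.pow_one]; exact ι_mem_augIdeal η
  | succ α ih =>
    rw [pow_succ', Module.End.mul_apply, LieAlgebra.ad_apply, LieHom.map_lie,
      LieRing.of_associative_ring_bracket]
    refine sub_mem ?_ ?_
    · rw [Ideal.IsTwoSided.pow_succ]
      exact Ideal.mul_mem_mul (ι_mem_augIdeal ξ) ih
    · rw [Submodule.pow_succ]
      exact Ideal.mul_mem_mul ih (ι_mem_augIdeal ξ)

theorem lev_ad_pow_eq_zero {k α : ℕ} (h : k ≤ α + 1) (ξ η : 𝔤) :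
    lev 𝔤 k ((LieAlgebra.ad ℂ 𝔤 ξ ^ α) η) = 0 :=
  Ideal.Quotient.eq_zero_iff_mem.2 (Ideal.pow_le_pow_right h (ι_ad_pow_mem ξ η α))

theorem comp_hat (k : ℕ) (ξ : 𝔤) : Uhat.comp 𝔤 k (hat ξ) = lev 𝔤 k ξ := rfl

theorem mapLev_smul (f : 𝔤 →ₗ⁅ℂ⁆ 𝔥) (k : ℕ) (r : ℂ) (u : NilQuot 𝔤 k) :
    mapLev f k (r • u) = r • mapLev f k u := by
  rw [Algebra.smul_def, Algebra.smul_def, map_mul, NilQuot.algebraMap_eq, NilQuot.algebraMap_eq]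
  congr 1
  change NilQuot.mk 𝔥 k (mapU f _) = _
  rw [AlgHom.commutes]

/-- Functoriality of the completion, for morphisms inverse to each other on one side. -/
theorem mapHat_mapHat (f : 𝔤 →ₗ⁅ℂ⁆ 𝔥) (g : 𝔥 →ₗ⁅ℂ⁆ 𝔤) (h : ∀ ξ, g (f ξ) = ξ) (u : Uhat 𝔤) :
    mapHat g (mapHat f u) = u := by
  have h1 : (mapU g).comp (mapU f) = AlgHom.id ℂ _ := by
    apply UniversalEnvelopingAlgebra.hom_ext
    ext ξ
    rw [LieHom.comp_apply, LieHom.comp_apply, AlgHom.coe_toLieHom, AlgHom.coe_toLieHom,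
      AlgHom.comp_apply, mapU_ι, mapU_ι, h, AlgHom.id_apply]
  refine Uhat.ext_comp fun k => ?_
  obtain ⟨a, ha⟩ := Ideal.Quotient.mk_surjective (Uhat.comp 𝔤 k u)
  change mapLev g k (mapLev f k (Uhat.comp 𝔤 k u)) = Uhat.comp 𝔤 k u
  rw [← ha]
  exact congrArg (NilQuot.mk 𝔤 k) (DFunLike.congr_fun h1 a)

theorem mapExp_mapExp (f : 𝔤 →ₗ⁅ℂ⁆ 𝔥) (g : 𝔥 →ₗ⁅ℂ⁆ 𝔤) (h : ∀ ξ, g (f ξ) = ξ) (u : ExpGroup 𝔤) :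
    mapExp g (mapExp f u) = u :=
  Subtype.ext (Units.ext (mapHat_mapHat f g h _))

theorem mapExp_bijective (φ : 𝔤 ≃ₗ⁅ℂ⁆ 𝔥) :
    Function.Bijective (mapExp (φ : 𝔤 →ₗ⁅ℂ⁆ 𝔥)) :=
  Function.bijective_iff_has_inverse.2 ⟨mapExp (φ.symm : 𝔥 →ₗ⁅ℂ⁆ 𝔤),
    mapExp_mapExp _ _ φ.symm_apply_apply, mapExp_mapExp _ _ φ.apply_symm_apply⟩

theorem expElt_zero : expElt (0 : 𝔤) = 1 :=
  Uhat.ext_comp fun k => by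
    change IsNilpotent.exp (lev 𝔤 k 0) = 1
    rw [← levL_apply, map_zero, IsNilpotent.exp_zero]

theorem expElt_add {ξ η : 𝔤} (h : ⁅ξ, η⁆ = 0) : expElt (ξ + η) = expElt ξ * expElt η :=
  Uhat.ext_comp fun k => by
    have hc : Commute (lev 𝔤 k ξ) (lev 𝔤 k η) := by
      rw [Commute, SemiconjBy, ← sub_eq_zero, ← lev_lie, h, ← levL_apply, map_zero]
    change IsNilpotent.exp (lev 𝔤 k (ξ + η)) =
      IsNilpotent.exp (lev 𝔤 k ξ) * IsNilpotent.exp (lev 𝔤 k η)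
    rw [← levL_apply, map_add]
    exact IsNilpotent.exp_add_of_commute hc (isNilpotent_lev k ξ) (isNilpotent_lev k η)

theorem commute_hat_expElt {ξ η : 𝔤} (h : ⁅ξ, η⁆ = 0) : Commute (hat ξ) (expElt η) := by
  refine Uhat.ext_comp fun k => ?_
  have hc : Commute (lev 𝔤 k ξ) (lev 𝔤 k η) := by
    rw [Commute, SemiconjBy, ← sub_eq_zero, ← lev_lie, h, ← levL_apply, map_zero]
  obtain ⟨m, hm⟩ := isNilpotent_lev k η
  change lev 𝔤 k ξ * IsNilpotent.exp (lev 𝔤 k η) = IsNilpotent.exp (lev 𝔤 k η) * lev 𝔤 k ξ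
  rw [IsNilpotent.exp_eq_sum hm, Finset.mul_sum, Finset.sum_mul]
  refine Finset.sum_congr rfl fun i _ => ?_
  change lev 𝔤 k ξ * ((algebraMap ℚ ℂ _) • lev 𝔤 k η ^ i) =
    ((algebraMap ℚ ℂ _) • lev 𝔤 k η ^ i) * lev 𝔤 k ξ
  rw [mul_smul_comm, smul_mul_assoc, (hc.pow_right i).eq]

/-- The derivative of the exponential of a linear map with values in an abelian subalgebra. -/
theorem hasHatDeriv_expElt {V : Type} [NormedAddCommGroup V] [NormedSpace ℂ V] {n : ℕ}
    {x : Fin n → 𝔤} (hx : ∀ i j, ⁅x i, x j⁆ = 0) (c : Fin n → (V →L[ℂ] ℂ)) (v : V) :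
    HasHatDeriv (fun y => expElt (∑ i, c i y • x i))
      (fun u => hat (∑ i, c i u • x i) * expElt (∑ i, c i v • x i)) v := fun k => by
  have h0 : ∀ u, lev 𝔤 k (∑ i, c i u • x i) = ∑ i, c i u • lev 𝔤 k (x i) := fun u => by
    simp only [← levL_apply, map_sum, map_smul]
  have h := HasFinDeriv.sum Finset.univ fun i (_ : i ∈ Finset.univ) =>
    HasFinDeriv.smul_const ((c i).hasFDerivAt (x := v)) (lev 𝔤 k (x i))
  refine ⟨_, _, HasFinDeriv.exp (fun _ _ => rfl) (h.congr h0 h0) (fun u => ?_) (k := k)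
    fun y => ?_, Filter.Eventually.of_forall fun _ => rfl, fun u => rfl⟩
  · rw [Commute, SemiconjBy, ← sub_eq_zero, ← lev_lie, ← levL_apply]
    simp [sum_lie, lie_sum, hx]
  · rw [lev, ← map_pow]
    exact Ideal.Quotient.eq_zero_iff_mem.2 (Ideal.pow_mem_pow (ι_mem_augIdeal _) k)

end Levels

/-! ### The flat connection in the completion -/

section Etas

variable {n : ℕ} {τ : ℂ}

/-- The derivative of the function `y ↦ η_a(y)(u)`. -/
def dEtaAt (τ : ℂ) (w u : V2 n) : Idx n → (V2 n →L[ℂ] ℂ)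
  | .X _ => 0
  | .Y _ => 0
  | .T i j _ α => (u.1 i - u.1 j) • dfij τ α i j w

theorem hasFDerivAt_etaAt (hτ : 0 < τ.im) (a : Idx n) {w : V2 n} (hw : w ∈ confSharp n τ)
    (u : V2 n) : HasFDerivAt (fun y => etaAt τ a y u) (dEtaAt τ w u a) w := by
  cases a with
  | X i => exact hasFDerivAt_const _ _
  | Y i => exact hasFDerivAt_const _ _
  | T i j h α => exact (hasFDerivAt_fij hτ α h.ne hw).mul_const _

theorem dEtaAt_sub (hτ : 0 < τ.im) (a : Idx n) {w : V2 n} (hw : w ∈ confSharp n τ) (u v : V2 n) :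
    dEtaAt τ w v a u - dEtaAt τ w u a v = IsT1n.dEta τ w a u v := by
  rw [← IsT1n.dForm_eta hτ a ⟨w, hw⟩]
  simp only [dForm]
  have h (u v : V2 n) : pderiv (fun y => eta n τ a y v) u ⟨w, hw⟩ = dEtaAt τ w v a u :=
    pderiv_eq (g := fun y => etaAt τ a y v) hτ (fun _ => rfl) (hasFDerivAt_etaAt hτ a hw v) u
  rw [h, h]

theorem etaAt_add_latSharp (hτ : 0 < τ.im) {γ : V2 n} (hγ : γ ∈ latSharp n τ) (w u : V2 n)
    (a : Idx n) : etaAt τ a (w + γ) u = etaAt τ a w u := by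
  cases a with
  | X i => rfl
  | Y i => rfl
  | T i j h α => exact congrArg (· * (u.1 i - u.1 j)) (fij_add_latSharp hτ hγ w α i j)

end Etas

namespace IsT1n

variable {n : ℕ} {τ : ℂ} {L : Type} [LieRing L] [LieAlgebra ℂ L] {x y : Fin n → L}
  {t : Fin n → Fin n → L}

/-- The generator of degree `d` lies in the `d`-th power of the augmentation ideal. -/
theorem lev_gen_eq_zero {k : ℕ} {a : Idx n} (h : k ≤ a.deg) : lev L k (gen x y t a) = 0 := by
  cases a with
  | X i => exact lev_ad_pow_eq_zero (α := 0) h 0 (x i)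
  | Y i => exact lev_ad_pow_eq_zero (α := 0) (h.trans (Nat.zero_le 1)) 0 (y i)
  | T i j hij α => rw [gen, lev_neg, lev_ad_pow_eq_zero h, neg_zero]

theorem comp_smul_gen_eq_zero (c : Idx n → ℂ) (N : ℕ → ℕ) (hN : ∀ k, k ≤ N k) (k : ℕ) (a : Idx n)
    (ha : a ∉ idxFin n (N k)) : Uhat.comp L k (c a • hat (gen x y t a)) = 0 := by
  rw [map_smul, comp_hat,
    lev_gen_eq_zero ((hN k).trans (lt_deg_of_notMem_idxFin ha).le), smul_zero]

theorem summable_smul_gen (c : Idx n → ℂ) : Summable fun a => c a • hat (gen x y t a) :=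
  summable_of_finite (S := fun k => idxFin n k) (comp_smul_gen_eq_zero c id fun _ => le_rfl)

theorem comp_tsum_smul_gen (c : Idx n → ℂ) {k N : ℕ} (h : k ≤ N) :
    Uhat.comp L k (∑' a, c a • hat (gen x y t a)) =
      ∑ a ∈ idxFin n N, c a • lev L k (gen x y t a) := by
  rw [comp_tsum (S := fun k => idxFin n (max N k))
    (comp_smul_gen_eq_zero c _ fun _ => le_max_right _ _), max_eq_left h]
  rfl

/-- The form `∑_a η_a ⊗ gen_a` with values in the completion. -/
def omHat (x y : Fin n → L) (t : Fin n → Fin n → L) (τ : ℂ) (w u : V2 n) : Uhat L :=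
  ∑' a, etaAt τ a w u • hat (gen x y t a)

/-- The derivative of `w ↦ omHat w u`. -/
def domHat (x y : Fin n → L) (t : Fin n → Fin n → L) (τ : ℂ) (w u v : V2 n) : Uhat L :=
  ∑' a, dEtaAt τ w u a v • hat (gen x y t a)

theorem isLinearMap_omHat (w : V2 n) : IsLinearMap ℂ (omHat x y t τ w) where
  map_add u v := Uhat.ext_comp fun k => by
    rw [map_add, omHat, omHat, omHat, comp_tsum_smul_gen _ le_rfl, comp_tsum_smul_gen _ le_rfl,
      comp_tsum_smul_gen _ le_rfl]
    simp only [map_add, add_smul, Finset.sum_add_distrib]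
  map_smul c u := Uhat.ext_comp fun k => by
    rw [map_smul, omHat, omHat, comp_tsum_smul_gen _ le_rfl, comp_tsum_smul_gen _ le_rfl]
    simp only [map_smul, Finset.smul_sum, smul_eq_mul, mul_smul]

theorem isLie_omHat (w u : V2 n) : IsLie (omHat x y t τ w u) := fun k =>
  ⟨∑ a ∈ idxFin n k, etaAt τ a w u • gen x y t a, by
    rw [omHat, comp_tsum_smul_gen _ le_rfl, ← levL_apply, map_sum]
    simp only [map_smul, levL_apply]⟩

theorem omHat_add_latSharp (hτ : 0 < τ.im) {γ : V2 n} (hγ : γ ∈ latSharp n τ) (w u : V2 n) :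
    omHat x y t τ (w + γ) u = omHat x y t τ w u := by
  simp only [omHat, etaAt_add_latSharp hτ hγ]

theorem hasHatDeriv_omHat (hτ : 0 < τ.im) {w : V2 n} (hw : w ∈ confSharp n τ) (u : V2 n) :
    HasHatDeriv (fun z => omHat x y t τ z u) (domHat x y t τ w u) w := fun k =>
  ⟨_, _, HasFinDeriv.sum (idxFin n k) fun a _ =>
      HasFinDeriv.smul_const (hasFDerivAt_etaAt hτ a hw u) (lev L k (gen x y t a)),
    Filter.Eventually.of_forall fun _ => comp_tsum_smul_gen _ le_rfl,
    fun _ => comp_tsum_smul_gen _ le_rfl⟩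

theorem lev_om_eq_zero {k d : ℕ} (h : k ≤ d) (w u : V2 n) : lev L k (om x y t τ w d u) = 0 := by
  rw [om_apply, ← levL_apply, map_degSum]
  refine degSum_eq_zero _ _ fun a ha => ?_
  rw [map_smul, levL_apply, lev_gen_eq_zero (h.trans ha.ge), smul_zero]

/-- At level `k`, the form is the sum of its parts of degree at most `N`, for every `N ≥ k`. -/
theorem comp_omHat {k N : ℕ} (h : k ≤ N) (hN : 1 ≤ N) (w u : V2 n) :
    Uhat.comp L k (omHat x y t τ w u) =
      ∑ d ∈ Finset.range (N + 1), lev L k (om x y t τ w d u) := by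
  rw [omHat, comp_tsum_smul_gen _ h, sum_idxFin_eq_sum_degSum hN]
  refine Finset.sum_congr rfl fun d _ => ?_
  rw [om_apply, ← levL_apply, map_degSum]
  simp only [map_smul, levL_apply]

/-- The connection `d + omHat` is flat. -/
theorem omHat_flat (h : IsT1n x y t) (hτ : 0 < τ.im) {w : V2 n} (hw : w ∈ confSharp n τ)
    (u v : V2 n) : domHat x y t τ w v u - domHat x y t τ w u v +
      (omHat x y t τ w u * omHat x y t τ w v - omHat x y t τ w v * omHat x y t τ w u) = 0 := by
  refine Uhat.ext_comp fun k => ?_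
  have hk : k ≤ 2 * k + 1 := by omega
  have hN : 1 ≤ 2 * k + 1 := by omega
  have hd : Uhat.comp L k (domHat x y t τ w v u - domHat x y t τ w u v) =
      ∑ d ∈ Finset.range (2 * k + 1 + 1), lev L k (dom x y t τ w d u v) := by
    rw [map_sub, domHat, domHat, comp_tsum_smul_gen _ hk, comp_tsum_smul_gen _ hk,
      ← Finset.sum_sub_distrib]
    simp only [← sub_smul, dEtaAt_sub hτ _ hw]
    rw [sum_idxFin_eq_sum_degSum hN]
    refine Finset.sum_congr rfl fun d _ => ?_
    rw [dom_apply, ← levL_apply, map_degSum]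
    simp only [map_smul, levL_apply]
  have hb : Uhat.comp L k (omHat x y t τ w u * omHat x y t τ w v -
      omHat x y t τ w v * omHat x y t τ w u) =
      ∑ d ∈ Finset.range (2 * k + 1 + 1), ∑ r ∈ Finset.HasAntidiagonal.antidiagonal d,
        lev L k ⁅om x y t τ w r.1 u, om x y t τ w r.2 v⁆ := by
    rw [map_sub, map_mul, map_mul, comp_omHat hk hN, comp_omHat hk hN, Finset.sum_mul_sum,
      Finset.sum_mul_sum, Finset.sum_comm (s := Finset.range (2 * k + 1 + 1))
        (f := fun i j => lev L k (om x y t τ w i v) * lev L k (om x y t τ w j u)),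
      ← Finset.sum_sub_distrib]
    simp only [← Finset.sum_sub_distrib, ← lev_lie]
    -- in the other products, one of the factors has degree at least `k`
    refine sum_range_mul_range _ (fun a b => lev L k ⁅om x y t τ w a u, om x y t τ w b v⁆)
      fun a b hab => ?_
    rw [lev_lie]
    rcases le_or_gt k a with hka | hka
    · rw [lev_om_eq_zero hka, zero_mul, mul_zero, sub_zero]
    · rw [lev_om_eq_zero (by omega : k ≤ b), zero_mul, mul_zero, sub_zero]
  rw [map_add, hd, hb, ← Finset.sum_add_distrib, map_zero]
  refine Finset.sum_eq_zero fun d _ => ?_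
  have hc := congrArg (levL L k) (LinearMap.congr_fun (LinearMap.congr_fun
    (h.curv_eq_zero hτ hw d) u) v)
  rw [curv_apply, map_add, map_sum] at hc
  simpa using! hc

theorem omHat_snd (w : V2 n) (c : Fin n → ℂ) :
    omHat x y t τ w (0, c) = hat (∑ i, c i • x i) := by
  refine Uhat.ext_comp fun k => ?_
  rw [omHat, comp_tsum_smul_gen _ le_rfl, sum_idxFin]
  simp only [comp_hat, ← levL_apply, map_sum, map_smul]
  simp [etaAt, dp, dc, gen]

theorem domHat_snd (w v : V2 n) (c : Fin n → ℂ) : domHat x y t τ w (0, c) v = 0 := by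
  have h0 : ∀ a : Idx n, dEtaAt τ w (0, c) a v = 0 := fun a => by
    cases a <;> simp [dEtaAt]
  simp only [domHat, h0, zero_smul, tsum_zero]

/-- The coordinate `c_i`. -/
def cCoord (n : ℕ) (i : Fin n) : V2 n →L[ℂ] ℂ :=
  (ContinuousLinearMap.proj i).comp (ContinuousLinearMap.snd ℂ (Fin n → ℂ) (Fin n → ℂ))

theorem lie_sum_smul_x (h : IsT1n x y t) (c c' : Fin n → ℂ) :
    ⁅∑ i, c i • x i, ∑ i, c' i • x i⁆ = 0 := by
  simp [sum_lie, lie_sum, h.xx]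

theorem conj_deriv_eq_zero {R : Type*} [Ring R] (e a b e' : R) :
    (e * a * b + e * -(a * b - b * a)) * e' + e * b * (-a * e') = 0 := by
  noncomm_ring

/-- Conjugation with `exp(∑ c_i x_i)` removes the variables `c` from the connection form: along
`s ↦ (p, s c)`, flatness in the direction of `c` makes the conjugate of the form constant. -/
theorem gauge_mul_omHat (h : IsT1n x y t) (hτ : 0 < τ.im) {w : V2 n} (hw : w ∈ confSharp n τ)
    (u : V2 n) : expElt (∑ i, w.2 i • x i) * omHat x y t τ w u =
      omHat x y t τ (w.1, 0) u * expElt (∑ i, w.2 i • x i) := by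
  set E : V2 n → Uhat L := fun z => expElt (∑ i, cCoord n i z • x i) with hE
  set E' : V2 n → Uhat L := fun z => expElt (∑ i, (-cCoord n i) z • x i) with hE'
  have hline : ((w.1, 0) : V2 n) + (0, w.2) = w := by ext <;> simp
  have key := eq_of_hasHolDeriv_zero (f := fun z => E z * omHat x y t τ z u * E' z)
    (v := (w.1, 0)) (u := (0, w.2)) fun s => by
      have hz : ((w.1, 0) : V2 n) + s • (0, w.2) ∈ confSharp n τ := by
        simpa [confSharp] using hw
      refine ⟨_, (((hasHatDeriv_expElt h.xx (cCoord n) _).mul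
        (hasHatDeriv_omHat hτ hz u)).mul
        (hasHatDeriv_expElt h.xx (fun i => -cCoord n i) _)).hasHolDeriv, ?_⟩
      have hf := h.omHat_flat hτ hz (0, w.2) u
      rw [domHat_snd, sub_zero, omHat_snd, add_eq_zero_iff_eq_neg] at hf
      have h1 : ∑ i, cCoord n i (0, w.2) • x i = ∑ i, w.2 i • x i := rfl
      have h2 : hat (∑ i, (-cCoord n i) (0, w.2) • x i) = -hat (∑ i, w.2 i • x i) := by
        refine Uhat.ext_comp fun k => ?_
        rw [map_neg, comp_hat, comp_hat, ← lev_neg, ← Finset.sum_neg_distrib]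
        simp only [← neg_smul]
        rfl
      have h3 := (commute_hat_expElt (h.lie_sum_smul_x w.2
        fun i => cCoord n i ((w.1, 0) + s • (0, w.2)))).eq
      rw [h1, h2, hf, h3]
      exact conj_deriv_eq_zero _ _ _ _
  simp only [hline] at key
  have h0 : ∀ z : V2 n, E' z * E z = 1 := fun z => by
    rw [hE, hE']
    simp only
    rw [← expElt_add (h.lie_sum_smul_x _ _), ← Finset.sum_add_distrib, ← expElt_zero]
    simp
  have h1 : E (w.1, 0) = 1 := by
    rw [← expElt_zero]
    simp [hE, cCoord]
  have h2 : E' (w.1, 0) = 1 := by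
    rw [← expElt_zero]
    simp [hE', cCoord]
  rw [h1, h2, one_mul, mul_one] at key
  calc E w * omHat x y t τ w u = E w * omHat x y t τ w u * (E' w * E w) := by rw [h0, mul_one]
    _ = omHat x y t τ (w.1, 0) u * E w := by rw [← mul_assoc, key]

end IsT1n

/-! ### The two bundles and their isomorphism -/

namespace BundleData

variable {V W : Type} [NormedAddCommGroup V] [NormedSpace ℂ V]
  [NormedAddCommGroup W] [NormedSpace ℂ W] {𝔤 : Type} [LieRing 𝔤] [LieAlgebra ℂ 𝔤]

namespace IsFlatBundle

variable {D : BundleData V 𝔤}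

theorem factor_zero (h : D.IsFlatBundle) {v : V} (hv : v ∈ D.U) : D.factor 0 v = 1 := by
  have := h.cocycle 0 D.Γ.zero_mem 0 D.Γ.zero_mem v hv
  rw [add_zero, add_zero] at this
  exact mul_eq_left.1 this.symm

/-- Two points have the same image in the total space only if they are glued by an element
of `Γ`. -/
theorem exists_of_mk_eq (h : D.IsFlatBundle) {a b : D.U × ExpGroup 𝔤}
    (hab : Quot.mk D.Rel a = Quot.mk D.Rel b) :
    ∃ γ ∈ D.Γ, (b.1 : V) = a.1 + γ ∧ b.2 = D.factor γ a.1 * a.2 := by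
  induction Quot.eqvGen_exact hab with
  | rel _ _ hr =>
    obtain ⟨γ, hγ, v, hv, hv', g⟩ := hr
    exact ⟨γ, hγ, rfl, rfl⟩
  | refl a => exact ⟨0, D.Γ.zero_mem, (add_zero _).symm, by rw [h.factor_zero a.1.2, one_mul]⟩
  | symm a b hr ih =>
    obtain ⟨γ, hγ, h1, h2⟩ := ih (Quot.eqvGen_sound hr)
    refine ⟨-γ, D.Γ.neg_mem hγ, by rw [h1, add_neg_cancel_right], ?_⟩
    rw [h2, h1, ← mul_assoc, ← h.cocycle _ (D.Γ.neg_mem hγ) _ hγ _ a.1.2, neg_add_cancel,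
      h.factor_zero a.1.2, one_mul]
  | trans a b c hr hr' ih ih' =>
    obtain ⟨γ, hγ, h1, h2⟩ := ih (Quot.eqvGen_sound hr)
    obtain ⟨γ', hγ', h1', h2'⟩ := ih' (Quot.eqvGen_sound hr')
    refine ⟨γ' + γ, D.Γ.add_mem hγ' hγ, by rw [h1', h1, add_assoc, add_comm γ], ?_⟩
    rw [h2', h2, h.cocycle _ hγ' _ hγ _ a.1.2, h1, mul_assoc]

/-- The canonical trivialization of the pull-back is bijective. -/
theorem bijective_triv (h : D.IsFlatBundle) (f : W →L[ℂ] V) :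
    Function.Bijective fun x : {w // f w ∈ D.U} × ExpGroup 𝔤 => Pull.triv D f x.1 x.1.2 x.2 := by
  constructor
  · rintro ⟨⟨w, hw⟩, g⟩ ⟨⟨w', hw'⟩, g'⟩ he
    have h1 : w = w' := congrArg (fun x : D.Pull f => x.1.1) he
    subst h1
    obtain ⟨γ, hγ, e1, e2⟩ := h.exists_of_mk_eq (congrArg (fun x : D.Pull f => x.1.2) he)
    have hγ0 : γ = 0 := add_eq_left.1 e1.symm
    simp only at e2
    rw [hγ0, h.factor_zero hw, one_mul] at e2
    rw [e2]
  · rintro ⟨⟨w, x⟩, hx⟩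
    obtain ⟨⟨⟨v, hv⟩, g⟩, rfl⟩ := Quot.exists_rep x
    have hγ : -v + f w ∈ D.Γ := QuotientAddGroup.eq.1 hx
    have hvw : v + (-v + f w) = f w := add_neg_cancel_left v (f w)
    have hw : f w ∈ D.U := by
      have := h.stable _ hγ v hv
      rwa [hvw] at this
    refine ⟨(⟨w, hw⟩, D.factor (-v + f w) v * g), Subtype.ext (Prod.ext rfl ?_)⟩
    have hr := Quot.sound (Rel.glue (D := D) _ hγ v hv (by rwa [hvw]) g)
    simp only [hvw] at hr
    exact hr.symm

end IsFlatBundle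

/-- A map between trivial bundles gives an isomorphism of the pull-backs. -/
theorem exists_pull_equiv {V' : Type} [NormedAddCommGroup V'] [NormedSpace ℂ V'] {𝔥 : Type}
    [LieRing 𝔥] [LieAlgebra ℂ 𝔥] {D₁ : BundleData V 𝔤} {D₂ : BundleData V' 𝔥}
    (h₁ : D₁.IsFlatBundle) (h₂ : D₂.IsFlatBundle) (f₁ : W →L[ℂ] V) (f₂ : W →L[ℂ] V')
    (hU : ∀ w, f₁ w ∈ D₁.U ↔ f₂ w ∈ D₂.U) (φ : ExpGroup 𝔤 ≃* ExpGroup 𝔥) (g : W → ExpGroup 𝔥) :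
    ∃ ψ : D₁.Pull f₁ ≃ D₂.Pull f₂, (∀ x, (ψ x).1.1 = x.1.1) ∧
      (∀ x h, ψ (x.act h) = (ψ x).act (φ h)) ∧
      ∀ w (hw₁ : f₁ w ∈ D₁.U) (hw₂ : f₂ w ∈ D₂.U) h, ψ (Pull.triv D₁ f₁ w hw₁ h) =
        Pull.triv D₂ f₂ w hw₂ (g w * φ h) := by
  set e₁ := Equiv.ofBijective _ (h₁.bijective_triv f₁) with he₁
  set e₂ := Equiv.ofBijective _ (h₂.bijective_triv f₂) with he₂
  let m : {w // f₁ w ∈ D₁.U} × ExpGroup 𝔤 ≃ {w // f₂ w ∈ D₂.U} × ExpGroup 𝔥 :=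
    { toFun := fun x => (⟨x.1, (hU _).1 x.1.2⟩, g x.1 * φ x.2)
      invFun := fun x => (⟨x.1, (hU _).2 x.1.2⟩, φ.symm ((g x.1)⁻¹ * x.2))
      left_inv := fun x => by simp
      right_inv := fun x => by simp }
  have key : ∀ w (hw₁ : f₁ w ∈ D₁.U) (hw₂ : f₂ w ∈ D₂.U) h,
      (e₁.symm.trans (m.trans e₂)) (Pull.triv D₁ f₁ w hw₁ h) =
        Pull.triv D₂ f₂ w hw₂ (g w * φ h) := fun w hw₁ hw₂ h => by
    have : Pull.triv D₁ f₁ w hw₁ h = e₁ (⟨w, hw₁⟩, h) := rfl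
    rw [this, Equiv.trans_apply, Equiv.symm_apply_apply]
    rfl
  refine ⟨e₁.symm.trans (m.trans e₂), fun x => ?_, fun x h => ?_, key⟩
  · obtain ⟨⟨⟨w, hw⟩, h⟩, rfl⟩ := (h₁.bijective_triv f₁).2 x
    simp only
    rw [key w hw ((hU w).1 hw)]
    rfl
  · obtain ⟨⟨⟨w, hw⟩, h'⟩, rfl⟩ := (h₁.bijective_triv f₁).2 x
    simp only
    have ha : (Pull.triv D₁ f₁ w hw h').act h = Pull.triv D₁ f₁ w hw (h' * h) := rfl
    have ha' : (Pull.triv D₂ f₂ w ((hU w).1 hw) (g w * φ h')).act (φ h) =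
      Pull.triv D₂ f₂ w ((hU w).1 hw) (g w * φ h' * φ h) := rfl
    rw [ha, key w hw ((hU w).1 hw), key w hw ((hU w).1 hw), ha', map_mul, mul_assoc]

end BundleData

section Omega

variable {n : ℕ} {τ : ℂ}

theorem GG.gen_eq (hτ : 0 < τ.im) (a : Idx n) : IsT1n.gen (fun i => GG.gen n τ (.X i))
    (fun i => GG.gen n τ (.Y i)) (fun i j => -gT n τ i j 0) a = GG.gen n τ a := by
  cases a with
  | X i => rfl
  | Y i => rfl
  | T i j h α => rw [IsT1n.gen, map_neg, neg_neg, ad_pow_gT hτ h.ne, gT_of_lt h]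

theorem omegaForm_eq (hτ : 0 < τ.im) (w u : V2 n) : omegaForm n τ w u =
    IsT1n.omHat (fun i => GG.gen n τ (.X i)) (fun i => GG.gen n τ (.Y i))
      (fun i j => -gT n τ i j 0) τ w u := by
  simp only [omegaForm, IsT1n.omHat, GG.gen_eq hτ]

theorem summable_omegaForm (hτ : 0 < τ.im) (w u : V2 n) :
    Summable fun a : Idx n => etaAt τ a w u • hat (GG.gen n τ a) := by
  simpa only [GG.gen_eq hτ] using IsT1n.summable_smul_gen (L := GG n τ)
    (x := fun i => GG.gen n τ (.X i)) (y := fun i => GG.gen n τ (.Y i))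
    (t := fun i j => -gT n τ i j 0) fun a => etaAt τ a w u

theorem omegaBundle_isFlatBundle (hτ : 0 < τ.im) : (omegaBundle n τ).IsFlatBundle := by
  have hd := fun (w : V2 n) (hw : w ∈ confSharp n τ) (u : V2 n) =>
    ((IsT1n.hasHatDeriv_omHat (x := fun i => GG.gen n τ (.X i))
      (y := fun i => GG.gen n τ (.Y i)) (t := fun i j => -gT n τ i j 0) hτ hw u).congr
      (f₁ := fun y => omegaForm n τ y u)
      (Filter.Eventually.of_forall fun y => omegaForm_eq hτ y u) fun _ => rfl).hasHolDeriv
  refine ⟨isOpen_confSharp hτ, fun γ hγ v hv => add_mem_confSharp hv hγ,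
    fun _ _ _ _ _ _ => (one_mul 1).symm, fun v _ u => ?_, fun v _ => ?_,
    fun v hv u => ⟨_, hd v hv u⟩, fun γ hγ v hv => ?_, fun v hv u u' f f' hf hf' => ?_⟩
  · change IsLie (omegaForm n τ v u)
    rw [omegaForm_eq hτ]
    exact IsT1n.isLie_omHat v u
  · change IsLinearMap ℂ (omegaForm n τ v)
    rw [funext (omegaForm_eq hτ v)]
    exact IsT1n.isLinearMap_omHat v
  · refine ((HasHatDeriv.const (v := v) (1 : Uhat (GG n τ))).congr
      (Filter.Eventually.of_forall fun _ => rfl) fun u => ?_).hasHolDeriv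
    change 1 * omegaForm n τ v u - omegaForm n τ (v + γ) u * 1 = 0
    rw [one_mul, mul_one, omegaForm_eq hτ, omegaForm_eq hτ, IsT1n.omHat_add_latSharp hτ hγ,
      sub_self]
  · rw [hf.unique (hd v hv u) u', hf'.unique (hd v hv u') u]
    change _ + (omegaForm n τ v u * omegaForm n τ v u' - omegaForm n τ v u' * omegaForm n τ v u) = 0
    rw [omegaForm_eq hτ, omegaForm_eq hτ]
    exact (GG.isT1n hτ).omHat_flat hτ hv u u'

/-- The isomorphism carries the form `ω` to the form `omHat` of `𝔱_{1,n}`. -/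
theorem mapHat_omegaForm (hτ : 0 < τ.im) (w u : V2 n) :
    mapHat ((isoTT hτ : GG n τ ≃ₗ⁅ℂ⁆ TT n) : GG n τ →ₗ⁅ℂ⁆ TT n) (omegaForm n τ w u) =
      IsT1n.omHat TT.x TT.y TT.tt τ w u := by
  refine Uhat.ext_comp fun k => ?_
  change mapLev _ k (Uhat.comp _ k (omegaForm n τ w u)) = _
  rw [omegaForm_eq hτ, IsT1n.omHat, IsT1n.omHat, IsT1n.comp_tsum_smul_gen _ le_rfl,
    IsT1n.comp_tsum_smul_gen _ le_rfl, map_sum]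
  refine Finset.sum_congr rfl fun a _ => ?_
  rw [mapLev_smul, mapLev_lev, GG.gen_eq hτ]
  exact congrArg (fun b => etaAt τ a w u • lev (TT n) k b) (isoTT_gen hτ a)

end Omega

section KZBConnection

variable {n : ℕ} {τ : ℂ}

theorem lev_adx_eq_zero {k α : ℕ} (h : k ≤ α + 1) (i : Fin n) (b : TT n) :
    lev (TT n) k (adx i α b) = 0 := by
  rw [adx_eq, lev_ad_pow_eq_zero h]

theorem comp_smul_adx_eq_zero (c : ℕ → ℂ) (i : Fin n) (b : TT n) (k α : ℕ)
    (hα : α ∉ Finset.range (k + 1 + 1)) : Uhat.comp (TT n) k (c α • hat (adx i α b)) = 0 := by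
  rw [Finset.mem_range, not_lt] at hα
  rw [map_smul, comp_hat, lev_adx_eq_zero (by omega), smul_zero]

theorem summable_smul_adx (c : ℕ → ℂ) (i : Fin n) (b : TT n) :
    Summable fun α => c α • hat (adx i α b) :=
  summable_of_finite (comp_smul_adx_eq_zero c i b)

/-- The bracket `[x_i, y_j] = t_ij` lowers the power of `ad x_i` by one; the constant term of the
series cancels. -/
theorem comp_kzbTerm {i j : Fin n} (hij : i ≠ j) {p : ℂ} (hτ : 0 < τ.im) (hp : p ∉ lat τ) (k : ℕ) :
    Uhat.comp (TT n) k (kzbTerm τ i j p) = ∑ m ∈ Finset.range (k + 1),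
      fcoef τ m p 0 • lev (TT n) k ((LieAlgebra.ad ℂ (TT n) (TT.x i) ^ m) (TT.tt i j)) := by
  rw [kzbTerm, comp_tsum (comp_smul_adx_eq_zero _ i _), Finset.sum_range_succ']
  have h0 : PowerSeries.coeff 0 (zF τ p 0 - 1) = 0 := by
    have : PowerSeries.coeff 0 (zF τ p 0) = 1 := kcoef_zero hτ hp 0
    simp only [map_sub, this, PowerSeries.coeff_one, if_true, sub_self]
  rw [h0, zero_smul, map_zero, add_zero]
  refine Finset.sum_congr rfl fun m _ => ?_
  rw [map_smul, comp_hat, adx_eq, pow_succ, Module.End.mul_apply, LieAlgebra.ad_apply,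
    TT.isT1n.xy i j hij, map_sub, PowerSeries.coeff_one, if_neg (Nat.succ_ne_zero m), sub_zero]
  rfl

/-- On the vectors `ep i`, at `c = 0`, the form `omHat` is the coefficient of `dp_i` in the KZB
form. -/
theorem omHat_ep (hτ : 0 < τ.im) {p : Fin n → ℂ} (hp : p ∈ conf n τ) (i : Fin n) :
    IsT1n.omHat TT.x TT.y TT.tt τ (p, 0) (ep i) =
      -(-hat (TT.y i) + ∑ j ∈ Finset.univ.erase i, kzbTerm τ i j (p i - p j)) := by
  refine Uhat.ext_comp fun k => ?_
  rw [IsT1n.comp_omHat (Nat.le_succ k) (Nat.succ_pos k), Finset.sum_range_succ', map_neg, map_add,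
    map_neg, map_sum, neg_add, neg_neg, IsT1n.om_zero_ep, add_comm, comp_hat]
  congr 1
  rw [Finset.sum_congr rfl fun j hj => comp_kzbTerm (Finset.ne_of_mem_erase hj).symm hτ
    (hp i j (Finset.ne_of_mem_erase hj).symm) k, Finset.sum_comm, ← Finset.sum_neg_distrib]
  refine Finset.sum_congr rfl fun m _ => ?_
  rw [IsT1n.om_succ_ep TT.isT1n hτ, lev_neg, IsT1n.W, ← levL_apply, map_sum]
  simp [fij, levL_apply]

/-- The KZB form is the restriction of the form `omHat` of `𝔱_{1,n}` to `c = 0`. -/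
theorem kzbForm_eq (hτ : 0 < τ.im) {p : Fin n → ℂ} (hp : p ∈ conf n τ) (u : Fin n → ℂ) :
    kzbForm n τ p u = IsT1n.omHat TT.x TT.y TT.tt τ (p, 0) (u, 0) := by
  have hu : ((u, 0) : V2 n) = ∑ i, u i • ep i := by
    have := sum_ep_ec ((u, 0) : V2 n)
    simpa using this
  have hl := congrArg (IsLinearMap.mk' _ (IsT1n.isLinearMap_omHat (x := TT.x) (y := TT.y)
    (t := TT.tt) (τ := τ) ((p, 0) : V2 n))) hu
  rw [map_sum] at hl
  simp only [map_smul, IsLinearMap.mk'_apply, omHat_ep hτ hp] at hl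
  rw [hl, kzbForm, ← Finset.sum_neg_distrib]
  simp only [smul_neg]

/-- The values of the coordinates `c` for a lift to `latSharp` of a vector of the lattice. -/
def liftC (τ : ℂ) (γ : Fin n → ℂ) (i : Fin n) : ℂ :=
  -(2 * Real.pi * Complex.I) * (((γ i).im / τ.im : ℝ) : ℂ)

theorem mem_latSharp_liftC (hτ : 0 < τ.im) {γ : Fin n → ℂ} (hγ : γ ∈ latn n τ) :
    ((γ, liftC τ γ) : V2 n) ∈ latSharp n τ := by
  have h : ∀ i, ∃ a b : ℤ, γ i = a + b * τ := fun i =>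
    mem_lat.1 ((AddSubgroup.mem_pi _).1 hγ i (Set.mem_univ i))
  choose a b hab using h
  refine ⟨a, b, fun i => ⟨hab i, ?_⟩⟩
  have : (γ i).im / τ.im = b i := by
    rw [hab i]
    simp [hτ.ne']
  simp only [liftC, this, Complex.ofReal_intCast]

theorem mem_lat_of_mem_latn {γ : Fin n → ℂ} (hγ : γ ∈ latn n τ) (i : Fin n) : γ i ∈ lat τ :=
  (AddSubgroup.mem_pi _).1 hγ i (Set.mem_univ i)

theorem hasHolDeriv_kzbForm (hτ : 0 < τ.im) {p : Fin n → ℂ} (hp : p ∈ conf n τ) (u : Fin n → ℂ) :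
    HasHolDeriv (fun q => kzbForm n τ q u)
      (fun v => IsT1n.domHat TT.x TT.y TT.tt τ (p, 0) (u, 0) (v, 0)) p := by
  intro k l
  obtain ⟨L, hL, hL'⟩ := (IsT1n.hasHatDeriv_omHat (x := TT.x) (y := TT.y) (t := TT.tt) hτ
    (w := ((p, 0) : V2 n)) hp (u, 0)).hasHolDeriv k l
  refine ⟨L.comp (ContinuousLinearMap.inl ℂ (Fin n → ℂ) (Fin n → ℂ)), ?_, fun v => hL' (v, 0)⟩
  have h := HasFDerivAt.comp p (f := ContinuousLinearMap.inl ℂ (Fin n → ℂ) (Fin n → ℂ)) hL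
    (ContinuousLinearMap.hasFDerivAt _)
  refine h.congr_of_eventuallyEq ?_
  filter_upwards [(isOpen_conf hτ).mem_nhds hp] with q hq
  rw [kzbForm_eq hτ hq]
  rfl

/-- Flatness is inherited from `omHat`. The form descends because `omHat` is invariant under
`latSharp`: a translation by `γ` becomes, after lifting `γ` to `latSharp`, a translation of `c`,
which is removed by conjugation with the exponential. -/
theorem kzbBundle_isFlatBundle (hτ : 0 < τ.im) : (kzbBundle n τ).IsFlatBundle := by
  refine ⟨isOpen_conf hτ, fun γ hγ v hv => add_mem_conf hv (mem_lat_of_mem_latn hγ),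
    fun γ hγ γ' hγ' v _ => ?_, fun v hv u => ?_, fun v hv => ?_,
    fun v hv u => ⟨_, hasHolDeriv_kzbForm hτ hv u⟩, fun γ hγ v hv => ?_,
    fun v hv u u' f f' hf hf' => ?_⟩
  · refine Subtype.ext (Units.ext ?_)
    change expElt (∑ i, liftC τ (γ + γ') i • TT.x i) =
      expElt (∑ i, liftC τ γ i • TT.x i) * expElt (∑ i, liftC τ γ' i • TT.x i)
    rw [← expElt_add (TT.isT1n.lie_sum_smul_x _ _), ← Finset.sum_add_distrib]
    congr 1
    refine Finset.sum_congr rfl fun i _ => ?_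
    rw [← add_smul]
    congr 1
    simp only [liftC, Pi.add_apply, Complex.add_im, add_div, Complex.ofReal_add]
    ring
  · change IsLie (kzbForm n τ v u)
    rw [kzbForm_eq hτ hv]
    exact IsT1n.isLie_omHat _ _
  · change IsLinearMap ℂ (kzbForm n τ v)
    rw [funext (kzbForm_eq hτ hv)]
    have h := IsT1n.isLinearMap_omHat (x := TT.x) (y := TT.y) (t := TT.tt) (τ := τ)
      ((v, 0) : V2 n)
    refine ⟨fun u u' => ?_, fun c u => ?_⟩
    · rw [← h.map_add]; simp
    · rw [← h.map_smul]; simp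
  · set g : Uhat (TT n) := expElt (∑ i, liftC τ γ i • TT.x i)
    refine ((HasHatDeriv.const (v := v) g).congr
      (Filter.Eventually.of_forall fun _ => rfl) fun u => ?_).hasHolDeriv
    change g * kzbForm n τ v u - kzbForm n τ (v + γ) u * g = 0
    have hv' : v + γ ∈ conf n τ := add_mem_conf hv (mem_lat_of_mem_latn hγ)
    -- compare the points `(v, 0)` and `(v + γ, liftC γ)`, which differ by an element of `latSharp`
    have h1 := TT.isT1n.gauge_mul_omHat hτ (w := ((v + γ, liftC τ γ) : V2 n)) hv' (u, 0)
    have h2 : ((v + γ, liftC τ γ) : V2 n) = (v, 0) + (γ, liftC τ γ) := by simp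
    rw [h2, IsT1n.omHat_add_latSharp hτ (mem_latSharp_liftC hτ hγ), ← h2] at h1
    rw [kzbForm_eq hτ hv, kzbForm_eq hτ hv', sub_eq_zero]
    exact h1
  · rw [hf.unique (hasHolDeriv_kzbForm hτ hv u) u', hf'.unique (hasHolDeriv_kzbForm hτ hv u') u]
    change _ + (kzbForm n τ v u * kzbForm n τ v u' - kzbForm n τ v u' * kzbForm n τ v u) = 0
    rw [kzbForm_eq hτ hv, kzbForm_eq hτ hv]
    exact TT.isT1n.omHat_flat hτ (w := ((v, 0) : V2 n)) hv _ _

/-- The derivative of `g = exp(∑ c_i x_i)` is `g ω - A g`: conjugation with `g` takes `ω` to its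
restriction to `c = 0`, which is `A` plus the part in the directions of `c`. -/
theorem hasHolDeriv_gauge (hτ : 0 < τ.im) {w : V2 n} (hw : w ∈ confSharp n τ) :
    HasHolDeriv (fun y => gval (gauge n y))
      (fun u => gval (gauge n w) * mapHat ((isoTT hτ : GG n τ ≃ₗ⁅ℂ⁆ TT n) : GG n τ →ₗ⁅ℂ⁆ TT n) (omegaForm n τ w u) -
        kzbForm n τ w.1 u.1 * gval (gauge n w)) w := by
  refine ((hasHatDeriv_expElt (V := V2 n) TT.isT1n.xx (IsT1n.cCoord n) w).congr
    (Filter.Eventually.of_forall fun _ => rfl) fun u => ?_).hasHolDeriv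
  change expElt (∑ i, w.2 i • TT.x i) * mapHat ((isoTT hτ : GG n τ ≃ₗ⁅ℂ⁆ TT n) : GG n τ →ₗ⁅ℂ⁆ TT n) _ -
    _ * expElt (∑ i, w.2 i • TT.x i) = hat (∑ i, u.2 i • TT.x i) * expElt (∑ i, w.2 i • TT.x i)
  have hu : u - (u.1, 0) = (0, u.2) := by ext <;> simp
  rw [mapHat_omegaForm, TT.isT1n.gauge_mul_omHat hτ hw, kzbForm_eq hτ hw, ← sub_mul,
    ← IsT1n.omHat_snd (y := TT.y) (t := TT.tt) (τ := τ) (w.1, 0),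
    ← (IsT1n.isLinearMap_omHat _).map_sub, hu]

theorem isPullIso (hτ : 0 < τ.im) : BundleData.IsPullIso (omegaBundle n τ) (kzbBundle n τ)
    (ContinuousLinearMap.id ℂ (V2 n)) (ContinuousLinearMap.fst ℂ (Fin n → ℂ) (Fin n → ℂ))
    (isoTT hτ) (gauge n) where
  bundle := BundleData.exists_pull_equiv (omegaBundle_isFlatBundle hτ) (kzbBundle_isFlatBundle hτ)
    _ _ (fun _ => Iff.rfl) (MulEquiv.ofBijective (mapExp ((isoTT hτ : GG n τ ≃ₗ⁅ℂ⁆ TT n) : GG n τ →ₗ⁅ℂ⁆ TT n))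
      (mapExp_bijective (isoTT hτ))) (gauge n)
  domain _ := Iff.rfl
  group := mapExp_bijective _
  connection _ hw := hasHolDeriv_gauge hτ hw

end KZBConnection

end KZB

end

/-- The family `dc_i, dp_i, ω_ij^α` is a basis of `Ω¹`, so that `𝔊` and `ω` are attached to `Ω¹`;
the two bundles with connection are well-defined and flat; and, for the identification of `𝔊` with
`𝔱_{1,n}`, the gauge map is an isomorphism between their pull-backs to `ℂ^{2n}`. -/
theorem mainTheorem3 (n : ℕ) (hn : 1 ≤ n) (τ : ℂ) (hτ : 0 < τ.im) :
    (LinearIndependent ℂ (KZB.eta n τ) ∧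
      Submodule.span ℂ (Set.range (KZB.eta n τ)) = KZB.Omega1 n τ) ∧
    (∀ w ∈ KZB.confSharp n τ, ∀ u : KZB.V2 n, Summable fun a : KZB.Idx n =>
      KZB.etaAt τ a w u • KZB.hat (KZB.GG.gen n τ a)) ∧
    (∀ (i j : Fin n) (p : ℂ), Summable fun α : ℕ =>
      PowerSeries.coeff α (KZB.zF τ p 0 - 1) • KZB.hat (KZB.adx i α (KZB.TT.y j))) ∧
    (KZB.kzbBundle n τ).IsFlatBundle ∧
    (KZB.omegaBundle n τ).IsFlatBundle ∧
    ∃ Φ : KZB.GG n τ ≃ₗ⁅ℂ⁆ KZB.TT n,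
      (∀ i, Φ (KZB.GG.gen n τ (.X i)) = KZB.TT.x i) ∧
      (∀ i, Φ (KZB.GG.gen n τ (.Y i)) = KZB.TT.y i) ∧
      (∀ (i j : Fin n) (h : i < j) (α : ℕ), Φ (KZB.GG.gen n τ (.T i j h α)) =
        -KZB.adx i α (KZB.TT.t i j h.ne)) ∧
      KZB.BundleData.IsPullIso (KZB.omegaBundle n τ) (KZB.kzbBundle n τ)
        (ContinuousLinearMap.id ℂ (KZB.V2 n))
        (ContinuousLinearMap.fst ℂ (Fin n → ℂ) (Fin n → ℂ)) Φ (KZB.gauge n) := by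
  refine ⟨⟨KZB.linearIndependent_eta hτ, KZB.span_eta hτ⟩,
    fun w _ u => KZB.summable_omegaForm hτ w u, fun i j p => KZB.summable_smul_adx _ i _,
    KZB.kzbBundle_isFlatBundle hτ, KZB.omegaBundle_isFlatBundle hτ, KZB.isoTT hτ,
    fun i => KZB.isoTT_gen hτ _, fun i => KZB.isoTT_gen hτ _, fun i j h α => ?_,
    KZB.isPullIso hτ⟩
  rw [KZB.isoTT_gen, KZB.adx_eq, ← KZB.TT.tt_eq h.ne]
  rfl
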